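/- **Setting.** Let $\mathbb{H}^2$ be the Poincaré disk $|z|<1$ with metric $g=4|dz|^2/(1-|z|^2)^2$ and let $\Omega\subset\mathbb{H}^2$ be open. A map $f(u,v)$ on a rectangle is $C^{1M}$ if it is $C^1$ and its mixed partial derivatives $f_{uv}=f_{vu}$ exist and are continuous. A *PS-front* on a rectangle is a $C^{1M}$ map $r$ to $\mathbb{R}^3$ for which there is a $C^{1M}$ map $N$ to $S^2$ with $N_u\neq0$, $N_v\neq 0$, $N_{uv}=\nu N$ for a continuous function $\nu$, and $r_u=N_u\times N$, $r_v=-N_v\times N$. An *$m$-star* is obtained from angles $\alpha_0,\dots,\alpha_{2m-1}\in(0,\pi)$ with sum $2\pi$ and lengths $l_0,\dots,l_{2m}>0$ with $l_{2m}=l_0$. Put $\beta_k=\sum_{i<k}\alpha_i$ and $\mathbf{s}_k=(\cos\beta_k,\sin\beta_k)$. The star is the union of the $2m$ sectors $S_k=\{c\,\mathbf{s}_k+d\,\mathbf{s}_{k+1}: 0\le c<l_k,\ 0\le d<l_{k+1}\}\subset\mathbb{R}^2$. The even rays $\{c\,\mathbf{s}_k\}$ are called $u$-rays and the odd ones $v$-rays.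 On each sector the coordinate along its $u$-ray is called $u$ and the coordinate along its $v$-ray is called $v$. A *branched pseudospherical immersion* is an isometric immersion $\psi:(\Omega,g)\to\mathbb{R}^3$ of class $C^{1,1}$ (differentiable, with locally Lipschitz derivative) such that every $p\in\Omega$ has an open neighbourhood $O_p\subset\Omega$ and a homeomorphism of $O_p$ onto an $m_p$-star, taking $p$ to the centre, for which $\psi$ is a PS-front in the coordinates $(u,v)$ of each closed sector. The number $m_p$ is the *order of saddleness* at $p$, and $p$ is a *branch point* if $m_p\ne2$. The curves in $\Omega$ that correspond to constant $v$ (constant $u$) are the $u$- ($v$-) asymptotic curves. Let $\omega$ be an orientation of $\Omega$ (a continuous nowhere vanishing two-form). On each sector, with $r=\psi$ written in the coordinates $(u,v)$, let $\sigma=\operatorname{sign}\omega(\partial_u,\partial_v)$ and let $\varphi\in(0,\pi)$ be the angle between $\partial_u r$ and $\sigma\,\partial_v r$. When $u,v$ are arc-length parameters this means $\cos\varphi=\sigma\,\partial_u r\cdot\partial_v r$ and $\sin\varphi=\|\partial_u r\times\partial_v r\|$. The angle $\varphi$ may jump across some asymptotic curves, in particular those incident on branch points; there $\varphi$ is given any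 one of its one-sided values. **Theorem.** Let $\psi:(\Omega,g)\to\mathbb{R}^3$ be a branched pseudospherical immersion with finitely many branch points $p_1,\dots,p_k$ of orders $m_1,\dots,m_k$, and let $\omega$ be an orientation of $\Omega$. Let $\Gamma\subset\Omega$ be a domain with compact closure in $\Omega$ whose boundary is a Hamburger polygon, that is, a Jordan curve which, traversed in the direction induced by $\omega$, has successive vertices $q_0,q_1,\dots,q_{2j-1}$ $(j\ge 1)$, the side from $q_n$ to $q_{n+1}$ (indices mod $2j$) being a $u$-asymptotic arc for even $n$ and a $v$-asymptotic arc for odd $n$. Assume that no branch point lies on $\partial\Gamma$, except possibly at a vertex, and that at each vertex $q_n$ the angle $\varphi$ is continuous from $\Gamma$, i.e. $\varphi(x)\to\varphi(q_n)$ as $x\to q_n$, $x\in\Gamma$. Then $$\sum_{n=0}^{2j-1}(-1)^n\varphi(q_n)=A(\Gamma)-\sum_{p_i\in\Gamma}(m_i-2)\,\pi ,$$ where $A(\Gamma)$ is the area of $\Gamma$ with respect to $g$. -/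

import Mathlib

open Set Filter Topology MeasureTheory

noncomputable section

namespace BranchedPS

/-- Euclidean three-space. -/
abbrev E3 : Type := EuclideanSpace ℝ (Fin 3)

/-- The cross product in Euclidean three-space. -/
def cross (a b : E3) : E3 :=
  WithLp.toLp 2 (crossProduct (WithLp.ofLp a) (WithLp.ofLp b))

/-! ### `C^{1M}` maps, weakly harmonic maps and pseudospherical fronts -/

/-- Partial derivative in the first variable (one-sided at an end point of `I`). -/
def partialU {E : Type*} [NormedAddCommGroup E] [NormedSpace ℝ E]
    (I : Set ℝ) (f : ℝ → ℝ → E) (u v : ℝ) : E :=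
  derivWithin (fun x => f x v) I u

/-- Partial derivative in the second variable (one-sided at an end point of `J`). -/
def partialV {E : Type*} [NormedAddCommGroup E] [NormedSpace ℝ E]
    (J : Set ℝ) (f : ℝ → ℝ → E) (u v : ℝ) : E :=
  derivWithin (fun y => f u y) J v

/-- `f` is `C^{1M}` on the rectangle `I × J`: it is `C¹`, and the mixed second partial derivatives
exist, are continuous and agree. -/
structure IsC1M {E : Type*} [NormedAddCommGroup E] [NormedSpace ℝ E]
    (I J : Set ℝ) (f : ℝ → ℝ → E) : Prop where
  continuousOn : ContinuousOn (fun x : ℝ × ℝ => f x.1 x.2) (I ×ˢ J)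
  diff_u : ∀ v ∈ J, DifferentiableOn ℝ (fun u => f u v) I
  diff_v : ∀ u ∈ I, DifferentiableOn ℝ (fun v => f u v) J
  continuousOn_u : ContinuousOn (fun x : ℝ × ℝ => partialU I f x.1 x.2) (I ×ˢ J)
  continuousOn_v : ContinuousOn (fun x : ℝ × ℝ => partialV J f x.1 x.2) (I ×ˢ J)
  diff_uv : ∀ u ∈ I, DifferentiableOn ℝ (fun v => partialU I f u v) J
  diff_vu : ∀ v ∈ J, DifferentiableOn ℝ (fun u => partialV J f u v) I
  continuousOn_uv :
    ContinuousOn (fun x : ℝ × ℝ => partialV J (partialU I f) x.1 x.2) (I ×ˢ J)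
  mixed_eq : ∀ u ∈ I, ∀ v ∈ J,
    partialV J (partialU I f) u v = partialU I (partialV J f) u v

/-- `N` is a weakly (Lorentz) harmonic map of the rectangle `I × J` to the unit sphere. -/
structure IsWeaklyHarmonic (I J : Set ℝ) (N : ℝ → ℝ → E3) : Prop where
  unit : ∀ u ∈ I, ∀ v ∈ J, ‖N u v‖ = 1
  c1m : IsC1M I J N
  regular_u : ∀ u ∈ I, ∀ v ∈ J, partialU I N u v ≠ 0
  regular_v : ∀ u ∈ I, ∀ v ∈ J, partialV J N u v ≠ 0
  moutard : ∃ ν : ℝ → ℝ → ℝ, ContinuousOn (fun x : ℝ × ℝ => ν x.1 x.2) (I ×ˢ J) ∧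
    ∀ u ∈ I, ∀ v ∈ J, partialV J (partialU I N) u v = ν u v • N u v

/-- `r` is a pseudospherical front on the rectangle `I × J`: a `C^{1M}` solution of the
Lelieuvre equations `r_u = N_u × N`, `r_v = - N_v × N` for a weakly harmonic `N`.
(Then `r_u`, `r_v` vanish nowhere, as `‖r_u‖ = ‖N_u‖` and `‖r_v‖ = ‖N_v‖`.) -/
def IsPSFront (I J : Set ℝ) (r : ℝ → ℝ → E3) : Prop :=
  IsC1M I J r ∧ ∃ N : ℝ → ℝ → E3, IsWeaklyHarmonic I J N ∧
    (∀ u ∈ I, ∀ v ∈ J, partialU I r u v = cross (partialU I N u v) (N u v)) ∧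
    (∀ u ∈ I, ∀ v ∈ J, partialV J r u v = - cross (partialV J N u v) (N u v))

/-! ### `m`-stars -/

/-- Data of an `m`-star: `2m` sector angles in `(0, π)` with sum `2π`, and lengths of the rays that
separate the sectors. Sector `k` lies between ray `k` and ray `k + 1`, and
ray `2m` is ray `0` again. -/
structure MStar (m : ℕ) where
  angle : ℕ → ℝ
  len : ℕ → ℝ
  angle_pos : ∀ k < 2 * m, 0 < angle k
  angle_lt : ∀ k < 2 * m, angle k < Real.pi
  angle_sum : ∑ k ∈ Finset.range (2 * m), angle k = 2 * Real.pi
  len_pos : ∀ k ≤ 2 * m, 0 < len k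
  len_closed : len (2 * m) = len 0

namespace MStar

variable {m : ℕ} (T : MStar m)

/-- The unit vector along ray `k`. -/
def dir (k : ℕ) : ℂ :=
  Complex.exp (((∑ i ∈ Finset.range k, T.angle i : ℝ) : ℂ) * Complex.I)

/-- The point of sector `k` with asymptotic coordinates `(u, v)`; `u` is measured along the
even rays and `v` along the odd rays. -/
def point (k : ℕ) (u v : ℝ) : ℂ :=
  if Even k then u • T.dir k + v • T.dir (k + 1) else v • T.dir k + u • T.dir (k + 1)

/-- The range of the coordinate `u` on sector `k`. -/
def uDom (k : ℕ) : Set ℝ := Ico 0 (if Even k then T.len k else T.len (k + 1))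

/-- The range of the coordinate `v` on sector `k`. -/
def vDom (k : ℕ) : Set ℝ := Ico 0 (if Even k then T.len (k + 1) else T.len k)

/-- The `m`-star as a subset of the plane: the union of its sectors. -/
def carrier : Set ℂ :=
  {z | ∃ k < 2 * m, ∃ u ∈ T.uDom k, ∃ v ∈ T.vDom k, z = T.point k u v}

/-- The union of the `u`-rays (the even ones). -/
def uRays : Set ℂ := {z | ∃ k < 2 * m, Even k ∧ ∃ c ∈ Ico 0 (T.len k), z = c • T.dir k}

/-- The union of the `v`-rays (the odd ones). -/
def vRays : Set ℂ := {z | ∃ k < 2 * m, Odd k ∧ ∃ c ∈ Ico 0 (T.len k), z = c • T.dir k}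

end MStar

/-! ### Branched pseudospherical immersions -/

/-- A star chart at `p` for `ψ : Ω → ℝ³`: a homeomorphism of an open neighbourhood of `p` in `Ω`
onto an `m`-star, with `p` going to the centre, such that in the asymptotic coordinates
of each (closed) sector `ψ` is a pseudospherical front. -/
structure StarChart (Ω : Set ℂ) (ψ : ℂ → E3) (p : ℂ) (m : ℕ) where
  star : MStar m
  homeo : OpenPartialHomeomorph ℂ ℂ
  source_subset : homeo.source ⊆ Ω
  mem_source : p ∈ homeo.source
  map_center : homeo p = 0
  target_eq : homeo.target = star.carrier
  front : ∀ k < 2 * m, IsPSFront (star.uDom k) (star.vDom k)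
    (fun u v => ψ (homeo.symm (star.point k u v)))

/-- `p` is a point of order of saddleness `m`. -/
def HasSaddleOrder (Ω : Set ℂ) (ψ : ℂ → E3) (p : ℂ) (m : ℕ) : Prop :=
  Nonempty (StarChart Ω ψ p m)

/-- `ψ : Ω → ℝ³` is a branched pseudospherical immersion of an open subset `Ω` of the hyperbolic
plane, in the Poincaré disk model `‖z‖ < 1`, `g = 4 |dz|² / (1 - ‖z‖²)²`. -/
structure IsBranchedPSImmersion (Ω : Set ℂ) (ψ : ℂ → E3) : Prop where
  isOpen : IsOpen Ω
  subset_disk : Ω ⊆ Metric.ball (0 : ℂ) 1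
  differentiableOn : DifferentiableOn ℝ ψ Ω
  lipschitz_fderiv : LocallyLipschitzOn Ω (fderiv ℝ ψ)
  isometric : ∀ z ∈ Ω, ∀ X Y : ℂ,
    inner ℝ (fderiv ℝ ψ z X) (fderiv ℝ ψ z Y) = 4 / (1 - ‖z‖ ^ 2) ^ 2 * inner ℝ X Y
  saddle : ∀ p ∈ Ω, ∃ m : ℕ, HasSaddleOrder Ω ψ p m

/-- The hyperbolic area of a subset of the Poincaré disk. -/
def hyperbolicArea (Γ : Set ℂ) : ℝ := ∫ z in Γ, 4 / (1 - ‖z‖ ^ 2) ^ 2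

/-! ### The angle between the asymptotic directions -/

/-- `dx ∧ dy` on a pair of tangent vectors of the plane. -/
def planarDet (X Y : ℂ) : ℝ := X.re * Y.im - X.im * Y.re

namespace StarChart

variable {Ω : Set ℂ} {ψ : ℂ → E3} {p : ℂ} {m : ℕ} (c : StarChart Ω ψ p m)

/-- The point of `Ω` with asymptotic coordinates `(u, v)` in sector `k`. -/
def param (k : ℕ) (u v : ℝ) : ℂ := c.homeo.symm (c.star.point k u v)

/-- The sign `σ` of `ω(∂_u, ∂_v)`, for the two-form `ω(z) dx ∧ dy` on `Ω`. -/
def sigma (ω : ℂ → ℝ) (k : ℕ) (u v : ℝ) : ℝ :=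
  Real.sign (ω (c.param k u v) *
    planarDet (partialU (c.star.uDom k) (c.param k) u v)
      (partialV (c.star.vDom k) (c.param k) u v))

/-- The angle `φ` between `∂_u r` and `σ ∂_v r` in sector `k`, where `r = ψ ∘ param k`; for
arc-length coordinates, `cos φ = σ ∂_u r · ∂_v r` and `sin φ = ‖∂_u r × ∂_v r‖`. -/
def phi (ω : ℂ → ℝ) (k : ℕ) (u v : ℝ) : ℝ :=
  InnerProductGeometry.angle
    (partialU (c.star.uDom k) (fun s t => ψ (c.param k s t)) u v)
    (c.sigma ω k u v • partialV (c.star.vDom k) (fun s t => ψ (c.param k s t)) u v)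

end StarChart

/-- `θ` is the asymptotic angle at `x`, computed in some (closed) sector that contains `x`. It is
unique except on asymptotic curves across which the angle jumps, where
it is one of the one-sided values. -/
def IsAsymptoticAngle (Ω : Set ℂ) (ψ : ℂ → E3) (ω : ℂ → ℝ) (x : ℂ) (θ : ℝ) : Prop :=
  ∃ (p : ℂ) (m : ℕ) (c : StarChart Ω ψ p m), ∃ k < 2 * m,
    ∃ u ∈ c.star.uDom k, ∃ v ∈ c.star.vDom k, c.param k u v = x ∧ θ = c.phi ω k u v

/-! ### Hamburger polygons -/

/-- `γ`, restricted to `[a, b]`, runs along `u`-asymptotic curves: near each of its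
points it stays on the `u`-rays that issue from the point. (A `u`-arc may have a corner
where it crosses an asymptotic curve across which the angle jumps.) -/
def IsUArc (Ω : Set ℂ) (ψ : ℂ → E3) (γ : ℝ → ℂ) (a b : ℝ) : Prop :=
  ∀ t ∈ Icc a b, ∃ (m : ℕ) (c : StarChart Ω ψ (γ t) m),
    ∀ᶠ s in 𝓝[Icc a b] t, γ s ∈ c.homeo.symm '' c.star.uRays

/-- `γ`, restricted to `[a, b]`, runs along `v`-asymptotic curves. -/
def IsVArc (Ω : Set ℂ) (ψ : ℂ → E3) (γ : ℝ → ℂ) (a b : ℝ) : Prop :=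
  ∀ t ∈ Icc a b, ∃ (m : ℕ) (c : StarChart Ω ψ (γ t) m),
    ∀ᶠ s in 𝓝[Icc a b] t, γ s ∈ c.homeo.symm '' c.star.vRays

/-- `γ : [0, 2j] → Ω` is a Hamburger polygon with vertices `γ 0, γ 1, …, γ (2j - 1)`: a Jordan
curve whose arc from `γ n` to `γ (n + 1)` is a `u`-arc for even `n` and a `v`-arc for odd `n`. -/
structure IsHamburgerPolygon (Ω : Set ℂ) (ψ : ℂ → E3) (j : ℕ) (γ : ℝ → ℂ) : Prop where
  pos : 0 < j
  continuousOn : ContinuousOn γ (Icc 0 (2 * j))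
  closed : γ (2 * j) = γ 0
  injOn : InjOn γ (Ico 0 (2 * j))
  uArc : ∀ n < 2 * j, Even n → IsUArc Ω ψ γ n (n + 1)
  vArc : ∀ n < 2 * j, Odd n → IsVArc Ω ψ γ n (n + 1)

/-- The closed curve `γ : [0, L] → ℂ` winds `w` times around `z`: a continuous choice of the
argument of `γ - z` increases by `2πw`. -/
def HasWindingNumber (γ : ℝ → ℂ) (L : ℝ) (z : ℂ) (w : ℝ) : Prop :=
  ∃ ϑ : ℝ → ℝ, ContinuousOn ϑ (Icc 0 L) ∧
    (∀ t ∈ Icc 0 L, γ t ≠ z ∧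
      γ t - z = (‖γ t - z‖ : ℂ) * Complex.exp ((ϑ t : ℂ) * Complex.I)) ∧
    ϑ L - ϑ 0 = 2 * Real.pi * w

end BranchedPS

end

noncomputable section

namespace BranchedPS

open ComplexConjugate

/-! Along an asymptotic net each of the two tangent fields is parallel in the direction of the
other, because lengths along one family do not change along the other. The angle between the
families therefore satisfies Hazzidakis' equation: its mixed derivative, times the coordinate area
form, is plus or minus the curvature form, that is, the area. On one rectangle, integration gives
the alternating sum of the corner angles. The theorem is the version of this with many rectangles,
with sectors meeting at branch points, and with a polygon whose parametrization is merely
continuous.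

The angle is not differentiable enough for the classical argument and may jump across rays, so
everything is tested against a C² function χ. On a cell with corner p, where χ vanishes near the two
far edges, ∫ χ dA is the sum of χ(p) f(p), of the integrals of f dχ along the two near edges, and of
the integral of f times the covariant Hessian of χ in the asymptotic directions (`weak_hazzidakis`,
`IsNet.integral_mul_lam`). Here f is the angle of the cell up to a constant. With a suitable
constant it is φ up to sign, and the Hessian term becomes the integral of a density that does not
depend on the chart (`hessWeight`, `IsNet.phi_eq`).

Regularity comes first. The net is only C¹ in the disk, but the lengths of its tangent vectors and
the Lipschitz bound on the differential of the immersion force its mixed derivative to exist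
(`hasDerivWithinAt_mixed`). The two directions are independent because the unit normal is Lipschitz
and rotates with opposite signs along the two families (`IsSector.planarDet_ne_zero`). The same fact
makes the asymptotic directions and rays independent of the chart (`IsFrame.eq_smul`,
`IsFan.ray_subset`).

Around a point of order m there are 2m cells whose angles at the centre add up to 2π
(`IsFan.angle_sum`). The sum of the two angles on the sides of a ray is constant along the ray
(`IsNet.netAngle_add_eq`), so the ray integrals collapse to values at the centre. At an interior
point what remains is (m - 2)π χ(p) (`IsFan.setIntegral_of_subset`). At a boundary point the polygon
is exactly two rays of the fan (`IsHamburgerPolygon.exists_boundaryFan`). These two rays contribute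
the Stieltjes integral along γ of the signed boundary angle against d(χ ∘ γ), taken as a limit of
Riemann sums. A vertex contributes in addition its signed angle times χ
(`IsBoundaryFan.setIntegral_formula`). The side on which the polygon sees Γ is found from the
winding number by integrating a smoothed Cauchy kernel over Γ (`hasSide_eq`).

The resulting identity is additive in χ, so a partition of unity glues the local statements into one
for a function equal to 1 on the closure of Γ (`exists_eqOn_one`). For this function all Hessian and
Stieltjes terms vanish, and what is left is the theorem. -/

/-- The function `f` of two variables has continuous partial derivatives `fu` and `fv`
on `I × J`. -/
structure HasPartials {E : Type*} [NormedAddCommGroup E] [NormedSpace ℝ E]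
    (I J : Set ℝ) (f fu fv : ℝ → ℝ → E) : Prop where
  hu : ∀ u ∈ I, ∀ v ∈ J, HasDerivWithinAt (fun s => f s v) (fu u v) I u
  hv : ∀ u ∈ I, ∀ v ∈ J, HasDerivWithinAt (fun t => f u t) (fv u v) J v
  cu : ContinuousOn (fun z : ℝ × ℝ => fu z.1 z.2) (I ×ˢ J)
  cv : ContinuousOn (fun z : ℝ × ℝ => fv z.1 z.2) (I ×ˢ J)

/-! ### Functions of two variables with continuous partial derivatives -/

section Partials

variable {E : Type*} [NormedAddCommGroup E] [NormedSpace ℝ E]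

/-- The linear map with the given values on the two coordinate vectors. -/
def pairMap (a b : E) : ℝ × ℝ →L[ℝ] E :=
  (ContinuousLinearMap.fst ℝ ℝ ℝ).smulRight a + (ContinuousLinearMap.snd ℝ ℝ ℝ).smulRight b

@[simp] lemma pairMap_apply (a b : E) (z : ℝ × ℝ) : pairMap a b z = z.1 • a + z.2 • b := by
  simp [pairMap]

/-- Mean value inequality for `g s - s • c` on the segment from u to u'. Only points within distance
|u' - u| of u occur on it, hence the form of `hb`. -/
lemma increment_le_of_hasDerivWithinAt {I : Set ℝ} (hI : Convex ℝ I) {g g' : ℝ → E} {c : E}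
    {ε u u' : ℝ} (hu : u ∈ I) (hu' : u' ∈ I)
    (hg : ∀ s ∈ I, HasDerivWithinAt g (g' s) I s)
    (hb : ∀ s ∈ I, |s - u| ≤ |u' - u| → ‖g' s - c‖ ≤ ε) :
    ‖g u' - g u - (u' - u) • c‖ ≤ ε * |u' - u| := by
  have hseg : uIcc u u' ⊆ I := by
    rw [← segment_eq_uIcc]; exact hI.segment_subset hu hu'
  have := (convex_uIcc u u').norm_image_sub_le_of_norm_hasDerivWithin_le
    (f := fun s => g s - s • c) (f' := fun s => g' s - (1 : ℝ) • c) (C := ε) (x := u) (y := u')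
    (fun s hs => ((hg s (hseg hs)).mono hseg).sub ((hasDerivWithinAt_id s _).smul_const c))
    (fun s hs => by
      rw [one_smul]
      refine hb s (hseg hs) ?_
      have := abs_sub_left_of_mem_uIcc hs
      simpa using this) left_mem_uIcc right_mem_uIcc
  rw [Real.norm_eq_abs] at this
  convert this using 2
  rw [sub_smul]; abel

/-- The increment is taken along the legs (u, v) → (u, v') → (u', v'). On each leg the partial
derivative is close to its value at (u, v) by joint continuity. -/
lemma HasPartials.hasFDerivWithinAt {I J : Set ℝ} (hI : Convex ℝ I) (hJ : Convex ℝ J)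
    {f fu fv : ℝ → ℝ → E} (h : HasPartials I J f fu fv) {z : ℝ × ℝ} (hz : z ∈ I ×ˢ J) :
    HasFDerivWithinAt (fun w : ℝ × ℝ => f w.1 w.2) (pairMap (fu z.1 z.2) (fv z.1 z.2))
      (I ×ˢ J) z := by
  obtain ⟨u, v⟩ := z
  rw [hasFDerivWithinAt_iff_isLittleO, Asymptotics.isLittleO_iff]
  intro ε hε
  have h1 := Metric.continuousWithinAt_iff.1 (h.cu (u, v) hz) (ε / 2) (by positivity)
  have h2 := Metric.continuousWithinAt_iff.1 (h.cv (u, v) hz) (ε / 2) (by positivity)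
  obtain ⟨d1, hd1, h1⟩ := h1
  obtain ⟨d2, hd2, h2⟩ := h2
  have hmem : I ×ˢ J ∩ Metric.ball (u, v) (min d1 d2) ∈ 𝓝[I ×ˢ J] (u, v) :=
    inter_mem self_mem_nhdsWithin
      (mem_nhdsWithin_of_mem_nhds (Metric.ball_mem_nhds _ (lt_min hd1 hd2)))
  filter_upwards [hmem] with w hw
  obtain ⟨u', v'⟩ := w
  obtain ⟨⟨hu', hv'⟩, hball⟩ := hw
  obtain ⟨hu, hv⟩ := hz
  simp only at hu hv hu' hv'
  rw [Metric.mem_ball, Prod.dist_eq, max_lt_iff] at hball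
  simp only [Real.dist_eq] at hball
  have e1 := increment_le_of_hasDerivWithinAt hI (c := fu u v) (ε := ε / 2) hu hu'
    (fun s hs => h.hu s hs v' hv') (fun s hs hs' => by
      have := h1 (x := (s, v')) ⟨hs, hv'⟩ (by
        rw [Prod.dist_eq, max_lt_iff]; simp only [Real.dist_eq]
        exact ⟨lt_of_le_of_lt hs' (hball.1.trans_le (min_le_left _ _)),
          hball.2.trans_le (min_le_left _ _)⟩)
      rw [dist_eq_norm] at this
      exact this.le)
  have e2 := increment_le_of_hasDerivWithinAt hJ (c := fv u v) (ε := ε / 2) hv hv'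
    (fun s hs => h.hv u hu s hs) (fun s hs hs' => by
      have := h2 (x := (u, s)) ⟨hu, hs⟩ (by
        rw [Prod.dist_eq, max_lt_iff]; simp only [Real.dist_eq]
        exact ⟨by simp [hd2],
          lt_of_le_of_lt hs' (hball.2.trans_le (min_le_right _ _))⟩)
      rw [dist_eq_norm] at this
      exact this.le)
  have hn : |u' - u| ≤ ‖((u', v') : ℝ × ℝ) - (u, v)‖ := by
    exact norm_fst_le (((u', v') : ℝ × ℝ) - (u, v))
  have hn' : |v' - v| ≤ ‖((u', v') : ℝ × ℝ) - (u, v)‖ := by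
    exact norm_snd_le (((u', v') : ℝ × ℝ) - (u, v))
  have : f u' v' - f u v - pairMap (fu u v) (fv u v) (((u', v') : ℝ × ℝ) - (u, v))
      = (f u' v' - f u v' - (u' - u) • fu u v) + (f u v' - f u v - (v' - v) • fv u v) := by
    simp [pairMap_apply]; abel
  simp only
  rw [this]
  calc _ ≤ _ := norm_add_le _ _
    _ ≤ ε / 2 * |u' - u| + ε / 2 * |v' - v| := add_le_add e1 e2
    _ ≤ ε / 2 * ‖((u', v') : ℝ × ℝ) - (u, v)‖ + ε / 2 * ‖((u', v') : ℝ × ℝ) - (u, v)‖ := by gcongr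
    _ = _ := by ring

lemma HasPartials.continuousOn {I J : Set ℝ} (hI : Convex ℝ I) (hJ : Convex ℝ J)
    {f fu fv : ℝ → ℝ → E} (h : HasPartials I J f fu fv) :
    ContinuousOn (fun w : ℝ × ℝ => f w.1 w.2) (I ×ˢ J) :=
  fun _ hz => (h.hasFDerivWithinAt hI hJ hz).continuousWithinAt

lemma HasPartials.mono {I J I' J' : Set ℝ} {f fu fv : ℝ → ℝ → E} (h : HasPartials I J f fu fv)
    (hI : I' ⊆ I) (hJ : J' ⊆ J) : HasPartials I' J' f fu fv where
  hu u hu v hv := (h.hu u (hI hu) v (hJ hv)).mono hI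
  hv u hu v hv := (h.hv u (hI hu) v (hJ hv)).mono hJ
  cu := h.cu.mono (prod_mono hI hJ)
  cv := h.cv.mono (prod_mono hI hJ)

lemma HasPartials.swap {I J : Set ℝ} {f fu fv : ℝ → ℝ → E} (h : HasPartials I J f fu fv) :
    HasPartials J I (fun v u => f u v) (fun v u => fv u v) (fun v u => fu u v) where
  hu v hv u hu := h.hv u hu v hv
  hv v hv u hu := h.hu u hu v hv
  cu := h.cv.comp continuous_swap.continuousOn (fun _ hz => ⟨hz.2, hz.1⟩)
  cv := h.cu.comp continuous_swap.continuousOn (fun _ hz => ⟨hz.2, hz.1⟩)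

end Partials

/-! ### Integration over a square -/

section Square

lemma ContinuousOn.slice_fst {X : Type*} [TopologicalSpace X] {I J : Set ℝ} {f : ℝ → ℝ → X}
    (h : ContinuousOn (fun z : ℝ × ℝ => f z.1 z.2) (I ×ˢ J)) {v : ℝ} (hv : v ∈ J) :
    ContinuousOn (fun u => f u v) I :=
  h.comp (f := fun u : ℝ => ((u, v) : ℝ × ℝ)) (by fun_prop) (fun _ hu => ⟨hu, hv⟩)

lemma ContinuousOn.slice_snd {X : Type*} [TopologicalSpace X] {I J : Set ℝ} {f : ℝ → ℝ → X}
    (h : ContinuousOn (fun z : ℝ × ℝ => f z.1 z.2) (I ×ˢ J)) {u : ℝ} (hu : u ∈ I) :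
    ContinuousOn (fun v => f u v) J :=
  h.comp (f := fun v : ℝ => ((u, v) : ℝ × ℝ)) (by fun_prop) (fun _ hv => ⟨hu, hv⟩)

lemma integrableOn_square {E : Type*} [NormedAddCommGroup E] {δ : ℝ} {f : ℝ → ℝ → E}
    (hf : ContinuousOn (fun z : ℝ × ℝ => f z.1 z.2) (Icc 0 δ ×ˢ Icc 0 δ)) :
    IntegrableOn (fun z : ℝ × ℝ => f z.1 z.2) (Icc 0 δ ×ˢ Icc 0 δ) :=
  hf.integrableOn_compact (isCompact_Icc.prod isCompact_Icc)

variable {E : Type*} [NormedAddCommGroup E] [NormedSpace ℝ E]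

lemma integral_square_eq {δ : ℝ} (hδ : 0 ≤ δ) {f : ℝ → ℝ → E}
    (hf : ContinuousOn (fun z : ℝ × ℝ => f z.1 z.2) (Icc 0 δ ×ˢ Icc 0 δ)) :
    ∫ z in Icc 0 δ ×ˢ Icc 0 δ, f z.1 z.2 = ∫ x in 0..δ, ∫ y in 0..δ, f x y := by
  have := setIntegral_prod (μ := volume) (ν := volume) (fun z : ℝ × ℝ => f z.1 z.2)
    (integrableOn_square hf)
  rw [← Measure.volume_eq_prod] at this
  rw [this, intervalIntegral.integral_of_le hδ, ← integral_Icc_eq_integral_Ioc]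
  refine setIntegral_congr_fun measurableSet_Icc fun x _ => ?_
  simp only
  rw [intervalIntegral.integral_of_le hδ, integral_Icc_eq_integral_Ioc]

lemma integral_square_eq' {δ : ℝ} (hδ : 0 ≤ δ) {f : ℝ → ℝ → E}
    (hf : ContinuousOn (fun z : ℝ × ℝ => f z.1 z.2) (Icc 0 δ ×ˢ Icc 0 δ)) :
    ∫ z in Icc 0 δ ×ˢ Icc 0 δ, f z.1 z.2 = ∫ y in 0..δ, ∫ x in 0..δ, f x y := by
  rw [integral_square_eq hδ hf, intervalIntegral_intervalIntegral_swap]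
  rw [uIoc_of_le hδ]
  exact (integrableOn_square hf).mono_set (prod_mono Ioc_subset_Icc_self Ioc_subset_Icc_self)

variable [CompleteSpace E]

lemma integral_eq_sub_of_hasDerivWithinAt_Icc {a b : ℝ} (hab : a ≤ b) {f f' : ℝ → E}
    (hf : ∀ x ∈ Icc a b, HasDerivWithinAt f (f' x) (Icc a b) x) (hf' : ContinuousOn f' (Icc a b)) :
    ∫ x in a..b, f' x = f b - f a := by
  refine intervalIntegral.integral_eq_sub_of_hasDerivAt_of_le hab
    (fun x hx => (hf x hx).continuousWithinAt)
    (fun x hx => (hf x (Ioo_subset_Icc_self hx)).hasDerivAt (Icc_mem_nhds hx.1 hx.2)) ?_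
  exact ContinuousOn.intervalIntegrable (by rwa [uIcc_of_le hab])

lemma integral_square_partial_fst {δ : ℝ} (hδ : 0 ≤ δ) {f fx : ℝ → ℝ → E}
    (hf : ∀ x ∈ Icc 0 δ, ∀ y ∈ Icc 0 δ, HasDerivWithinAt (fun s => f s y) (fx x y) (Icc 0 δ) x)
    (hfx : ContinuousOn (fun z : ℝ × ℝ => fx z.1 z.2) (Icc 0 δ ×ˢ Icc 0 δ)) :
    ∫ z in Icc 0 δ ×ˢ Icc 0 δ, fx z.1 z.2 = ∫ y in 0..δ, (f δ y - f 0 y) := by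
  rw [integral_square_eq' hδ hfx]
  refine intervalIntegral.integral_congr fun y hy => ?_
  rw [uIcc_of_le hδ] at hy
  exact integral_eq_sub_of_hasDerivWithinAt_Icc (f := fun s => f s y) hδ (fun x hx => hf x hx y hy)
    (ContinuousOn.slice_fst (f := fx) hfx hy)

lemma integral_square_partial_snd {δ : ℝ} (hδ : 0 ≤ δ) {f fy : ℝ → ℝ → E}
    (hf : ∀ x ∈ Icc 0 δ, ∀ y ∈ Icc 0 δ, HasDerivWithinAt (fun t => f x t) (fy x y) (Icc 0 δ) y)
    (hfy : ContinuousOn (fun z : ℝ × ℝ => fy z.1 z.2) (Icc 0 δ ×ˢ Icc 0 δ)) :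
    ∫ z in Icc 0 δ ×ˢ Icc 0 δ, fy z.1 z.2 = ∫ x in 0..δ, (f x δ - f x 0) := by
  rw [integral_square_eq hδ hfy]
  refine intervalIntegral.integral_congr fun x hx => ?_
  rw [uIcc_of_le hδ] at hx
  exact integral_eq_sub_of_hasDerivWithinAt_Icc (f := fun s => f x s) hδ (fun y hy => hf x hx y hy)
    (ContinuousOn.slice_snd (f := fy) hfy hx)

/-- Green's formula on a square, for one-forms `a dx + b dy` that vanish on the far sides. -/
lemma green_square {δ : ℝ} (hδ : 0 ≤ δ) {a b ay bx : ℝ → ℝ → E}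
    (ha : ∀ x ∈ Icc 0 δ, ∀ y ∈ Icc 0 δ, HasDerivWithinAt (fun t => a x t) (ay x y) (Icc 0 δ) y)
    (hb : ∀ x ∈ Icc 0 δ, ∀ y ∈ Icc 0 δ, HasDerivWithinAt (fun s => b s y) (bx x y) (Icc 0 δ) x)
    (hay : ContinuousOn (fun z : ℝ × ℝ => ay z.1 z.2) (Icc 0 δ ×ˢ Icc 0 δ))
    (hbx : ContinuousOn (fun z : ℝ × ℝ => bx z.1 z.2) (Icc 0 δ ×ˢ Icc 0 δ))
    (ha0 : ∀ x ∈ Icc 0 δ, a x δ = 0) (hb0 : ∀ y ∈ Icc 0 δ, b δ y = 0) :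
    ∫ z in Icc 0 δ ×ˢ Icc 0 δ, (bx z.1 z.2 - ay z.1 z.2)
      = (∫ x in 0..δ, a x 0) - ∫ y in 0..δ, b 0 y := by
  rw [integral_sub (integrableOn_square hbx) (integrableOn_square hay),
    integral_square_partial_fst hδ hb hbx, integral_square_partial_snd hδ ha hay]
  have e1 : ∫ y in 0..δ, (b δ y - b 0 y) = - ∫ y in 0..δ, b 0 y := by
    rw [← intervalIntegral.integral_neg]
    refine intervalIntegral.integral_congr fun y hy => ?_
    rw [uIcc_of_le hδ] at hy
    simp [hb0 y hy]
  have e2 : ∫ x in 0..δ, (a x δ - a x 0) = - ∫ x in 0..δ, a x 0 := by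
    rw [← intervalIntegral.integral_neg]
    refine intervalIntegral.integral_congr fun y hy => ?_
    rw [uIcc_of_le hδ] at hy
    simp [ha0 y hy]
  rw [e1, e2]; abel

/-- The weak form of Hazzidakis' formula. If `β_x = -a`, `α_y = -b`, then `b_x - a_y` is the mixed
derivative of `β - α` in the sense of distributions. -/
lemma weak_hazzidakis {δ : ℝ} (hδ : 0 < δ) {χ χx χy χxy a b ay bx α β : ℝ → ℝ → ℝ}
    (hχ : HasPartials (Icc 0 δ) (Icc 0 δ) χ χx χy)
    (hχx : ∀ x ∈ Icc 0 δ, ∀ y ∈ Icc 0 δ, HasDerivWithinAt (fun t => χx x t) (χxy x y) (Icc 0 δ) y)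
    (hχy : ∀ x ∈ Icc 0 δ, ∀ y ∈ Icc 0 δ, HasDerivWithinAt (fun s => χy s y) (χxy x y) (Icc 0 δ) x)
    (hχxy : ContinuousOn (fun z : ℝ × ℝ => χxy z.1 z.2) (Icc 0 δ ×ˢ Icc 0 δ))
    (hχ1 : ∀ y ∈ Icc 0 δ, χ δ y = 0) (hχ2 : ∀ x ∈ Icc 0 δ, χ x δ = 0)
    (hχ3 : ∀ y ∈ Icc 0 δ, χy δ y = 0) (hχ4 : ∀ x ∈ Icc 0 δ, χx x δ = 0)
    (ha : ∀ x ∈ Icc 0 δ, ∀ y ∈ Icc 0 δ, HasDerivWithinAt (fun t => a x t) (ay x y) (Icc 0 δ) y)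
    (hb : ∀ x ∈ Icc 0 δ, ∀ y ∈ Icc 0 δ, HasDerivWithinAt (fun s => b s y) (bx x y) (Icc 0 δ) x)
    (hay : ContinuousOn (fun z : ℝ × ℝ => ay z.1 z.2) (Icc 0 δ ×ˢ Icc 0 δ))
    (hbx : ContinuousOn (fun z : ℝ × ℝ => bx z.1 z.2) (Icc 0 δ ×ˢ Icc 0 δ))
    (hac : ContinuousOn (fun z : ℝ × ℝ => a z.1 z.2) (Icc 0 δ ×ˢ Icc 0 δ))
    (hbc : ContinuousOn (fun z : ℝ × ℝ => b z.1 z.2) (Icc 0 δ ×ˢ Icc 0 δ))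
    (hαc : ContinuousOn (fun z : ℝ × ℝ => α z.1 z.2) (Icc 0 δ ×ˢ Icc 0 δ))
    (hβc : ContinuousOn (fun z : ℝ × ℝ => β z.1 z.2) (Icc 0 δ ×ˢ Icc 0 δ))
    (hα : ∀ x ∈ Icc 0 δ, ∀ y ∈ Icc 0 δ, HasDerivWithinAt (fun t => α x t) (-b x y) (Icc 0 δ) y)
    (hβ : ∀ x ∈ Icc 0 δ, ∀ y ∈ Icc 0 δ, HasDerivWithinAt (fun s => β s y) (-a x y) (Icc 0 δ) x) :
    ∫ z in Icc 0 δ ×ˢ Icc 0 δ, χ z.1 z.2 * (bx z.1 z.2 - ay z.1 z.2)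
      = χ 0 0 * (β 0 0 - α 0 0) + (∫ x in 0..δ, χx x 0 * (β x 0 - α x 0))
        + (∫ y in 0..δ, χy 0 y * (β 0 y - α 0 y))
        + ∫ z in Icc 0 δ ×ˢ Icc 0 δ, χxy z.1 z.2 * (β z.1 z.2 - α z.1 z.2) := by
  have hδ0 := hδ.le
  have h0 : (0 : ℝ) ∈ Icc 0 δ := ⟨le_rfl, hδ0⟩
  have hχc := hχ.continuousOn (convex_Icc _ _) (convex_Icc _ _)
  -- `G` is Green's formula for χ (a dx + b dy) and contains the left-hand side. `A` and `B`
  -- integrate (χ_x α)_y and (χ_y β)_x over the square, which trades χ_x b and χ_y a for χ_xy α and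
  -- χ_xy β. `C` and `D` do the same on the near edges. Thus α is differentiated in y only and β in
  -- x only.
  have G := green_square (E := ℝ) hδ0 (a := fun x y => χ x y * a x y) (b := fun x y => χ x y * b x y)
    (ay := fun x y => χy x y * a x y + χ x y * ay x y)
    (bx := fun x y => χx x y * b x y + χ x y * bx x y)
    (fun x hx y hy => (hχ.hv x hx y hy).mul (ha x hx y hy))
    (fun x hx y hy => (hχ.hu x hx y hy).mul (hb x hx y hy))
    ((hχ.cv.mul hac).add (hχc.mul hay)) ((hχ.cu.mul hbc).add (hχc.mul hbx))
    (fun x hx => by simp [hχ2 x hx]) (fun y hy => by simp [hχ1 y hy])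
  have A := integral_square_partial_snd (E := ℝ) hδ0 (f := fun x y => χx x y * α x y)
    (fy := fun x y => χxy x y * α x y + χx x y * (-b x y))
    (fun x hx y hy => (hχx x hx y hy).mul (hα x hx y hy))
    ((hχxy.mul hαc).add (hχ.cu.mul hbc.neg))
  have B := integral_square_partial_fst (E := ℝ) hδ0 (f := fun x y => χy x y * β x y)
    (fx := fun x y => χxy x y * β x y + χy x y * (-a x y))
    (fun x hx y hy => (hχy x hx y hy).mul (hβ x hx y hy))
    ((hχxy.mul hβc).add (hχ.cv.mul hac.neg))
  have C := integral_eq_sub_of_hasDerivWithinAt_Icc (E := ℝ) hδ0 (f := fun x => χ x 0 * β x 0)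
    (f' := fun x => χx x 0 * β x 0 + χ x 0 * (-a x 0))
    (fun x hx => (hχ.hu x hx 0 h0).mul (hβ x hx 0 h0))
    (ContinuousOn.slice_fst (f := fun x y => χx x y * β x y + χ x y * (-a x y))
      ((hχ.cu.mul hβc).add (hχc.mul hac.neg)) h0)
  have D := integral_eq_sub_of_hasDerivWithinAt_Icc (E := ℝ) hδ0 (f := fun y => χ 0 y * α 0 y)
    (f' := fun y => χy 0 y * α 0 y + χ 0 y * (-b 0 y))
    (fun y hy => (hχ.hv 0 h0 y hy).mul (hα 0 h0 y hy))
    (ContinuousOn.slice_snd (f := fun x y => χy x y * α x y + χ x y * (-b x y))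
      ((hχ.cv.mul hαc).add (hχc.mul hbc.neg)) h0)
  have iv : ∀ {f : ℝ → ℝ}, ContinuousOn f (Icc 0 δ) → IntervalIntegrable f volume 0 δ :=
    fun h => ContinuousOn.intervalIntegrable (by rwa [uIcc_of_le hδ0])
  have cx : ∀ {f : ℝ → ℝ → ℝ}, ContinuousOn (fun z : ℝ × ℝ => f z.1 z.2) (Icc 0 δ ×ˢ Icc 0 δ) →
      IntervalIntegrable (fun x => f x 0) volume 0 δ := fun h =>
    iv (ContinuousOn.slice_fst h h0)
  have cy : ∀ {f : ℝ → ℝ → ℝ}, ContinuousOn (fun z : ℝ × ℝ => f z.1 z.2) (Icc 0 δ ×ˢ Icc 0 δ) →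
      IntervalIntegrable (fun y => f 0 y) volume 0 δ := fun h =>
    iv (ContinuousOn.slice_snd h h0)
  have A' : ∫ x in 0..δ, (χx x δ * α x δ - χx x 0 * α x 0) = - ∫ x in 0..δ, χx x 0 * α x 0 := by
    rw [← intervalIntegral.integral_neg]
    refine intervalIntegral.integral_congr fun y hy => ?_
    rw [uIcc_of_le hδ0] at hy
    simp [hχ4 y hy]
  have B' : ∫ y in 0..δ, (χy δ y * β δ y - χy 0 y * β 0 y) = - ∫ y in 0..δ, χy 0 y * β 0 y := by
    rw [← intervalIntegral.integral_neg]
    refine intervalIntegral.integral_congr fun y hy => ?_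
    rw [uIcc_of_le hδ0] at hy
    simp [hχ3 y hy]
  simp only [A'] at A
  simp only [B'] at B
  rw [integral_add (integrableOn_square (f := fun x y => χxy x y * α x y) (hχxy.mul hαc))
    (integrableOn_square (f := fun x y => χx x y * -b x y) (hχ.cu.mul hbc.neg))] at A
  rw [integral_add (integrableOn_square (f := fun x y => χxy x y * β x y) (hχxy.mul hβc))
    (integrableOn_square (f := fun x y => χy x y * -a x y) (hχ.cv.mul hac.neg))] at B
  rw [intervalIntegral.integral_add (cx (f := fun x y => χx x y * β x y) (hχ.cu.mul hβc))
    (cx (f := fun x y => χ x y * -a x y) (hχc.mul hac.neg))] at C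
  rw [intervalIntegral.integral_add (cy (f := fun x y => χy x y * α x y) (hχ.cv.mul hαc))
    (cy (f := fun x y => χ x y * -b x y) (hχc.mul hbc.neg))] at D
  simp only [mul_neg, integral_neg, intervalIntegral.integral_neg] at A B C D
  have G' : ∫ z in Icc 0 δ ×ˢ Icc 0 δ, ((χx z.1 z.2 * b z.1 z.2 + χ z.1 z.2 * bx z.1 z.2)
      - (χy z.1 z.2 * a z.1 z.2 + χ z.1 z.2 * ay z.1 z.2))
      = (∫ z in Icc 0 δ ×ˢ Icc 0 δ, χx z.1 z.2 * b z.1 z.2)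
        - (∫ z in Icc 0 δ ×ˢ Icc 0 δ, χy z.1 z.2 * a z.1 z.2)
        + ∫ z in Icc 0 δ ×ˢ Icc 0 δ, χ z.1 z.2 * (bx z.1 z.2 - ay z.1 z.2) := by
    rw [← integral_sub (integrableOn_square (f := fun x y => χx x y * b x y) (hχ.cu.mul hbc))
      (integrableOn_square (f := fun x y => χy x y * a x y) (hχ.cv.mul hac)),
      ← integral_add]
    · refine integral_congr_ae (Eventually.of_forall fun z => ?_); simp only; ring
    · exact integrableOn_square (f := fun x y => χx x y * b x y - χy x y * a x y)
        ((hχ.cu.mul hbc).sub (hχ.cv.mul hac))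
    · exact integrableOn_square (f := fun x y => χ x y * (bx x y - ay x y))
        (hχc.mul (hbx.sub hay))
  rw [G'] at G
  simp only [mul_sub (χx _ _), mul_sub (χy _ _), mul_sub (χxy _ _)]
  rw [intervalIntegral.integral_sub (cx (f := fun x y => χx x y * β x y) (hχ.cu.mul hβc))
      (cx (f := fun x y => χx x y * α x y) (hχ.cu.mul hαc)),
    intervalIntegral.integral_sub (cy (f := fun x y => χy x y * β x y) (hχ.cv.mul hβc))
      (cy (f := fun x y => χy x y * α x y) (hχ.cv.mul hαc)),
    integral_sub (integrableOn_square (f := fun x y => χxy x y * β x y) (hχxy.mul hβc))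
    (integrableOn_square (f := fun x y => χxy x y * α x y) (hχxy.mul hαc))]
  simp only [hχ1 0 h0, hχ2 0 h0, zero_mul, zero_sub] at C D
  linarith

end Square

/-! ### The hyperbolic metric and the mixed derivative of a C¹ net -/

/-- The conformal factor of the hyperbolic metric on the disk. -/
def lam (z : ℂ) : ℝ := 4 / (1 - ‖z‖ ^ 2) ^ 2

/-- The Christoffel symbol of the hyperbolic metric on the disk, in complex notation. -/
def chris (z : ℂ) : ℂ := 2 * conj z / ((1 - ‖z‖ ^ 2 : ℝ) : ℂ)

lemma one_sub_sq_pos {z : ℂ} (hz : ‖z‖ < 1) : 0 < 1 - ‖z‖ ^ 2 := by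
  nlinarith [norm_nonneg z]

lemma lam_pos {z : ℂ} (hz : ‖z‖ < 1) : 0 < lam z := by
  have := one_sub_sq_pos hz
  unfold lam; positivity

/-- The covariant mixed derivative of a net with tangent vectors `a`, `b` vanishes when the mixed
derivative is this. -/
def mixedTerm (z a b : ℂ) : ℂ := -(chris z * a * b)

lemma mixedTerm_comm (z a b : ℂ) : mixedTerm z a b = mixedTerm z b a := by
  unfold mixedTerm; ring

lemma norm_sq_increment (w w' : ℂ) :
    ‖w'‖ ^ 2 - ‖w‖ ^ 2 = 2 * (conj w * (w' - w)).re + ‖w' - w‖ ^ 2 := by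
  simp only [← Complex.normSq_eq_norm_sq, Complex.normSq_apply, Complex.mul_re, Complex.conj_re,
    Complex.conj_im, Complex.sub_re, Complex.sub_im]
  ring

/-- Cramer's rule: det(a, b) w is, up to a rotation, the combination of a and b whose coefficients
are the inner products of w with b and a. -/
lemma norm_mul_planarDet_le (w a b : ℂ) :
    ‖w‖ * |planarDet a b| ≤ ‖b‖ * |(conj a * w).re| + ‖a‖ * |(conj b * w).re| := by
  have h : (planarDet a b : ℂ) * w = Complex.I * ((conj b * w).re * a - (conj a * w).re * b) := by
    apply Complex.ext <;> simp [planarDet] <;> ring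
  have h2 : ‖w‖ * |planarDet a b| = ‖(planarDet a b : ℂ) * w‖ := by
    rw [norm_mul, Complex.norm_real, Real.norm_eq_abs, mul_comm]
  rw [h2, h, norm_mul, Complex.norm_I, one_mul]
  refine (norm_sub_le _ _).trans ?_
  rw [norm_mul, norm_mul, Complex.norm_real, Complex.norm_real, Real.norm_eq_abs, Real.norm_eq_abs]
  linarith

lemma exists_ball_of_continuousWithinAt {X : Type*} [PseudoMetricSpace X] {I J : Set ℝ}
    {f : ℝ → ℝ → X} (hf : ContinuousOn (fun z : ℝ × ℝ => f z.1 z.2) (I ×ˢ J)) {u v : ℝ}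
    (hu : u ∈ I) (hv : v ∈ J) {ε : ℝ} (hε : 0 < ε) :
    ∃ η > 0, ∀ s ∈ I, ∀ t ∈ J, |s - u| ≤ η → |t - v| ≤ η → dist (f s t) (f u v) ≤ ε := by
  obtain ⟨d, hd, h⟩ := Metric.continuousWithinAt_iff.1 (hf (u, v) ⟨hu, hv⟩) ε hε
  refine ⟨d / 2, by positivity, fun s hs t ht h1 h2 => (h (x := (s, t)) ⟨hs, ht⟩ ?_).le⟩
  rw [Prod.dist_eq, max_lt_iff]
  simp only [Real.dist_eq]
  constructor <;> linarith

/-- The projection of the second difference on a = z_u(u, v) is estimated by the mean value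
inequality in s. Its derivative at r is Re(ā A), with A the increment of z_u(r, ·). The identity |w
+ A|² - |w|² = 2 Re(w̄ A) + |A|² with w = z_u(r, v) finds Re(w̄ A) from the known derivative of
|z_u|². The Lipschitz bound makes |A|² negligible, and w is close to a. -/
lemma mixed_difference_re {I J : Set ℝ} (hI : Convex ℝ I) (hJ : Convex ℝ J)
    {z zu zv : ℝ → ℝ → ℂ} (hz : HasPartials I J z zu zv) {T : ℝ → ℝ → ℝ}
    (hT : ∀ u ∈ I, ∀ v ∈ J, HasDerivWithinAt (fun t => ‖zu u t‖ ^ 2) (T u v) J v)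
    (hTc : ContinuousOn (fun z : ℝ × ℝ => T z.1 z.2) (I ×ˢ J))
    {C : ℝ} (hC : ∀ u ∈ I, ∀ v ∈ J, ∀ v' ∈ J, ‖zu u v' - zu u v‖ ≤ C * |v' - v|)
    {u v : ℝ} (hu : u ∈ I) (hv : v ∈ J) {H : ℂ} (hH : T u v = 2 * (conj (zu u v) * H).re)
    {ε : ℝ} (hε : 0 < ε) :
    ∃ η > 0, ∀ s ∈ I, ∀ t ∈ J, |s - u| ≤ η → |t - v| ≤ η →
      |(conj (zu u v) * (z s t - z s v - z u t + z u v - ((s - u) * (t - v) : ℝ) * H)).re|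
        ≤ ε * (|s - u| * |t - v|) := by
  obtain ⟨η1, hη1, h1⟩ := exists_ball_of_continuousWithinAt hTc hu hv (half_pos hε)
  set C' : ℝ := |C| + 1 with hC'
  have hC'pos : 0 < C' := by positivity
  have hC2 : ∀ u ∈ I, ∀ v ∈ J, ∀ v' ∈ J, ‖zu u v' - zu u v‖ ≤ C' * |v' - v| := by
    intro u hu v hv v' hv'
    refine (hC u hu v hv v' hv').trans ?_
    gcongr
    rw [hC']; linarith [le_abs_self C]
  obtain ⟨η2, hη2, h2⟩ := exists_ball_of_continuousWithinAt hz.cu hu hv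
    (show 0 < ε / (4 * C') by positivity)
  refine ⟨min (min η1 η2) (ε / (2 * C' ^ 2)), by positivity, fun s hs t ht hsu htv => ?_⟩
  have hsu1 : |s - u| ≤ η1 := hsu.trans ((min_le_left _ _).trans (min_le_left _ _))
  have hsu2 : |s - u| ≤ η2 := hsu.trans ((min_le_left _ _).trans (min_le_right _ _))
  have htv1 : |t - v| ≤ η1 := htv.trans ((min_le_left _ _).trans (min_le_left _ _))
  have htv3 : |t - v| ≤ ε / (2 * C' ^ 2) := htv.trans (min_le_right _ _)
  set a := zu u v with ha
  have key := increment_le_of_hasDerivWithinAt (E := ℝ) hI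
    (g := fun r => (conj a * (z r t - z r v)).re)
    (g' := fun r => (conj a * (zu r t - zu r v)).re) (c := (t - v) * (conj a * H).re)
    (ε := ε * |t - v|) hu hs
    (fun r hr => Complex.reCLM.hasFDerivAt.comp_hasDerivWithinAt r
      (((hz.hu r hr t ht).sub (hz.hu r hr v hv)).const_mul _))
    (fun r hr hru => by
      have q := increment_le_of_hasDerivWithinAt (E := ℝ) hJ (c := T u v) (ε := ε / 2) hv ht
        (fun s hs => hT r hr s hs) (fun s hs hs' => by
          have := h1 r hr s hs (hru.trans hsu1) (hs'.trans htv1)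
          rwa [dist_eq_norm] at this)
      rw [Real.norm_eq_abs, norm_sq_increment, hH, smul_eq_mul] at q
      have hA := hC2 r hr v hv t ht
      have hw := h2 r hr v hv (hru.trans hsu2) (by simp [hη2.le])
      rw [dist_eq_norm] at hw
      set A := zu r t - zu r v with hAdef
      set w := zu r v with hw'
      have e1 : (conj w * A).re = (conj a * A).re + (conj (w - a) * A).re := by
        rw [← Complex.add_re, ← add_mul, map_sub]; ring_nf
      have e2 : |(conj (w - a) * A).re| ≤ ε / (4 * C') * (C' * |t - v|) := by
        refine (Complex.abs_re_le_norm _).trans ?_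
        rw [norm_mul, Complex.norm_conj]
        gcongr
      have e3 : ε / (4 * C') * (C' * |t - v|) = ε / 4 * |t - v| := by field_simp
      have e4 : ‖A‖ ^ 2 ≤ ε / 2 * |t - v| := by
        calc ‖A‖ ^ 2 ≤ (C' * |t - v|) ^ 2 := by gcongr
          _ = C' ^ 2 * |t - v| * |t - v| := by ring
          _ ≤ C' ^ 2 * (ε / (2 * C' ^ 2)) * |t - v| := by gcongr
          _ = _ := by field_simp
      rw [Real.norm_eq_abs]
      rw [e3] at e2
      rw [e1] at q
      have := sq_nonneg ‖A‖
      rw [abs_le] at q e2 ⊢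
      constructor <;> nlinarith [q.1, q.2, e2.1, e2.2])
  rw [Real.norm_eq_abs] at key
  have e : (conj a * (z s t - z s v - z u t + z u v - ((s - u) * (t - v) : ℝ) * H)).re
      = (conj a * (z s t - z s v)).re - (conj a * (z u t - z u v)).re
        - (s - u) • ((t - v) * (conj a * H).re) := by
    have : ((s - u) * (t - v) : ℝ) * (conj a * H).re
        = (conj a * (((s - u) * (t - v) : ℝ) * H)).re := by
      rw [← Complex.re_ofReal_mul]; ring_nf
    rw [smul_eq_mul, ← mul_assoc, this, ← Complex.sub_re, ← Complex.sub_re]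
    ring_nf
  rw [e]
  calc _ ≤ _ := key
    _ = _ := by ring

/-- The mixed derivative of a `C¹` net is determined by the metric, when the length of each
tangent vector is constant in the transverse direction. -/
lemma hasDerivWithinAt_mixed {I J : Set ℝ} (hI : Convex ℝ I) (hJ : Convex ℝ J)
    (hJ' : UniqueDiffOn ℝ J)
    {z zu zv : ℝ → ℝ → ℂ} (hz : HasPartials I J z zu zv) {T S : ℝ → ℝ → ℝ}
    (hT : ∀ u ∈ I, ∀ v ∈ J, HasDerivWithinAt (fun t => ‖zu u t‖ ^ 2) (T u v) J v)
    (hTc : ContinuousOn (fun z : ℝ × ℝ => T z.1 z.2) (I ×ˢ J))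
    (hS : ∀ u ∈ I, ∀ v ∈ J, HasDerivWithinAt (fun s => ‖zv s v‖ ^ 2) (S u v) I u)
    (hSc : ContinuousOn (fun z : ℝ × ℝ => S z.1 z.2) (I ×ˢ J))
    {C : ℝ} (hC : ∀ u ∈ I, ∀ v ∈ J, ∀ v' ∈ J, ‖zu u v' - zu u v‖ ≤ C * |v' - v|)
    (hC' : ∀ u ∈ I, ∀ u' ∈ I, ∀ v ∈ J, ‖zv u' v - zv u v‖ ≤ C * |u' - u|)
    {u v : ℝ} (hu : u ∈ I) (hv : v ∈ J) (hdet : planarDet (zu u v) (zv u v) ≠ 0)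
    {H : ℂ} (hH : T u v = 2 * (conj (zu u v) * H).re) (hH' : S u v = 2 * (conj (zv u v) * H).re) :
    HasDerivWithinAt (fun s => zv s v) H I u := by
  rw [hasDerivWithinAt_iff_isLittleO, Asymptotics.isLittleO_iff]
  intro ε hε
  set d := |planarDet (zu u v) (zv u v)| with hd
  have hdpos : 0 < d := abs_pos.2 hdet
  set K := (‖zu u v‖ + ‖zv u v‖ + 1) / d with hK
  have hKpos : 0 < K := by positivity
  obtain ⟨η1, hη1, h1⟩ := mixed_difference_re hI hJ hz hT hTc hC hu hv hH
    (show 0 < ε / K by positivity)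
  obtain ⟨η2, hη2, h2⟩ := mixed_difference_re hJ hI hz.swap (fun v hv u hu => hS u hu v hv)
    (hSc.comp continuous_swap.continuousOn (fun _ hz => ⟨hz.2, hz.1⟩))
    (fun v hv u hu u' hu' => hC' u hu u' hu' v hv) hv hu hH' (show 0 < ε / K by positivity)
  -- The second difference minus (s - u)(t - v) H has small inner product with both z_u and z_v. As
  -- these are independent, it is itself small.
  have main : ∀ s ∈ I, ∀ t ∈ J, |s - u| ≤ min η1 η2 → |t - v| ≤ min η1 η2 →
      ‖z s t - z s v - z u t + z u v - ((s - u) * (t - v) : ℝ) * H‖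
        ≤ ε * |s - u| * |t - v| := by
    intro s hs t ht hsu htv
    have e1 := h1 s hs t ht (hsu.trans (min_le_left _ _)) (htv.trans (min_le_left _ _))
    have e2 := h2 t ht s hs (htv.trans (min_le_right _ _)) (hsu.trans (min_le_right _ _))
    rw [show z s t - z u t - z s v + z u v - ((t - v) * (s - u) : ℝ) * H
      = z s t - z s v - z u t + z u v - ((s - u) * (t - v) : ℝ) * H by push_cast; ring] at e2
    set W := z s t - z s v - z u t + z u v - ((s - u) * (t - v) : ℝ) * H
    have e3 := norm_mul_planarDet_le W (zu u v) (zv u v)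
    rw [← hd] at e3
    have e4 : ‖W‖ * d ≤ (ε / K * (|s - u| * |t - v|)) * (‖zu u v‖ + ‖zv u v‖ + 1) := by
      have : 0 ≤ ε / K * (|s - u| * |t - v|) := by positivity
      nlinarith [norm_nonneg (zu u v), norm_nonneg (zv u v)]
    have e5 : (ε / K * (|s - u| * |t - v|)) * (‖zu u v‖ + ‖zv u v‖ + 1)
        = (ε * |s - u| * |t - v|) * d := by
      have : (‖zu u v‖ + ‖zv u v‖ + 1) = K * d := by rw [hK]; field_simp
      rw [this]; field_simp
    rw [e5] at e4
    exact le_of_mul_le_mul_right e4 hdpos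
  have hmem : I ∩ Metric.closedBall u (min η1 η2) ∈ 𝓝[I] u :=
    inter_mem self_mem_nhdsWithin (mem_nhdsWithin_of_mem_nhds
      (Metric.closedBall_mem_nhds _ (lt_min hη1 hη2)))
  filter_upwards [hmem] with s hs
  obtain ⟨hs, hsb⟩ := hs
  rw [Metric.mem_closedBall, Real.dist_eq] at hsb
  rw [Real.norm_eq_abs]
  -- With s fixed, dividing the second difference by t - v and letting t → v leaves the increment of
  -- z_v in s.
  have hder : HasDerivWithinAt (fun t => z s t - z u t - ((s - u) * t : ℝ) * H)
      (zv s v - zv u v - (s - u : ℝ) * H) J v := by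
    refine ((hz.hv s hs v hv).sub (hz.hv u hu v hv)).sub ?_
    have : HasDerivWithinAt (fun t : ℝ => (((s - u) * t : ℝ) : ℂ)) ((s - u : ℝ) : ℂ) J v := by
      have := ((hasDerivWithinAt_id v J).const_mul (s - u)).ofReal_comp
      simpa using this
    exact this.mul_const H
  have hslope := hasDerivWithinAt_iff_tendsto_slope.1 hder
  have hne : (𝓝[J \ {v}] v).NeBot :=
    accPt_principal_iff_nhdsWithin.mp ((hJ' v hv).accPt)
  have hb := hslope.norm
  have : ‖zv s v - zv u v - (s - u : ℝ) * H‖ ≤ ε * |s - u| := by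
    refine le_of_tendsto hb ?_
    have hm : (J \ {v}) ∩ Metric.closedBall v (min η1 η2) ∈ 𝓝[J \ {v}] v :=
      inter_mem self_mem_nhdsWithin (mem_nhdsWithin_of_mem_nhds
        (Metric.closedBall_mem_nhds _ (lt_min hη1 hη2)))
    filter_upwards [hm] with t ht
    obtain ⟨⟨ht, htv⟩, htb⟩ := ht
    rw [Metric.mem_closedBall, Real.dist_eq] at htb
    have htv' : 0 < |t - v| := abs_pos.2 (sub_ne_zero.2 htv)
    rw [slope_def_module, norm_smul, norm_inv, Real.norm_eq_abs, inv_mul_le_iff₀ htv']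
    have := main s hs t ht hsb htb
    have e : z s t - z u t - ((s - u) * t : ℝ) * H - (z s v - z u v - ((s - u) * v : ℝ) * H)
        = z s t - z s v - z u t + z u v - ((s - u) * (t - v) : ℝ) * H := by push_cast; ring
    rw [e]
    linarith
  rwa [← Complex.real_smul] at this

/-! ### The cross product -/

lemma inner_E3 (a b : E3) : inner ℝ a b = a 0 * b 0 + a 1 * b 1 + a 2 * b 2 := by
  rw [PiLp.inner_apply, Fin.sum_univ_three]
  simp [mul_comm]

lemma cross_zero (a b : E3) : cross a b 0 = a 1 * b 2 - a 2 * b 1 := by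
  simp [cross, cross_apply]

lemma cross_one (a b : E3) : cross a b 1 = a 2 * b 0 - a 0 * b 2 := by
  simp [cross, cross_apply]

lemma cross_two (a b : E3) : cross a b 2 = a 0 * b 1 - a 1 * b 0 := by
  simp [cross, cross_apply]

lemma E3_ext {a b : E3} (h0 : a 0 = b 0) (h1 : a 1 = b 1) (h2 : a 2 = b 2) : a = b := by
  ext i; fin_cases i <;> assumption

lemma cross_cross_left (a b c : E3) :
    cross (cross a b) c = (inner ℝ a c) • b - (inner ℝ b c) • a := by
  apply E3_ext <;> simp [cross_zero, cross_one, cross_two, inner_E3] <;> ring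

lemma cross_anticomm' (a b : E3) : cross a b = - cross b a := by
  apply E3_ext <;> simp [cross_zero, cross_one, cross_two] <;> ring

lemma cross_add_right (a b c : E3) : cross a (b + c) = cross a b + cross a c := by
  apply E3_ext <;> simp [cross_zero, cross_one, cross_two] <;> ring

lemma cross_smul_right (a b : E3) (t : ℝ) : cross a (t • b) = t • cross a b := by
  apply E3_ext <;> simp [cross_zero, cross_one, cross_two] <;> ring

lemma cross_smul_left (a b : E3) (t : ℝ) : cross (t • a) b = t • cross a b := by
  apply E3_ext <;> simp [cross_zero, cross_one, cross_two] <;> ring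

lemma inner_cross_right (a b : E3) : inner ℝ (cross a b) b = 0 := by
  simp [cross_zero, cross_one, cross_two, inner_E3]; ring

lemma norm_cross_sq (a b : E3) : ‖cross a b‖ ^ 2 = ‖a‖ ^ 2 * ‖b‖ ^ 2 - (inner ℝ a b) ^ 2 := by
  simp only [← real_inner_self_eq_norm_sq, inner_E3, cross_zero, cross_one, cross_two]
  ring

lemma norm_cross_le (a b : E3) : ‖cross a b‖ ≤ ‖a‖ * ‖b‖ := by
  refine le_of_sq_le_sq ?_ (by positivity)
  rw [norm_cross_sq, mul_pow]
  nlinarith [sq_nonneg (inner ℝ a b)]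

/-- The cross product as a continuous bilinear map. -/
def crossL : E3 →L[ℝ] E3 →L[ℝ] E3 :=
  LinearMap.mkContinuous₂ (LinearMap.mk₂ ℝ cross
    (fun a b c => by
      apply E3_ext <;> simp [cross_zero, cross_one, cross_two] <;> ring)
    (fun t a b => cross_smul_left a b t) cross_add_right (fun t a b => cross_smul_right a b t)) 1
    (fun a b => by simpa using norm_cross_le a b)

@[simp] lemma crossL_apply (a b : E3) : crossL a b = cross a b := rfl

/-! ### The unit normal of a conformal linear map -/

section Conformal

variable {D : ℂ →L[ℝ] E3} {L : ℝ}

/-- The unit normal of a conformal linear map with conformal factor `L`. -/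
def unitNormal (D : ℂ →L[ℝ] E3) (L : ℝ) : E3 := L⁻¹ • cross (D 1) (D Complex.I)

lemma apply_eq (D : ℂ →L[ℝ] E3) (X : ℂ) : D X = X.re • D 1 + X.im • D Complex.I := by
  rw [← map_smul, ← map_smul, ← map_add]
  congr 1
  apply Complex.ext <;> simp

variable (hL : 0 < L) (hD : ∀ X Y : ℂ, inner ℝ (D X) (D Y) = L * inner ℝ X Y)

include hD in
lemma conformal_norm_sq (X : ℂ) : ‖D X‖ ^ 2 = L * ‖X‖ ^ 2 := by
  rw [← real_inner_self_eq_norm_sq, hD, real_inner_self_eq_norm_sq]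

include hL hD in
lemma conformal_injective {X : ℂ} (h : D X = 0) : X = 0 := by
  have := conformal_norm_sq hD X
  rw [h] at this
  simpa [hL.ne'] using this

include hL hD in
-- A conformal map carries the rotation by a right angle in the plane to the rotation by a right
-- angle in the tangent plane, which is the cross product with the normal.
lemma cross_unitNormal (X : ℂ) : cross (unitNormal D L) (D X) = D (Complex.I * X) := by
  rw [apply_eq D X, apply_eq D (Complex.I * X), unitNormal, cross_smul_left, cross_add_right,
    cross_smul_right, cross_smul_right, cross_cross_left, cross_cross_left]
  simp only [hD]
  simp only [Complex.inner]
  have h1 : L⁻¹ * (X.re * L) = X.re := by field_simp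
  have h2 : L⁻¹ * (X.im * L) = X.im := by field_simp
  simp only [map_one, mul_one, Complex.one_re, Complex.conj_I, Complex.I_re, mul_neg, 
    Complex.I_mul_I, Complex.neg_re, neg_neg, smul_add, smul_smul, neg_zero, mul_zero,
    zero_smul, sub_zero, zero_sub, smul_neg, Complex.mul_re, Complex.mul_im, Complex.I_im,
    zero_mul, one_mul, zero_add, h1, h2, neg_smul]
  abel

include hL hD in
lemma norm_unitNormal : ‖unitNormal D L‖ = 1 := by
  have h : ‖unitNormal D L‖ ^ 2 = 1 := by
    rw [unitNormal, norm_smul, mul_pow, norm_cross_sq, conformal_norm_sq hD, conformal_norm_sq hD,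
      hD]
    simp [Complex.inner]
    field_simp
  nlinarith [norm_nonneg (unitNormal D L)]

include hL hD in
/-- A unit vector orthogonal to two independent tangent vectors is the normal, up to sign. -/
lemma eq_inner_smul_unitNormal {N : E3} (hN : ‖N‖ = 1) {X Y : ℂ} (hXY : planarDet X Y ≠ 0)
    (h1 : inner ℝ N (D X) = 0) (h2 : inner ℝ N (D Y) = 0) :
    (inner ℝ N (unitNormal D L)) ^ 2 = 1 := by
  rw [apply_eq D X, inner_add_right, inner_smul_right, inner_smul_right] at h1
  rw [apply_eq D Y, inner_add_right, inner_smul_right, inner_smul_right] at h2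
  have e1 : inner ℝ N (D 1) = 0 := by
    have : planarDet X Y * inner ℝ N (D 1) = 0 := by unfold planarDet; linear_combination Y.im * h1 - X.im * h2
    simpa [hXY] using this
  have e2 : inner ℝ N (D Complex.I) = 0 := by
    have : planarDet X Y * inner ℝ N (D Complex.I) = 0 := by
      unfold planarDet; linear_combination X.re * h2 - Y.re * h1
    simpa [hXY] using this
  have e3 : cross (unitNormal D L) N = 0 := by
    rw [unitNormal, cross_smul_left, cross_cross_left, real_inner_comm, e1, real_inner_comm, e2]
    simp
  have := norm_cross_sq (unitNormal D L) N
  rw [e3, hN, norm_unitNormal hL hD, real_inner_comm] at this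
  simp at this
  linarith

end Conformal

/-- A unit vector is recovered from a unit vector with which it has inner product `±1`. -/
lemma eq_smul_of_inner_sq_eq_one {N n : E3} (hN : ‖N‖ = 1) (hn : ‖n‖ = 1)
    (h : (inner ℝ N n) ^ 2 = 1) : n = (inner ℝ N n) • N := by
  rw [← sub_eq_zero, ← norm_eq_zero, ← sq_eq_zero_iff, norm_sub_sq_real, norm_smul, inner_smul_right,
    hn, hN, real_inner_comm, mul_pow]
  rw [Real.norm_eq_abs, sq_abs]
  rw [real_inner_comm] at h
  linear_combination -h

lemma cross_cross_unit {N W : E3} (hN : ‖N‖ = 1) (hW : inner ℝ N W = 0) :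
    cross N (cross W N) = W := by
  rw [cross_anticomm', cross_cross_left, real_inner_comm, hW, real_inner_self_eq_norm_sq, hN]
  simp

lemma det_pairMap (a b : ℂ) :
    (pairMap a b ∘L (Complex.equivRealProdCLM : ℂ →L[ℝ] ℝ × ℝ)).det = planarDet a b := by
  rw [ContinuousLinearMap.det, ← LinearMap.det_toMatrix Complex.basisOneI, Matrix.det_fin_two]
  simp [LinearMap.toMatrix_apply, planarDet]
  ring

/-! ### Sectors, and the unit normal of the immersion -/

/-- A net of curves that parametrizes a piece of `Ω`, in which `ψ` is a pseudospherical front. -/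
structure IsSector (Ω : Set ℂ) (ψ : ℂ → E3) (a b : ℝ) (F : ℝ → ℝ → ℂ) : Prop where
  ha : 0 < a
  hb : 0 < b
  maps : ∀ u ∈ Ico 0 a, ∀ v ∈ Ico 0 b, F u v ∈ Ω
  cont : ContinuousOn (fun z : ℝ × ℝ => F z.1 z.2) (Ico 0 a ×ˢ Ico 0 b)
  inj : InjOn (fun z : ℝ × ℝ => F z.1 z.2) (Ico 0 a ×ˢ Ico 0 b)
  isOpen : ∀ U ⊆ Ioo 0 a ×ˢ Ioo 0 b, IsOpen U → IsOpen ((fun z : ℝ × ℝ => F z.1 z.2) '' U)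
  front : IsPSFront (Ico 0 a) (Ico 0 b) (fun u v => ψ (F u v))

/-- The unit normal of the immersion `ψ`. -/
def normal (ψ : ℂ → E3) (z : ℂ) : E3 := unitNormal (fderiv ℝ ψ z) (lam z)

variable {Ω : Set ℂ} {ψ : ℂ → E3}

namespace IsBranchedPSImmersion

variable (hψ : IsBranchedPSImmersion Ω ψ)
include hψ

lemma norm_lt {z : ℂ} (hz : z ∈ Ω) : ‖z‖ < 1 := by
  simpa using hψ.subset_disk hz

lemma lam_pos {z : ℂ} (hz : z ∈ Ω) : 0 < lam z := BranchedPS.lam_pos (hψ.norm_lt hz)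

lemma inner_eq {z : ℂ} (hz : z ∈ Ω) (X Y : ℂ) :
    inner ℝ (fderiv ℝ ψ z X) (fderiv ℝ ψ z Y) = lam z * inner ℝ X Y := hψ.isometric z hz X Y

lemma hasFDerivAt {z : ℂ} (hz : z ∈ Ω) : HasFDerivAt ψ (fderiv ℝ ψ z) z :=
  (hψ.differentiableOn.differentiableAt (hψ.isOpen.mem_nhds hz)).hasFDerivAt

lemma norm_normal {z : ℂ} (hz : z ∈ Ω) : ‖normal ψ z‖ = 1 :=
  norm_unitNormal (hψ.lam_pos hz) (hψ.inner_eq hz)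

lemma cross_normal {z : ℂ} (hz : z ∈ Ω) (X : ℂ) :
    cross (normal ψ z) (fderiv ℝ ψ z X) = fderiv ℝ ψ z (Complex.I * X) :=
  cross_unitNormal (hψ.lam_pos hz) (hψ.inner_eq hz) X

lemma fderiv_injective {z : ℂ} (hz : z ∈ Ω) : Function.Injective (fderiv ℝ ψ z) :=
  (injective_iff_map_eq_zero _).2 fun _ h => conformal_injective (hψ.lam_pos hz) (hψ.inner_eq hz) h

/-- The left inverse of the derivative of `ψ`. -/
lemma leftInverse {z : ℂ} (hz : z ∈ Ω) :
    Function.LeftInverse ((lam z)⁻¹ • ContinuousLinearMap.adjoint (fderiv ℝ ψ z))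
      (fderiv ℝ ψ z) := by
  intro X
  refine ext_inner_right ℝ fun Y => ?_
  have := hψ.lam_pos hz
  simp only [smul_apply]
  rw [inner_smul_left, ContinuousLinearMap.adjoint_inner_left, hψ.inner_eq hz]
  simp
  field_simp

lemma continuousOn_lam : ContinuousOn lam Ω := by
  unfold lam
  refine ContinuousOn.div (by fun_prop) (by fun_prop) fun z hz => ?_
  have := one_sub_sq_pos (hψ.norm_lt hz)
  positivity

lemma continuousOn_fderiv : ContinuousOn (fderiv ℝ ψ) Ω := hψ.lipschitz_fderiv.continuousOn

lemma continuousOn_normal : ContinuousOn (normal ψ) Ω := by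
  have h1 : ContinuousOn (fun z => crossL (fderiv ℝ ψ z 1) (fderiv ℝ ψ z Complex.I)) Ω := by
    have := hψ.continuousOn_fderiv
    fun_prop
  exact (hψ.continuousOn_lam.inv₀ fun z hz => (hψ.lam_pos hz).ne').smul h1

/-- The unit normal is locally Lipschitz. -/
lemma exists_lipschitz_normal {z : ℂ} (hz : z ∈ Ω) :
    ∃ C : ℝ, ∃ t ∈ 𝓝 z, ∀ w ∈ t, ∀ w' ∈ t, ‖normal ψ w - normal ψ w'‖ ≤ C * ‖w - w'‖ := by
  obtain ⟨K, t, ht, hK⟩ := hψ.lipschitz_fderiv hz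
  rw [nhdsWithin_eq_nhds.2 (hψ.isOpen.mem_nhds hz)] at ht
  have hb : ∀ᶠ w in 𝓝 z, ‖fderiv ℝ ψ w‖ < ‖fderiv ℝ ψ z‖ + 1 :=
    ((hψ.continuousOn_fderiv.continuousAt (hψ.isOpen.mem_nhds hz)).norm).eventually_lt
      continuousAt_const (by simp)
  set M := ‖fderiv ℝ ψ z‖ + 1 with hM
  have hM0 : 0 ≤ M := by positivity
  -- M bounds the differential and K is its Lipschitz constant. The first summand comes from the
  -- factor 1/λ, which is Lipschitz with constant 1 on the disk, the second from the cross product.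
  refine ⟨M * M + 2 * M * K, _, inter_mem (inter_mem ht hb) (hψ.isOpen.mem_nhds hz), ?_⟩
  rintro w ⟨⟨hw1, hw2⟩, hw3⟩ w' ⟨⟨hw1', hw2'⟩, hw3'⟩
  have hw2 : ‖fderiv ℝ ψ w‖ ≤ M := le_of_lt hw2
  have hw2' : ‖fderiv ℝ ψ w'‖ ≤ M := le_of_lt hw2'
  have hD : ‖fderiv ℝ ψ w - fderiv ℝ ψ w'‖ ≤ K * ‖w - w'‖ := by
    simpa [dist_eq_norm] using hK.dist_le_mul w hw1 w' hw1'
  have e0 : ∀ (A : ℂ →L[ℝ] E3) (X : ℂ), ‖X‖ = 1 → ‖A X‖ ≤ ‖A‖ := fun A X hX => by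
    simpa [hX] using A.le_opNorm X
  set k : ℂ → ℝ := fun w => (1 - ‖w‖ ^ 2) ^ 2 / 4 with hk
  have hlam : ∀ w : ℂ, (lam w)⁻¹ = k w := fun w => by simp only [lam, hk, inv_div]
  have n1 := hψ.norm_lt hw3
  have n2 := hψ.norm_lt hw3'
  have hk1 : |k w - k w'| ≤ ‖w - w'‖ := by
    have h1 : k w - k w' = (‖w'‖ - ‖w‖) * ((‖w'‖ + ‖w‖) * (2 - ‖w‖ ^ 2 - ‖w'‖ ^ 2) / 4) := by
      simp only [hk]; ring
    have h2 : |‖w'‖ - ‖w‖| ≤ ‖w - w'‖ := by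
      rw [norm_sub_rev]; exact abs_norm_sub_norm_le _ _
    have h3 : |(‖w'‖ + ‖w‖) * (2 - ‖w‖ ^ 2 - ‖w'‖ ^ 2) / 4| ≤ 1 := by
      have a1 := norm_nonneg w
      have a2 := norm_nonneg w'
      have b0 : 0 ≤ 2 - ‖w‖ ^ 2 - ‖w'‖ ^ 2 := by
        linarith [one_sub_sq_pos n1, one_sub_sq_pos n2]
      rw [abs_of_nonneg (by positivity)]
      have : (‖w'‖ + ‖w‖) * (2 - ‖w‖ ^ 2 - ‖w'‖ ^ 2) ≤ 2 * 2 :=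
        mul_le_mul (by linarith) (by linarith [sq_nonneg ‖w‖, sq_nonneg ‖w'‖]) b0 (by norm_num)
      linarith
    rw [h1, abs_mul]
    calc _ ≤ ‖w - w'‖ * 1 := by gcongr
      _ = _ := mul_one _
  have hk2 : |k w'| ≤ 1 := by
    have : 0 ≤ k w' := by simp only [hk]; positivity
    rw [abs_of_nonneg this]
    have b : (1 - ‖w'‖ ^ 2) ^ 2 ≤ 1 ^ 2 := by
      have := one_sub_sq_pos n2
      have a2 := sq_nonneg ‖w'‖
      gcongr
      linarith
    simp only [hk]; linarith
  set A := fderiv ℝ ψ w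
  set A' := fderiv ℝ ψ w'
  have hI : ‖Complex.I‖ = 1 := Complex.norm_I
  have h1' : ‖(1 : ℂ)‖ = 1 := norm_one
  have hm : ‖cross (A 1) (A Complex.I)‖ ≤ M * M := by
    refine (norm_cross_le _ _).trans ?_
    gcongr
    · exact (e0 A 1 h1').trans hw2
    · exact (e0 A _ hI).trans hw2
  have hmm : ‖cross (A 1) (A Complex.I) - cross (A' 1) (A' Complex.I)‖ ≤ 2 * M * K * ‖w - w'‖ := by
    have : cross (A 1) (A Complex.I) - cross (A' 1) (A' Complex.I)
        = cross ((A - A') 1) (A Complex.I) + cross (A' 1) ((A - A') Complex.I) := by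
      simp only [← crossL_apply, _root_.sub_apply, map_sub]
      abel
    rw [this]
    calc _ ≤ _ := norm_add_le _ _
      _ ≤ ‖(A - A') 1‖ * ‖A Complex.I‖ + ‖A' 1‖ * ‖(A - A') Complex.I‖ :=
        add_le_add (norm_cross_le _ _) (norm_cross_le _ _)
      _ ≤ (K * ‖w - w'‖) * M + M * (K * ‖w - w'‖) := by
        have b1 := (e0 (A - A') 1 h1').trans hD
        have b2 := (e0 (A - A') _ hI).trans hD
        have b3 := (e0 A _ hI).trans hw2
        have b4 := (e0 A' _ h1').trans hw2'
        gcongr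
      _ = _ := by ring
  have : normal ψ w - normal ψ w' = (k w - k w') • cross (A 1) (A Complex.I)
      + k w' • (cross (A 1) (A Complex.I) - cross (A' 1) (A' Complex.I)) := by
    simp only [normal, unitNormal, hlam, sub_smul, smul_sub]
    abel
  rw [this]
  calc _ ≤ _ := norm_add_le _ _
    _ ≤ ‖w - w'‖ * (M * M) + 1 * (2 * M * K * ‖w - w'‖) := by
      rw [norm_smul, norm_smul, Real.norm_eq_abs, Real.norm_eq_abs]
      gcongr
    _ = _ := by ring

end IsBranchedPSImmersion

namespace IsSector

variable {a b : ℝ} {F : ℝ → ℝ → ℂ} (hψ : IsBranchedPSImmersion Ω ψ) (hF : IsSector Ω ψ a b F)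

lemma uniqueDiffOn_Ico {a b : ℝ} : UniqueDiffOn ℝ (Ico a b) := _root_.uniqueDiffOn_Ico a b

/-- The tangent vector of the `u`-curves. -/
def tu (a : ℝ) (F : ℝ → ℝ → ℂ) : ℝ → ℝ → ℂ := partialU (Ico 0 a) F

/-- The tangent vector of the `v`-curves. -/
def tv (b : ℝ) (F : ℝ → ℝ → ℂ) : ℝ → ℝ → ℂ := partialV (Ico 0 b) F

include hψ hF in
-- The net is only known to be continuous. It is differentiable along u because ψ ∘ F is and the
-- differential of ψ has a left inverse.
lemma hasDerivWithinAt_u {u v : ℝ} (hu : u ∈ Ico 0 a) (hv : v ∈ Ico 0 b) :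
    HasDerivWithinAt (fun s => F s v) (((lam (F u v))⁻¹ • ContinuousLinearMap.adjoint
      (fderiv ℝ ψ (F u v))) (partialU (Ico 0 a) (fun u v => ψ (F u v)) u v)) (Ico 0 a) u := by
  have hz := hF.maps u hu v hv
  have hr : HasDerivWithinAt (fun s => ψ (F s v)) (partialU (Ico 0 a) (fun u v => ψ (F u v)) u v)
      (Ico 0 a) u := (hF.front.1.diff_u v hv u hu).hasDerivWithinAt
  have hc : ContinuousWithinAt (fun s => F s v) (Ico 0 a) u :=
    ContinuousOn.slice_fst (f := F) hF.cont hv u hu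
  have := HasFDerivWithinAt.of_comp_of_leftInverse (t := univ) (g := fun s => F s v)
    (by simpa using hc.tendsto) (hψ.hasFDerivAt hz).hasFDerivWithinAt hr.hasFDerivWithinAt
    (Eventually.of_forall fun _ => rfl) (hψ.leftInverse hz) hu
  have := this.hasDerivWithinAt
  simpa using this

include hψ hF in
lemma hasDerivWithinAt_v {u v : ℝ} (hu : u ∈ Ico 0 a) (hv : v ∈ Ico 0 b) :
    HasDerivWithinAt (fun t => F u t) (((lam (F u v))⁻¹ • ContinuousLinearMap.adjoint
      (fderiv ℝ ψ (F u v))) (partialV (Ico 0 b) (fun u v => ψ (F u v)) u v)) (Ico 0 b) v := by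
  have hz := hF.maps u hu v hv
  have hr : HasDerivWithinAt (fun t => ψ (F u t)) (partialV (Ico 0 b) (fun u v => ψ (F u v)) u v)
      (Ico 0 b) v := (hF.front.1.diff_v u hu v hv).hasDerivWithinAt
  have hc : ContinuousWithinAt (fun t => F u t) (Ico 0 b) v :=
    ContinuousOn.slice_snd (f := F) hF.cont hu v hv
  have := HasFDerivWithinAt.of_comp_of_leftInverse (t := univ) (g := fun t => F u t)
    (by simpa using hc.tendsto) (hψ.hasFDerivAt hz).hasFDerivWithinAt hr.hasFDerivWithinAt
    (Eventually.of_forall fun _ => rfl) (hψ.leftInverse hz) hv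
  have := this.hasDerivWithinAt
  simpa using this

include hψ hF in
lemma continuousOn_pullback {f : ℝ → ℝ → E3}
    (hf : ContinuousOn (fun z : ℝ × ℝ => f z.1 z.2) (Ico 0 a ×ˢ Ico 0 b)) :
    ContinuousOn (fun z : ℝ × ℝ => ((lam (F z.1 z.2))⁻¹ • ContinuousLinearMap.adjoint
      (fderiv ℝ ψ (F z.1 z.2))) (f z.1 z.2)) (Ico 0 a ×ˢ Ico 0 b) := by
  have hm : MapsTo (fun z : ℝ × ℝ => F z.1 z.2) (Ico 0 a ×ˢ Ico 0 b) Ω :=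
    fun z hz => hF.maps _ hz.1 _ hz.2
  have h1 := hψ.continuousOn_lam.comp hF.cont hm
  have h2 := hψ.continuousOn_fderiv.comp hF.cont hm
  have h3 : ContinuousOn (fun z : ℝ × ℝ => ContinuousLinearMap.adjoint
      (fderiv ℝ ψ (F z.1 z.2))) (Ico 0 a ×ˢ Ico 0 b) :=
    (ContinuousLinearMap.adjoint (𝕜 := ℝ) (E := ℂ) (F := E3)).continuous.comp_continuousOn h2
  exact ((h1.inv₀ fun z hz => (hψ.lam_pos (hm hz)).ne').smul h3).clm_apply hf

include hψ hF in
lemma hasPartials : HasPartials (Ico 0 a) (Ico 0 b) F (tu a F) (tv b F) := by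
  have e1 : ∀ z ∈ Ico 0 a ×ˢ Ico 0 b, tu a F z.1 z.2 = _ := fun z hz =>
    (hasDerivWithinAt_u hψ hF hz.1 hz.2).derivWithin (uniqueDiffOn_Ico _ hz.1)
  have e2 : ∀ z ∈ Ico 0 a ×ˢ Ico 0 b, tv b F z.1 z.2 = _ := fun z hz =>
    (hasDerivWithinAt_v hψ hF hz.1 hz.2).derivWithin (uniqueDiffOn_Ico _ hz.2)
  refine ⟨fun u hu v hv => ?_, fun u hu v hv => ?_, ?_, ?_⟩
  · exact (hasDerivWithinAt_u hψ hF hu hv).differentiableWithinAt.hasDerivWithinAt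
  · exact (hasDerivWithinAt_v hψ hF hu hv).differentiableWithinAt.hasDerivWithinAt
  · exact (continuousOn_pullback hψ hF hF.front.1.continuousOn_u).congr e1
  · exact (continuousOn_pullback hψ hF hF.front.1.continuousOn_v).congr e2

include hψ hF in
lemma fderiv_tu {u v : ℝ} (hu : u ∈ Ico 0 a) (hv : v ∈ Ico 0 b) :
    partialU (Ico 0 a) (fun u v => ψ (F u v)) u v = fderiv ℝ ψ (F u v) (tu a F u v) :=
  ((hψ.hasFDerivAt (hF.maps u hu v hv)).comp_hasDerivWithinAt u
    ((hasPartials hψ hF).hu u hu v hv)).derivWithin (uniqueDiffOn_Ico _ hu)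

include hψ hF in
lemma fderiv_tv {u v : ℝ} (hu : u ∈ Ico 0 a) (hv : v ∈ Ico 0 b) :
    partialV (Ico 0 b) (fun u v => ψ (F u v)) u v = fderiv ℝ ψ (F u v) (tv b F u v) :=
  ((hψ.hasFDerivAt (hF.maps u hu v hv)).comp_hasDerivWithinAt v
    ((hasPartials hψ hF).hv u hu v hv)).derivWithin (uniqueDiffOn_Ico _ hv)

end IsSector

/-! ### Rotation of the normal and independence of the asymptotic directions -/

lemma exists_real_mul_of_planarDet_eq_zero {x y : ℂ} (hx : x ≠ 0) (h : planarDet x y = 0) :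
    ∃ μ : ℝ, y = μ * x := by
  refine ⟨(conj x * y).re / ‖x‖ ^ 2, ?_⟩
  have hx' : ‖x‖ ^ 2 ≠ 0 := by positivity
  have h1 : (‖x‖ ^ 2 : ℂ) * y = (conj x * y).re * x := by
    have e : (‖x‖ ^ 2 : ℂ) = ((x.re * x.re + x.im * x.im : ℝ) : ℂ) := by
      rw [← Complex.normSq_apply, Complex.normSq_eq_norm_sq]; push_cast; rfl
    unfold planarDet at h
    rw [e]
    apply Complex.ext
    · simp; linear_combination -x.im * h
    · simp; linear_combination x.re * h
  have hx2 : (‖x‖ ^ 2 : ℂ) ≠ 0 := by exact_mod_cast hx'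
  refine mul_left_cancel₀ hx2 (h1.trans ?_)
  rw [Complex.ofReal_div, Complex.ofReal_pow, ← mul_assoc, mul_div_cancel₀ _ hx2]

lemma eq_of_hasDerivWithinAt_zero {E : Type*} [NormedAddCommGroup E] [NormedSpace ℝ E]
    {s : Set ℝ} (hs : Convex ℝ s) {f : ℝ → E}
    (hf : ∀ x ∈ s, HasDerivWithinAt f 0 s x) {x y : ℝ} (hx : x ∈ s) (hy : y ∈ s) : f x = f y := by
  have := hs.norm_image_sub_le_of_norm_hasDerivWithin_le (C := 0) hf (fun _ _ => by simp) hy hx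
  rw [zero_mul] at this
  exact sub_eq_zero.1 (norm_le_zero_iff.1 this)

lemma hasDerivWithinAt_zero_of_norm_le {E E' : Type*} [NormedAddCommGroup E] [NormedSpace ℝ E]
    [NormedAddCommGroup E'] [NormedSpace ℝ E'] {f : ℝ → E} {g : ℝ → E'} {s : Set ℝ} {x C : ℝ}
    (hf : HasDerivWithinAt f 0 s x) (h : ∀ᶠ y in 𝓝[s] x, ‖g y - g x‖ ≤ C * ‖f y - f x‖) :
    HasDerivWithinAt g 0 s x := by
  rw [hasDerivWithinAt_iff_isLittleO] at hf ⊢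
  simp only [smul_zero, sub_zero] at hf ⊢
  exact (Asymptotics.IsBigO.of_bound C h).trans_isLittleO hf

variable {Ω : Set ℂ} {ψ : ℂ → E3}

lemma IsWeaklyHarmonic.inner_partialU {a b : ℝ} {N : ℝ → ℝ → E3}
    (hN : IsWeaklyHarmonic (Ico 0 a) (Ico 0 b) N) {u v : ℝ} (hu : u ∈ Ico 0 a) (hv : v ∈ Ico 0 b) :
    inner ℝ (N u v) (partialU (Ico 0 a) N u v) = 0 := by
  have h := (hN.c1m.diff_u v hv u hu).hasDerivWithinAt
  have h2 := h.norm_sq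
  have h3 : HasDerivWithinAt (fun s => ‖N s v‖ ^ 2) 0 (Ico 0 a) u :=
    (hasDerivWithinAt_const u (Ico 0 a) (1 : ℝ)).congr (fun s hs => by simp [hN.unit s hs v hv])
      (by simp [hN.unit u hu v hv])
  have := (uniqueDiffOn_Ico _ _ u hu).eq_deriv _ h2 h3
  simp only [mul_eq_zero, OfNat.ofNat_ne_zero, false_or] at this
  exact this

lemma IsWeaklyHarmonic.inner_partialV {a b : ℝ} {N : ℝ → ℝ → E3}
    (hN : IsWeaklyHarmonic (Ico 0 a) (Ico 0 b) N) {u v : ℝ} (hu : u ∈ Ico 0 a) (hv : v ∈ Ico 0 b) :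
    inner ℝ (N u v) (partialV (Ico 0 b) N u v) = 0 := by
  have h := (hN.c1m.diff_v u hu v hv).hasDerivWithinAt
  have h2 := h.norm_sq
  have h3 : HasDerivWithinAt (fun s => ‖N u s‖ ^ 2) 0 (Ico 0 b) v :=
    (hasDerivWithinAt_const v (Ico 0 b) (1 : ℝ)).congr (fun s hs => by simp [hN.unit u hu s hs])
      (by simp [hN.unit u hu v hv])
  have := (uniqueDiffOn_Ico _ _ v hv).eq_deriv _ h2 h3
  simp only [mul_eq_zero, OfNat.ofNat_ne_zero, false_or] at this
  exact this

/-- N_uv is a multiple of N, which is orthogonal to N_u. Hence |N_u|² has zero derivative in v. -/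
lemma IsWeaklyHarmonic.norm_partialU {a b : ℝ} {N : ℝ → ℝ → E3}
    (hN : IsWeaklyHarmonic (Ico 0 a) (Ico 0 b) N) {u v v' : ℝ} (hu : u ∈ Ico 0 a)
    (hv : v ∈ Ico 0 b) (hv' : v' ∈ Ico 0 b) :
    ‖partialU (Ico 0 a) N u v‖ ^ 2 = ‖partialU (Ico 0 a) N u v'‖ ^ 2 := by
  obtain ⟨ν, -, hν⟩ := hN.moutard
  refine eq_of_hasDerivWithinAt_zero (convex_Ico 0 b) (f := fun v => ‖partialU (Ico 0 a) N u v‖ ^ 2)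
    (fun t ht => ?_) hv hv'
  have h := (hN.c1m.diff_uv u hu t ht).hasDerivWithinAt.norm_sq
  have e : derivWithin (fun v => partialU (Ico 0 a) N u v) (Ico 0 b) t = ν u t • N u t := hν u hu t ht
  rw [e, inner_smul_right, real_inner_comm, hN.inner_partialU hu ht] at h
  simpa using h

lemma IsWeaklyHarmonic.norm_partialV {a b : ℝ} {N : ℝ → ℝ → E3}
    (hN : IsWeaklyHarmonic (Ico 0 a) (Ico 0 b) N) {u u' v : ℝ} (hu : u ∈ Ico 0 a)
    (hu' : u' ∈ Ico 0 a) (hv : v ∈ Ico 0 b) :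
    ‖partialV (Ico 0 b) N u v‖ ^ 2 = ‖partialV (Ico 0 b) N u' v‖ ^ 2 := by
  obtain ⟨ν, -, hν⟩ := hN.moutard
  refine eq_of_hasDerivWithinAt_zero (convex_Ico 0 a) (f := fun u => ‖partialV (Ico 0 b) N u v‖ ^ 2)
    (fun t ht => ?_) hu hu'
  have h := (hN.c1m.diff_vu v hv t ht).hasDerivWithinAt.norm_sq
  have e : derivWithin (fun u => partialV (Ico 0 b) N u v) (Ico 0 a) t = ν t v • N t v :=
    (hN.c1m.mixed_eq t ht v hv).symm.trans (hν t ht v hv)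
  rw [e, inner_smul_right, real_inner_comm, hN.inner_partialV ht hv] at h
  simpa using h

namespace IsSector

variable {a b : ℝ} {F : ℝ → ℝ → ℂ} (hψ : IsBranchedPSImmersion Ω ψ) (hF : IsSector Ω ψ a b F)

include hψ hF in
/-- By Sard's theorem the regular points of a sector are dense. -/
lemma exists_regular {U : Set (ℝ × ℝ)} (hU : U ⊆ Ioo 0 a ×ˢ Ioo 0 b) (hUo : IsOpen U)
    (hne : U.Nonempty) : ∃ z ∈ U, planarDet (tu a F z.1 z.2) (tv b F z.1 z.2) ≠ 0 := by
  by_contra! hcon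
  set s : Set ℂ := Complex.equivRealProdCLM ⁻¹' U
  have himg : (fun w : ℂ => F w.re w.im) '' s = (fun z : ℝ × ℝ => F z.1 z.2) '' U := by
    rw [show (fun w : ℂ => F w.re w.im) = (fun z : ℝ × ℝ => F z.1 z.2) ∘ Complex.equivRealProdCLM
      from rfl, image_comp, image_preimage_eq _ Complex.equivRealProdCLM.surjective]
  -- If the determinant vanished on all of U, the image of U would be null, whereas it is open and
  -- nonempty.
  have hz : volume ((fun w : ℂ => F w.re w.im) '' s) = 0 := by
    refine addHaar_image_eq_zero_of_det_fderivWithin_eq_zero volume (f' := fun w =>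
      pairMap (tu a F w.re w.im) (tv b F w.re w.im) ∘L (Complex.equivRealProdCLM : ℂ →L[ℝ] ℝ × ℝ))
      (fun w hw => ?_) (fun w hw => ?_)
    · have h1 := ((hasPartials hψ hF).hasFDerivWithinAt (convex_Ico _ _) (convex_Ico _ _)
        (z := Complex.equivRealProdCLM w) (prod_mono Ioo_subset_Ico_self Ioo_subset_Ico_self (hU hw)))
      exact h1.comp w Complex.equivRealProdCLM.hasFDerivAt.hasFDerivWithinAt
        (fun x hx => prod_mono Ioo_subset_Ico_self Ioo_subset_Ico_self (hU hx))
    · rw [det_pairMap]; exact hcon _ hw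
  rw [himg] at hz
  exact (hF.isOpen U hU hUo).measure_pos volume (hne.image _) |>.ne' hz

include hψ hF in
/-- The normal of the front is the normal of the immersion, up to sign. -/
lemma exists_sign {N : ℝ → ℝ → E3} (hN : IsWeaklyHarmonic (Ico 0 a) (Ico 0 b) N)
    (hNu : ∀ u ∈ Ico 0 a, ∀ v ∈ Ico 0 b, partialU (Ico 0 a) (fun u v => ψ (F u v)) u v
      = cross (partialU (Ico 0 a) N u v) (N u v))
    (hNv : ∀ u ∈ Ico 0 a, ∀ v ∈ Ico 0 b, partialV (Ico 0 b) (fun u v => ψ (F u v)) u v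
      = - cross (partialV (Ico 0 b) N u v) (N u v)) :
    ∃ ε : ℝ, ∀ u ∈ Ico 0 a, ∀ v ∈ Ico 0 b, normal ψ (F u v) = ε • N u v := by
  set c : ℝ × ℝ → ℝ := fun z => inner ℝ (N z.1 z.2) (normal ψ (F z.1 z.2)) with hc
  have hm : MapsTo (fun z : ℝ × ℝ => F z.1 z.2) (Ico 0 a ×ˢ Ico 0 b) Ω :=
    fun z hz => hF.maps _ hz.1 _ hz.2
  have hcc : ContinuousOn c (Ico 0 a ×ˢ Ico 0 b) :=
    hN.c1m.continuousOn.inner (hψ.continuousOn_normal.comp hF.cont hm)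
  have hreg : ∀ z ∈ Ico 0 a ×ˢ Ico 0 b, planarDet (tu a F z.1 z.2) (tv b F z.1 z.2) ≠ 0 →
      c z ^ 2 = 1 := by
    intro z hz hd
    have hzΩ := hm hz
    refine eq_inner_smul_unitNormal (hψ.lam_pos hzΩ) (hψ.inner_eq hzΩ) (hN.unit _ hz.1 _ hz.2) hd
      ?_ ?_
    · rw [← fderiv_tu hψ hF hz.1 hz.2, hNu _ hz.1 _ hz.2, real_inner_comm]
      exact inner_cross_right _ _
    · rw [← fderiv_tv hψ hF hz.1 hz.2, hNv _ hz.1 _ hz.2, real_inner_comm, inner_neg_left,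
        inner_cross_right, neg_zero]
  have hsub : Ioo 0 a ×ˢ Ioo 0 b ⊆ Ico 0 a ×ˢ Ico 0 b :=
    prod_mono Ioo_subset_Ico_self Ioo_subset_Ico_self
  have ho : IsOpen (Ioo 0 a ×ˢ Ioo 0 b) := isOpen_Ioo.prod isOpen_Ioo
  -- At regular points both unit vectors are orthogonal to the tangent plane. Regular points are
  -- dense, so the relation holds on the open sector, then by continuity on the edges. By
  -- connectedness the sign is one and the same.
  have h1 : ∀ z ∈ Ioo 0 a ×ˢ Ioo 0 b, c z ^ 2 = 1 := by
    intro z hz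
    by_contra hne
    have hcz : ContinuousOn (fun z => c z ^ 2) (Ioo 0 a ×ˢ Ioo 0 b) := (hcc.mono hsub).pow 2
    obtain ⟨w, ⟨hw1, hw2⟩, hw3⟩ := exists_regular hψ hF
      (U := (Ioo 0 a ×ˢ Ioo 0 b) ∩ (fun z => c z ^ 2) ⁻¹' {1}ᶜ) inter_subset_left
      (hcz.isOpen_inter_preimage ho isOpen_compl_singleton) ⟨z, hz, hne⟩
    exact hw2 (hreg w (hsub hw1) hw3)
  have h2 : ∀ z ∈ Ico 0 a ×ˢ Ico 0 b, c z ^ 2 = 1 := by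
    intro z hz
    have hzc : z ∈ closure (Ioo 0 a ×ˢ Ioo 0 b) := by
      rw [closure_prod_eq, closure_Ioo hF.ha.ne, closure_Ioo hF.hb.ne]
      exact prod_mono Ico_subset_Icc_self Ico_subset_Icc_self hz
    have := mem_closure_iff_nhdsWithin_neBot.1 hzc
    have ht : Tendsto (fun z => c z ^ 2) (𝓝[Ioo 0 a ×ˢ Ioo 0 b] z) (𝓝 (c z ^ 2)) :=
      ((hcc z hz).mono hsub).pow 2
    refine tendsto_nhds_unique ht (tendsto_const_nhds.congr' ?_)
    filter_upwards [self_mem_nhdsWithin] with w hw using (h1 w hw).symm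
  have hpre : IsPreconnected (Ico 0 a ×ˢ Ico 0 b) := isPreconnected_Ico.prod isPreconnected_Ico
  have h3 := hpre.eq_or_eq_neg_of_sq_eq (f := c) (g := fun _ => (1 : ℝ)) hcc continuousOn_const
    (fun z hz => by simpa using h2 z hz) (fun _ => one_ne_zero)
  have h4 : ∃ ε : ℝ, ∀ z ∈ Ico 0 a ×ˢ Ico 0 b, c z = ε := by
    rcases h3 with h | h
    · exact ⟨1, fun z hz => h hz⟩
    · exact ⟨-1, fun z hz => by simpa using h hz⟩
  obtain ⟨ε, hε⟩ := h4
  refine ⟨ε, fun u hu v hv => ?_⟩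
  rw [← hε (u, v) ⟨hu, hv⟩]
  exact eq_smul_of_inner_sq_eq_one (hN.unit u hu v hv) (hψ.norm_normal (hm (x := (u, v)) ⟨hu, hv⟩))
    (h2 (u, v) ⟨hu, hv⟩)

include hψ hF in
-- The Lelieuvre equations solved for N_u and N_v: since N is a unit vector orthogonal to its
-- derivatives, N_u = N × r_u and N_v = -N × r_v. The opposite signs are what tells the two families
-- of asymptotic curves apart.
lemma hasDerivWithinAt_normal {u v : ℝ} (hu : u ∈ Ico 0 a) (hv : v ∈ Ico 0 b) :
    HasDerivWithinAt (fun s => normal ψ (F s v))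
      (fderiv ℝ ψ (F u v) (Complex.I * tu a F u v)) (Ico 0 a) u ∧
    HasDerivWithinAt (fun t => normal ψ (F u t))
      (-fderiv ℝ ψ (F u v) (Complex.I * tv b F u v)) (Ico 0 b) v := by
  obtain ⟨N, hN, hNu, hNv⟩ := hF.front.2
  obtain ⟨ε, hε⟩ := exists_sign hψ hF hN hNu hNv
  have hΩ := hF.maps u hu v hv
  have e1 : ε • partialU (Ico 0 a) N u v = fderiv ℝ ψ (F u v) (Complex.I * tu a F u v) := by
    rw [← hψ.cross_normal hΩ, ← fderiv_tu hψ hF hu hv, hNu u hu v hv, hε u hu v hv,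
      cross_smul_left, cross_cross_unit (hN.unit u hu v hv) (hN.inner_partialU hu hv)]
  have e2 : ε • partialV (Ico 0 b) N u v = -fderiv ℝ ψ (F u v) (Complex.I * tv b F u v) := by
    rw [← hψ.cross_normal hΩ, ← fderiv_tv hψ hF hu hv, hNv u hu v hv, hε u hu v hv,
      cross_smul_left, ← neg_one_smul ℝ (cross _ _), cross_smul_right,
      cross_cross_unit (hN.unit u hu v hv) (hN.inner_partialV hu hv)]
    simp
  constructor
  · rw [← e1]
    exact ((hN.c1m.diff_u v hv u hu).hasDerivWithinAt.const_smul ε).congr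
      (fun s hs => hε s hs v hv) (hε u hu v hv)
  · rw [← e2]
    exact ((hN.c1m.diff_v u hu v hv).hasDerivWithinAt.const_smul ε).congr
      (fun s hs => hε u hu s hs) (hε u hu v hv)

include hψ hF in
lemma hasPartials_normal : HasPartials (Ico 0 a) (Ico 0 b) (fun u v => normal ψ (F u v))
    (fun u v => fderiv ℝ ψ (F u v) (Complex.I * tu a F u v))
    (fun u v => -fderiv ℝ ψ (F u v) (Complex.I * tv b F u v)) := by
  have hm : MapsTo (fun z : ℝ × ℝ => F z.1 z.2) (Ico 0 a ×ˢ Ico 0 b) Ω :=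
    fun z hz => hF.maps _ hz.1 _ hz.2
  have h2 := hψ.continuousOn_fderiv.comp hF.cont hm
  exact ⟨fun u hu v hv => (hasDerivWithinAt_normal hψ hF hu hv).1,
    fun u hu v hv => (hasDerivWithinAt_normal hψ hF hu hv).2,
    h2.clm_apply (continuousOn_const.mul (hasPartials hψ hF).cu),
    (h2.clm_apply (continuousOn_const.mul (hasPartials hψ hF).cv)).neg⟩

include hψ hF in
-- |r_u| = |N_u| because N is a unit vector orthogonal to N_u, and |N_u| does not depend on v. This
-- is the Chebyshev property of the net.
lemma exists_norm_tu : ∃ E : ℝ → ℝ, ∀ u ∈ Ico 0 a, 0 < E u ∧ ∀ v ∈ Ico 0 b,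
    lam (F u v) * ‖tu a F u v‖ ^ 2 = E u := by
  obtain ⟨N, hN, hNu, hNv⟩ := hF.front.2
  have h0 : (0 : ℝ) ∈ Ico 0 b := ⟨le_rfl, hF.hb⟩
  refine ⟨fun u => ‖partialU (Ico 0 a) N u 0‖ ^ 2, fun u hu => ⟨?_, fun v hv => ?_⟩⟩
  · have := hN.regular_u u hu 0 h0
    positivity
  · rw [← conformal_norm_sq (hψ.inner_eq (hF.maps u hu v hv)), ← fderiv_tu hψ hF hu hv,
      hNu u hu v hv, norm_cross_sq, hN.unit u hu v hv, real_inner_comm, hN.inner_partialU hu hv,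
      hN.norm_partialU hu hv h0]
    simp

include hψ hF in
lemma exists_norm_tv : ∃ E : ℝ → ℝ, ∀ v ∈ Ico 0 b, 0 < E v ∧ ∀ u ∈ Ico 0 a,
    lam (F u v) * ‖tv b F u v‖ ^ 2 = E v := by
  obtain ⟨N, hN, hNu, hNv⟩ := hF.front.2
  have h0 : (0 : ℝ) ∈ Ico 0 a := ⟨le_rfl, hF.ha⟩
  refine ⟨fun v => ‖partialV (Ico 0 b) N 0 v‖ ^ 2, fun v hv => ⟨?_, fun u hu => ?_⟩⟩
  · have := hN.regular_v 0 h0 v hv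
    positivity
  · rw [← conformal_norm_sq (hψ.inner_eq (hF.maps u hu v hv)), ← fderiv_tv hψ hF hu hv,
      hNv u hu v hv, norm_neg, norm_cross_sq, hN.unit u hu v hv, real_inner_comm,
      hN.inner_partialV hu hv, hN.norm_partialV hu h0 hv]
    simp

include hψ hF in
lemma tu_ne_zero {u v : ℝ} (hu : u ∈ Ico 0 a) (hv : v ∈ Ico 0 b) : tu a F u v ≠ 0 := by
  obtain ⟨E, hE⟩ := exists_norm_tu hψ hF
  intro h
  have := (hE u hu).2 v hv
  have h2 := (hE u hu).1
  rw [h] at this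
  simp at this
  linarith

include hψ hF in
lemma tv_ne_zero {u v : ℝ} (hu : u ∈ Ico 0 a) (hv : v ∈ Ico 0 b) : tv b F u v ≠ 0 := by
  obtain ⟨E, hE⟩ := exists_norm_tv hψ hF
  intro h
  have := (hE v hv).2 u hu
  have h2 := (hE v hv).1
  rw [h] at this
  simp at this
  linarith

include hψ hF in
/-- The tangent vectors of a sector are independent. -/
lemma planarDet_ne_zero {u v : ℝ} (hu : u ∈ Ico 0 a) (hv : v ∈ Ico 0 b) :
    planarDet (tu a F u v) (tv b F u v) ≠ 0 := by
  intro hdet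
  obtain ⟨μ, hμ⟩ := exists_real_mul_of_planarDet_eq_zero (tu_ne_zero hψ hF hu hv) hdet
  have hΩ := hF.maps u hu v hv
  obtain ⟨C, t, ht, hC⟩ := hψ.exists_lipschitz_normal hΩ
  have hI : Convex ℝ (Ico 0 a) := convex_Ico 0 a
  have hJ : Convex ℝ (Ico 0 b) := convex_Ico 0 b
  have dF := (hasPartials hψ hF).hasFDerivWithinAt hI hJ (z := (u, v)) ⟨hu, hv⟩
  have dN := (hasPartials_normal hψ hF).hasFDerivWithinAt hI hJ (z := (u, v)) ⟨hu, hv⟩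
  set X := tu a F u v with hX
  set Y := tv b F u v with hY
  obtain ⟨η, hη, hηu, hηv⟩ : ∃ η > 0, u + (|μ| + 1) * η < a ∧ v + η < b := by
    have h1 : 0 < a - u := sub_pos.2 hu.2
    have h2 : 0 < b - v := sub_pos.2 hv.2
    refine ⟨min ((a - u) / (2 * (|μ| + 1))) ((b - v) / 2), by positivity, ?_, ?_⟩
    · have : (|μ| + 1) * min ((a - u) / (2 * (|μ| + 1))) ((b - v) / 2)
          ≤ (|μ| + 1) * ((a - u) / (2 * (|μ| + 1))) := by gcongr; exact min_le_left _ _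
      have e : (|μ| + 1) * ((a - u) / (2 * (|μ| + 1))) = (a - u) / 2 := by field_simp
      linarith
    · have := min_le_right ((a - u) / (2 * (|μ| + 1))) ((b - v) / 2)
      linarith
  -- Two coordinate directions with the same velocity in the disk give the normal the same velocity,
  -- because the normal is Lipschitz; but the normal sees the v-component with the opposite sign.
  -- Only nonnegative components are used, so that the lines stay in the sector also when they start
  -- on an edge.
  have key : ∀ (p q p' q' : ℝ), 0 ≤ p → 0 ≤ q → 0 ≤ p' → 0 ≤ q' → p ≤ |μ| + 1 → p' ≤ |μ| + 1 →
      q ≤ 1 → q' ≤ 1 → (p - p') * X + (q - q') * Y = 0 →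
      (p - p') * X - (q - q') * Y = 0 := by
    intro p q p' q' hp hq hp' hq' h1 h1' h2 h2' h0
    have hmaps : ∀ p q : ℝ, 0 ≤ p → 0 ≤ q → p ≤ |μ| + 1 → q ≤ 1 →
        MapsTo (fun s : ℝ => ((u + s * p, v + s * q) : ℝ × ℝ)) (Ico 0 η) (Ico 0 a ×ˢ Ico 0 b) := by
      intro p q hp hq h1 h2 s hs
      have a1 : 0 ≤ s * p := mul_nonneg hs.1 hp
      have a2 : 0 ≤ s * q := mul_nonneg hs.1 hq
      have a3 : s * p ≤ η * (|μ| + 1) := by have := hs.2.le; gcongr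
      have a4 : s * q ≤ η * 1 := by have := hs.2.le; gcongr
      exact ⟨⟨by linarith [hu.1], by linarith⟩, ⟨by linarith [hv.1], by linarith⟩⟩
    have hder : ∀ p q : ℝ, HasDerivWithinAt (fun s : ℝ => ((u + s * p, v + s * q) : ℝ × ℝ))
        (p, q) (Ico 0 η) 0 := by
      intro p q
      have a1 : HasDerivWithinAt (fun s : ℝ => u + s * p) p (Ico 0 η) 0 := by
        simpa using ((hasDerivWithinAt_id (0 : ℝ) (Ico 0 η)).mul_const p).const_add u
      have a2 : HasDerivWithinAt (fun s : ℝ => v + s * q) q (Ico 0 η) 0 := by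
        simpa using ((hasDerivWithinAt_id (0 : ℝ) (Ico 0 η)).mul_const q).const_add v
      exact a1.prodMk a2
    have z0 : ∀ p q : ℝ, ((u + 0 * p, v + 0 * q) : ℝ × ℝ) = (u, v) := by simp
    have fF : ∀ p q : ℝ, 0 ≤ p → 0 ≤ q → p ≤ |μ| + 1 → q ≤ 1 →
        HasDerivWithinAt (fun s : ℝ => F (u + s * p) (v + s * q)) (p * X + q * Y) (Ico 0 η) 0 := by
      intro p q hp hq h1 h2
      have := HasFDerivWithinAt.comp_hasDerivWithinAt (0 : ℝ)
        (l := fun w : ℝ × ℝ => F w.1 w.2) (by rw [z0 p q]; exact dF) (hder p q)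
        (hmaps p q hp hq h1 h2)
      exact this.congr_deriv (by simp)
    have fN : ∀ p q : ℝ, 0 ≤ p → 0 ≤ q → p ≤ |μ| + 1 → q ≤ 1 →
        HasDerivWithinAt (fun s : ℝ => normal ψ (F (u + s * p) (v + s * q)))
          (p • fderiv ℝ ψ (F u v) (Complex.I * X) - q • fderiv ℝ ψ (F u v) (Complex.I * Y))
          (Ico 0 η) 0 := by
      intro p q hp hq h1 h2
      have := HasFDerivWithinAt.comp_hasDerivWithinAt (0 : ℝ)
        (l := fun w : ℝ × ℝ => normal ψ (F w.1 w.2)) (by rw [z0 p q]; exact dN) (hder p q)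
        (hmaps p q hp hq h1 h2)
      exact this.congr_deriv (by simp [sub_eq_add_neg])
    have d1 := (fF p q hp hq h1 h2).sub (fF p' q' hp' hq' h1' h2')
    have d2 := (fN p q hp hq h1 h2).sub (fN p' q' hp' hq' h1' h2')
    have e0 : (p * X + q * Y - (p' * X + q' * Y) : ℂ) = 0 := by rw [← h0]; ring
    rw [e0] at d1
    have d3 := hasDerivWithinAt_zero_of_norm_le d1 (g := (fun s : ℝ => normal ψ (F (u + s * p) (v + s * q)))
      - fun s : ℝ => normal ψ (F (u + s * p') (v + s * q'))) (C := C) (by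
        have c1 := (fF p q hp hq h1 h2).continuousWithinAt
        have c2 := (fF p' q' hp' hq' h1' h2').continuousWithinAt
        have c1' := c1.preimage_mem_nhdsWithin (t := t) (by simpa using ht)
        have c2' := c2.preimage_mem_nhdsWithin (t := t) (by simpa using ht)
        filter_upwards [c1', c2'] with s hs hs'
        simpa using hC _ hs _ hs')
    have huniq := (uniqueDiffOn_Ico (0 : ℝ) ⟨le_rfl, hη⟩).eq_deriv _ d2 d3
    refine (mul_eq_zero.1 (conformal_injective (hψ.lam_pos hΩ) (hψ.inner_eq hΩ)
      (X := Complex.I * ((p - p') * X - (q - q') * Y)) ?_)).resolve_left Complex.I_ne_zero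
    rw [← huniq, ← map_smul, ← map_smul, ← map_smul, ← map_smul, ← map_sub, ← map_sub, ← map_sub]
    congr 1
    simp only [Complex.real_smul]
    ring
  have hXne := tu_ne_zero hψ hF hu hv
  have hYne : Y ≠ 0 := tv_ne_zero hψ hF hu hv
  have hYx : ∀ c : ℂ, c * X = 0 → c = 0 := fun c h => (mul_eq_zero.1 h).resolve_right hXne
  -- If Y = μX with μ ≥ 0, the directions (μ, 0) and (0, 1) have the same velocity. If μ ≤ 0, the
  -- direction (-μ, 1) has velocity zero and is compared with (0, 0). Both cases force μ = 0.
  rcases le_total 0 μ with h | h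
  · have := key μ 0 0 1 h le_rfl le_rfl zero_le_one (by rw [abs_of_nonneg h]; linarith)
      (by positivity) zero_le_one le_rfl (by rw [hμ]; push_cast; ring)
    rw [hμ] at this
    have h2 := hYx (2 * μ) (by rw [← this]; push_cast; ring)
    have : (μ : ℂ) = 0 := by simpa using h2
    rw [this, zero_mul] at hμ
    exact hYne hμ
  · have := key (-μ) 1 0 0 (by linarith) zero_le_one le_rfl le_rfl
      (by rw [abs_of_nonpos h]; linarith) (by positivity) le_rfl zero_le_one
      (by rw [hμ]; push_cast; ring)
    rw [hμ] at this
    have h2 := hYx (2 * μ) (by linear_combination (-1 : ℂ) * this + (by push_cast; ring : (2 * μ * X : ℂ) - 0 + (((-μ : ℝ) : ℂ) - (0 : ℝ)) * X - (((1 : ℝ) : ℂ) - (0 : ℝ)) * (μ * X) = 0))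
    have : (μ : ℂ) = 0 := by simpa using h2
    rw [this, zero_mul] at hμ
    exact hYne hμ

end IsSector

/-! ### The mixed derivative of an asymptotic net -/

lemma lam_ge_one {z : ℂ} (hz : ‖z‖ < 1) : 1 ≤ lam z := by
  have h := one_sub_sq_pos hz
  have h2 : (1 - ‖z‖ ^ 2) ^ 2 ≤ 1 := by
    have := sq_nonneg ‖z‖
    nlinarith
  unfold lam
  rw [le_div_iff₀ (by positivity)]
  linarith

lemma contDiffAt_chris {z : ℂ} (hz : ‖z‖ < 1) : ContDiffAt ℝ ⊤ chris z := by
  have h := one_sub_sq_pos hz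
  unfold chris
  have h1 : ContDiffAt ℝ ⊤ (fun z : ℂ => conj z) z := Complex.conjCLE.contDiff.contDiffAt
  have h2 : ContDiffAt ℝ ⊤ (fun z : ℂ => ((1 - ‖z‖ ^ 2 : ℝ) : ℂ)) z :=
    Complex.ofRealCLM.contDiff.contDiffAt.comp z (by
      have : ContDiff ℝ ⊤ (fun z : ℂ => ‖z‖ ^ 2) := contDiff_norm_sq ℝ
      exact contDiffAt_const.sub this.contDiffAt)
  have h3 : ((1 - ‖z‖ ^ 2 : ℝ) : ℂ) ≠ 0 := by exact_mod_cast h.ne'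
  simp only [div_eq_mul_inv]
  exact (contDiffAt_const.mul h1).mul (h2.inv h3)

/-- Constant hyperbolic length makes |w|² an explicit function of the base point. Its derivative is
the one it would have if w were parallel, although w itself need not be differentiable. -/
lemma hasDerivWithinAt_norm_sq_of_lam {J : Set ℝ} {F w : ℝ → ℂ} {p : ℂ} {v E : ℝ} (hv : v ∈ J)
    (hF : HasDerivWithinAt F p J v) (hn : ∀ t ∈ J, ‖F t‖ < 1)
    (hE : ∀ t ∈ J, lam (F t) * ‖w t‖ ^ 2 = E) :
    HasDerivWithinAt (fun t => ‖w t‖ ^ 2)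
      (2 * (conj (w v) * mixedTerm (F v) (w v) p).re) J v := by
  have e : ∀ t ∈ J, ‖w t‖ ^ 2 = E / 4 * (1 - ‖F t‖ ^ 2) ^ 2 := fun t ht => by
    have := one_sub_sq_pos (hn t ht)
    rw [← hE t ht, lam]
    field_simp
  have h := ((hF.norm_sq.const_sub 1).pow 2).const_mul (E / 4)
  refine HasDerivWithinAt.congr_of_eventuallyEq (f := fun t => E / 4 * (1 - ‖F t‖ ^ 2) ^ 2) ?_
    (eventually_nhdsWithin_of_forall e) (e v hv)
  refine HasDerivWithinAt.congr_deriv h ?_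
  have hp := one_sub_sq_pos (hn v hv)
  have e1 : conj (w v) * mixedTerm (F v) (w v) p
      = ((-(2 * ‖w v‖ ^ 2 / (1 - ‖F v‖ ^ 2)) : ℝ) : ℂ) * (conj (F v) * p) := by
    have : conj (w v) * w v = ((‖w v‖ ^ 2 : ℝ) : ℂ) := by
      rw [mul_comm, Complex.mul_conj, Complex.normSq_eq_norm_sq]
    unfold mixedTerm chris
    push_cast at this ⊢
    linear_combination -(2 * conj (F v) / (1 - (‖F v‖ : ℂ) ^ 2)) * p * this
  rw [e1, Complex.re_ofReal_mul]
  have e2 : (conj (F v) * p).re = inner ℝ (F v) p := by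
    rw [Complex.inner]; ring_nf
  rw [e2, e v hv]
  field_simp
  ring

lemma hasDerivWithinAt_mixed_pair {I J : Set ℝ} (hI : Convex ℝ I) (hJ : Convex ℝ J)
    (hI' : UniqueDiffOn ℝ I) (hJ' : UniqueDiffOn ℝ J)
    {z zu zv : ℝ → ℝ → ℂ} (hz : HasPartials I J z zu zv) {T S : ℝ → ℝ → ℝ}
    (hT : ∀ u ∈ I, ∀ v ∈ J, HasDerivWithinAt (fun t => ‖zu u t‖ ^ 2) (T u v) J v)
    (hTc : ContinuousOn (fun z : ℝ × ℝ => T z.1 z.2) (I ×ˢ J))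
    (hS : ∀ u ∈ I, ∀ v ∈ J, HasDerivWithinAt (fun s => ‖zv s v‖ ^ 2) (S u v) I u)
    (hSc : ContinuousOn (fun z : ℝ × ℝ => S z.1 z.2) (I ×ˢ J))
    {C : ℝ} (hC : ∀ u ∈ I, ∀ v ∈ J, ∀ v' ∈ J, ‖zu u v' - zu u v‖ ≤ C * |v' - v|)
    (hC' : ∀ u ∈ I, ∀ u' ∈ I, ∀ v ∈ J, ‖zv u' v - zv u v‖ ≤ C * |u' - u|)
    {u v : ℝ} (hu : u ∈ I) (hv : v ∈ J) (hdet : planarDet (zu u v) (zv u v) ≠ 0)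
    {H : ℂ} (hH : T u v = 2 * (conj (zu u v) * H).re) (hH' : S u v = 2 * (conj (zv u v) * H).re) :
    HasDerivWithinAt (fun s => zv s v) H I u ∧ HasDerivWithinAt (fun t => zu u t) H J v := by
  refine ⟨hasDerivWithinAt_mixed hI hJ hJ' hz hT hTc hS hSc hC hC' hu hv hdet hH hH', ?_⟩
  have hdet' : planarDet (zv u v) (zu u v) ≠ 0 := by
    unfold planarDet at hdet ⊢
    intro h; apply hdet; linarith
  have hsw : MapsTo Prod.swap (J ×ˢ I) (I ×ˢ J) := fun z hz => ⟨hz.2, hz.1⟩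
  have hcs : ContinuousOn (Prod.swap : ℝ × ℝ → ℝ × ℝ) (J ×ˢ I) := continuous_swap.continuousOn
  exact hasDerivWithinAt_mixed hJ hI hI' hz.swap (fun v hv u hu => hS u hu v hv)
    (hSc.comp hcs hsw) (fun v hv u hu => hT u hu v hv) (hTc.comp hcs hsw)
    (fun v hv u hu u' hu' => hC' u hu u' hu' v hv)
    (fun v hv v' hv' u hu => hC u hu v hv v' hv') hv hu hdet' hH' hH

variable {Ω : Set ℂ} {ψ : ℂ → E3}

lemma IsBranchedPSImmersion.norm_le_norm_fderiv (hψ : IsBranchedPSImmersion Ω ψ) {z : ℂ}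
    (hz : z ∈ Ω) (X : ℂ) : ‖X‖ ≤ ‖fderiv ℝ ψ z X‖ := by
  have h1 := conformal_norm_sq (hψ.inner_eq hz) X
  have h2 := lam_ge_one (hψ.norm_lt hz)
  refine (sq_le_sq₀ (norm_nonneg _) (norm_nonneg _)).1 ?_
  rw [h1]
  nlinarith [sq_nonneg ‖X‖]

/-- A tangent field is Lipschitz if its image under `ψ` is differentiable. -/
lemma IsBranchedPSImmersion.exists_lipschitz_tangent (hψ : IsBranchedPSImmersion Ω ψ) {I J : Set ℝ}
    (hI : IsCompact I) (hJ : IsCompact J) (hJc : Convex ℝ J) {F w Fv : ℝ → ℝ → ℂ}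
    {ρ ρv : ℝ → ℝ → E3} (hm : ∀ u ∈ I, ∀ v ∈ J, F u v ∈ Ω)
    (hFc : ContinuousOn (fun z : ℝ × ℝ => F z.1 z.2) (I ×ˢ J))
    (hF : ∀ u ∈ I, ∀ v ∈ J, HasDerivWithinAt (fun t => F u t) (Fv u v) J v)
    (hFvc : ContinuousOn (fun z : ℝ × ℝ => Fv z.1 z.2) (I ×ˢ J))
    (hwc : ContinuousOn (fun z : ℝ × ℝ => w z.1 z.2) (I ×ˢ J))
    (hρ : ∀ u ∈ I, ∀ v ∈ J, HasDerivWithinAt (fun t => ρ u t) (ρv u v) J v)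
    (hρc : ContinuousOn (fun z : ℝ × ℝ => ρv z.1 z.2) (I ×ˢ J))
    (hw : ∀ u ∈ I, ∀ v ∈ J, ρ u v = fderiv ℝ ψ (F u v) (w u v)) :
    ∃ C : ℝ, ∀ u ∈ I, ∀ v ∈ J, ∀ v' ∈ J, ‖w u v' - w u v‖ ≤ C * |v' - v| := by
  have hIJ := hI.prod hJ
  obtain ⟨M, hM⟩ := hIJ.exists_bound_of_continuousOn hFvc
  obtain ⟨B, hB⟩ := hIJ.exists_bound_of_continuousOn hwc
  obtain ⟨R, hR⟩ := hIJ.exists_bound_of_continuousOn hρc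
  have hK := hIJ.image_of_continuousOn hFc
  have hKΩ : (fun z : ℝ × ℝ => F z.1 z.2) '' (I ×ˢ J) ⊆ Ω := by
    rintro _ ⟨z, hz, rfl⟩; exact hm _ hz.1 _ hz.2
  obtain ⟨L, hL⟩ := (hψ.lipschitz_fderiv.mono hKΩ).exists_lipschitzOnWith_of_compact hK
  refine ⟨R + L * M * B, fun u hu v hv v' hv' => ?_⟩
  have a1 : ‖F u v' - F u v‖ ≤ M * |v' - v| := by
    have := hJc.norm_image_sub_le_of_norm_hasDerivWithin_le (hF u hu)
      (fun t ht => hM (u, t) ⟨hu, ht⟩) hv hv'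
    simpa using this
  have a2 : ‖ρ u v' - ρ u v‖ ≤ R * |v' - v| := by
    have := hJc.norm_image_sub_le_of_norm_hasDerivWithin_le (hρ u hu)
      (fun t ht => hR (u, t) ⟨hu, ht⟩) hv hv'
    simpa using this
  have a3 : ‖fderiv ℝ ψ (F u v') - fderiv ℝ ψ (F u v)‖ ≤ L * ‖F u v' - F u v‖ := by
    simpa [dist_eq_norm] using hL.dist_le_mul _ (mem_image_of_mem _ (show (u, v') ∈ I ×ˢ J from ⟨hu, hv'⟩))
      _ (mem_image_of_mem _ (show (u, v) ∈ I ×ˢ J from ⟨hu, hv⟩))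
  have a4 : ‖w u v‖ ≤ B := hB (u, v) ⟨hu, hv⟩
  refine (hψ.norm_le_norm_fderiv (hm u hu v' hv') _).trans ?_
  -- The first term is controlled by the derivative of ρ, the second by the Lipschitz constant of
  -- the differential. The differential does not shrink vectors, since λ ≥ 1, so the bound passes to
  -- the increment of w.
  have e : fderiv ℝ ψ (F u v') (w u v' - w u v) = (ρ u v' - ρ u v)
      - (fderiv ℝ ψ (F u v') - fderiv ℝ ψ (F u v)) (w u v) := by
    rw [hw u hu v' hv', hw u hu v hv, map_sub, _root_.sub_apply]; abel
  rw [e]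
  calc _ ≤ _ := norm_sub_le _ _
    _ ≤ R * |v' - v| + (L * (M * |v' - v|)) * B := by
      refine add_le_add a2 (((_ : ℂ →L[ℝ] E3).le_opNorm _).trans ?_)
      have : 0 ≤ B := (norm_nonneg _).trans a4
      have a5 := a3.trans (mul_le_mul_of_nonneg_left a1 L.2)
      exact mul_le_mul a5 a4 (norm_nonneg _) ((norm_nonneg _).trans a5)
    _ = _ := by ring

namespace IsSector

variable {a b : ℝ} {F : ℝ → ℝ → ℂ} (hψ : IsBranchedPSImmersion Ω ψ) (hF : IsSector Ω ψ a b F)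

set_option maxHeartbeats 400000 in
include hψ hF in
/-- The second fundamental equations of an asymptotic net: the tangent vectors are parallel along
the transverse curves in the sense of the Levi-Civita connection. -/
lemma hasDerivWithinAt_mixed {δ : ℝ} (hδa : δ < a) (hδb : δ < b) {u v : ℝ}
    (hu : u ∈ Icc 0 δ) (hv : v ∈ Icc 0 δ) (hδ : 0 < δ) :
    HasDerivWithinAt (fun s => tv b F s v) (mixedTerm (F u v) (tu a F u v) (tv b F u v))
      (Icc 0 δ) u ∧
    HasDerivWithinAt (fun t => tu a F u t) (mixedTerm (F u v) (tu a F u v) (tv b F u v))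
      (Icc 0 δ) v := by
  have sa : Icc 0 δ ⊆ Ico 0 a := Icc_subset_Ico_right hδa
  have sb : Icc 0 δ ⊆ Ico 0 b := Icc_subset_Ico_right hδb
  have P := (hasPartials hψ hF).mono sa sb
  have hc := hF.cont.mono (prod_mono sa sb)
  have hm : ∀ u ∈ Icc 0 δ, ∀ v ∈ Icc 0 δ, F u v ∈ Ω :=
    fun u hu v hv => hF.maps u (sa hu) v (sb hv)
  have hchris : ContinuousOn (fun z : ℝ × ℝ => chris (F z.1 z.2)) (Icc 0 δ ×ˢ Icc 0 δ) :=
    fun z hz => ContinuousAt.comp_continuousWithinAt (f := fun z : ℝ × ℝ => F z.1 z.2)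
      (contDiffAt_chris (hψ.norm_lt (hm _ hz.1 _ hz.2))).continuousAt (hc z hz)
  have hmc : ContinuousOn (fun z : ℝ × ℝ => mixedTerm (F z.1 z.2) (tu a F z.1 z.2) (tv b F z.1 z.2))
      (Icc 0 δ ×ˢ Icc 0 δ) := ((hchris.mul P.cu).mul P.cv).neg
  have hconj : Continuous (fun z : ℂ => conj z) := Complex.continuous_conj
  obtain ⟨E, hE⟩ := exists_norm_tu hψ hF
  obtain ⟨G, hG⟩ := exists_norm_tv hψ hF
  set T : ℝ → ℝ → ℝ := fun u v => 2 * (conj (tu a F u v) *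
    mixedTerm (F u v) (tu a F u v) (tv b F u v)).re with hT
  set S : ℝ → ℝ → ℝ := fun u v => 2 * (conj (tv b F u v) *
    mixedTerm (F u v) (tu a F u v) (tv b F u v)).re with hS
  have hTc : ContinuousOn (fun z : ℝ × ℝ => T z.1 z.2) (Icc 0 δ ×ˢ Icc 0 δ) :=
    continuousOn_const.mul (Complex.continuous_re.comp_continuousOn
      ((hconj.comp_continuousOn P.cu).mul hmc))
  have hSc : ContinuousOn (fun z : ℝ × ℝ => S z.1 z.2) (Icc 0 δ ×ˢ Icc 0 δ) :=
    continuousOn_const.mul (Complex.continuous_re.comp_continuousOn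
      ((hconj.comp_continuousOn P.cv).mul hmc))
  have hTd : ∀ u ∈ Icc 0 δ, ∀ v ∈ Icc 0 δ,
      HasDerivWithinAt (fun t => ‖tu a F u t‖ ^ 2) (T u v) (Icc 0 δ) v := fun u hu v hv =>
    hasDerivWithinAt_norm_sq_of_lam hv (P.hv u hu v hv) (fun t ht => hψ.norm_lt (hm u hu t ht))
      (fun t ht => (hE u (sa hu)).2 t (sb ht))
  have hSd : ∀ u ∈ Icc 0 δ, ∀ v ∈ Icc 0 δ,
      HasDerivWithinAt (fun s => ‖tv b F s v‖ ^ 2) (S u v) (Icc 0 δ) u := fun u hu v hv => by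
    have := hasDerivWithinAt_norm_sq_of_lam hu (P.hu u hu v hv)
      (fun s hs => hψ.norm_lt (hm s hs v hv)) (fun s hs => (hG v (sb hv)).2 s (sa hs))
    rwa [mixedTerm_comm] at this
  have hr := hF.front.1
  have hsub := prod_mono sa sb
  -- The field r_u in space is C¹ in v because r is C^{1M}. This is what makes its preimage in the
  -- disk Lipschitz in the transverse direction.
  obtain ⟨C1, hC1⟩ := hψ.exists_lipschitz_tangent isCompact_Icc isCompact_Icc (convex_Icc 0 δ) hm hc
    P.hv P.cv P.cu (ρ := partialU (Ico 0 a) (fun u v => ψ (F u v)))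
    (fun u hu v hv => ((hr.diff_uv u (sa hu) v (sb hv)).hasDerivWithinAt.mono sb))
    (hr.continuousOn_uv.mono hsub) (fun u hu v hv => fderiv_tu hψ hF (sa hu) (sb hv))
  have hsw : MapsTo Prod.swap (Icc 0 δ ×ˢ Icc 0 δ) (Icc 0 δ ×ˢ Icc 0 δ) := fun z hz => ⟨hz.2, hz.1⟩
  have hcs : ContinuousOn (Prod.swap : ℝ × ℝ → ℝ × ℝ) (Icc 0 δ ×ˢ Icc 0 δ) :=
    continuous_swap.continuousOn
  have hvu : ContinuousOn (fun z : ℝ × ℝ => partialU (Ico 0 a) (partialV (Ico 0 b)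
      (fun u v => ψ (F u v))) z.1 z.2) (Icc 0 δ ×ˢ Icc 0 δ) :=
    (hr.continuousOn_uv.mono hsub).congr fun z hz => (hr.mixed_eq _ (sa hz.1) _ (sb hz.2)).symm
  obtain ⟨C2, hC2⟩ := hψ.exists_lipschitz_tangent isCompact_Icc isCompact_Icc (convex_Icc 0 δ)
    (F := fun v u => F u v) (w := fun v u => tv b F u v) (Fv := fun v u => tu a F u v)
    (ρ := fun v u => partialV (Ico 0 b) (fun u v => ψ (F u v)) u v)
    (ρv := fun v u => partialU (Ico 0 a) (partialV (Ico 0 b) (fun u v => ψ (F u v))) u v)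
    (fun v hv u hu => hm u hu v hv) (hc.comp hcs hsw) (fun v hv u hu => P.hu u hu v hv)
    (P.cu.comp hcs hsw) (P.cv.comp hcs hsw)
    (fun v hv u hu => ((hr.diff_vu v (sb hv) u (sa hu)).hasDerivWithinAt.mono sa))
    (hvu.comp hcs hsw) (fun v hv u hu => fderiv_tv hψ hF (sa hu) (sb hv))
  have b1 : ∀ u ∈ Icc 0 δ, ∀ v ∈ Icc 0 δ, ∀ v' ∈ Icc 0 δ,
      ‖tu a F u v' - tu a F u v‖ ≤ max C1 C2 * |v' - v| := fun u hu v hv v' hv' =>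
    (hC1 u hu v hv v' hv').trans (by gcongr; exact le_max_left _ _)
  have b2 : ∀ u ∈ Icc 0 δ, ∀ u' ∈ Icc 0 δ, ∀ v ∈ Icc 0 δ,
      ‖tv b F u' v - tv b F u v‖ ≤ max C1 C2 * |u' - u| := fun u hu u' hu' v hv =>
    (hC2 v hv u hu u' hu').trans (by gcongr; exact le_max_right _ _)
  have hud : UniqueDiffOn ℝ (Icc 0 δ) := uniqueDiffOn_Icc hδ
  exact hasDerivWithinAt_mixed_pair (convex_Icc 0 δ) (convex_Icc 0 δ) hud hud P hTd hTc hSd hSc b1 b2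
    hu hv (planarDet_ne_zero hψ hF (sa hu) (sb hv)) (by rw [hT]) (by rw [hS])

end IsSector

/-! ### The connection form and the curvature -/

section Chris

lemma hasFDerivAt_chris {z : ℂ} (hz : ‖z‖ < 1) :
    HasFDerivAt chris ((2 / (1 - ‖z‖ ^ 2)) • (Complex.conjCLE : ℂ →L[ℝ] ℂ)
      + ((4 / (1 - ‖z‖ ^ 2) ^ 2) • innerSL ℝ z).smulRight (conj z)) z := by
  have h := one_sub_sq_pos hz
  have h1 : HasFDerivAt (fun z : ℂ => 1 - ‖z‖ ^ 2) (-(2 • innerSL ℝ z)) z :=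
    (hasStrictFDerivAt_norm_sq z).hasFDerivAt.const_sub 1
  have h2 : HasFDerivAt (fun w : ℂ => 2 / (1 - ‖w‖ ^ 2)) ((4 / (1 - ‖z‖ ^ 2) ^ 2) • innerSL ℝ z) z := by
    have := (hasDerivAt_inv h.ne').const_mul 2
    have := this.comp_hasFDerivAt z h1
    refine HasFDerivAt.congr_fderiv this ?_
    ext <;> (simp; try ring)
  have h3 : HasFDerivAt (fun z : ℂ => conj z) (Complex.conjCLE : ℂ →L[ℝ] ℂ) z :=
    Complex.conjCLE.hasFDerivAt
  have := h2.smul h3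
  refine HasFDerivAt.congr_fderiv (this.congr_of_eventuallyEq (Eventually.of_forall fun w => ?_)) ?_
  · simp [chris]; ring
  · rfl

/-- The curvature of the hyperbolic metric is `-1`. -/
lemma im_fderiv_chris {z : ℂ} (hz : ‖z‖ < 1) (X Y : ℂ) :
    (fderiv ℝ chris z X * Y - fderiv ℝ chris z Y * X).im = lam z * planarDet X Y := by
  have h := one_sub_sq_pos hz
  rw [(hasFDerivAt_chris hz).fderiv]
  have e : ‖z‖ ^ 2 = z.re * z.re + z.im * z.im := by
    rw [← Complex.normSq_eq_norm_sq, Complex.normSq_apply]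
  have e2 : lam z = 2 * (2 / (1 - ‖z‖ ^ 2)) + 4 / (1 - ‖z‖ ^ 2) ^ 2 * ‖z‖ ^ 2 := by
    unfold lam; field_simp; ring
  rw [e2, e]
  generalize 2 / (1 - (z.re * z.re + z.im * z.im)) = a
  generalize 4 / (1 - (z.re * z.re + z.im * z.im)) ^ 2 = b
  simp [Complex.inner, planarDet]
  ring

lemma continuousOn_fderiv_chris : ContinuousOn (fderiv ℝ chris) (Metric.ball 0 1) := by
  have : ContDiffOn ℝ ⊤ chris (Metric.ball 0 1) := fun z hz =>
    (contDiffAt_chris (by simpa using hz)).contDiffWithinAt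
  exact this.continuousOn_fderiv_of_isOpen Metric.isOpen_ball (by simp)

end Chris

/-! ### Covariant Hessian, closed cells of a net, and the angle of a cell -/

lemma hasDerivWithinAt_arg {w : ℝ → ℂ} {w' : ℂ} {s : Set ℝ} {x : ℝ} (h : HasDerivWithinAt w w' s x)
    (hw : w x ∈ Complex.slitPlane) :
    HasDerivWithinAt (fun t => (w t).arg) (w' / w x).im s x := by
  have := Complex.imCLM.hasFDerivAt.comp_hasDerivWithinAt (f := fun t => Complex.log (w t)) x
    (h.clog_real hw)
  simpa only [Function.comp_def, Complex.imCLM_apply, Complex.log_im] using this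

/-- The covariant Hessian of a function on the hyperbolic plane. -/
def covHess (χ : ℂ → ℝ) (z X Y : ℂ) : ℝ :=
  fderiv ℝ (fderiv ℝ χ) z X Y + fderiv ℝ χ z (mixedTerm z X Y)

lemma covHess_symm {χ : ℂ → ℝ} (hχ : ContDiff ℝ 2 χ) (z X Y : ℂ) :
    covHess χ z X Y = covHess χ z Y X := by
  have := (hχ.contDiffAt (x := z)).isSymmSndFDerivAt (by simp) X Y
  unfold covHess
  rw [this, mixedTerm_comm]

lemma covHess_smul (χ : ℂ → ℝ) (z X Y : ℂ) (s t : ℝ) :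
    covHess χ z (s * X) (t * Y) = s * t * covHess χ z X Y := by
  unfold covHess
  have e : mixedTerm z (s * X) (t * Y) = (s * t) • mixedTerm z X Y := by
    simp only [mixedTerm, Complex.real_smul]; push_cast; ring
  rw [e, ← Complex.real_smul, ← Complex.real_smul, map_smul, map_smul, map_smul]
  simp
  ring

/-- A closed square of an asymptotic net; `ε` tells which family is the first one. -/
structure IsNet (Ω : Set ℂ) (ψ : ℂ → E3) (ε δ : ℝ) (P Px Py : ℝ → ℝ → ℂ) : Prop where
  pos : 0 < δ
  maps : ∀ x ∈ Icc 0 δ, ∀ y ∈ Icc 0 δ, P x y ∈ Ω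
  part : HasPartials (Icc 0 δ) (Icc 0 δ) P Px Py
  mixed_x : ∀ x ∈ Icc 0 δ, ∀ y ∈ Icc 0 δ,
    HasDerivWithinAt (fun s => Py s y) (mixedTerm (P x y) (Px x y) (Py x y)) (Icc 0 δ) x
  mixed_y : ∀ x ∈ Icc 0 δ, ∀ y ∈ Icc 0 δ,
    HasDerivWithinAt (fun t => Px x t) (mixedTerm (P x y) (Px x y) (Py x y)) (Icc 0 δ) y
  det_ne : ∀ x ∈ Icc 0 δ, ∀ y ∈ Icc 0 δ, planarDet (Px x y) (Py x y) ≠ 0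
  inj : InjOn (fun z : ℝ × ℝ => P z.1 z.2) (Icc 0 δ ×ˢ Icc 0 δ)
  re_x : ∀ x ∈ Icc 0 δ, ∀ y ∈ Icc 0 δ, 0 < (Px x y / Px 0 0).re
  re_y : ∀ x ∈ Icc 0 δ, ∀ y ∈ Icc 0 δ, 0 < (Py x y / Py 0 0).re
  part_normal : HasPartials (Icc 0 δ) (Icc 0 δ) (fun x y => normal ψ (P x y))
    (fun x y => ε • fderiv ℝ ψ (P x y) (Complex.I * Px x y))
    (fun x y => -(ε • fderiv ℝ ψ (P x y) (Complex.I * Py x y)))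

lemma planarDet_ne_zero_left {X Y : ℂ} (h : planarDet X Y ≠ 0) : X ≠ 0 := by
  rintro rfl; simp [planarDet] at h

lemma planarDet_ne_zero_right {X Y : ℂ} (h : planarDet X Y ≠ 0) : Y ≠ 0 := by
  rintro rfl; simp [planarDet] at h

lemma planarDet_eq_im (X Y : ℂ) : planarDet X Y = ‖X‖ ^ 2 * (Y / X).im := by
  rcases eq_or_ne X 0 with rfl | hX
  · simp [planarDet]
  · have h : Complex.normSq X ≠ 0 := by simpa using hX
    rw [← Complex.normSq_eq_norm_sq, Complex.div_im, planarDet]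
    field_simp

lemma planarDet_swap (X Y : ℂ) : planarDet X Y = -planarDet Y X := by
  unfold planarDet; ring

/-- The signed angle from the first to the second tangent vector. -/
def netAngle (Px Py : ℝ → ℝ → ℂ) (x y : ℝ) : ℝ := (Py x y / Px x y).arg

/-- The two sides agree modulo 2π. Each is less than π in absolute value, the left one because both
quotients lie in the right half-plane, so they are equal. -/
lemma arg_sub_of_abs_lt {x x' y y' : ℂ} (hx : 0 < (x / x').re) (hy : 0 < (y / y').re)
    (hx' : x' ≠ 0) (hy' : y' ≠ 0)
    (h : |(y / x).arg - (y' / x').arg| < Real.pi) :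
    (y / y').arg - (x / x').arg = (y / x).arg - (y' / x').arg := by
  have hx0 : x ≠ 0 := by rintro rfl; simp at hx
  have hy0 : y ≠ 0 := by rintro rfl; simp at hy
  have e : (((y / y').arg - (x / x').arg : ℝ) : Real.Angle)
      = (((y / x).arg - (y' / x').arg : ℝ) : Real.Angle) := by
    rw [Real.Angle.coe_sub, Real.Angle.coe_sub, Complex.arg_div_coe_angle hy0 hy',
      Complex.arg_div_coe_angle hx0 hx', Complex.arg_div_coe_angle hy0 hx0,
      Complex.arg_div_coe_angle hy' hx']
    abel
  obtain ⟨k, hk⟩ := Real.Angle.angle_eq_iff_two_pi_dvd_sub.1 e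
  have a1 := abs_lt.1 (Complex.abs_arg_lt_pi_div_two_iff.2 (Or.inl hx))
  have a2 := abs_lt.1 (Complex.abs_arg_lt_pi_div_two_iff.2 (Or.inl hy))
  have a3 := abs_lt.1 h
  have hpi := Real.pi_pos
  have k1 : (k : ℝ) < 1 := by
    by_contra hc; push Not at hc; nlinarith
  have k2 : (-1 : ℝ) < k := by
    by_contra hc; push Not at hc; nlinarith
  have : k = 0 := by
    have k1' : k < 1 := by exact_mod_cast k1
    have k2' : -1 < k := by exact_mod_cast k2
    omega
  rw [this] at hk
  simp at hk
  linarith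

namespace IsNet

variable {Ω : Set ℂ} {ψ : ℂ → E3} {ε δ : ℝ} {P Px Py : ℝ → ℝ → ℂ}

lemma zero_mem (h : IsNet Ω ψ ε δ P Px Py) : (0 : ℝ) ∈ Icc 0 δ := ⟨le_rfl, h.pos.le⟩

lemma cont (h : IsNet Ω ψ ε δ P Px Py) :
    ContinuousOn (fun z : ℝ × ℝ => P z.1 z.2) (Icc 0 δ ×ˢ Icc 0 δ) :=
  h.part.continuousOn (convex_Icc _ _) (convex_Icc _ _)

lemma continuousOn_div (h : IsNet Ω ψ ε δ P Px Py) :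
    ContinuousOn (fun z : ℝ × ℝ => Py z.1 z.2 / Px z.1 z.2) (Icc 0 δ ×ˢ Icc 0 δ) :=
  h.part.cv.div h.part.cu fun _ hz => planarDet_ne_zero_left (h.det_ne _ hz.1 _ hz.2)

lemma im_div_ne (h : IsNet Ω ψ ε δ P Px Py) {x y : ℝ} (hx : x ∈ Icc 0 δ) (hy : y ∈ Icc 0 δ) :
    (Py x y / Px x y).im ≠ 0 := by
  intro h0
  apply h.det_ne x hx y hy
  rw [planarDet_eq_im, h0, mul_zero]

lemma continuousOn_netAngle (h : IsNet Ω ψ ε δ P Px Py) :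
    ContinuousOn (fun z : ℝ × ℝ => netAngle Px Py z.1 z.2) (Icc 0 δ ×ˢ Icc 0 δ) := fun z hz =>
  ContinuousAt.comp_continuousWithinAt (f := fun z : ℝ × ℝ => Py z.1 z.2 / Px z.1 z.2)
    (Complex.continuousAt_arg (Or.inr (h.im_div_ne hz.1 hz.2))) (h.continuousOn_div z hz)

/-- The orientation of a cell. -/
lemma exists_sign (h : IsNet Ω ψ ε δ P Px Py) : ∃ τ : ℝ, (τ = 1 ∨ τ = -1) ∧
    ∀ x ∈ Icc 0 δ, ∀ y ∈ Icc 0 δ, 0 < τ * planarDet (Px x y) (Py x y) := by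
  have hc : ContinuousOn (fun z : ℝ × ℝ => planarDet (Px z.1 z.2) (Py z.1 z.2))
      (Icc 0 δ ×ˢ Icc 0 δ) := by
    have h1 := h.part.cu
    have h2 := h.part.cv
    have r := Complex.continuous_re
    have i := Complex.continuous_im
    exact ((r.comp_continuousOn h1).mul (i.comp_continuousOn h2)).sub
      ((i.comp_continuousOn h1).mul (r.comp_continuousOn h2))
  have hp : IsPreconnected (Icc 0 δ ×ˢ Icc 0 δ) := isPreconnected_Icc.prod isPreconnected_Icc
  have hI := hp.image _ hc
  have h0 : planarDet (Px 0 0) (Py 0 0) ∈ (fun z : ℝ × ℝ => planarDet (Px z.1 z.2) (Py z.1 z.2)) ''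
      (Icc 0 δ ×ˢ Icc 0 δ) := ⟨(0, 0), ⟨h.zero_mem, h.zero_mem⟩, rfl⟩
  have hne : (0 : ℝ) ∉ (fun z : ℝ × ℝ => planarDet (Px z.1 z.2) (Py z.1 z.2)) ''
      (Icc 0 δ ×ˢ Icc 0 δ) := by
    rintro ⟨z, hz, hz0⟩; exact h.det_ne _ hz.1 _ hz.2 hz0
  rcases lt_or_gt_of_ne (h.det_ne 0 h.zero_mem 0 h.zero_mem) with hl | hg
  · refine ⟨-1, Or.inr rfl, fun x hx y hy => ?_⟩
    by_contra hcon
    have : 0 ≤ planarDet (Px x y) (Py x y) := by linarith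
    exact hne (hI.ordConnected.out h0 ⟨(x, y), ⟨hx, hy⟩, rfl⟩ ⟨hl.le, this⟩)
  · refine ⟨1, Or.inl rfl, fun x hx y hy => ?_⟩
    by_contra hcon
    have : planarDet (Px x y) (Py x y) ≤ 0 := by linarith
    exact hne (hI.ordConnected.out ⟨(x, y), ⟨hx, hy⟩, rfl⟩ h0 ⟨this, hg.le⟩)

/-- `τ` times the signed angle is the angle between the tangent vectors. -/
lemma angle_mem {τ : ℝ} (hτ : τ = 1 ∨ τ = -1) {x y : ℝ}
    (hd : 0 < τ * planarDet (Px x y) (Py x y)) :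
    τ * netAngle Px Py x y ∈ Ioo 0 Real.pi := by
  rw [planarDet_eq_im] at hd
  have hX : 0 ≤ ‖Px x y‖ ^ 2 := by positivity
  unfold netAngle
  rcases hτ with rfl | rfl
  · have : 0 < (Py x y / Px x y).im := by
      by_contra hc; push Not at hc; nlinarith
    rw [one_mul]
    have h1 := Complex.arg_nonneg_iff.2 this.le
    have h2 := Complex.arg_lt_pi_iff.2 (Or.inr this.ne')
    refine ⟨lt_of_le_of_ne h1 fun h0 => ?_, h2⟩
    have := (Complex.arg_eq_zero_iff.1 h0.symm).2
    linarith
  · have : (Py x y / Px x y).im < 0 := by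
      by_contra hc; push Not at hc; nlinarith
    have h1 := Complex.arg_neg_iff.2 this
    have h2 := Complex.neg_pi_lt_arg (Py x y / Px x y)
    constructor <;> linarith

/-- In y the vector P_x solves a linear equation, that of a parallel field, with logarithmic
derivative minus the Christoffel symbol times P_y. The imaginary part of this is minus the
connection form on P_y. -/
lemma hasDerivWithinAt_argX (h : IsNet Ω ψ ε δ P Px Py) {x y : ℝ} (hx : x ∈ Icc 0 δ)
    (hy : y ∈ Icc 0 δ) : HasDerivWithinAt (fun t => (Px x t / Px 0 0).arg)
      (-(chris (P x y) * Py x y).im) (Icc 0 δ) y := by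
  have h1 := hasDerivWithinAt_arg ((h.mixed_y x hx y hy).div_const (Px 0 0))
    (Or.inl (h.re_x x hx y hy))
  refine h1.congr_deriv ?_
  have := planarDet_ne_zero_left (h.det_ne x hx y hy)
  have h0 := planarDet_ne_zero_left (h.det_ne 0 h.zero_mem 0 h.zero_mem)
  rw [← Complex.neg_im]
  congr 1
  unfold mixedTerm
  field_simp

lemma hasDerivWithinAt_argY (h : IsNet Ω ψ ε δ P Px Py) {x y : ℝ} (hx : x ∈ Icc 0 δ)
    (hy : y ∈ Icc 0 δ) : HasDerivWithinAt (fun s => (Py s y / Py 0 0).arg)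
      (-(chris (P x y) * Px x y).im) (Icc 0 δ) x := by
  have h1 := hasDerivWithinAt_arg ((h.mixed_x x hx y hy).div_const (Py 0 0))
    (Or.inl (h.re_y x hx y hy))
  refine h1.congr_deriv ?_
  have := planarDet_ne_zero_right (h.det_ne x hx y hy)
  have h0 := planarDet_ne_zero_right (h.det_ne 0 h.zero_mem 0 h.zero_mem)
  rw [← Complex.neg_im]
  congr 1
  unfold mixedTerm
  field_simp

lemma continuousOn_argX (h : IsNet Ω ψ ε δ P Px Py) :
    ContinuousOn (fun z : ℝ × ℝ => (Px z.1 z.2 / Px 0 0).arg) (Icc 0 δ ×ˢ Icc 0 δ) := fun z hz =>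
  ContinuousAt.comp_continuousWithinAt (f := fun z : ℝ × ℝ => Px z.1 z.2 / Px 0 0)
    (Complex.continuousAt_arg (Or.inl (h.re_x _ hz.1 _ hz.2)))
    ((h.part.cu.div_const (Px 0 0)) z hz)

lemma continuousOn_argY (h : IsNet Ω ψ ε δ P Px Py) :
    ContinuousOn (fun z : ℝ × ℝ => (Py z.1 z.2 / Py 0 0).arg) (Icc 0 δ ×ˢ Icc 0 δ) := fun z hz =>
  ContinuousAt.comp_continuousWithinAt (f := fun z : ℝ × ℝ => Py z.1 z.2 / Py 0 0)
    (Complex.continuousAt_arg (Or.inl (h.re_y _ hz.1 _ hz.2)))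
    ((h.part.cv.div_const (Py 0 0)) z hz)

/-- This splits the angle into a part that is differentiable in x and a part that is differentiable
in y, which is the form required by `weak_hazzidakis`. -/
lemma netAngle_eq (h : IsNet Ω ψ ε δ P Px Py) {x y : ℝ} (hx : x ∈ Icc 0 δ)
    (hy : y ∈ Icc 0 δ) :
    netAngle Px Py x y = (Py x y / Py 0 0).arg - (Px x y / Px 0 0).arg + netAngle Px Py 0 0 := by
  obtain ⟨τ, hτ, hd⟩ := h.exists_sign
  have m1 := angle_mem hτ (hd x hx y hy)
  have m2 := angle_mem hτ (hd 0 h.zero_mem 0 h.zero_mem)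
  have := h.det_ne 0 h.zero_mem 0 h.zero_mem
  rw [arg_sub_of_abs_lt (h.re_x x hx y hy) (h.re_y x hx y hy) (planarDet_ne_zero_left this)
    (planarDet_ne_zero_right this)]
  · unfold netAngle; ring
  · have : |τ| = 1 := by rcases hτ with rfl | rfl <;> simp
    rw [← one_mul |_ - _|, ← this, ← abs_mul, mul_sub, abs_lt]
    unfold netAngle at m1 m2
    constructor <;> linarith [m1.1, m1.2, m2.1, m2.2]

end IsNet

/-! ### Stokes' theorem and Hazzidakis' formula on a cell -/

/-- `2i` times the `∂̄`-derivative: `d(g dz) = curl g dx ∧ dy`. -/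
def curl (g : ℂ → ℂ) (z : ℂ) : ℂ := Complex.I * fderiv ℝ g z 1 - fderiv ℝ g z Complex.I

/-- The left-hand side is d(g dz) evaluated on X and Y, an alternating form in the plane and hence a
multiple of the determinant. -/
lemma curl_mul_planarDet (g : ℂ → ℂ) (z X Y : ℂ) :
    fderiv ℝ g z X * Y - fderiv ℝ g z Y * X = planarDet X Y • curl g z := by
  have e : ∀ X : ℂ, fderiv ℝ g z X = X.re * fderiv ℝ g z 1 + X.im * fderiv ℝ g z Complex.I := by
    intro X
    have : X = X.re • (1 : ℂ) + X.im • Complex.I := by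
      apply Complex.ext <;> simp
    conv_lhs => rw [this]
    rw [map_add, map_smul, map_smul]
    simp
  rw [e X, e Y, curl, Complex.real_smul]
  have hX : X = X.re + X.im * Complex.I := (Complex.re_add_im X).symm
  have hY : Y = Y.re + Y.im * Complex.I := (Complex.re_add_im Y).symm
  generalize fderiv ℝ g z 1 = p
  generalize fderiv ℝ g z Complex.I = q
  simp only [planarDet]
  push_cast
  linear_combination (X.re * p + X.im * q) * hY - (Y.re * p + Y.im * q) * hX

/-- The closed square of side `δ`. -/
abbrev sq (δ : ℝ) : Set (ℝ × ℝ) := Icc 0 δ ×ˢ Icc 0 δ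

/-- The image of a closed square under a net. -/
def netImage (δ : ℝ) (P : ℝ → ℝ → ℂ) : Set ℂ := (fun z : ℝ × ℝ => P z.1 z.2) '' sq δ

namespace IsNet

variable {Ω : Set ℂ} {ψ : ℂ → E3} {ε δ : ℝ} {P Px Py : ℝ → ℝ → ℂ}

lemma isCompact_netImage (h : IsNet Ω ψ ε δ P Px Py) : IsCompact (netImage δ P) :=
  (isCompact_Icc.prod isCompact_Icc).image_of_continuousOn h.cont

lemma integral_netImage {E : Type*} [NormedAddCommGroup E] [NormedSpace ℝ E]
    (h : IsNet Ω ψ ε δ P Px Py) (g : ℂ → E) :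
    ∫ z in netImage δ P, g z
      = ∫ z in sq δ, |planarDet (Px z.1 z.2) (Py z.1 z.2)| • g (P z.1 z.2) := by
  have hms : MeasurableSet (sq δ) := measurableSet_Icc.prod measurableSet_Icc
  have himg : (fun w : ℂ => P w.re w.im) '' (Complex.equivRealProdCLM ⁻¹' sq δ) = netImage δ P := by
    rw [show (fun w : ℂ => P w.re w.im) = (fun z : ℝ × ℝ => P z.1 z.2) ∘ Complex.equivRealProdCLM
      from rfl, image_comp, image_preimage_eq _ Complex.equivRealProdCLM.surjective]
    rfl
  have hmeas : MeasurableSet (Complex.equivRealProdCLM ⁻¹' sq δ) :=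
    Complex.equivRealProdCLM.continuous.measurable hms
  have hd : ∀ w ∈ Complex.equivRealProdCLM ⁻¹' sq δ, HasFDerivWithinAt (fun w : ℂ => P w.re w.im)
      (pairMap (Px w.re w.im) (Py w.re w.im) ∘L (Complex.equivRealProdCLM : ℂ →L[ℝ] ℝ × ℝ))
      (Complex.equivRealProdCLM ⁻¹' sq δ) w := fun w hw => by
    have h1 := h.part.hasFDerivWithinAt (convex_Icc _ _) (convex_Icc _ _)
        (z := Complex.equivRealProdCLM w) hw
    exact h1.comp w Complex.equivRealProdCLM.hasFDerivAt.hasFDerivWithinAt (fun x hx => hx)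
  have hinj : InjOn (fun w : ℂ => P w.re w.im) (Complex.equivRealProdCLM ⁻¹' sq δ) :=
    fun w hw w' hw' he => Complex.equivRealProdCLM.injective (h.inj hw hw' he)
  rw [← himg, integral_image_eq_integral_abs_det_fderiv_smul volume hmeas hd hinj]
  simp_rw [det_pairMap]
  exact Complex.volume_preserving_equiv_real_prod.setIntegral_preimage_emb
    Complex.measurableEquivRealProd.measurableEmbedding
    (fun z : ℝ × ℝ => |planarDet (Px z.1 z.2) (Py z.1 z.2)| • g (P z.1 z.2)) (sq δ)

lemma comp_partials {E : Type*} [NormedAddCommGroup E] [NormedSpace ℝ E]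
    (h : IsNet Ω ψ ε δ P Px Py) {g : ℂ → E} (hg : ContDiff ℝ 1 g) :
    HasPartials (Icc 0 δ) (Icc 0 δ) (fun x y => g (P x y))
      (fun x y => fderiv ℝ g (P x y) (Px x y)) (fun x y => fderiv ℝ g (P x y) (Py x y)) := by
  have hd := hg.differentiable one_ne_zero
  have hc : ContinuousOn (fun z : ℝ × ℝ => fderiv ℝ g (P z.1 z.2)) (sq δ) :=
    (hg.continuous_fderiv one_ne_zero).comp_continuousOn h.cont
  exact ⟨fun x hx y hy => (hd _).hasFDerivAt.comp_hasDerivWithinAt x (h.part.hu x hx y hy),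
    fun x hx y hy => (hd _).hasFDerivAt.comp_hasDerivWithinAt y (h.part.hv x hx y hy),
    hc.clm_apply h.part.cu, hc.clm_apply h.part.cv⟩

lemma tau_abs {τ d : ℝ} (hτ : τ = 1 ∨ τ = -1) (h : 0 < τ * d) : |d| = τ * d := by
  rcases hτ with rfl | rfl
  · rw [abs_of_pos (by linarith)]; ring
  · rw [abs_of_neg (by linarith)]; ring

lemma norm_lt (hψ : IsBranchedPSImmersion Ω ψ) (h : IsNet Ω ψ ε δ P Px Py) {x y : ℝ}
    (hx : x ∈ Icc 0 δ) (hy : y ∈ Icc 0 δ) : ‖P x y‖ < 1 := hψ.norm_lt (h.maps x hx y hy)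

lemma continuousOn_chris (hψ : IsBranchedPSImmersion Ω ψ) (h : IsNet Ω ψ ε δ P Px Py) :
    ContinuousOn (fun z : ℝ × ℝ => chris (P z.1 z.2)) (sq δ) := fun z hz =>
  ContinuousAt.comp_continuousWithinAt (f := fun z : ℝ × ℝ => P z.1 z.2)
    (contDiffAt_chris (h.norm_lt hψ hz.1 hz.2)).continuousAt (h.cont z hz)

lemma continuousOn_mixedTerm (hψ : IsBranchedPSImmersion Ω ψ) (h : IsNet Ω ψ ε δ P Px Py) :
    ContinuousOn (fun z : ℝ × ℝ => mixedTerm (P z.1 z.2) (Px z.1 z.2) (Py z.1 z.2)) (sq δ) :=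
  (((h.continuousOn_chris hψ).mul h.part.cu).mul h.part.cv).neg

lemma continuousOn_covHess (hψ : IsBranchedPSImmersion Ω ψ) (h : IsNet Ω ψ ε δ P Px Py)
    {χ : ℂ → ℝ} (hχ : ContDiff ℝ 2 χ) :
    ContinuousOn (fun z : ℝ × ℝ => covHess χ (P z.1 z.2) (Px z.1 z.2) (Py z.1 z.2)) (sq δ) := by
  have h1 : ContDiff ℝ 1 (fderiv ℝ χ) := hχ.fderiv_right (by norm_num)
  exact ((((h1.continuous_fderiv one_ne_zero).comp_continuousOn h.cont).clm_apply h.part.cu).clm_apply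
    h.part.cv).add (((hχ.continuous_fderiv two_ne_zero).comp_continuousOn h.cont).clm_apply
      (h.continuousOn_mixedTerm hψ))

lemma fderiv_eq_zero_of_notMem {E : Type*} [NormedAddCommGroup E] [NormedSpace ℝ E] {g : ℂ → E}
    {z : ℂ} (h : z ∉ tsupport g) : fderiv ℝ g z = 0 := by
  by_contra hne
  exact h (support_fderiv_subset ℝ hne)

/-- Stokes' theorem for `g dz` on a cell. -/
lemma integral_curl (hψ : IsBranchedPSImmersion Ω ψ) (h : IsNet Ω ψ ε δ P Px Py) {τ : ℝ} (hτ : τ = 1 ∨ τ = -1)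
    (hd : ∀ x ∈ Icc 0 δ, ∀ y ∈ Icc 0 δ, 0 < τ * planarDet (Px x y) (Py x y))
    {g : ℂ → ℂ} (hg : ContDiff ℝ 1 g)
    (hedge : ∀ x ∈ Icc 0 δ, ∀ y ∈ Icc 0 δ, x = δ ∨ y = δ → P x y ∉ tsupport g) :
    ∫ z in netImage δ P, curl g z
      = τ * ((∫ x in 0..δ, g (P x 0) * Px x 0) - ∫ y in 0..δ, g (P 0 y) * Py 0 y) := by
  have hgp := h.comp_partials hg
  have hδ : δ ∈ Icc 0 δ := ⟨h.pos.le, le_rfl⟩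
  have hgc : ContinuousOn (fun z : ℝ × ℝ => g (P z.1 z.2)) (sq δ) := hg.continuous.comp_continuousOn h.cont
  have hmc : ContinuousOn (fun z : ℝ × ℝ => mixedTerm (P z.1 z.2) (Px z.1 z.2) (Py z.1 z.2)) (sq δ) :=
    h.continuousOn_mixedTerm hψ
  have G := green_square h.pos.le (a := fun x y => g (P x y) * Px x y) (b := fun x y => g (P x y) * Py x y)
    (ay := fun x y => fderiv ℝ g (P x y) (Py x y) * Px x y
      + g (P x y) * mixedTerm (P x y) (Px x y) (Py x y))
    (bx := fun x y => fderiv ℝ g (P x y) (Px x y) * Py x y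
      + g (P x y) * mixedTerm (P x y) (Px x y) (Py x y))
    (fun x hx y hy => (hgp.hv x hx y hy).mul (h.mixed_y x hx y hy))
    (fun x hx y hy => (hgp.hu x hx y hy).mul (h.mixed_x x hx y hy))
    ((hgp.cv.mul h.part.cu).add (hgc.mul hmc)) ((hgp.cu.mul h.part.cv).add (hgc.mul hmc))
    (fun x hx => by rw [image_eq_zero_of_notMem_tsupport (hedge x hx δ hδ (Or.inr rfl)), zero_mul])
    (fun y hy => by rw [image_eq_zero_of_notMem_tsupport (hedge δ hδ y hy (Or.inl rfl)), zero_mul])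
  rw [← G, h.integral_netImage, ← smul_eq_mul (τ : ℂ), Complex.coe_smul, ← integral_smul]
  refine setIntegral_congr_fun (measurableSet_Icc.prod measurableSet_Icc) fun z hz => ?_
  -- The mixed derivative of the net occurs in both partial derivatives and cancels.
  rw [add_sub_add_right_eq_sub, curl_mul_planarDet, tau_abs hτ (hd _ hz.1 _ hz.2), smul_smul]

/-- The weak form of Hazzidakis' formula on a cell, with the angle `τ f - e`. -/
lemma integral_mul_lam (hψ : IsBranchedPSImmersion Ω ψ) (h : IsNet Ω ψ ε δ P Px Py) {τ : ℝ}
    (hτ : τ = 1 ∨ τ = -1)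
    (hd : ∀ x ∈ Icc 0 δ, ∀ y ∈ Icc 0 δ, 0 < τ * planarDet (Px x y) (Py x y)) (e : ℝ)
    {χ : ℂ → ℝ} (hχ : ContDiff ℝ 2 χ)
    (hedge : ∀ x ∈ Icc 0 δ, ∀ y ∈ Icc 0 δ, x = δ ∨ y = δ → P x y ∉ tsupport χ) :
    ∫ z in netImage δ P, χ z * lam z
      = χ (P 0 0) * (τ * netAngle Px Py 0 0 - e)
        + (∫ x in 0..δ, fderiv ℝ χ (P x 0) (Px x 0) * (τ * netAngle Px Py x 0 - e))
        + (∫ y in 0..δ, fderiv ℝ χ (P 0 y) (Py 0 y) * (τ * netAngle Px Py 0 y - e))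
        + ∫ z in sq δ, covHess χ (P z.1 z.2) (Px z.1 z.2) (Py z.1 z.2)
            * (τ * netAngle Px Py z.1 z.2 - e) := by
  have hδ : δ ∈ Icc 0 δ := ⟨h.pos.le, le_rfl⟩
  have hχ1 : ContDiff ℝ 1 χ := hχ.of_le (by norm_num)
  have hD : ContDiff ℝ 1 (fderiv ℝ χ) := hχ.fderiv_right (by norm_num)
  have p1 := h.comp_partials hχ1
  have p2 := h.comp_partials hD
  have hmc := h.continuousOn_mixedTerm hψ
  have hcc := h.continuousOn_chris hψ
  have i := Complex.continuous_im
  have hchd : ∀ x ∈ Icc 0 δ, ∀ y ∈ Icc 0 δ, HasFDerivAt chris (fderiv ℝ chris (P x y)) (P x y) :=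
    fun x hx y hy => ((contDiffAt_chris (h.norm_lt hψ hx hy)).differentiableAt (by simp)).hasFDerivAt
  have hDc : ContinuousOn (fun z : ℝ × ℝ => fderiv ℝ chris (P z.1 z.2)) (sq δ) :=
    continuousOn_fderiv_chris.comp h.cont fun z hz => by
      simpa using h.norm_lt hψ hz.1 hz.2
  set bx : ℝ → ℝ → ℝ := fun x y => τ * (fderiv ℝ chris (P x y) (Px x y) * Py x y
    + chris (P x y) * mixedTerm (P x y) (Px x y) (Py x y)).im with hbx
  set ay : ℝ → ℝ → ℝ := fun x y => τ * (fderiv ℝ chris (P x y) (Py x y) * Px x y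
    + chris (P x y) * mixedTerm (P x y) (Px x y) (Py x y)).im with hay
  -- Here a dx + b dy is τ times the connection form, while α and β are τ times the arguments of P_x
  -- and P_y, with the constants placed so that β - α is the angle minus e. As the covariant mixed
  -- derivative of the net vanishes, χ_xy is the covariant Hessian on (P_x, P_y).
  have key := weak_hazzidakis h.pos (χ := fun x y => χ (P x y))
    (χx := fun x y => fderiv ℝ χ (P x y) (Px x y)) (χy := fun x y => fderiv ℝ χ (P x y) (Py x y))
    (χxy := fun x y => covHess χ (P x y) (Px x y) (Py x y))
    (a := fun x y => τ * (chris (P x y) * Px x y).im) (b := fun x y => τ * (chris (P x y) * Py x y).im)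
    (ay := ay) (bx := bx)
    (α := fun x y => τ * (Px x y / Px 0 0).arg)
    (β := fun x y => τ * ((Py x y / Py 0 0).arg + netAngle Px Py 0 0) - e)
    p1 (fun x hx y hy => by
      have := (p2.hv x hx y hy).clm_apply (h.mixed_y x hx y hy)
      refine this.congr_deriv ?_
      rw [covHess_symm hχ, covHess, mixedTerm_comm])
    (fun x hx y hy => (p2.hu x hx y hy).clm_apply (h.mixed_x x hx y hy))
    (h.continuousOn_covHess hψ hχ)
    (fun y hy => image_eq_zero_of_notMem_tsupport (hedge δ hδ y hy (Or.inl rfl)))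
    (fun x hx => image_eq_zero_of_notMem_tsupport (hedge x hx δ hδ (Or.inr rfl)))
    (fun y hy => by rw [fderiv_eq_zero_of_notMem (hedge δ hδ y hy (Or.inl rfl))]; simp)
    (fun x hx => by rw [fderiv_eq_zero_of_notMem (hedge x hx δ hδ (Or.inr rfl))]; simp)
    (fun x hx y hy => (Complex.imCLM.hasFDerivAt.comp_hasDerivWithinAt y
      (((hchd x hx y hy).comp_hasDerivWithinAt y (h.part.hv x hx y hy)).mul
        (h.mixed_y x hx y hy))).const_mul τ)
    (fun x hx y hy => (Complex.imCLM.hasFDerivAt.comp_hasDerivWithinAt x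
      (((hchd x hx y hy).comp_hasDerivWithinAt x (h.part.hu x hx y hy)).mul
        (h.mixed_x x hx y hy))).const_mul τ)
    (continuousOn_const.mul (i.comp_continuousOn (((hDc.clm_apply h.part.cv).mul h.part.cu).add
      (hcc.mul hmc))))
    (continuousOn_const.mul (i.comp_continuousOn (((hDc.clm_apply h.part.cu).mul h.part.cv).add
      (hcc.mul hmc))))
    (continuousOn_const.mul (i.comp_continuousOn (hcc.mul h.part.cu)))
    (continuousOn_const.mul (i.comp_continuousOn (hcc.mul h.part.cv)))
    (continuousOn_const.mul h.continuousOn_argX)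
    ((continuousOn_const.mul (h.continuousOn_argY.add continuousOn_const)).sub continuousOn_const)
    (fun x hx y hy => ((h.hasDerivWithinAt_argX hx hy).const_mul τ).congr_deriv (by ring))
    (fun x hx y hy => ((((h.hasDerivWithinAt_argY hx hy).add_const _).const_mul τ).sub_const
      e).congr_deriv (by ring))
  have hs : ∀ x ∈ Icc 0 δ, ∀ y ∈ Icc 0 δ, τ * ((Py x y / Py 0 0).arg + netAngle Px Py 0 0) - e
      - τ * (Px x y / Px 0 0).arg = τ * netAngle Px Py x y - e := fun x hx y hy => by
    rw [h.netAngle_eq hx hy]; ring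
  have hms : MeasurableSet (sq δ) := measurableSet_Icc.prod measurableSet_Icc
  have z0 := h.zero_mem
  -- In b_x - a_y the mixed derivatives cancel again, and `im_fderiv_chris` identifies the rest with
  -- the area density.
  have L : ∫ z in netImage δ P, χ z * lam z
      = ∫ z in sq δ, χ (P z.1 z.2) * (bx z.1 z.2 - ay z.1 z.2) := by
    rw [h.integral_netImage]
    refine setIntegral_congr_fun hms fun z hz => ?_
    have e1 := im_fderiv_chris (h.norm_lt hψ hz.1 hz.2) (Px z.1 z.2) (Py z.1 z.2)
    rw [Complex.sub_im] at e1
    simp only [hbx, hay, Complex.add_im, smul_eq_mul]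
    rw [tau_abs hτ (hd _ hz.1 _ hz.2)]
    linear_combination -(τ * χ (P z.1 z.2)) * e1
  rw [L, key]
  have hu : uIcc 0 δ = Icc 0 δ := uIcc_of_le h.pos.le
  congr 1
  · congr 1
    · congr 1
      · rw [hs 0 z0 0 z0]
      · refine intervalIntegral.integral_congr fun x hx => ?_
        rw [hu] at hx
        simp only [hs x hx 0 z0]
    · refine intervalIntegral.integral_congr fun y hy => ?_
      rw [hu] at hy
      simp only [hs 0 z0 y hy]
  · refine setIntegral_congr_fun hms fun z hz => ?_
    simp only [hs _ hz.1 _ hz.2]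

end IsNet

/-! ### A cell near its corner, and two cells along a common edge -/

lemma pairMap_injective {A B : ℂ} (h : planarDet A B ≠ 0) : Function.Injective (pairMap A B) := by
  refine (injective_iff_map_eq_zero _).2 fun z hz => ?_
  obtain ⟨x, y⟩ := z
  simp only [pairMap_apply, Complex.real_smul] at hz
  have hr := congrArg Complex.re hz
  have hi := congrArg Complex.im hz
  simp at hr hi
  have e1 : x * planarDet A B = 0 := by
    unfold planarDet; linear_combination B.im * hr - B.re * hi
  have e2 : y * planarDet A B = 0 := by
    unfold planarDet; linear_combination A.re * hi - A.im * hr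
  have := (mul_eq_zero.1 e1).resolve_right h
  have := (mul_eq_zero.1 e2).resolve_right h
  simp [*]

/-- The linear equivalence of the plane with itself given by a basis. -/
def pairEquiv {A B : ℂ} (h : planarDet A B ≠ 0) : (ℝ × ℝ) ≃L[ℝ] ℂ :=
  (LinearMap.linearEquivOfInjective (pairMap A B : ℝ × ℝ →ₗ[ℝ] ℂ) (pairMap_injective h)
    (by simp)).toContinuousLinearEquiv

lemma coe_pairEquiv {A B : ℂ} (h : planarDet A B ≠ 0) :
    (pairEquiv h : ℝ × ℝ →L[ℝ] ℂ) = pairMap A B := rfl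

lemma norm_pairMap_sub_le (a b a' b' : ℂ) :
    ‖pairMap a b - pairMap a' b'‖ ≤ ‖a - a'‖ + ‖b - b'‖ := by
  refine ContinuousLinearMap.opNorm_le_bound _ (by positivity) fun z => ?_
  have e : (pairMap a b - pairMap a' b') z = z.1 • (a - a') + z.2 • (b - b') := by
    simp; ring
  rw [e]
  calc _ ≤ ‖z.1 • (a - a')‖ + ‖z.2 • (b - b')‖ := norm_add_le _ _
    _ ≤ ‖z‖ * ‖a - a'‖ + ‖z‖ * ‖b - b'‖ := by
      rw [norm_smul, norm_smul]
      gcongr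
      · exact norm_fst_le z
      · exact norm_snd_le z
    _ = _ := by ring

namespace IsNet

variable {Ω : Set ℂ} {ψ : ℂ → E3} {ε δ : ℝ} {P Px Py : ℝ → ℝ → ℂ}

/-- A cell covers the directions that point into it. -/
lemma exists_mem_image (h : IsNet Ω ψ ε δ P Px Py) {x₀ y₀ : ℝ} (hx : 0 < x₀) (hy : 0 < y₀) :
    ∃ t₀ > 0, ∀ t ∈ Ioo (0 : ℝ) t₀, ∃ x ∈ Ioc 0 δ, ∃ y ∈ Ioc 0 δ,
      P x y = P 0 0 + t * (x₀ * Px 0 0 + y₀ * Py 0 0) := by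
  have z0 := h.zero_mem
  have hdet := h.det_ne 0 z0 0 z0
  set L := pairEquiv hdet with hL
  set S := L.toNonlinearRightInverse with hS
  set M := max x₀ y₀ with hM
  set ρ := min x₀ y₀ / 2 with hρ
  have hMp : 0 < M := lt_max_of_lt_left hx
  have hρp : 0 < ρ := half_pos (lt_min hx hy)
  have hNp : 0 < S.nnnorm := by
    have := ContinuousLinearEquiv.nnnorm_symm_pos L
    exact this
  -- Near the corner P differs from its linear part by a map with Lipschitz constant c. This
  -- displaces the image of t(x₀, y₀) by at most c t M. The ball of radius tρ about t(x₀, y₀), which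
  -- stays in the open quadrant, covers a ball of radius (‖S‖⁻¹ - c) t ρ. The choice of c makes the
  -- two radii equal.
  set c : ℝ := (S.nnnorm : ℝ)⁻¹ * ρ / (ρ + M) with hc
  have hNp' : 0 < (S.nnnorm : ℝ) := hNp
  have hcp : 0 < c := by positivity
  obtain ⟨d1, hd1, h1⟩ := Metric.continuousWithinAt_iff.1 (h.part.cu (0, 0) ⟨z0, z0⟩) (c / 2) (by positivity)
  obtain ⟨d2, hd2, h2⟩ := Metric.continuousWithinAt_iff.1 (h.part.cv (0, 0) ⟨z0, z0⟩) (c / 2) (by positivity)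
  obtain ⟨η, hη, hη1, hη2, hηδ⟩ : ∃ η > 0, η < d1 ∧ η < d2 ∧ η < δ := by
    refine ⟨min (min d1 d2) δ / 2, ?_, ?_, ?_, ?_⟩
    · have := h.pos; positivity
    all_goals
      have a1 := min_le_left (min d1 d2) δ
      have a2 := min_le_right (min d1 d2) δ
      have a3 := min_le_left d1 d2
      have a4 := min_le_right d1 d2
      have : 0 < min (min d1 d2) δ := by have := h.pos; positivity
      linarith
  have hsub : Icc 0 η ⊆ Icc 0 δ := Icc_subset_Icc_right hηδ.le
  have hap : ApproximatesLinearOn (fun z : ℝ × ℝ => P z.1 z.2) (L : ℝ × ℝ →L[ℝ] ℂ)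
      (sq η) ⟨c, hcp.le⟩ := by
    intro z hz w hw
    have hconv : Convex ℝ (sq η) := (convex_Icc _ _).prod (convex_Icc _ _)
    have := hconv.norm_image_sub_le_of_norm_hasFDerivWithin_le
      (f := fun z : ℝ × ℝ => P z.1 z.2 - (L : ℝ × ℝ →L[ℝ] ℂ) z)
      (f' := fun z => pairMap (Px z.1 z.2) (Py z.1 z.2) - (L : ℝ × ℝ →L[ℝ] ℂ)) (C := c) (x := w) (y := z)
      (fun q hq => (((h.part.mono hsub hsub).hasFDerivWithinAt (convex_Icc _ _) (convex_Icc _ _)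
        hq).sub (L : ℝ × ℝ →L[ℝ] ℂ).hasFDerivWithinAt)) (fun q hq => by
          rw [hL, coe_pairEquiv]
          refine (norm_pairMap_sub_le _ _ _ _).trans ?_
          have hq' : q ∈ sq δ := ⟨hsub hq.1, hsub hq.2⟩
          have hdist : dist q (0, 0) ≤ η := by
            rw [Prod.dist_eq, max_le_iff]
            simp only [Real.dist_eq, sub_zero]
            rw [abs_of_nonneg hq.1.1, abs_of_nonneg hq.2.1]
            exact ⟨hq.1.2, hq.2.2⟩
          have b1 := h1 hq' (by linarith)
          have b2 := h2 hq' (by linarith)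
          rw [dist_eq_norm] at b1 b2
          linarith) hw hz
    rw [map_sub]
    refine le_trans (le_of_eq ?_) this
    congr 1
    abel
  refine ⟨η / (M + ρ), by positivity, fun t ht => ?_⟩
  have htη : t * (M + ρ) < η := by
    have := ht.2; rwa [lt_div_iff₀ (by positivity)] at this
  have hball : Metric.closedBall ((t * x₀, t * y₀) : ℝ × ℝ) (t * ρ) ⊆ Ioc 0 η ×ˢ Ioc 0 η := by
    intro q hq
    rw [Metric.mem_closedBall, Prod.dist_eq, max_le_iff, Real.dist_eq, Real.dist_eq, abs_le,
      abs_le] at hq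
    have t0 := ht.1
    have a1 : x₀ ≤ M := le_max_left _ _
    have a2 : y₀ ≤ M := le_max_right _ _
    have a3 : ρ < x₀ := by have := min_le_left x₀ y₀; rw [hρ]; linarith
    have a4 : ρ < y₀ := by have := min_le_right x₀ y₀; rw [hρ]; linarith
    have c1 := mul_le_mul_of_nonneg_left a1 t0.le
    have c2 := mul_le_mul_of_nonneg_left a2 t0.le
    have c3 := mul_lt_mul_of_pos_left a3 t0
    have c4 := mul_lt_mul_of_pos_left a4 t0
    obtain ⟨⟨q1, q2⟩, q3, q4⟩ := hq
    simp only at q1 q2 q3 q4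
    exact ⟨⟨by linarith, by linarith⟩, ⟨by linarith, by linarith⟩⟩
  have hsurj := hap.surjOn_closedBall_of_nonlinearRightInverse S (ε := t * ρ) (b := (t * x₀, t * y₀))
    (mul_nonneg ht.1.le hρp.le)
    (hball.trans (prod_mono Ioc_subset_Icc_self Ioc_subset_Icc_self))
  have hmem : P 0 0 + t * (x₀ * Px 0 0 + y₀ * Py 0 0) ∈ Metric.closedBall
      ((fun z : ℝ × ℝ => P z.1 z.2) (t * x₀, t * y₀)) (((S.nnnorm : ℝ)⁻¹ - c) * (t * ρ)) := by
    have hb : ((t * x₀, t * y₀) : ℝ × ℝ) ∈ sq η :=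
      prod_mono Ioc_subset_Icc_self Ioc_subset_Icc_self (hball (Metric.mem_closedBall_self
        (mul_nonneg ht.1.le hρp.le)))
    have := hap (t * x₀, t * y₀) hb (0, 0) ⟨⟨le_rfl, hη.le⟩, ⟨le_rfl, hη.le⟩⟩
    rw [Metric.mem_closedBall, dist_comm, dist_eq_norm]
    have e1 : ((S.nnnorm : ℝ)⁻¹ - c) * (t * ρ) = c * (t * M) := by
      rw [hc]; field_simp; ring
    rw [e1]
    have e2 : ‖((t * x₀, t * y₀) : ℝ × ℝ) - (0, 0)‖ = t * M := by
      rw [Prod.mk_zero_zero, sub_zero, Prod.norm_mk, Real.norm_eq_abs, Real.norm_eq_abs,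
        abs_of_pos (mul_pos ht.1 hx), abs_of_pos (mul_pos ht.1 hy), hM,
        mul_max_of_nonneg _ _ ht.1.le]
    rw [e2] at this
    refine le_trans (le_of_eq ?_) this
    congr 1
    rw [hL, coe_pairEquiv]
    simp
    ring
  obtain ⟨q, hq, hqe⟩ := hsurj hmem
  have := hball hq
  exact ⟨q.1, ⟨this.1.1, this.1.2.trans hηδ.le⟩, q.2, ⟨this.2.1, this.2.2.trans hηδ.le⟩, hqe⟩

/-- The sum of the angles on the two sides of a common boundary curve is constant. -/
lemma netAngle_add_eq {P' Px' Py' : ℝ → ℝ → ℂ} {ε' : ℝ} (h : IsNet Ω ψ ε δ P Px Py)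
    (h' : IsNet Ω ψ ε' δ P' Px' Py') (hP : ∀ x ∈ Icc 0 δ, P' 0 x = P x 0)
    (hT : ∀ x ∈ Icc 0 δ, Py' 0 x = Px x 0) {x : ℝ} (hx : x ∈ Icc 0 δ) :
    netAngle Px Py x 0 + netAngle Px' Py' 0 x = netAngle Px Py 0 0 + netAngle Px' Py' 0 0 := by
  have z0 := h.zero_mem
  -- On either side of the common curve the transverse vector is parallel along the curve, so the
  -- two turn at the same rate.
  have key : ∀ x ∈ Icc 0 δ, HasDerivWithinAt
      (fun x => (Py x 0 / Py 0 0).arg - (Px' 0 x / Px' 0 0).arg) 0 (Icc 0 δ) x := fun x hx => by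
    refine ((h.hasDerivWithinAt_argY hx z0).sub (h'.hasDerivWithinAt_argX z0 hx)).congr_deriv ?_
    rw [hP x hx, hT x hx]; ring
  have e := eq_of_hasDerivWithinAt_zero (convex_Icc 0 δ) key hx z0
  rw [h.netAngle_eq hx z0, h'.netAngle_eq z0 hx, hT x hx, hT 0 z0]
  have n1 := h.det_ne 0 z0 0 z0
  have n2 := h'.det_ne 0 z0 0 z0
  have e1 : (Py 0 0 / Py 0 0).arg = 0 := by
    rw [div_self (planarDet_ne_zero_right n1)]; simp
  have e2 : (Px' 0 0 / Px' 0 0).arg = 0 := by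
    rw [div_self (planarDet_ne_zero_left n2)]; simp
  simp only [e1, e2] at e
  linarith

end IsNet

/-! ### Fans: cells around a point, their orientation and their angles -/

/-- The predecessor in the cyclic order of `{0, …, n - 1}`. -/
def cycPred (n k : ℕ) : ℕ := if k = 0 then n - 1 else k - 1

lemma cycPred_lt {n k : ℕ} (h : k < n) : cycPred n k < n := by
  unfold cycPred; split_ifs <;> omega

lemma sum_cycPred {M : Type*} [AddCommMonoid M] (n : ℕ) (f : ℕ → M) :
    ∑ k ∈ Finset.range n, f (cycPred n k) = ∑ k ∈ Finset.range n, f k := by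
  cases n with
  | zero => simp
  | succ N =>
    rw [Finset.sum_range_succ', Finset.sum_range_succ]
    congr 1

/-- The union of the half-open cells of a fan. -/
def fanSet (n : ℕ) (δ : ℝ) (P : ℕ → ℝ → ℝ → ℂ) : Set ℂ :=
  {z | ∃ k < n, ∃ x ∈ Ico 0 δ, ∃ y ∈ Ico 0 δ, P k x y = z}

/-- Cells of asymptotic nets that fit together around the point `p`. -/
structure IsFan (Ω : Set ℂ) (ψ : ℂ → E3) (p : ℂ) (n : ℕ) (δ : ℝ) (P Px Py : ℕ → ℝ → ℝ → ℂ)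
    (R : ℕ → ℝ → ℂ) : Prop where
  even : Even n
  net : ∀ k < n, IsNet Ω ψ ((-1) ^ k) δ (P k) (Px k) (Py k)
  left : ∀ k < n, ∀ x ∈ Icc 0 δ, P k x 0 = R k x
  right : ∀ k < n, ∀ y ∈ Icc 0 δ, P k 0 y = R (k + 1) y
  closed : R n = R 0
  center : ∀ k < n, P k 0 0 = p
  disj : ∀ k < n, ∀ l < n, ∀ x ∈ Icc 0 δ, ∀ y ∈ Icc 0 δ, ∀ x' ∈ Icc 0 δ, ∀ y' ∈ Icc 0 δ,
    0 < x → 0 < y → P k x y = P l x' y' → k = l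
  ray_disj : ∀ k < n, ∀ l < n, ∀ x ∈ Icc 0 δ, ∀ x' ∈ Icc 0 δ, 0 < x → R k x = R l x' → k = l
  mem_nhds : fanSet n δ P ∈ 𝓝 p

/-- A direction between two adjacent ones, in terms of these. -/
lemma exp_between {s a : ℝ} {τ : ℝ} (hτ : τ = 1 ∨ τ = -1) (ha : Real.sin a ≠ 0) :
    Complex.exp ((τ * s : ℝ) * Complex.I) = ((Real.sin (a - s) / Real.sin a : ℝ) : ℂ)
      + ((Real.sin s / Real.sin a : ℝ) : ℂ) * Complex.exp ((τ * a : ℝ) * Complex.I) := by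
  rw [Complex.exp_mul_I, Complex.exp_mul_I, ← Complex.ofReal_cos, ← Complex.ofReal_sin,
    ← Complex.ofReal_cos, ← Complex.ofReal_sin]
  have hc : ∀ t : ℝ, Real.cos (τ * t) = Real.cos t := by rcases hτ with rfl | rfl <;> simp
  have hs : ∀ t : ℝ, Real.sin (τ * t) = τ * Real.sin t := by rcases hτ with rfl | rfl <;> simp
  rw [hc, hs, hc, hs, Real.sin_sub]
  generalize Real.sin a = p at *
  generalize Real.sin s = q
  generalize Real.cos a = p'
  generalize Real.cos s = q'
  have hp : (p : ℂ) ≠ 0 := by exact_mod_cast ha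
  push_cast
  field_simp
  ring

lemma exists_between_of_lt {β : ℕ → ℝ} {t : ℝ} : ∀ {n : ℕ}, β 0 < t → t < β n →
    (∀ k ≤ n, β k ≠ t) → ∃ k < n, β k < t ∧ t < β (k + 1)
  | 0, h0, h1, _ => absurd (h0.trans h1) (lt_irrefl _)
  | n + 1, h0, h1, h2 => by
    rcases lt_trichotomy (β n) t with h | h | h
    · exact ⟨n, by omega, h, h1⟩
    · exact absurd h (h2 n (by omega))
    · obtain ⟨k, hk, h3⟩ := exists_between_of_lt h0 h fun k hk => h2 k (by omega)
      exact ⟨k, by omega, h3⟩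

namespace IsFan

variable {Ω : Set ℂ} {ψ : ℂ → E3} {p : ℂ} {n : ℕ} {δ : ℝ} {P Px Py : ℕ → ℝ → ℝ → ℂ}
  {R : ℕ → ℝ → ℂ}

lemma n_pos (h : IsFan Ω ψ p n δ P Px Py R) : 0 < n := by
  obtain ⟨k, hk, -⟩ := mem_of_mem_nhds h.mem_nhds
  omega

lemma pos (h : IsFan Ω ψ p n δ P Px Py R) : 0 < δ := (h.net 0 h.n_pos).pos

lemma zero_mem (h : IsFan Ω ψ p n δ P Px Py R) : (0 : ℝ) ∈ Icc 0 δ := ⟨le_rfl, h.pos.le⟩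

lemma ray_zero (h : IsFan Ω ψ p n δ P Px Py R) {k : ℕ} (hk : k < n) : R k 0 = p := by
  rw [← h.left k hk 0 h.zero_mem, h.center k hk]

lemma ray_succ (h : IsFan Ω ψ p n δ P Px Py R) {k : ℕ} (hk : k < n) :
    ∃ l < n, R (k + 1) = R l ∧ cycPred n l = k := by
  rcases Nat.lt_or_ge (k + 1) n with h1 | h1
  · exact ⟨k + 1, h1, rfl, by simp [cycPred]⟩
  · have : k + 1 = n := by omega
    exact ⟨0, h.n_pos, by rw [this, h.closed], by simp [cycPred]; omega⟩

lemma right_pred (h : IsFan Ω ψ p n δ P Px Py R) {k : ℕ} (hk : k < n) {y : ℝ} (hy : y ∈ Icc 0 δ) :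
    P (cycPred n k) 0 y = R k y := by
  rw [h.right _ (cycPred_lt hk) y hy]
  unfold cycPred
  split_ifs with h0
  · rw [Nat.sub_add_cancel h.n_pos, h.closed, h0]
  · rw [Nat.sub_add_cancel (Nat.pos_of_ne_zero h0)]

lemma right_pred_eq (h : IsFan Ω ψ p n δ P Px Py R) {k : ℕ} (hk : k < n) {y : ℝ}
    (hy : y ∈ Icc 0 δ) : P (cycPred n k) 0 y = P k y 0 := by
  rw [h.right_pred hk hy, h.left k hk y hy]

lemma hasDerivWithinAt_ray (h : IsFan Ω ψ p n δ P Px Py R) {k : ℕ} (hk : k < n) {x : ℝ}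
    (hx : x ∈ Icc 0 δ) : HasDerivWithinAt (R k) (Px k x 0) (Icc 0 δ) x :=
  ((h.net k hk).part.hu x hx 0 h.zero_mem).congr (fun s hs => (h.left k hk s hs).symm)
    (h.left k hk x hx).symm

lemma py_pred (h : IsFan Ω ψ p n δ P Px Py R) {k : ℕ} (hk : k < n) {x : ℝ} (hx : x ∈ Icc 0 δ) :
    Py (cycPred n k) 0 x = Px k x 0 := by
  have h1 := (h.net _ (cycPred_lt hk)).part.hv 0 h.zero_mem x hx
  have h2 := (h.hasDerivWithinAt_ray hk hx).congr (fun s hs => h.right_pred hk hs)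
    (h.right_pred hk hx)
  exact (uniqueDiffOn_Icc h.pos x hx).eq_deriv _ h1 h2

/-- The cells that contain a point of an open ray. -/
lemma eq_ray (h : IsFan Ω ψ p n δ P Px Py R) {k l : ℕ} (hk : k < n) (hl : l < n) {x x' y' : ℝ}
    (hx : x ∈ Icc 0 δ) (hx0 : 0 < x) (hx' : x' ∈ Icc 0 δ) (hy' : y' ∈ Icc 0 δ)
    (he : P l x' y' = R k x) :
    (l = k ∧ x' = x ∧ y' = 0) ∨ (l = cycPred n k ∧ x' = 0 ∧ y' = x) := by
  have z0 := h.zero_mem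
  have he' : P l x' y' = P k x 0 := by rw [he, h.left k hk x hx]
  have inj : ∀ {k : ℕ}, k < n → ∀ {x y x' y' : ℝ}, x ∈ Icc 0 δ → y ∈ Icc 0 δ → x' ∈ Icc 0 δ →
      y' ∈ Icc 0 δ → P k x y = P k x' y' → x = x' ∧ y = y' := by
    intro k hk x y x' y' hx hy hx' hy' he
    have := (h.net k hk).inj (x₁ := (x, y)) ⟨hx, hy⟩ (x₂ := (x', y')) ⟨hx', hy'⟩ he
    exact Prod.mk_inj.1 this
  rcases hx'.1.eq_or_lt with h1 | h1
  · right
    obtain ⟨l', hl', hR, hpr⟩ := h.ray_succ hl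
    rw [← h1] at he
    rw [h.right l hl y' hy', hR] at he
    have hkl := h.ray_disj k hk l' hl' x hx y' hy' hx0 he.symm
    subst hkl
    rw [← h.left k hk x hx, ← h.left k hk y' hy'] at he
    exact ⟨hpr.symm, h1.symm, (inj hk hy' z0 hx z0 he).1⟩
  · rcases hy'.1.eq_or_lt with h2 | h2
    · left
      rw [← h2, h.left l hl x' hx'] at he
      have hkl := h.ray_disj k hk l hl x hx x' hx' hx0 he.symm
      subst hkl
      rw [← h.left k hk x hx, ← h.left k hk x' hx'] at he
      exact ⟨rfl, (inj hk hx' z0 hx z0 he).1, h2.symm⟩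
    · exfalso
      have hkl := h.disj l hl k hk x' hx' y' hy' x hx 0 z0 h1 h2 he'
      subst hkl
      have := (inj hl hx' hy' hx z0 he').2
      linarith

/-- The outer edges of the cells lie outside the union of the half-open cells. -/
lemma edge_notMem (h : IsFan Ω ψ p n δ P Px Py R) {k : ℕ} (hk : k < n) {x y : ℝ}
    (hx : x ∈ Icc 0 δ) (hy : y ∈ Icc 0 δ) (hxy : x = δ ∨ y = δ) : P k x y ∉ fanSet n δ P := by
  rintro ⟨l, hl, x', hx', y', hy', he⟩
  have z0 := h.zero_mem
  have ray : ∀ k < n, R k δ ≠ P l x' y' := by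
    intro k hk he
    rcases h.eq_ray hk hl ⟨h.pos.le, le_rfl⟩ h.pos (Ico_subset_Icc_self hx')
      (Ico_subset_Icc_self hy') he.symm with h1 | h1
    · have := hx'.2; linarith [h1.2.1]
    · have := hy'.2; linarith [h1.2.2]
  rcases hx.1.eq_or_lt with h1 | h1
  · obtain ⟨l', hl', hR, -⟩ := h.ray_succ hk
    have hyδ : y = δ := hxy.resolve_left fun hc => by have := h.pos; linarith
    apply ray l' hl'
    rw [he, ← h1, h.right k hk y hy, hR, hyδ]
  · rcases hy.1.eq_or_lt with h2 | h2
    · have hxδ : x = δ := hxy.resolve_right fun hc => by have := h.pos; linarith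
      apply ray k hk
      rw [he, ← h2, h.left k hk x hx, hxδ]
    · have hkl := h.disj k hk l hl x hx y hy x' (Ico_subset_Icc_self hx') y'
        (Ico_subset_Icc_self hy') h1 h2 he.symm
      subst hkl
      have := (h.net k hk).inj (x₁ := (x, y)) ⟨hx, hy⟩ (x₂ := (x', y'))
        ⟨Ico_subset_Icc_self hx', Ico_subset_Icc_self hy'⟩ he.symm
      have := Prod.mk_inj.1 this
      rcases hxy with e | e
      · have := hx'.2; linarith
      · have := hy'.2; linarith

/-- The open cones spanned by the tangent vectors at the centre are disjoint. -/
lemma cones_disjoint (h : IsFan Ω ψ p n δ P Px Py R) {k l : ℕ} (hk : k < n) (hl : l < n)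
    {x y x' y' : ℝ} (hx : 0 < x) (hy : 0 < y) (hx' : 0 < x') (hy' : 0 < y')
    (he : (x * Px k 0 0 + y * Py k 0 0 : ℂ) = x' * Px l 0 0 + y' * Py l 0 0) : k = l := by
  -- By `IsNet.exists_mem_image`, a point near the centre in a direction common to both cones has
  -- positive coordinates in both cells.
  obtain ⟨t1, ht1, h1⟩ := (h.net k hk).exists_mem_image hx hy
  obtain ⟨t2, ht2, h2⟩ := (h.net l hl).exists_mem_image hx' hy'
  have hm : 0 < min t1 t2 := lt_min ht1 ht2
  have e1 := min_le_left t1 t2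
  have e2 := min_le_right t1 t2
  obtain ⟨a, ha, b, hb, hab⟩ := h1 (min t1 t2 / 2) ⟨by linarith, by linarith⟩
  obtain ⟨a', ha', b', hb', hab'⟩ := h2 (min t1 t2 / 2) ⟨by linarith, by linarith⟩
  refine h.disj k hk l hl a (Ioc_subset_Icc_self ha) b (Ioc_subset_Icc_self hb) a'
    (Ioc_subset_Icc_self ha') b' (Ioc_subset_Icc_self hb') ha.1 hb.1 ?_
  rw [hab, hab', he, h.center k hk, h.center l hl]

/-- All cells of a fan have the same orientation. -/
lemma exists_sign (h : IsFan Ω ψ p n δ P Px Py R) : ∃ τ : ℝ, (τ = 1 ∨ τ = -1) ∧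
    ∀ k < n, ∀ x ∈ Icc 0 δ, ∀ y ∈ Icc 0 δ, 0 < τ * planarDet (Px k x y) (Py k x y) := by
  obtain ⟨τ, hτ, h0⟩ := (h.net 0 h.n_pos).exists_sign
  refine ⟨τ, hτ, fun k => ?_⟩
  have z0 := h.zero_mem
  induction k with
  | zero => exact fun _ => h0
  | succ k ih =>
    intro hk
    have hk' : k < n := by omega
    obtain ⟨τ', hτ', h1⟩ := (h.net (k + 1) hk).exists_sign
    suffices hs : τ' = τ by rwa [hs] at h1
    by_contra hne
    have hτ'' : τ' = -τ := by
      rcases hτ with rfl | rfl <;> rcases hτ' with rfl | rfl <;> simp_all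
    have d0 := ih hk' 0 z0 0 z0
    have d1 := h1 0 z0 0 z0
    have hpy : Py k 0 0 = Px (k + 1) 0 0 := by
      have := h.py_pred hk z0
      simpa [cycPred] using this
    rw [hτ''] at d1
    rw [hpy] at d0
    set A := Px (k + 1) 0 0
    set Z := Px k 0 0
    set Y := Py (k + 1) 0 0
    have hZA : planarDet Z A ≠ 0 := by
      intro h0; rw [h0, mul_zero] at d0; exact lt_irrefl _ d0
    set b := planarDet A Y / planarDet A Z with hb
    have hbpos : 0 < b := by
      have e : b = (-τ * planarDet A Y) / (τ * planarDet Z A) := by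
        have hτ0 : τ ≠ 0 := by rcases hτ with rfl | rfl <;> norm_num
        rw [hb, planarDet_swap A Z]; field_simp
      rw [e]; exact div_pos d1 d0
    -- If the orientation changed across the common tangent vector A, then Y would lie on the same
    -- side of A as Z, so that b > 0. The vector (|a| + 1) A + Y would then belong to both open
    -- cones.
    obtain ⟨a, ha⟩ : ∃ a : ℝ, Y = a * A + b * Z := by
      have hA : A ≠ 0 := planarDet_ne_zero_right hZA
      have hd : planarDet A (Y - b * Z) = 0 := by
        have hZA' : planarDet A Z ≠ 0 := by rw [planarDet_swap]; simpa using hZA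
        have : planarDet A (Y - b * Z) = planarDet A Y - b * planarDet A Z := by
          unfold planarDet; simp; ring
        rw [this, hb]; field_simp; ring
      obtain ⟨a, ha⟩ := exists_real_mul_of_planarDet_eq_zero hA hd
      exact ⟨a, by rw [← ha]; ring⟩
    have := h.cones_disjoint hk hk' (x := |a| + 1) (y := 1) (x' := b) (y' := |a| + 1 + a)
      (by positivity) one_pos hbpos (by linarith [neg_abs_le a]) (by
        rw [hpy]
        change ((|a| + 1 : ℝ) : ℂ) * A + (1 : ℝ) * Y = b * Z + ((|a| + 1 + a : ℝ) : ℂ) * A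
        rw [ha]; push_cast; ring)
    omega

lemma angle_const (h : IsFan Ω ψ p n δ P Px Py R) {k : ℕ} (hk : k < n) {x : ℝ} (hx : x ∈ Icc 0 δ) :
    netAngle (Px k) (Py k) x 0 + netAngle (Px (cycPred n k)) (Py (cycPred n k)) 0 x
      = netAngle (Px k) (Py k) 0 0 + netAngle (Px (cycPred n k)) (Py (cycPred n k)) 0 0 :=
  (h.net k hk).netAngle_add_eq (h.net _ (cycPred_lt hk)) (fun _ hx => h.right_pred_eq hk hx)
    (fun _ hx => h.py_pred hk hx) hx

/-- The angles at the centre of a fan add up to `2π`. -/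
lemma angle_sum (h : IsFan Ω ψ p n δ P Px Py R) {τ : ℝ} (hτ : τ = 1 ∨ τ = -1)
    (hd : ∀ k < n, ∀ x ∈ Icc 0 δ, ∀ y ∈ Icc 0 δ, 0 < τ * planarDet (Px k x y) (Py k x y)) :
    ∑ k ∈ Finset.range n, τ * netAngle (Px k) (Py k) 0 0 = 2 * Real.pi := by
  have z0 := h.zero_mem
  have hτ2 : τ * τ = 1 := by rcases hτ with rfl | rfl <;> norm_num
  set f : ℕ → ℝ := fun k => τ * netAngle (Px k) (Py k) 0 0 with hf
  have hfm : ∀ k < n, f k ∈ Ioo 0 Real.pi := fun k hk => IsNet.angle_mem hτ (hd k hk 0 z0 0 z0)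
  set β : ℕ → ℝ := fun k => ∑ i ∈ Finset.range k, f i with hβ
  have hβs : ∀ k, β (k + 1) = β k + f k := fun k => Finset.sum_range_succ _ _
  -- A k is the tangent vector of ray k at the centre. The default value closes the cycle: index n
  -- stands for ray 0.
  set A : ℕ → ℂ := fun k => if k < n then Px k 0 0 else Px 0 0 0 with hA
  have hAP : ∀ k < n, Px k 0 0 = A k := fun k hk => by simp [hA, hk]
  have hAQ : ∀ k < n, Py k 0 0 = A (k + 1) := fun k hk => by
    rcases Nat.lt_or_ge (k + 1) n with h1 | h1
    · have := h.py_pred h1 z0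
      simp only [hA, h1, if_true]
      simpa [cycPred] using this
    · have hkn : k = n - 1 := by omega
      have := h.py_pred h.n_pos z0
      simp only [hA, Nat.not_lt.2 h1, if_false]
      simpa [cycPred, hkn] using this
  have hA0 : ∀ k < n, A k ≠ 0 := fun k hk => by
    rw [← hAP k hk]; exact planarDet_ne_zero_left ((h.net k hk).det_ne 0 z0 0 z0)
  have hstep : ∀ k < n, ∃ r : ℝ, 0 < r ∧ A (k + 1) = r * A k * Complex.exp ((τ * f k : ℝ) * Complex.I) := by
    intro k hk
    have hne : A (k + 1) ≠ 0 := by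
      rw [← hAQ k hk]; exact planarDet_ne_zero_right ((h.net k hk).det_ne 0 z0 0 z0)
    refine ⟨‖A (k + 1) / A k‖, norm_pos_iff.2 (div_ne_zero hne (hA0 k hk)), ?_⟩
    have e : τ * f k = (A (k + 1) / A k).arg := by
      rw [hf, ← hAP k hk, ← hAQ k hk]; simp only [netAngle]; rw [← mul_assoc, hτ2, one_mul]
    have e2 := Complex.norm_mul_exp_arg_mul_I (A (k + 1) / A k)
    rw [e]
    have := hA0 k hk
    calc A (k + 1) = (A (k + 1) / A k) * A k := by field_simp
      _ = (‖A (k + 1) / A k‖ * Complex.exp ((A (k + 1) / A k).arg * Complex.I)) * A k := by rw [e2]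
      _ = _ := by ring
  have hpos : ∀ k ≤ n, ∃ r : ℝ, 0 < r ∧ A k = r * A 0 * Complex.exp ((τ * β k : ℝ) * Complex.I) := by
    intro k
    induction k with
    | zero => exact fun _ => ⟨1, one_pos, by simp [hβ]⟩
    | succ k ih =>
      intro hk
      obtain ⟨r, hr, h1⟩ := ih (by omega)
      obtain ⟨r', hr', h2⟩ := hstep k (by omega)
      refine ⟨r' * r, mul_pos hr' hr, ?_⟩
      rw [h2, h1, hβs, mul_add]
      push_cast
      rw [add_mul, Complex.exp_add]
      ring
  have hn := h.n_pos
  -- After n steps the direction of A 0 is reached again, so the total angle is a multiple of 2π.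
  obtain ⟨N, hN⟩ : ∃ N : ℤ, β n = N * (2 * Real.pi) := by
    obtain ⟨r, hr, h1⟩ := hpos n le_rfl
    have hAn : A n = A 0 := by simp [hA]
    have h00 := hA0 0 hn
    rw [hAn] at h1
    have h2 : (1 : ℂ) = r * Complex.exp ((τ * β n : ℝ) * Complex.I) := by
      have : A 0 * 1 = A 0 * (r * Complex.exp ((τ * β n : ℝ) * Complex.I)) := by
        rw [mul_one]; nth_rewrite 1 [h1]; ring
      exact mul_left_cancel₀ h00 this
    have h3 : r = 1 := by
      have := congrArg norm h2
      rw [norm_mul, Complex.norm_exp_ofReal_mul_I, norm_one, mul_one, Complex.norm_real,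
        Real.norm_eq_abs, abs_of_pos hr] at this
      exact this.symm
    rw [h3, Complex.ofReal_one, one_mul] at h2
    obtain ⟨N, hN⟩ := Complex.exp_eq_one_iff.1 h2.symm
    have hN' : τ * β n = N * (2 * Real.pi) := by
      have : ((τ * β n : ℝ) : ℂ) * Complex.I = ((N * (2 * Real.pi) : ℝ) : ℂ) * Complex.I := by
        rw [hN]; push_cast; ring
      exact_mod_cast mul_right_cancel₀ Complex.I_ne_zero this
    rcases hτ with rfl | rfl
    · exact ⟨N, by linarith⟩
    · exact ⟨-N, by push_cast; linarith⟩
  have hβpos : 0 < β n := Finset.sum_pos (fun k hk => (hfm k (Finset.mem_range.1 hk)).1)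
    ⟨0, Finset.mem_range.2 hn⟩
  have hpi := Real.pi_pos
  have hN1 : 1 ≤ N := by
    by_contra hc
    have : N ≤ 0 := by omega
    have : (N : ℝ) ≤ 0 := by exact_mod_cast this
    nlinarith
  rcases hN1.eq_or_lt with h1 | h1
  · change β n = _
    rw [hN, ← h1]; simp
  exfalso
  have hN2 : (2 : ℝ) ≤ N := by exact_mod_cast h1
  have hβ4 : 4 * Real.pi ≤ β n := by rw [hN]; nlinarith
  -- If the total were at least 4π, a direction t off all rays would be met twice, at angle t and at
  -- t + 2π. Since the open cones are disjoint, both would lie in one cell, but a cell is narrower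
  -- than π.
  obtain ⟨t, ht, htn⟩ : ∃ t ∈ Ioo 0 (2 * Real.pi), t ∉ (Finset.image β (Finset.range (n + 1))
      ∪ Finset.image (fun k => β k - 2 * Real.pi) (Finset.range (n + 1)) : Finset ℝ) :=
    (Ioo_infinite (by linarith)).exists_notMem_finset _
  simp only [Finset.mem_union, Finset.mem_image, Finset.mem_range, not_or, not_exists, not_and] at htn
  have hβ0 : β 0 = 0 := by simp [hβ]
  obtain ⟨k, hk, hk1, hk2⟩ := exists_between_of_lt (β := β) (t := t) (n := n) (by rw [hβ0]; exact ht.1)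
    (by linarith [ht.2]) fun k hk => htn.1 k (by omega)
  obtain ⟨l, hl, hl1, hl2⟩ := exists_between_of_lt (β := β) (t := t + 2 * Real.pi) (n := n)
    (by rw [hβ0]; linarith [ht.1])
    (by linarith [ht.2]) fun k hk he => htn.2 k (by omega) (by linarith)
  have hcone : ∀ k < n, ∀ t, β k < t → t < β (k + 1) → ∃ x y : ℝ, 0 < x ∧ 0 < y ∧
      (x * Px k 0 0 + y * Py k 0 0 : ℂ) = A 0 * Complex.exp ((τ * t : ℝ) * Complex.I) := by
    intro k hk t h1 h2
    obtain ⟨r, hr, e1⟩ := hpos k hk.le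
    obtain ⟨r', hr', e2⟩ := hstep k hk
    have hm := hfm k hk
    rw [hβs] at h2
    have s1 : 0 < Real.sin (f k) := Real.sin_pos_of_mem_Ioo hm
    have s2 : 0 < Real.sin (t - β k) :=
      Real.sin_pos_of_mem_Ioo ⟨by linarith, by linarith [hm.2]⟩
    have s3 : 0 < Real.sin (f k - (t - β k)) :=
      Real.sin_pos_of_mem_Ioo ⟨by linarith, by linarith [hm.2]⟩
    refine ⟨r⁻¹ * (Real.sin (f k - (t - β k)) / Real.sin (f k)),
      r⁻¹ * (r'⁻¹ * (Real.sin (t - β k) / Real.sin (f k))), by positivity, by positivity, ?_⟩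
    have e3 : A 0 * Complex.exp ((τ * t : ℝ) * Complex.I)
        = (r : ℂ)⁻¹ * (A k * Complex.exp ((τ * (t - β k) : ℝ) * Complex.I)) := by
      rw [e1]
      have hr0 : (r : ℂ) ≠ 0 := by exact_mod_cast hr.ne'
      have : (τ * t : ℝ) = τ * β k + τ * (t - β k) := by ring
      rw [this, Complex.ofReal_add, add_mul, Complex.exp_add]
      field_simp
    rw [e3, exp_between hτ s1.ne', hAP k hk, hAQ k hk, e2]
    have hr0 : (r' : ℂ) ≠ 0 := by exact_mod_cast hr'.ne'
    push_cast
    field_simp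
  obtain ⟨x, y, hx, hy, e1⟩ := hcone k hk t hk1 hk2
  obtain ⟨x', y', hx', hy', e2⟩ := hcone l hl _ hl1 hl2
  have e3 : Complex.exp ((τ * (t + 2 * Real.pi) : ℝ) * Complex.I)
      = Complex.exp ((τ * t : ℝ) * Complex.I) := by
    rw [Complex.exp_eq_exp_iff_exists_int]
    rcases hτ with rfl | rfl
    · exact ⟨1, by push_cast; ring⟩
    · exact ⟨-1, by push_cast; ring⟩
  have hkl := h.cones_disjoint hk hl hx hy hx' hy' (by rw [e1, e2, e3])
  subst hkl
  rw [hβs] at hk2 hl2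
  linarith [(hfm k hk).2]

end IsFan

/-! ### Integration over cells and fans -/

/-- A differentiable curve in the plane is a null set. -/
lemma volume_image_curve {R R' : ℝ → ℂ} {I : Set ℝ}
    (hR : ∀ x ∈ I, HasDerivWithinAt R (R' x) I x) : volume (R '' I) = 0 := by
  have himg : R '' I = (fun w : ℂ => R w.re) '' {w : ℂ | w.re ∈ I ∧ w.im = 0} := by
    ext z
    constructor
    · rintro ⟨x, hx, rfl⟩
      exact ⟨(x : ℂ), ⟨by simpa using hx, by simp⟩, by simp⟩
    · rintro ⟨w, ⟨hw, -⟩, rfl⟩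
      exact ⟨w.re, hw, rfl⟩
  rw [himg]
  refine addHaar_image_eq_zero_of_differentiableOn_of_addHaar_eq_zero volume (fun w hw => ?_) ?_
  · have h1 := (hR w.re hw.1).hasFDerivWithinAt
    exact (h1.comp w (t := I) Complex.reCLM.hasFDerivAt.hasFDerivWithinAt
      (fun w' hw' => hw'.1)).differentiableWithinAt
  · refine measure_mono_null (t := (LinearMap.ker (Complex.imCLM : ℂ →ₗ[ℝ] ℝ) : Set ℂ))
      (fun w hw => by simpa using hw.2) (Measure.addHaar_submodule volume _ fun h => ?_)
    have : Complex.I ∈ LinearMap.ker (Complex.imCLM : ℂ →ₗ[ℝ] ℝ) := by rw [h]; trivial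
    simp at this

namespace IsNet

variable {Ω : Set ℂ} {ψ : ℂ → E3} {ε δ : ℝ} {P Px Py : ℝ → ℝ → ℂ}

lemma volume_horizontal (h : IsNet Ω ψ ε δ P Px Py) {y : ℝ} (hy : y ∈ Icc 0 δ) :
    volume ((fun x => P x y) '' Icc 0 δ) = 0 :=
  volume_image_curve fun x hx => h.part.hu x hx y hy

lemma volume_vertical (h : IsNet Ω ψ ε δ P Px Py) {x : ℝ} (hx : x ∈ Icc 0 δ) :
    volume ((fun y => P x y) '' Icc 0 δ) = 0 :=
  volume_image_curve fun y hy => h.part.hv x hx y hy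

lemma ae_mem_interior (h : IsNet Ω ψ ε δ P Px Py) : ∀ᵐ z ∂(volume.restrict (netImage δ P)),
    ∃ x ∈ Ioo 0 δ, ∃ y ∈ Ioo 0 δ, P x y = z := by
  have z0 := h.zero_mem
  have zδ : δ ∈ Icc 0 δ := ⟨h.pos.le, le_rfl⟩
  rw [ae_restrict_iff' h.isCompact_netImage.measurableSet]
  have n := measure_union_null (measure_union_null (h.volume_horizontal z0) (h.volume_horizontal zδ))
    (measure_union_null (h.volume_vertical z0) (h.volume_vertical zδ))
  filter_upwards [measure_eq_zero_iff_ae_notMem.1 n] with z hz hzm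
  obtain ⟨⟨x, y⟩, ⟨hx, hy⟩, rfl⟩ := hzm
  simp only [mem_union, not_or] at hz
  obtain ⟨⟨h1, h2⟩, h3, h4⟩ := hz
  simp only at hx hy
  refine ⟨x, ⟨lt_of_le_of_ne hx.1 ?_, lt_of_le_of_ne hx.2 ?_⟩, y,
    ⟨lt_of_le_of_ne hy.1 ?_, lt_of_le_of_ne hy.2 ?_⟩, rfl⟩
  · rintro rfl; exact h3 ⟨y, hy, rfl⟩
  · rintro rfl; exact h4 ⟨y, hy, rfl⟩
  · rintro rfl; exact h1 ⟨x, hx, rfl⟩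
  · rintro rfl; exact h2 ⟨x, hx, rfl⟩

lemma integrableOn_netImage {E : Type*} [NormedAddCommGroup E] [NormedSpace ℝ E]
    (h : IsNet Ω ψ ε δ P Px Py) (g : ℂ → E) :
    IntegrableOn g (netImage δ P) ↔ IntegrableOn
      (fun z : ℝ × ℝ => |planarDet (Px z.1 z.2) (Py z.1 z.2)| • g (P z.1 z.2)) (sq δ) := by
  have hms : MeasurableSet (sq δ) := measurableSet_Icc.prod measurableSet_Icc
  have himg : (fun w : ℂ => P w.re w.im) '' (Complex.equivRealProdCLM ⁻¹' sq δ) = netImage δ P := by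
    rw [show (fun w : ℂ => P w.re w.im) = (fun z : ℝ × ℝ => P z.1 z.2) ∘ Complex.equivRealProdCLM
      from rfl, image_comp, image_preimage_eq _ Complex.equivRealProdCLM.surjective]
    rfl
  have hmeas : MeasurableSet (Complex.equivRealProdCLM ⁻¹' sq δ) :=
    Complex.equivRealProdCLM.continuous.measurable hms
  have hd : ∀ w ∈ Complex.equivRealProdCLM ⁻¹' sq δ, HasFDerivWithinAt (fun w : ℂ => P w.re w.im)
      (pairMap (Px w.re w.im) (Py w.re w.im) ∘L (Complex.equivRealProdCLM : ℂ →L[ℝ] ℝ × ℝ))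
      (Complex.equivRealProdCLM ⁻¹' sq δ) w := fun w hw => by
    have h1 := h.part.hasFDerivWithinAt (convex_Icc _ _) (convex_Icc _ _)
        (z := Complex.equivRealProdCLM w) hw
    exact h1.comp w Complex.equivRealProdCLM.hasFDerivAt.hasFDerivWithinAt (fun x hx => hx)
  have hinj : InjOn (fun w : ℂ => P w.re w.im) (Complex.equivRealProdCLM ⁻¹' sq δ) :=
    fun w hw w' hw' he => Complex.equivRealProdCLM.injective (h.inj hw hw' he)
  rw [← himg, integrableOn_image_iff_integrableOn_abs_det_fderiv_smul volume hmeas hd hinj]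
  simp_rw [det_pairMap]
  exact Complex.volume_preserving_equiv_real_prod.integrableOn_comp_preimage
    Complex.measurableEquivRealProd.measurableEmbedding
    (f := fun z : ℝ × ℝ => |planarDet (Px z.1 z.2) (Py z.1 z.2)| • g (P z.1 z.2))

lemma ae_mem_sq_interior {δ : ℝ} : ∀ᵐ z : ℝ × ℝ ∂(volume.restrict (sq δ)),
    z.1 ∈ Ioo 0 δ ∧ z.2 ∈ Ioo 0 δ := by
  have : (volume.restrict (sq δ) : Measure (ℝ × ℝ))
      = (volume.restrict (Icc 0 δ)).prod (volume.restrict (Icc 0 δ)) := by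
    rw [Measure.prod_restrict]; rfl
  have h1 : ∀ᵐ x : ℝ ∂(volume.restrict (Icc 0 δ)), x ∈ Ioo 0 δ := by
    rw [← restrict_Ioo_eq_restrict_Icc]
    exact ae_restrict_mem measurableSet_Ioo
  rw [this]
  exact (Measure.quasiMeasurePreserving_fst.ae h1).and (Measure.quasiMeasurePreserving_snd.ae h1)

lemma integral_congr_interior {δ : ℝ} {E : Type*} [NormedAddCommGroup E] [NormedSpace ℝ E]
    {f g : ℝ × ℝ → E} (h : ∀ x ∈ Ioo 0 δ, ∀ y ∈ Ioo 0 δ, f (x, y) = g (x, y)) :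
    ∫ z in sq δ, f z = ∫ z in sq δ, g z := by
  refine integral_congr_ae ?_
  filter_upwards [ae_mem_sq_interior] with z hz using h _ hz.1 _ hz.2

/-- Hazzidakis' formula for a cell, with the Hessian term as an integral over the image. -/
lemma integral_sub (hψ : IsBranchedPSImmersion Ω ψ) (h : IsNet Ω ψ ε δ P Px Py) {τ : ℝ}
    (hτ : τ = 1 ∨ τ = -1)
    (hd : ∀ x ∈ Icc 0 δ, ∀ y ∈ Icc 0 δ, 0 < τ * planarDet (Px x y) (Py x y)) (e : ℝ)
    {χ : ℂ → ℝ} (hχ : ContDiff ℝ 2 χ)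
    (hedge : ∀ x ∈ Icc 0 δ, ∀ y ∈ Icc 0 δ, x = δ ∨ y = δ → P x y ∉ tsupport χ)
    {w : ℂ → ℝ} (hw : ∀ x ∈ Ioo 0 δ, ∀ y ∈ Ioo 0 δ, |planarDet (Px x y) (Py x y)| * w (P x y)
      = (τ * netAngle Px Py x y - e) * covHess χ (P x y) (Px x y) (Py x y)) :
    IntegrableOn (fun z => χ z * lam z) (netImage δ P) ∧ IntegrableOn w (netImage δ P) ∧
    ∫ z in netImage δ P, (χ z * lam z - w z)
      = χ (P 0 0) * (τ * netAngle Px Py 0 0 - e)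
        + (∫ x in 0..δ, fderiv ℝ χ (P x 0) (Px x 0) * (τ * netAngle Px Py x 0 - e))
        + ∫ y in 0..δ, fderiv ℝ χ (P 0 y) (Py 0 y) * (τ * netAngle Px Py 0 y - e) := by
  have hΩ : netImage δ P ⊆ Ω := by
    rintro _ ⟨z, hz, rfl⟩; exact h.maps _ hz.1 _ hz.2
  have i1 : IntegrableOn (fun z => χ z * lam z) (netImage δ P) :=
    (hχ.continuous.continuousOn.mul (hψ.continuousOn_lam.mono hΩ)).integrableOn_compact
      h.isCompact_netImage
  have hcont : IntegrableOn (fun z : ℝ × ℝ => covHess χ (P z.1 z.2) (Px z.1 z.2) (Py z.1 z.2)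
      * (τ * netAngle Px Py z.1 z.2 - e)) (sq δ) :=
    ((h.continuousOn_covHess hψ hχ).mul ((continuousOn_const.mul h.continuousOn_netAngle).sub
      continuousOn_const)).integrableOn_compact (isCompact_Icc.prod isCompact_Icc)
  have i2 : IntegrableOn w (netImage δ P) := by
    rw [h.integrableOn_netImage]
    refine hcont.congr_fun_ae ?_
    filter_upwards [ae_mem_sq_interior] with z hz
    rw [smul_eq_mul, hw _ hz.1 _ hz.2, mul_comm]
  refine ⟨i1, i2, ?_⟩
  have e1 : ∫ z in netImage δ P, w z = ∫ z in sq δ,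
      covHess χ (P z.1 z.2) (Px z.1 z.2) (Py z.1 z.2) * (τ * netAngle Px Py z.1 z.2 - e) :=
    (h.integral_netImage w).trans (integral_congr_interior fun x hx y hy => by
      rw [smul_eq_mul, hw _ hx _ hy, mul_comm])
  rw [MeasureTheory.integral_sub i1 i2, h.integral_mul_lam hψ hτ hd e hχ hedge, e1,
    add_sub_cancel_right]

end IsNet

namespace IsFan

variable {Ω : Set ℂ} {ψ : ℂ → E3} {p : ℂ} {n : ℕ} {δ : ℝ} {P Px Py : ℕ → ℝ → ℝ → ℂ}
  {R : ℕ → ℝ → ℂ}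

lemma volume_ray (h : IsFan Ω ψ p n δ P Px Py R) {k : ℕ} (hk : k < n) :
    volume (R k '' Icc 0 δ) = 0 :=
  volume_image_curve fun _ hx => h.hasDerivWithinAt_ray hk hx

/-- A point common to two different cells lies on one of the two rays that bound the first, and rays
are null sets. -/
lemma aedisjoint (h : IsFan Ω ψ p n δ P Px Py R) {k l : ℕ} (hk : k < n) (hl : l < n) (hkl : k ≠ l) :
    AEDisjoint volume (netImage δ (P k)) (netImage δ (P l)) := by
  obtain ⟨k', hk', hR, -⟩ := h.ray_succ hk
  refine measure_mono_null (t := R k '' Icc 0 δ ∪ R k' '' Icc 0 δ) ?_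
    (measure_union_null (h.volume_ray hk) (h.volume_ray hk'))
  rintro z ⟨⟨⟨x, y⟩, ⟨hx, hy⟩, hz⟩, ⟨⟨x', y'⟩, ⟨hx', hy'⟩, hz'⟩⟩
  simp only at hx hy hx' hy' hz hz'
  rcases hx.1.eq_or_lt with h1 | h1
  · right; exact ⟨y, hy, by rw [← hR, ← h.right k hk y hy, ← hz, h1]⟩
  · rcases hy.1.eq_or_lt with h2 | h2
    · left; exact ⟨x, hx, by rw [← h.left k hk x hx, ← hz, h2]⟩
    · exact absurd (h.disj k hk l hl x hx y hy x' hx' y' hy' h1 h2 (hz.trans hz'.symm)) hkl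

/-- The integral of a function supported in a fan. -/
lemma integral_eq_sum {E : Type*} [NormedAddCommGroup E] [NormedSpace ℝ E]
    (h : IsFan Ω ψ p n δ P Px Py R) {g : ℂ → E} (hg : ∀ z ∉ fanSet n δ P, g z = 0)
    (hi : ∀ k < n, IntegrableOn g (netImage δ (P k))) :
    Integrable g ∧ ∫ z, g z = ∑ k ∈ Finset.range n, ∫ z in netImage δ (P k), g z := by
  have hsub : fanSet n δ P ⊆ ⋃ k : Fin n, netImage δ (P k) := by
    rintro z ⟨k, hk, x, hx, y, hy, rfl⟩
    exact mem_iUnion.2 ⟨⟨k, hk⟩, (x, y), ⟨Ico_subset_Icc_self hx, Ico_subset_Icc_self hy⟩, rfl⟩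
  have hg0 : ∀ z ∉ ⋃ k : Fin n, netImage δ (P k), g z = 0 := fun z hz => hg z fun hc => hz (hsub hc)
  have hmeas : ∀ k : Fin n, MeasurableSet (netImage δ (P k)) := fun k =>
    (h.net k k.2).isCompact_netImage.measurableSet
  have hint : IntegrableOn g (⋃ k : Fin n, netImage δ (P k)) :=
    integrableOn_finite_iUnion.2 fun k => hi k k.2
  refine ⟨(integrableOn_iff_integrable_of_support_subset fun z hz => ?_).1 hint, ?_⟩
  · by_contra hc; exact hz (hg0 z hc)
  rw [← setIntegral_eq_integral_of_forall_compl_eq_zero hg0,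
    integral_iUnion_ae (fun k => (hmeas k).nullMeasurableSet)
      (fun k l hkl => h.aedisjoint k.2 l.2 (fun hc => hkl (Fin.ext hc))) hint, tsum_fintype,
    Finset.sum_range]

/-- The integral over an open set that contains some of the cells and avoids the others. -/
lemma setIntegral_eq_sum {E : Type*} [NormedAddCommGroup E] [NormedSpace ℝ E]
    (h : IsFan Ω ψ p n δ P Px Py R) {Γ : Set ℂ} (hΓ : IsOpen Γ) {a : ℕ → ℝ}
    (ha : ∀ k < n, (a k = 1 ∧ ∀ x ∈ Ioo 0 δ, ∀ y ∈ Ioo 0 δ, P k x y ∈ Γ) ∨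
      (a k = 0 ∧ ∀ x ∈ Ioo 0 δ, ∀ y ∈ Ioo 0 δ, P k x y ∉ Γ))
    {g : ℂ → E} (hg : ∀ z ∉ fanSet n δ P, g z = 0)
    (hi : ∀ k < n, a k = 1 → IntegrableOn g (netImage δ (P k))) :
    IntegrableOn g Γ ∧
    ∫ z in Γ, g z = ∑ k ∈ Finset.range n, a k • ∫ z in netImage δ (P k), g z := by
  have e1 : ∀ k < n, a k = 1 → Γ.indicator g =ᵐ[volume.restrict (netImage δ (P k))] g := by
    intro k hk hak
    have h1 := (ha k hk).resolve_right fun hc => by rw [hc.1] at hak; norm_num at hak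
    filter_upwards [(h.net k hk).ae_mem_interior] with z hz
    obtain ⟨x, hx, y, hy, rfl⟩ := hz
    exact indicator_of_mem (h1.2 x hx y hy) _
  have e0 : ∀ k < n, a k = 0 → Γ.indicator g =ᵐ[volume.restrict (netImage δ (P k))] 0 := by
    intro k hk hak
    have h1 := (ha k hk).resolve_left fun hc => by rw [hc.1] at hak; norm_num at hak
    filter_upwards [(h.net k hk).ae_mem_interior] with z hz
    obtain ⟨x, hx, y, hy, rfl⟩ := hz
    exact indicator_of_notMem (h1.2 x hx y hy) _
  have key := h.integral_eq_sum (g := Γ.indicator g)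
    (fun z hz => by by_cases hzΓ : z ∈ Γ <;> simp [hzΓ, hg z hz]) (fun k hk => by
      rcases ha k hk with h1 | h1
      · exact (hi k hk h1.1).congr (e1 k hk h1.1).symm
      · exact (integrable_zero _ _ _).congr (e0 k hk h1.1).symm)
  refine ⟨(integrable_indicator_iff hΓ.measurableSet).1 key.1, ?_⟩
  rw [← integral_indicator hΓ.measurableSet, key.2]
  refine Finset.sum_congr rfl fun k hk => ?_
  have hk' := Finset.mem_range.1 hk
  rcases ha k hk' with h1 | h1
  · rw [integral_congr_ae (e1 k hk' h1.1), h1.1, one_smul]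
  · rw [integral_congr_ae (e0 k hk' h1.1), h1.1, zero_smul]; simp

end IsFan

/-! ### Polar angles and sectors of a star -/

/-- The relations |w| sin(arg w) = y sin α and |w| sin(α - arg w) = x sin α convert the signs of y
and x into the lower and upper bounds for the argument. -/
lemma exists_polar {α x y : ℝ} (hα : 0 < α) (hα' : α < Real.pi) (hx : 0 ≤ x) (hy : 0 ≤ y)
    (hxy : 0 < x + y) : ∃ r s : ℝ, 0 < r ∧ 0 ≤ s ∧ s ≤ α ∧ (0 < y → 0 < s) ∧ (0 < x → s < α) ∧
      (x + y * Complex.exp (α * Complex.I) : ℂ) = r * Complex.exp (s * Complex.I) := by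
  set w : ℂ := x + y * Complex.exp (α * Complex.I) with hw
  have hsin := Real.sin_pos_of_pos_of_lt_pi hα hα'
  have him : w.im = y * Real.sin α := by
    simp [hw, Complex.exp_ofReal_mul_I_im, Complex.exp_ofReal_mul_I_re]
  have hre : w.re = x + y * Real.cos α := by
    simp [hw, Complex.exp_ofReal_mul_I_im, Complex.exp_ofReal_mul_I_re]
  have hw0 : w ≠ 0 := by
    intro h0
    have h1 : y * Real.sin α = 0 := by rw [← him, h0]; rfl
    have hy0 : y = 0 := (mul_eq_zero.1 h1).resolve_right hsin.ne'
    have h2 : x + y * Real.cos α = 0 := by rw [← hre, h0]; rfl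
    rw [hy0, zero_mul, add_zero] at h2
    linarith
  have hr : 0 < ‖w‖ := norm_pos_iff.2 hw0
  have h1 : 0 ≤ w.arg := Complex.arg_nonneg_iff.2 (by rw [him]; positivity)
  have hne : w.arg ≠ Real.pi := by
    intro h
    obtain ⟨h2, h3⟩ := Complex.arg_eq_pi_iff.1 h
    rw [him] at h3
    have hy0 : y = 0 := (mul_eq_zero.1 h3).resolve_right hsin.ne'
    rw [hre, hy0] at h2
    linarith
  have h2 : w.arg < Real.pi := lt_of_le_of_ne (Complex.arg_le_pi w) hne
  have e := Complex.norm_mul_exp_arg_mul_I w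
  have hc : ‖w‖ * Real.cos w.arg = w.re := Complex.norm_mul_cos_arg w
  have hs : ‖w‖ * Real.sin w.arg = w.im := Complex.norm_mul_sin_arg w
  have key : ‖w‖ * Real.sin (α - w.arg) = x * Real.sin α := by
    rw [Real.sin_sub]
    linear_combination Real.sin α * hc - Real.cos α * hs + Real.sin α * hre - Real.cos α * him
  refine ⟨‖w‖, w.arg, hr, h1, ?_, fun hy0 => ?_, fun hx0 => ?_, e.symm⟩
  · by_contra hc
    push Not at hc
    have : Real.sin (α - w.arg) < 0 := Real.sin_neg_of_neg_of_neg_pi_lt (by linarith) (by linarith)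
    have h3 : 0 ≤ x * Real.sin α := by positivity
    rw [← key] at h3
    nlinarith
  · refine lt_of_le_of_ne h1 fun h0 => ?_
    rw [← h0, Real.sin_zero, mul_zero, him] at hs
    have := mul_pos hy0 hsin
    linarith
  · by_contra hc
    push Not at hc
    have : Real.sin (α - w.arg) ≤ 0 := by
      rcases hc.eq_or_lt with h | h
      · rw [← h]; simp
      · exact (Real.sin_neg_of_neg_of_neg_pi_lt (by linarith) (by linarith)).le
    have h3 : 0 < x * Real.sin α := by positivity
    rw [← key] at h3
    nlinarith

namespace MStar

variable {m : ℕ} (T : MStar m)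

/-- The polar angle of ray `k`. -/
def beta (k : ℕ) : ℝ := ∑ i ∈ Finset.range k, T.angle i

lemma dir_eq (k : ℕ) : T.dir k = Complex.exp ((T.beta k : ℝ) * Complex.I) := rfl

lemma beta_succ (k : ℕ) : T.beta (k + 1) = T.beta k + T.angle k := Finset.sum_range_succ _ _

lemma beta_zero : T.beta 0 = 0 := by simp [beta]

lemma beta_last : T.beta (2 * m) = 2 * Real.pi := T.angle_sum

lemma beta_lt {k l : ℕ} (hkl : k < l) (hl : l ≤ 2 * m) : T.beta k < T.beta l := by
  induction l with
  | zero => omega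
  | succ l ih =>
    have h1 := T.angle_pos l (by omega)
    rw [T.beta_succ]
    rcases Nat.lt_succ_iff_lt_or_eq.1 hkl with h | h
    · linarith [ih h (by omega)]
    · rw [h]; linarith

lemma beta_nonneg {k : ℕ} (hk : k ≤ 2 * m) : 0 ≤ T.beta k := by
  rcases Nat.eq_zero_or_pos k with rfl | h
  · rw [T.beta_zero]
  · have := T.beta_lt h hk
    rw [T.beta_zero] at this
    exact this.le

lemma beta_le {k : ℕ} (hk : k ≤ 2 * m) : T.beta k ≤ 2 * Real.pi := by
  rw [← T.beta_last]
  rcases hk.eq_or_lt with h | h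
  · rw [h]
  · exact (T.beta_lt h le_rfl).le

lemma dir_succ (k : ℕ) : T.dir (k + 1) = T.dir k * Complex.exp (T.angle k * Complex.I) := by
  rw [dir_eq, dir_eq, beta_succ, ← Complex.exp_add]
  push_cast
  ring_nf

lemma norm_dir (k : ℕ) : ‖T.dir k‖ = 1 := by
  rw [dir_eq]; exact Complex.norm_exp_ofReal_mul_I _

lemma dir_ne_zero (k : ℕ) : T.dir k ≠ 0 := Complex.exp_ne_zero _

lemma dir_last : T.dir (2 * m) = T.dir 0 := by
  rw [dir_eq, dir_eq, T.beta_last, T.beta_zero]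
  have : ((2 * Real.pi : ℝ) : ℂ) * Complex.I = 2 * Real.pi * Complex.I := by push_cast; ring
  rw [this, Complex.exp_two_pi_mul_I]
  simp

/-- The point of sector `k` with coordinate `x` along ray `k` and `y` along ray `k + 1`. -/
def pt (k : ℕ) (x y : ℝ) : ℂ := x * T.dir k + y * T.dir (k + 1)

lemma point_even {k : ℕ} (hk : Even k) (u v : ℝ) : T.point k u v = T.pt k u v := by
  simp [point, pt, hk]

lemma point_odd {k : ℕ} (hk : ¬ Even k) (u v : ℝ) : T.point k u v = T.pt k v u := by
  simp [point, pt, hk]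

/-- A coordinate times the sine of the sector angle is the distance from the line of the other ray.
It is seen as an imaginary part after that ray is rotated to the real axis. -/
lemma mul_sin_le {k : ℕ} (hk : k < 2 * m) {x y : ℝ} :
    |x| * Real.sin (T.angle k) ≤ ‖T.pt k x y‖ ∧ |y| * Real.sin (T.angle k) ≤ ‖T.pt k x y‖ := by
  have hs := Real.sin_pos_of_pos_of_lt_pi (T.angle_pos k hk) (T.angle_lt k hk)
  have e : T.pt k x y = T.dir k * (x + y * Complex.exp (T.angle k * Complex.I)) := by
    rw [pt, dir_succ]; ring
  have e' : T.pt k x y = T.dir (k + 1) * (y + x * Complex.exp ((-T.angle k : ℝ) * Complex.I)) := by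
    have : T.dir k = T.dir (k + 1) * Complex.exp ((-T.angle k : ℝ) * Complex.I) := by
      rw [dir_succ, mul_assoc, ← Complex.exp_add]
      push_cast
      ring_nf
      simp
    rw [pt]
    nth_rewrite 1 [this]
    ring
  constructor
  · rw [e', norm_mul, norm_dir, one_mul]
    have := Complex.abs_im_le_norm (y + x * Complex.exp ((-T.angle k : ℝ) * Complex.I))
    rw [Complex.add_im, Complex.im_ofReal_mul, Complex.exp_ofReal_mul_I_im, Complex.ofReal_im,
      Real.sin_neg, zero_add, abs_mul, abs_neg, abs_of_pos hs] at this
    exact this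
  · rw [e, norm_mul, norm_dir, one_mul]
    have := Complex.abs_im_le_norm (x + y * Complex.exp (T.angle k * Complex.I))
    rw [Complex.add_im, Complex.im_ofReal_mul, Complex.exp_ofReal_mul_I_im, Complex.ofReal_im,
      zero_add, abs_mul, abs_of_pos hs] at this
    exact this

lemma pt_injective {k : ℕ} (hk : k < 2 * m) {x y x' y' : ℝ} (h : T.pt k x y = T.pt k x' y') :
    x = x' ∧ y = y' := by
  have hs := Real.sin_pos_of_pos_of_lt_pi (T.angle_pos k hk) (T.angle_lt k hk)
  have e : T.pt k (x - x') (y - y') = 0 := by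
    have : T.pt k (x - x') (y - y') = T.pt k x y - T.pt k x' y' := by
      unfold pt; push_cast; ring
    rw [this, h, sub_self]
  obtain ⟨h1, h2⟩ := T.mul_sin_le hk (x := x - x') (y := y - y')
  rw [e, norm_zero] at h1 h2
  have a1 : |x - x'| ≤ 0 := by
    by_contra hc; push Not at hc; nlinarith
  have a2 : |y - y'| ≤ 0 := by
    by_contra hc; push Not at hc; nlinarith
  exact ⟨sub_eq_zero.1 (abs_nonpos_iff.1 a1), sub_eq_zero.1 (abs_nonpos_iff.1 a2)⟩

lemma eq_of_exp_eq {r r' s s' : ℝ} (hr : 0 < r) (hr' : 0 < r') (hs : |s - s'| < 2 * Real.pi)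
    (h : (r * Complex.exp (s * Complex.I) : ℂ) = r' * Complex.exp (s' * Complex.I)) :
    s = s' := by
  have hn := congrArg norm h
  rw [norm_mul, norm_mul, Complex.norm_exp_ofReal_mul_I, Complex.norm_exp_ofReal_mul_I,
    Complex.norm_real, Complex.norm_real, Real.norm_eq_abs, Real.norm_eq_abs, abs_of_pos hr,
    abs_of_pos hr', mul_one, mul_one] at hn
  rw [hn] at h
  have h2 := mul_left_cancel₀ (by exact_mod_cast hr'.ne') h
  obtain ⟨k, hk⟩ := Complex.exp_eq_exp_iff_exists_int.1 h2
  have h3 : s = s' + k * (2 * Real.pi) := by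
    have : (s : ℂ) * Complex.I = ((s' + k * (2 * Real.pi) : ℝ) : ℂ) * Complex.I := by
      rw [hk]; push_cast; ring
    exact_mod_cast mul_right_cancel₀ Complex.I_ne_zero this
  have hpi := Real.pi_pos
  rw [h3, add_sub_cancel_left, abs_mul, abs_of_pos (by linarith : (0 : ℝ) < 2 * Real.pi)] at hs
  have h4 : |(k : ℝ)| < 1 := by
    by_contra hc; push Not at hc; nlinarith
  have h5 : |k| < 1 := by exact_mod_cast h4
  have h6 : k = 0 := Int.abs_lt_one_iff.1 h5
  rw [h3, h6]; simp

lemma exists_polar_pt {k : ℕ} (hk : k < 2 * m) {x y : ℝ} (hx : 0 ≤ x) (hy : 0 ≤ y)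
    (hxy : 0 < x + y) : ∃ r s : ℝ, 0 < r ∧ T.beta k ≤ s ∧ s ≤ T.beta (k + 1) ∧
      (0 < y → T.beta k < s) ∧ (0 < x → s < T.beta (k + 1)) ∧
      T.pt k x y = r * Complex.exp (s * Complex.I) := by
  obtain ⟨r, s, hr, h1, h2, h3, h4, h5⟩ := exists_polar (T.angle_pos k hk) (T.angle_lt k hk) hx hy hxy
  refine ⟨r, T.beta k + s, hr, by linarith, ?_, fun h => ?_, fun h => ?_, ?_⟩
  · rw [beta_succ]; linarith
  · linarith [h3 h]
  · rw [beta_succ]; linarith [h4 h]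
  · have : T.pt k x y = T.dir k * (x + y * Complex.exp (T.angle k * Complex.I)) := by
      rw [pt, dir_succ]; ring
    rw [this, h5, dir_eq]
    push_cast
    rw [add_mul, Complex.exp_add]
    ring

/-- A point with positive coordinates has a polar angle strictly between those of the two rays of
its sector. The polar angles of the rays increase from 0 to 2π, so no other closed sector reaches
it. -/
lemma pt_disjoint {k l : ℕ} (hk : k < 2 * m) (hl : l < 2 * m) {x y x' y' : ℝ} (hx : 0 < x)
    (hy : 0 < y) (hx' : 0 ≤ x') (hy' : 0 ≤ y') (h : T.pt k x y = T.pt l x' y') : k = l := by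
  have h0 : 0 < x' + y' := by
    by_contra hc
    have a1 : x' = 0 := by linarith
    have a2 : y' = 0 := by linarith
    have : T.pt k x y = T.pt k 0 0 := by rw [h, a1, a2]; simp [pt]
    have := (T.pt_injective hk this).1
    linarith
  obtain ⟨r, s, hr, a1, a2, a3, a4, a5⟩ := T.exists_polar_pt hk hx.le hy.le (by linarith)
  obtain ⟨r', s', hr', b1, b2, -, -, b5⟩ := T.exists_polar_pt hl hx' hy' h0
  have c1 := T.beta_nonneg hk.le
  have c2 := T.beta_le (k := k + 1) hk
  have c3 := T.beta_nonneg hl.le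
  have c4 := T.beta_le (k := l + 1) hl
  have e := eq_of_exp_eq (s := s) (s' := s') hr hr' (by rw [abs_lt]; constructor <;> linarith [a3 hy, a4 hx])
    (by rw [← a5, ← b5, h])
  rcases lt_trichotomy k l with hlt | heq | hgt
  · rcases Nat.lt_or_ge (k + 1) l with h1 | h1
    · have := T.beta_lt h1 hl.le
      linarith [a4 hx]
    · have : l = k + 1 := by omega
      rw [this] at b1
      linarith [a4 hx]
  · exact heq
  · rcases Nat.lt_or_ge (l + 1) k with h1 | h1
    · have := T.beta_lt h1 hk.le
      linarith [a3 hy]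
    · have : k = l + 1 := by omega
      rw [this] at a3
      linarith [a3 hy]

lemma ray_disjoint {k l : ℕ} (hk : k < 2 * m) (hl : l < 2 * m) {x x' : ℝ} (hx : 0 < x)
    (hx' : 0 ≤ x') (h : (x * T.dir k : ℂ) = x' * T.dir l) : k = l := by
  have hn := congrArg norm h
  rw [norm_mul, norm_mul, norm_dir, norm_dir, Complex.norm_real, Complex.norm_real, mul_one, mul_one,
    Real.norm_eq_abs, Real.norm_eq_abs, abs_of_pos hx, abs_of_nonneg hx'] at hn
  have hx0 : 0 < x' := hn ▸ hx
  have c1 := T.beta_nonneg hk.le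
  have c2 := T.beta_lt hk le_rfl
  have c3 := T.beta_nonneg hl.le
  have c4 := T.beta_lt hl le_rfl
  rw [T.beta_last] at c2 c4
  have e := eq_of_exp_eq (s := T.beta k) (s' := T.beta l) hx hx0 (by rw [abs_lt]; constructor <;> linarith) h
  rcases lt_trichotomy k l with hlt | heq | hgt
  · have := T.beta_lt hlt hl.le; linarith
  · exact heq
  · have := T.beta_lt hgt hk.le; linarith

lemma exists_sin_lower : ∃ s > 0, ∀ k < 2 * m, s ≤ Real.sin (T.angle k) := by
  have h : ∀ k < 2 * m, 0 < Real.sin (T.angle k) := fun k hk =>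
    Real.sin_pos_of_pos_of_lt_pi (T.angle_pos k hk) (T.angle_lt k hk)
  have : ∀ᶠ s in 𝓝[>] (0 : ℝ), ∀ k ∈ Finset.range (2 * m), s ≤ Real.sin (T.angle k) := by
    rw [Filter.eventually_all_finset]
    intro k hk
    exact nhdsWithin_le_nhds (eventually_le_nhds (h k (Finset.mem_range.1 hk)))
  obtain ⟨s, hs1, hs2⟩ := (this.and self_mem_nhdsWithin).exists
  exact ⟨s, hs2, fun k hk => hs1 k (Finset.mem_range.2 hk)⟩

end MStar

/-! ### Star charts give fans -/

section

variable {Ω : Set ℂ} {ψ : ℂ → E3}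

/-- This serves the odd sectors, whose coordinates have to be exchanged so that x always runs along
ray k and y along ray k + 1. The sign of ε records that the first family is then the other one. -/
lemma IsNet.swap {ε δ : ℝ} {P Px Py : ℝ → ℝ → ℂ} (h : IsNet Ω ψ ε δ P Px Py) :
    IsNet Ω ψ (-ε) δ (fun x y => P y x) (fun x y => Py y x) (fun x y => Px y x) where
  pos := h.pos
  maps x hx y hy := h.maps y hy x hx
  part := h.part.swap
  mixed_x x hx y hy := by
    rw [mixedTerm_comm]; exact h.mixed_y y hy x hx
  mixed_y x hx y hy := by
    rw [mixedTerm_comm]; exact h.mixed_x y hy x hx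
  det_ne x hx y hy := by
    rw [planarDet_swap]; simpa using h.det_ne y hy x hx
  inj := by
    rintro ⟨x, y⟩ ⟨hx, hy⟩ ⟨x', y'⟩ ⟨hx', hy'⟩ he
    have := h.inj (x₁ := (y, x)) ⟨hy, hx⟩ (x₂ := (y', x')) ⟨hy', hx'⟩ he
    have := Prod.mk_inj.1 this
    rw [this.1, this.2]
  re_x x hx y hy := h.re_y y hy x hx
  re_y x hx y hy := h.re_x y hy x hx
  part_normal := by
    have := h.part_normal.swap
    simpa only [neg_smul, neg_neg] using this

/-- Small corners of a sector are cells of an asymptotic net. -/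
lemma IsSector.eventually_isNet (hψ : IsBranchedPSImmersion Ω ψ) {a b : ℝ} {F : ℝ → ℝ → ℂ}
    (hF : IsSector Ω ψ a b F) :
    ∀ᶠ δ in 𝓝[>] (0 : ℝ), IsNet Ω ψ 1 δ F (IsSector.tu a F) (IsSector.tv b F) := by
  have hz : ((0 : ℝ), (0 : ℝ)) ∈ Ico 0 a ×ˢ Ico 0 b := ⟨⟨le_rfl, hF.ha⟩, ⟨le_rfl, hF.hb⟩⟩
  have P := IsSector.hasPartials hψ hF
  -- The quotient by the value at the corner is 1 there, so it stays in the right half-plane on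
  -- small squares, where the argument is continuous.
  have key : ∀ f : ℝ × ℝ → ℂ, ContinuousOn f (Ico 0 a ×ˢ Ico 0 b) → f (0, 0) ≠ 0 →
      ∀ᶠ δ in 𝓝[>] (0 : ℝ), ∀ x ∈ Icc 0 δ, ∀ y ∈ Icc 0 δ, 0 < (f (x, y) / f (0, 0)).re := by
    intro f hf h0
    have h1 : ContinuousWithinAt (fun z => (f z / f (0, 0)).re) (Ico 0 a ×ˢ Ico 0 b) (0, 0) :=
      Complex.continuous_re.continuousAt.comp_continuousWithinAt ((hf _ hz).div_const _)
    have h2 : ∀ᶠ z in 𝓝[Ico 0 a ×ˢ Ico 0 b] ((0 : ℝ), (0 : ℝ)), 0 < (f z / f (0, 0)).re := by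
      refine h1.eventually_const_lt ?_
      simp only [div_self h0]; simp
    obtain ⟨η, hη, h3⟩ := Metric.mem_nhdsWithin_iff.1 h2
    filter_upwards [Ioo_mem_nhdsGT (lt_min hη (lt_min hF.ha hF.hb))] with δ hδ x hx y hy
    have d1 := hδ.2.trans_le (min_le_left _ _)
    have d2 := hδ.2.trans_le ((min_le_right _ _).trans (min_le_left _ _))
    have d3 := hδ.2.trans_le ((min_le_right _ _).trans (min_le_right _ _))
    refine h3 (a := (x, y)) ⟨?_, ⟨hx.1, hx.2.trans_lt d2⟩, ⟨hy.1, hy.2.trans_lt d3⟩⟩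
    rw [Metric.mem_ball, Prod.dist_eq, max_lt_iff, Real.dist_eq, Real.dist_eq, sub_zero, sub_zero,
      abs_of_nonneg hx.1, abs_of_nonneg hy.1]
    exact ⟨hx.2.trans_lt d1, hy.2.trans_lt d1⟩
  filter_upwards [key _ P.cu (IsSector.tu_ne_zero hψ hF hz.1 hz.2),
    key _ P.cv (IsSector.tv_ne_zero hψ hF hz.1 hz.2), Ioo_mem_nhdsGT (lt_min hF.ha hF.hb)]
    with δ h1 h2 hδ
  have hδa := hδ.2.trans_le (min_le_left _ _)
  have hδb := hδ.2.trans_le (min_le_right _ _)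
  have sa : Icc 0 δ ⊆ Ico 0 a := Icc_subset_Ico_right hδa
  have sb : Icc 0 δ ⊆ Ico 0 b := Icc_subset_Ico_right hδb
  refine ⟨hδ.1, fun x hx y hy => hF.maps x (sa hx) y (sb hy), P.mono sa sb,
    fun x hx y hy => (IsSector.hasDerivWithinAt_mixed hψ hF hδa hδb hx hy hδ.1).1,
    fun x hx y hy => (IsSector.hasDerivWithinAt_mixed hψ hF hδa hδb hx hy hδ.1).2,
    fun x hx y hy => IsSector.planarDet_ne_zero hψ hF (sa hx) (sb hy),
    hF.inj.mono (prod_mono sa sb), h1, h2, ?_⟩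
  simpa only [one_smul] using (IsSector.hasPartials_normal hψ hF).mono sa sb

namespace StarChart

variable {p : ℂ} {m : ℕ} (c : StarChart Ω ψ p m)

/-- The range of `u` in sector `k`. -/
def uLen (k : ℕ) : ℝ := if Even k then c.star.len k else c.star.len (k + 1)

/-- The range of `v` in sector `k`. -/
def vLen (k : ℕ) : ℝ := if Even k then c.star.len (k + 1) else c.star.len k

lemma point_mem {k : ℕ} (hk : k < 2 * m) {u v : ℝ} (hu : u ∈ Ico 0 (c.uLen k))
    (hv : v ∈ Ico 0 (c.vLen k)) : c.star.point k u v ∈ c.homeo.target := by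
  rw [c.target_eq]; exact ⟨k, hk, u, hu, v, hv, rfl⟩

lemma point_injective {k : ℕ} (hk : k < 2 * m) {u v u' v' : ℝ}
    (h : c.star.point k u v = c.star.point k u' v') : u = u' ∧ v = v' := by
  by_cases he : Even k
  · rw [c.star.point_even he, c.star.point_even he] at h
    exact c.star.pt_injective hk h
  · rw [c.star.point_odd he, c.star.point_odd he] at h
    exact (c.star.pt_injective hk h).symm

lemma continuous_point (k : ℕ) : Continuous fun z : ℝ × ℝ => c.star.point k z.1 z.2 := by
  unfold MStar.point
  split_ifs <;> fun_prop

lemma planarDet_dir {k : ℕ} (hk : k < 2 * m) :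
    planarDet (c.star.dir k) (c.star.dir (k + 1)) ≠ 0 := by
  rw [planarDet_eq_im, c.star.norm_dir, c.star.dir_succ, mul_div_cancel_left₀ _ (c.star.dir_ne_zero k),
    Complex.exp_ofReal_mul_I_im]
  have := Real.sin_pos_of_pos_of_lt_pi (c.star.angle_pos k hk) (c.star.angle_lt k hk)
  simpa using this.ne'

lemma isOpen_image_point {k : ℕ} (hk : k < 2 * m) {U : Set (ℝ × ℝ)} (hU : IsOpen U) :
    IsOpen ((fun z : ℝ × ℝ => c.star.point k z.1 z.2) '' U) := by
  have hd := c.planarDet_dir hk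
  by_cases he : Even k
  · have : (fun z : ℝ × ℝ => c.star.point k z.1 z.2) = pairEquiv hd := by
      funext z
      rw [c.star.point_even he]
      change _ = pairMap _ _ z
      simp [MStar.pt]
    rw [this]
    exact (pairEquiv hd).toHomeomorph.isOpenMap U hU
  · have : (fun z : ℝ × ℝ => c.star.point k z.1 z.2) = pairEquiv hd ∘ Prod.swap := by
      funext z
      rw [c.star.point_odd he]
      change _ = pairMap _ _ z.swap
      simp [MStar.pt]
    rw [this, image_comp]
    exact (pairEquiv hd).toHomeomorph.isOpenMap _ ((Homeomorph.prodComm ℝ ℝ).isOpenMap U hU)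

lemma isSector {k : ℕ} (hk : k < 2 * m) : IsSector Ω ψ (c.uLen k) (c.vLen k) (c.param k) where
  ha := by
    unfold uLen; split_ifs
    · exact c.star.len_pos k hk.le
    · exact c.star.len_pos (k + 1) hk
  hb := by
    unfold vLen; split_ifs
    · exact c.star.len_pos (k + 1) hk
    · exact c.star.len_pos k hk.le
  maps u hu v hv := c.source_subset (c.homeo.map_target (c.point_mem hk hu hv))
  cont := c.homeo.continuousOn_symm.comp (c.continuous_point k).continuousOn
    fun z hz => c.point_mem hk hz.1 hz.2
  inj := by
    rintro ⟨u, v⟩ ⟨hu, hv⟩ ⟨u', v'⟩ ⟨hu', hv'⟩ he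
    have := c.homeo.symm.injOn (c.point_mem hk hu hv) (c.point_mem hk hu' hv') he
    exact Prod.ext_iff.2 (c.point_injective hk this)
  isOpen U hU hUo := by
    have : (fun z : ℝ × ℝ => c.param k z.1 z.2) '' U
        = c.homeo.symm '' ((fun z : ℝ × ℝ => c.star.point k z.1 z.2) '' U) := by
      rw [← image_comp]; rfl
    rw [this]
    refine c.homeo.isOpen_image_symm_of_subset_target (c.isOpen_image_point hk hUo) ?_
    rintro _ ⟨z, hz, rfl⟩
    exact c.point_mem hk (Ioo_subset_Ico_self (hU hz).1) (Ioo_subset_Ico_self (hU hz).2)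
  front := c.front k hk

/-- The cell `k` of a star chart, parametrized by the coordinates along the rays `k` and `k + 1`. -/
def cell (k : ℕ) (x y : ℝ) : ℂ := c.homeo.symm (c.star.pt k x y)

/-- The tangent vector of the first family of curves. -/
def cellX (k : ℕ) (x y : ℝ) : ℂ :=
  if Even k then IsSector.tu (c.uLen k) (c.param k) x y else IsSector.tv (c.vLen k) (c.param k) y x

/-- The tangent vector of the second family of curves. -/
def cellY (k : ℕ) (x y : ℝ) : ℂ :=
  if Even k then IsSector.tv (c.vLen k) (c.param k) x y else IsSector.tu (c.uLen k) (c.param k) y x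

/-- Ray `k` of a star chart. -/
def ray (k : ℕ) (x : ℝ) : ℂ := c.homeo.symm (x * c.star.dir k)

lemma cell_even {k : ℕ} (hk : Even k) (x y : ℝ) : c.cell k x y = c.param k x y := by
  rw [cell, param, c.star.point_even hk]

lemma cell_odd {k : ℕ} (hk : ¬ Even k) (x y : ℝ) : c.cell k x y = c.param k y x := by
  rw [cell, param, c.star.point_odd hk]

lemma pt_mem {k : ℕ} (hk : k < 2 * m) {x y : ℝ} (hx : x ∈ Ico 0 (c.star.len k))
    (hy : y ∈ Ico 0 (c.star.len (k + 1))) : c.star.pt k x y ∈ c.homeo.target := by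
  by_cases he : Even k
  · rw [← c.star.point_even he]
    exact c.point_mem hk (by simpa [uLen, he] using hx) (by simpa [vLen, he] using hy)
  · rw [← c.star.point_odd he]
    exact c.point_mem hk (by simpa [uLen, he] using hy) (by simpa [vLen, he] using hx)

lemma eventually_isNet (hψ : IsBranchedPSImmersion Ω ψ) {k : ℕ} (hk : k < 2 * m) :
    ∀ᶠ δ in 𝓝[>] (0 : ℝ), IsNet Ω ψ ((-1) ^ k) δ (c.cell k) (c.cellX k) (c.cellY k) := by
  filter_upwards [(c.isSector hk).eventually_isNet hψ] with δ h
  by_cases he : Even k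
  · have e1 : c.cell k = c.param k := by funext x y; exact c.cell_even he x y
    have e2 : c.cellX k = IsSector.tu (c.uLen k) (c.param k) := by
      funext x y; simp [cellX, he]
    have e3 : c.cellY k = IsSector.tv (c.vLen k) (c.param k) := by
      funext x y; simp [cellY, he]
    rw [e1, e2, e3, he.neg_one_pow]
    exact h
  · have e1 : c.cell k = fun x y => c.param k y x := by funext x y; exact c.cell_odd he x y
    have e2 : c.cellX k = fun x y => IsSector.tv (c.vLen k) (c.param k) y x := by
      funext x y; simp [cellX, he]
    have e3 : c.cellY k = fun x y => IsSector.tu (c.uLen k) (c.param k) y x := by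
      funext x y; simp [cellY, he]
    rw [e1, e2, e3, (Nat.not_even_iff_odd.1 he).neg_one_pow]
    exact h.swap

/-- Small neighbourhoods of the centre in a star chart are fans. -/
lemma eventually_isFan (hψ : IsBranchedPSImmersion Ω ψ) :
    ∀ᶠ δ in 𝓝[>] (0 : ℝ), IsFan Ω ψ p (2 * m) δ c.cell c.cellX c.cellY c.ray := by
  have h1 : ∀ᶠ δ in 𝓝[>] (0 : ℝ), ∀ k ∈ Finset.range (2 * m),
      IsNet Ω ψ ((-1) ^ k) δ (c.cell k) (c.cellX k) (c.cellY k) := by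
    rw [Filter.eventually_all_finset]
    exact fun k hk => c.eventually_isNet hψ (Finset.mem_range.1 hk)
  have h2 : ∀ᶠ δ in 𝓝[>] (0 : ℝ), ∀ k ∈ Finset.range (2 * m + 1), δ < c.star.len k := by
    rw [Filter.eventually_all_finset]
    exact fun k hk => nhdsWithin_le_nhds (eventually_lt_nhds
      (c.star.len_pos k (by have := Finset.mem_range.1 hk; omega)))
  filter_upwards [h1, h2, self_mem_nhdsWithin] with δ h1 h2 hδ
  have hδ0 : 0 < δ := hδ
  have hlen : ∀ k ≤ 2 * m, Icc 0 δ ⊆ Ico 0 (c.star.len k) := fun k hk =>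
    Icc_subset_Ico_right (h2 k (Finset.mem_range.2 (by omega)))
  have hmem : ∀ k < 2 * m, ∀ x ∈ Icc 0 δ, ∀ y ∈ Icc 0 δ, c.star.pt k x y ∈ c.homeo.target :=
    fun k hk x hx y hy => c.pt_mem hk (hlen k hk.le hx) (hlen (k + 1) hk hy)
  have z0 : (0 : ℝ) ∈ Icc 0 δ := ⟨le_rfl, hδ0.le⟩
  have hray : ∀ k < 2 * m, ∀ x ∈ Icc 0 δ, (x * c.star.dir k : ℂ) ∈ c.homeo.target := by
    intro k hk x hx
    have := hmem k hk x hx 0 z0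
    simpa [MStar.pt] using this
  refine ⟨even_two_mul m, fun k hk => h1 k (Finset.mem_range.2 hk), fun k hk x hx => ?_,
    fun k hk y hy => ?_, ?_, fun k hk => ?_, ?_, ?_, ?_⟩
  · simp [cell, ray, MStar.pt]
  · simp [cell, ray, MStar.pt]
  · funext x; simp only [ray]; rw [c.star.dir_last]
  · have : c.star.pt k 0 0 = c.homeo p := by simp [MStar.pt, c.map_center]
    rw [cell, this, c.homeo.left_inv c.mem_source]
  · intro k hk l hl x hx y hy x' hx' y' hy' hx0 hy0 he
    have := c.homeo.symm.injOn (hmem k hk x hx y hy) (hmem l hl x' hx' y' hy') he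
    exact c.star.pt_disjoint hk hl hx0 hy0 hx'.1 hy'.1 this
  · intro k hk l hl x hx x' hx' hx0 he
    have := c.homeo.symm.injOn (hray k hk x hx) (hray l hl x' hx') he
    exact c.star.ray_disjoint hk hl hx0 hx'.1 this
  -- With s a lower bound for the sines of the sector angles, `MStar.mul_sin_le` shows that a point
  -- of the star of norm less than s δ has both coordinates less than δ.
  · obtain ⟨s, hs, hsk⟩ := c.star.exists_sin_lower
    have hc := (c.homeo.continuousAt c.mem_source).norm
    rw [ContinuousAt, c.map_center, norm_zero] at hc
    have hev := hc.eventually (eventually_lt_nhds (show 0 < s * δ by positivity))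
    filter_upwards [hev, c.homeo.open_source.mem_nhds c.mem_source] with z hz hzs
    have hzt := c.homeo.map_source hzs
    rw [c.target_eq] at hzt
    obtain ⟨k, hk, u, hu, v, hv, huv⟩ := hzt
    have main : ∀ x y : ℝ, 0 ≤ x → 0 ≤ y → c.homeo z = c.star.pt k x y → z ∈ fanSet (2 * m) δ c.cell := by
      intro x y hx hy he
      obtain ⟨b1, b2⟩ := c.star.mul_sin_le hk (x := x) (y := y)
      rw [← he] at b1 b2
      rw [abs_of_nonneg hx] at b1
      rw [abs_of_nonneg hy] at b2
      have s1 := hsk k hk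
      refine ⟨k, hk, x, ⟨hx, ?_⟩, y, ⟨hy, ?_⟩, ?_⟩
      · by_contra hcon; push Not at hcon; nlinarith
      · by_contra hcon; push Not at hcon; nlinarith
      · rw [cell, ← he, c.homeo.left_inv hzs]
    by_cases he : Even k
    · exact main u v hu.1 hv.1 (by rw [huv, c.star.point_even he])
    · exact main v u hv.1 hu.1 (by rw [huv, c.star.point_odd he])

end StarChart

end

/-! ### Chart independence of the asymptotic directions, and the angle in a cell -/

section

variable {Ω : Set ℂ} {ψ : ℂ → E3}

/-- The velocity of a curve determines the velocity of the normal along the curve. -/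
lemma IsBranchedPSImmersion.normal_deriv_unique (hψ : IsBranchedPSImmersion Ω ψ) {z : ℂ}
    (hz : z ∈ Ω) {c₁ c₂ : ℝ → ℂ} {X : ℂ} {W₁ W₂ : E3} (h1 : c₁ 0 = z) (h2 : c₂ 0 = z)
    (d1 : HasDerivWithinAt c₁ X (Ici 0) 0) (d2 : HasDerivWithinAt c₂ X (Ici 0) 0)
    (n1 : HasDerivWithinAt (fun s => normal ψ (c₁ s)) W₁ (Ici 0) 0)
    (n2 : HasDerivWithinAt (fun s => normal ψ (c₂ s)) W₂ (Ici 0) 0) : W₁ = W₂ := by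
  obtain ⟨C, t, ht, hC⟩ := hψ.exists_lipschitz_normal hz
  have d3 := d1.sub d2
  rw [sub_self] at d3
  have c1 := d1.continuousWithinAt.preimage_mem_nhdsWithin (t := t) (by rw [h1]; exact ht)
  have c2 := d2.continuousWithinAt.preimage_mem_nhdsWithin (t := t) (by rw [h2]; exact ht)
  have n3 := hasDerivWithinAt_zero_of_norm_le d3
    (g := (fun s => normal ψ (c₁ s)) - fun s => normal ψ (c₂ s)) (C := C) (by
      filter_upwards [c1, c2] with s hs hs'
      simpa [h1, h2] using hC _ hs _ hs')
  exact sub_eq_zero.1 ((uniqueDiffWithinAt_Ici (0 : ℝ)).eq_deriv _ (n1.sub n2) n3)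

lemma exists_coords {A B : ℂ} (h : planarDet A B ≠ 0) (X : ℂ) : ∃ p q : ℝ, X = p * A + q * B := by
  refine ⟨planarDet X B / planarDet A B, planarDet A X / planarDet A B, ?_⟩
  have h' : (planarDet A B : ℂ) ≠ 0 := by exact_mod_cast h
  push_cast
  field_simp
  apply Complex.ext <;> simp [planarDet] <;> ring

lemma eventually_mem_Icc {x δ p : ℝ} (hx : x ∈ Ico 0 δ) (h : 0 < x ∨ 0 ≤ p) :
    ∀ᶠ s in 𝓝[≥] (0 : ℝ), x + s * p ∈ Icc 0 δ := by
  have hc : Tendsto (fun s : ℝ => x + s * p) (𝓝[≥] 0) (𝓝 x) := by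
    have : Continuous fun s : ℝ => x + s * p := by fun_prop
    simpa using (this.tendsto 0).mono_left nhdsWithin_le_nhds
  have h1 := hc.eventually (eventually_lt_nhds hx.2)
  rcases h with h | h
  · filter_upwards [h1, hc.eventually (eventually_gt_nhds h)] with s a b using ⟨b.le, a.le⟩
  · filter_upwards [h1, self_mem_nhdsWithin] with s a b
    exact ⟨add_nonneg hx.1 (mul_nonneg b h), a.le⟩

/-- The conditions on p and q say that the line enters the square, so that a right derivative makes
sense also on the near edges. -/
lemma HasPartials.hasDerivWithinAt_line {E : Type*} [NormedAddCommGroup E] [NormedSpace ℝ E]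
    {δ : ℝ} {f fu fv : ℝ → ℝ → E} (h : HasPartials (Icc 0 δ) (Icc 0 δ) f fu fv) {x y p q : ℝ}
    (hx : x ∈ Ico 0 δ) (hy : y ∈ Ico 0 δ) (hp : 0 < x ∨ 0 ≤ p) (hq : 0 < y ∨ 0 ≤ q) :
    HasDerivWithinAt (fun s => f (x + s * p) (y + s * q)) (p • fu x y + q • fv x y) (Ici 0) 0 := by
  have hd := h.hasFDerivWithinAt (convex_Icc _ _) (convex_Icc _ _) (z := (x, y))
    ⟨Ico_subset_Icc_self hx, Ico_subset_Icc_self hy⟩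
  set s₀ : Set ℝ := {s | x + s * p ∈ Icc 0 δ ∧ y + s * q ∈ Icc 0 δ} ∩ Ici 0 with hs₀
  have hs : s₀ ∈ 𝓝[≥] (0 : ℝ) :=
    inter_mem ((eventually_mem_Icc hx hp).and (eventually_mem_Icc hy hq)) self_mem_nhdsWithin
  have a1 : HasDerivWithinAt (fun s : ℝ => x + s * p) p s₀ 0 := by
    simpa using ((hasDerivWithinAt_id (0 : ℝ) s₀).mul_const p).const_add x
  have a2 : HasDerivWithinAt (fun s : ℝ => y + s * q) q s₀ 0 := by
    simpa using ((hasDerivWithinAt_id (0 : ℝ) s₀).mul_const q).const_add y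
  have e0 : ((x + 0 * p, y + 0 * q) : ℝ × ℝ) = (x, y) := by simp
  have := HasFDerivWithinAt.comp_hasDerivWithinAt (0 : ℝ) (l := fun w : ℝ × ℝ => f w.1 w.2)
    (by rw [e0]; exact hd) (a1.prodMk a2) (t := Icc 0 δ ×ˢ Icc 0 δ) (fun s hs => hs.1)
  exact (this.congr_deriv (by simp)).mono_of_mem_nhdsWithin hs

/-- A curve through a point of a cell whose normal rotates like along an asymptotic curve is
tangent to one of the families of the cell. -/
lemma IsNet.tangent_eq (hψ : IsBranchedPSImmersion Ω ψ) {ε δ : ℝ} {P Px Py : ℝ → ℝ → ℂ}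
    (h : IsNet Ω ψ ε δ P Px Py) {x y p q : ℝ} (hε : ε = 1 ∨ ε = -1)
    (hx : x ∈ Ico 0 δ) (hy : y ∈ Ico 0 δ) (hp : 0 < x ∨ 0 ≤ p) (hq : 0 < y ∨ 0 ≤ q)
    {c : ℝ → ℂ} {X : ℂ} {ε' : ℝ} (hc : c 0 = P x y)
    (hd : HasDerivWithinAt c X (Ici 0) 0)
    (hn : HasDerivWithinAt (fun s => normal ψ (c s))
      (ε' • fderiv ℝ ψ (P x y) (Complex.I * X)) (Ici 0) 0)
    (hX : X = p * Px x y + q * Py x y) : (ε' = ε → q = 0) ∧ (ε' = -ε → p = 0) := by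
  have hx' := Ico_subset_Icc_self hx
  have hy' := Ico_subset_Icc_self hy
  have hΩ := h.maps x hx' y hy'
  have d2 := h.part.hasDerivWithinAt_line hx hy hp hq
  have n2 := h.part_normal.hasDerivWithinAt_line hx hy hp hq
  rw [Complex.real_smul, Complex.real_smul, ← hX] at d2
  have key := hψ.normal_deriv_unique hΩ hc (by simp) hd d2 hn n2
  have hdet := h.det_ne x hx' y hy'
  -- Since the velocity of the normal depends only on the velocity of the curve, the normal velocity
  -- along the coordinate line (p, q) must be the prescribed one. The coordinate line contributes p
  -- with sign ε and q with sign -ε, so one of them has to vanish.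
  have e1 : ε' * (Complex.I * X) = ε * (Complex.I * (p * Px x y - q * Py x y)) := by
    refine hψ.fderiv_injective hΩ ?_
    rw [← Complex.real_smul, ← Complex.real_smul, map_smul, map_smul, key]
    rw [show (Complex.I * (p * Px x y - q * Py x y) : ℂ) = p • (Complex.I * Px x y)
      - q • (Complex.I * Py x y) by simp only [Complex.real_smul]; ring, map_sub, map_smul, map_smul,
      smul_sub, smul_neg, smul_comm p ε, smul_comm q ε, sub_eq_add_neg]
  have hI := Complex.I_ne_zero
  have e2 : (ε' : ℂ) * X = ε * (p * Px x y - q * Py x y) := by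
    apply mul_left_cancel₀ hI
    linear_combination e1
  rw [hX] at e2
  have hεne : (ε : ℂ) ≠ 0 := by rcases hε with rfl | rfl <;> norm_num
  constructor
  · rintro rfl
    have : (q : ℂ) * Py x y = 0 := by
      have := mul_left_cancel₀ hεne e2
      linear_combination this / 2
    have := (mul_eq_zero.1 this).resolve_right (planarDet_ne_zero_right hdet)
    exact_mod_cast this
  · rintro rfl
    have : (p : ℂ) * Px x y = 0 := by
      refine mul_left_cancel₀ hεne ?_
      push_cast at e2
      linear_combination -e2 / 2
    have := (mul_eq_zero.1 this).resolve_right (planarDet_ne_zero_left hdet)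
    exact_mod_cast this

/-- `U` and `V` are the tangent vectors of the two families of asymptotic curves in some sector
at `z`. -/
def IsFrame (Ω : Set ℂ) (ψ : ℂ → E3) (z U V : ℂ) : Prop :=
  ∃ (a b : ℝ) (F : ℝ → ℝ → ℂ), IsSector Ω ψ a b F ∧ ∃ u ∈ Ico 0 a, ∃ v ∈ Ico 0 b,
    F u v = z ∧ U = IsSector.tu a F u v ∧ V = IsSector.tv b F u v

lemma hasDerivWithinAt_shift {E : Type*} [NormedAddCommGroup E] [NormedSpace ℝ E] {f : ℝ → E}
    {X : E} {a u : ℝ} (hu : u ∈ Ico 0 a) (h : HasDerivWithinAt f X (Ico 0 a) u) :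
    HasDerivWithinAt (fun s => f (u + s)) X (Ici 0) 0 := by
  have h1 : HasDerivWithinAt (fun s : ℝ => u + s) 1 (Ico 0 (a - u)) 0 :=
    (hasDerivWithinAt_id _ _).const_add u
  have h2 := HasDerivWithinAt.scomp (t' := Ico 0 a) (0 : ℝ) (by simpa using h) h1
    (fun s hs => ⟨by linarith [hu.1, hs.1], by linarith [hs.2]⟩)
  rw [one_smul] at h2
  refine h2.mono_of_mem_nhdsWithin ?_
  exact Ico_mem_nhdsGE (by linarith [hu.2])

lemma IsFrame.curves (hψ : IsBranchedPSImmersion Ω ψ) {z U V : ℂ} (h : IsFrame Ω ψ z U V) :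
    U ≠ 0 ∧ V ≠ 0 ∧
    (∃ c : ℝ → ℂ, c 0 = z ∧ HasDerivWithinAt c U (Ici 0) 0 ∧
      HasDerivWithinAt (fun s => normal ψ (c s)) ((1 : ℝ) • fderiv ℝ ψ z (Complex.I * U)) (Ici 0) 0) ∧
    ∃ c : ℝ → ℂ, c 0 = z ∧ HasDerivWithinAt c V (Ici 0) 0 ∧
      HasDerivWithinAt (fun s => normal ψ (c s)) ((-1 : ℝ) • fderiv ℝ ψ z (Complex.I * V)) (Ici 0) 0 := by
  obtain ⟨a, b, F, hF, u, hu, v, hv, rfl, rfl, rfl⟩ := h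
  have hN := IsSector.hasDerivWithinAt_normal hψ hF hu hv
  have hP := IsSector.hasPartials hψ hF
  refine ⟨IsSector.tu_ne_zero hψ hF hu hv, IsSector.tv_ne_zero hψ hF hu hv,
    ⟨fun s => F (u + s) v, by simp, hasDerivWithinAt_shift hu (hP.hu u hu v hv), ?_⟩,
    ⟨fun s => F u (v + s), by simp, hasDerivWithinAt_shift hv (hP.hv u hu v hv), ?_⟩⟩
  · rw [one_smul]
    exact hasDerivWithinAt_shift (f := fun s => normal ψ (F s v)) hu hN.1
  · rw [neg_one_smul]
    exact hasDerivWithinAt_shift (f := fun s => normal ψ (F u s)) hv hN.2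

/-- The asymptotic directions at an interior point of a cell are unique. -/
lemma IsFrame.eq_smul (hψ : IsBranchedPSImmersion Ω ψ) {δ : ℝ} {P Px Py : ℝ → ℝ → ℂ}
    (h : IsNet Ω ψ 1 δ P Px Py) {x y : ℝ} (hx : x ∈ Ioo 0 δ) (hy : y ∈ Ioo 0 δ) {U V : ℂ}
    (hf : IsFrame Ω ψ (P x y) U V) :
    ∃ s t : ℝ, s ≠ 0 ∧ t ≠ 0 ∧ U = s * Px x y ∧ V = t * Py x y := by
  obtain ⟨hU, hV, ⟨c1, a1, a2, a3⟩, c2, b1, b2, b3⟩ := hf.curves hψ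
  have hdet := h.det_ne x (Ioo_subset_Icc_self hx) y (Ioo_subset_Icc_self hy)
  obtain ⟨p, q, hpq⟩ := exists_coords hdet U
  obtain ⟨p', q', hpq'⟩ := exists_coords hdet V
  have e1 := (h.tangent_eq hψ (Or.inl rfl) (Ioo_subset_Ico_self hx) (Ioo_subset_Ico_self hy)
    (Or.inl hx.1) (Or.inl hy.1) a1 a2 a3 hpq).1 rfl
  have e2 := (h.tangent_eq hψ (Or.inl rfl) (Ioo_subset_Ico_self hx) (Ioo_subset_Ico_self hy)
    (Or.inl hx.1) (Or.inl hy.1) b1 b2 b3 hpq').2 rfl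
  rw [e1] at hpq
  rw [e2] at hpq'
  simp only [Complex.ofReal_zero, zero_mul, add_zero, zero_add] at hpq hpq'
  refine ⟨p, q', ?_, ?_, hpq, hpq'⟩
  · rintro rfl; simp at hpq; exact hU hpq
  · rintro rfl; simp at hpq'; exact hV hpq'

/-- A choice of asymptotic directions at each point, with the angle `φ` between them. -/
structure IsFrameField (Ω : Set ℂ) (ψ : ℂ → E3) (ω φ : ℂ → ℝ) (U V : ℂ → ℂ) : Prop where
  frame : ∀ z ∈ Ω, IsFrame Ω ψ z (U z) (V z)
  angle : ∀ z ∈ Ω, φ z = InnerProductGeometry.angle (U z)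
    (Real.sign (ω z * planarDet (U z) (V z)) • V z)

lemma IsBranchedPSImmersion.angle_eq (hψ : IsBranchedPSImmersion Ω ψ) {z : ℂ} (hz : z ∈ Ω)
    (X Y : ℂ) : InnerProductGeometry.angle (fderiv ℝ ψ z X) (fderiv ℝ ψ z Y)
      = InnerProductGeometry.angle X Y := by
  have hl := hψ.lam_pos hz
  have hn : ∀ X : ℂ, ‖fderiv ℝ ψ z X‖ = Real.sqrt (lam z) * ‖X‖ := fun X => by
    have := conformal_norm_sq (hψ.inner_eq hz) X
    rw [← Real.sqrt_sq (norm_nonneg (fderiv ℝ ψ z X)), this, Real.sqrt_mul hl.le,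
      Real.sqrt_sq (norm_nonneg _)]
  unfold InnerProductGeometry.angle
  rw [hψ.inner_eq hz, hn, hn]
  congr 1
  have h2 := Real.mul_self_sqrt hl.le
  have h3 : Real.sqrt (lam z) * ‖X‖ * (Real.sqrt (lam z) * ‖Y‖) = lam z * (‖X‖ * ‖Y‖) := by
    linear_combination ‖X‖ * ‖Y‖ * h2
  rw [h3, mul_div_mul_left _ _ hl.ne']

/-- At each point the frame is taken from the very sector in which the value of φ is computed. No
continuity of the choice is needed. -/
lemma exists_frameField (hψ : IsBranchedPSImmersion Ω ψ) {ω φ : ℂ → ℝ}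
    (hφ : ∀ x ∈ Ω, IsAsymptoticAngle Ω ψ ω x (φ x)) :
    ∃ U V : ℂ → ℂ, IsFrameField Ω ψ ω φ U V := by
  have key : ∀ z : ℂ, ∃ W : ℂ × ℂ, z ∈ Ω → IsFrame Ω ψ z W.1 W.2 ∧
      φ z = InnerProductGeometry.angle W.1 (Real.sign (ω z * planarDet W.1 W.2) • W.2) := by
    intro z
    by_cases hz : z ∈ Ω
    · obtain ⟨p, m, c, k, hk, u, hu, v, hv, hz', hθ⟩ := hφ z hz
      have hF := c.isSector hk
      refine ⟨(IsSector.tu (c.uLen k) (c.param k) u v, IsSector.tv (c.vLen k) (c.param k) u v),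
        fun _ => ⟨⟨_, _, _, hF, u, hu, v, hv, hz', rfl, rfl⟩, ?_⟩⟩
      rw [hθ, StarChart.phi]
      have e1 := IsSector.fderiv_tu hψ hF hu hv
      have e2 := IsSector.fderiv_tv hψ hF hu hv
      change InnerProductGeometry.angle (partialU (Ico 0 (c.uLen k)) (fun s t => ψ (c.param k s t)) u v)
        (c.sigma ω k u v • partialV (Ico 0 (c.vLen k)) (fun s t => ψ (c.param k s t)) u v) = _
      rw [e1, e2, ← map_smul, hz', hψ.angle_eq hz]
      simp only
      congr 2
      rw [← hz']
      rfl
    · exact ⟨(0, 0), fun h => absurd h hz⟩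
  choose W hW using key
  exact ⟨fun z => (W z).1, fun z => (W z).2, fun z hz => (hW z hz).1, fun z hz => (hW z hz).2⟩

/-- The angle-weighted covariant Hessian of a test function in the asymptotic directions. -/
def hessWeight (ω φ : ℂ → ℝ) (U V : ℂ → ℂ) (χ : ℂ → ℝ) (z : ℂ) : ℝ :=
  Real.sign (ω z) * φ z * covHess χ z (U z) (V z) / planarDet (U z) (V z)

lemma netAngle_swap {Px Py : ℝ → ℝ → ℂ} {x y : ℝ} (h : planarDet (Px y x) (Py y x) ≠ 0) :
    netAngle (fun x y => Py y x) (fun x y => Px y x) x y = -netAngle Px Py y x := by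
  unfold netAngle
  have : (Py y x / Px y x).arg ≠ Real.pi := by
    intro h0
    have := (Complex.arg_eq_pi_iff.1 h0).2
    rw [planarDet_eq_im, this, mul_zero] at h
    exact h rfl
  rw [← inv_div, Complex.arg_inv, if_neg this]

namespace IsNet

variable {δ : ℝ} {P Px Py : ℝ → ℝ → ℂ} {ω φ : ℂ → ℝ} {U V : ℂ → ℂ}

lemma real_sign_mul (a b : ℝ) : Real.sign (a * b) = Real.sign a * Real.sign b := by
  rcases lt_trichotomy a 0 with h | h | h <;> rcases lt_trichotomy b 0 with h' | h' | h' <;>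
    simp [Real.sign_of_neg, Real.sign_of_pos, mul_neg_of_neg_of_pos, mul_neg_of_pos_of_neg,
      mul_pos_of_neg_of_neg, h, h', Real.sign_zero]

/-- The frame differs from the tangent vectors of the cell by real factors (`IsFrame.eq_smul`).
These factors change neither the angle, because of the sign in its definition, nor the quotient of
Hessian and determinant. If o τ = -1, the second direction is reversed and φ is the supplement of
the angle of the cell; this is the source of the constant π (1 - o τ) / 2. -/
lemma phi_eq_one (hψ : IsBranchedPSImmersion Ω ψ) (h : IsNet Ω ψ 1 δ P Px Py)
    (hf : IsFrameField Ω ψ ω φ U V) {τ o : ℝ} (hτ : τ = 1 ∨ τ = -1) (ho : o = 1 ∨ o = -1) {x y : ℝ}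
    (hx : x ∈ Ioo 0 δ) (hy : y ∈ Ioo 0 δ) (hd : 0 < τ * planarDet (Px x y) (Py x y))
    (hω : Real.sign (ω (P x y)) = o) :
    o * τ * φ (P x y) = τ * netAngle Px Py x y - Real.pi * ((1 - o * τ) / 2) ∧
    ∀ χ : ℂ → ℝ, |planarDet (Px x y) (Py x y)| * hessWeight ω φ U V χ (P x y)
      = (τ * netAngle Px Py x y - Real.pi * ((1 - o * τ) / 2)) * covHess χ (P x y) (Px x y) (Py x y) := by
  have hΩ := h.maps x (Ioo_subset_Icc_self hx) y (Ioo_subset_Icc_self hy)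
  obtain ⟨s, t, hs, ht, hU, hV⟩ := (hf.frame _ hΩ).eq_smul hψ h hx hy
  have hdet := h.det_ne x (Ioo_subset_Icc_self hx) y (Ioo_subset_Icc_self hy)
  set A := Px x y
  set B := Py x y
  have hA := planarDet_ne_zero_left hdet
  have hB := planarDet_ne_zero_right hdet
  have e1 : planarDet (U (P x y)) (V (P x y)) = s * t * planarDet A B := by
    rw [hU, hV]; simp [planarDet]; ring
  have hsd : Real.sign (planarDet A B) = τ := by
    rcases hτ with rfl | rfl
    · exact Real.sign_of_pos (by linarith)
    · exact Real.sign_of_neg (by linarith)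
  have hang : InnerProductGeometry.angle A B = τ * netAngle Px Py x y := by
    have := IsNet.angle_mem (Px := Px) (Py := Py) hτ hd
    rw [InnerProductGeometry.angle_comm, Complex.angle_eq_abs_arg hB hA]
    change |netAngle Px Py x y| = _
    rw [← abs_of_pos this.1, abs_mul]
    rcases hτ with rfl | rfl <;> simp
  have hφ : φ (P x y) = InnerProductGeometry.angle A ((o * τ) • B) := by
    rw [hf.angle _ hΩ, e1, real_sign_mul, real_sign_mul, real_sign_mul, hω, hsd, hU, hV,
      ← Complex.real_smul, ← Complex.real_smul, smul_smul]
    rcases lt_or_gt_of_ne hs with h1 | h1 <;> rcases lt_or_gt_of_ne ht with h2 | h2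
    · rw [Real.sign_of_neg h1, Real.sign_of_neg h2,
        show s • A = -((-s) • A) by simp,
        show (o * (-1 * -1 * τ) * t) • B = -((-t) • ((o * τ) • B)) by
          rw [smul_smul, ← neg_smul]; congr 1; ring,
        InnerProductGeometry.angle_neg_neg, InnerProductGeometry.angle_smul_left_of_pos _ _ (by linarith),
        InnerProductGeometry.angle_smul_right_of_pos _ _ (by linarith)]
    · rw [Real.sign_of_neg h1, Real.sign_of_pos h2,
        show s • A = -((-s) • A) by simp,
        show (o * (-1 * 1 * τ) * t) • B = -(t • ((o * τ) • B)) by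
          rw [smul_smul, ← neg_smul]; congr 1; ring,
        InnerProductGeometry.angle_neg_neg, InnerProductGeometry.angle_smul_left_of_pos _ _ (by linarith),
        InnerProductGeometry.angle_smul_right_of_pos _ _ h2]
    · rw [Real.sign_of_pos h1, Real.sign_of_neg h2,
        show (o * (1 * -1 * τ) * t) • B = (-t) • ((o * τ) • B) by
          rw [smul_smul]; congr 1; ring,
        InnerProductGeometry.angle_smul_left_of_pos _ _ h1,
        InnerProductGeometry.angle_smul_right_of_pos _ _ (by linarith)]
    · rw [Real.sign_of_pos h1, Real.sign_of_pos h2,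
        show (o * (1 * 1 * τ) * t) • B = t • ((o * τ) • B) by
          rw [smul_smul]; congr 1; ring,
        InnerProductGeometry.angle_smul_left_of_pos _ _ h1,
        InnerProductGeometry.angle_smul_right_of_pos _ _ h2]
  have key : o * τ * φ (P x y) = τ * netAngle Px Py x y - Real.pi * ((1 - o * τ) / 2) := by
    have hoτ : o * τ = 1 ∨ o * τ = -1 := by
      rcases ho with rfl | rfl <;> rcases hτ with rfl | rfl <;> norm_num
    rw [hφ, ← hang]
    rcases hoτ with h1 | h1 <;> rw [h1]
    · simp
    · rw [neg_one_smul, InnerProductGeometry.angle_neg_right]; ring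
  refine ⟨key, fun χ => ?_⟩
  rw [← key, tau_abs hτ hd, hessWeight, hω, e1, hU, hV, covHess_smul]
  field_simp

/-- The angle and the Hessian term in an open cell. -/
lemma phi_eq (hψ : IsBranchedPSImmersion Ω ψ) {ε : ℝ} (h : IsNet Ω ψ ε δ P Px Py)
    (hε : ε = 1 ∨ ε = -1)
    (hf : IsFrameField Ω ψ ω φ U V) {τ o : ℝ} (hτ : τ = 1 ∨ τ = -1) (ho : o = 1 ∨ o = -1) {x y : ℝ}
    (hx : x ∈ Ioo 0 δ) (hy : y ∈ Ioo 0 δ) (hd : 0 < τ * planarDet (Px x y) (Py x y))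
    (hω : Real.sign (ω (P x y)) = o) :
    o * τ * ε * φ (P x y) = τ * netAngle Px Py x y - Real.pi * ((1 - o * τ * ε) / 2) ∧
    ∀ χ : ℂ → ℝ, ContDiff ℝ 2 χ → |planarDet (Px x y) (Py x y)| * hessWeight ω φ U V χ (P x y)
      = (τ * netAngle Px Py x y - Real.pi * ((1 - o * τ * ε) / 2))
        * covHess χ (P x y) (Px x y) (Py x y) := by
  rcases hε with rfl | rfl
  · have := h.phi_eq_one hψ hf hτ ho hx hy hd hω
    rw [mul_one]
    exact ⟨this.1, fun χ _ => this.2 χ⟩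
  · have h' := h.swap
    rw [neg_neg] at h'
    have hdet := h.det_ne x (Ioo_subset_Icc_self hx) y (Ioo_subset_Icc_self hy)
    have := h'.phi_eq_one hψ hf (τ := -τ) (o := o) (by rcases hτ with rfl | rfl <;> simp) ho hy hx
      (by rw [planarDet_swap]; linarith) hω
    rw [netAngle_swap hdet] at this
    constructor
    · linear_combination this.1
    · intro χ hχ
      have h2 := this.2 χ
      rw [planarDet_swap, abs_neg, covHess_symm hχ] at h2
      rw [h2]
      ring

end IsNet

end

/-! ### Coordinates along curves, the height function of a fan, and uniqueness of rays -/

section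

variable {Ω : Set ℂ} {ψ : ℂ → E3}

lemma continuousOn_leftInverse {α β : Type*} [TopologicalSpace α] [TopologicalSpace β] [T2Space β]
    {K : Set α} (hK : IsCompact K) {f : α → β} (hf : ContinuousOn f K) {g : β → α}
    (hg : ∀ x ∈ K, g (f x) = x) : ContinuousOn g (f '' K) := by
  refine continuousOn_iff_isClosed.2 fun t ht => ⟨f '' (K ∩ t), ?_, ?_⟩
  · exact ((hK.inter_right ht).image_of_continuousOn (hf.mono inter_subset_left)).isClosed
  · ext z
    constructor
    · rintro ⟨hz, x, hx, rfl⟩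
      exact ⟨⟨x, ⟨hx, by simpa [hg x hx] using hz⟩, rfl⟩, x, hx, rfl⟩
    · rintro ⟨⟨x, ⟨hx, hxt⟩, rfl⟩, -⟩
      exact ⟨by simpa [hg x hx] using hxt, x, hx, rfl⟩

/-- The coordinates of a point of a cell. -/
def coord (δ : ℝ) (P : ℝ → ℝ → ℂ) : ℂ → ℝ × ℝ :=
  Function.invFunOn (fun z : ℝ × ℝ => P z.1 z.2) (sq δ)

namespace IsNet

variable {ε δ : ℝ} {P Px Py : ℝ → ℝ → ℂ}

lemma coord_eq (h : IsNet Ω ψ ε δ P Px Py) {x y : ℝ} (hx : x ∈ Icc 0 δ) (hy : y ∈ Icc 0 δ) :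
    coord δ P (P x y) = (x, y) :=
  h.inj.leftInvOn_invFunOn (show (x, y) ∈ sq δ from ⟨hx, hy⟩)

lemma coord_mem {z : ℂ} (hz : z ∈ netImage δ P) : coord δ P z ∈ sq δ := Function.invFunOn_mem hz

lemma map_coord {z : ℂ} (hz : z ∈ netImage δ P) : P (coord δ P z).1 (coord δ P z).2 = z :=
  Function.invFunOn_eq hz

lemma continuousOn_coord (h : IsNet Ω ψ ε δ P Px Py) : ContinuousOn (coord δ P) (netImage δ P) :=
  continuousOn_leftInverse (isCompact_Icc.prod isCompact_Icc) h.cont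
    fun _ hz => h.coord_eq hz.1 hz.2

/-- The coordinates depend continuously on the point because the square is compact, and the
differential of the net is invertible. Differentiability of the curve therefore passes to its
coordinates, even on the edges of the square. -/
lemma hasDerivWithinAt_coord (h : IsNet Ω ψ ε δ P Px Py) {x y p q : ℝ} (hx : x ∈ Icc 0 δ)
    (hy : y ∈ Icc 0 δ) {c : ℝ → ℂ} {S : Set ℝ} (hS : ∀ s ∈ S, c s ∈ netImage δ P)
    (h0 : (0 : ℝ) ∈ S) (hc : c 0 = P x y)
    (hd : HasDerivWithinAt c (p * Px x y + q * Py x y) S 0) :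
    HasDerivWithinAt (fun s => coord δ P (c s)) (p, q) S 0 := by
  have hf := h.part.hasFDerivWithinAt (convex_Icc _ _) (convex_Icc _ _) (z := (x, y)) ⟨hx, hy⟩
  have e0 : coord δ P (c 0) = (x, y) := by rw [hc, h.coord_eq hx hy]
  have hdet := h.det_ne x hx y hy
  have hcont : ContinuousWithinAt (fun s => coord δ P (c s)) S 0 :=
    (h.continuousOn_coord (c 0) (hS 0 h0)).comp hd.continuousWithinAt hS
  refine HasFDerivWithinAt.of_comp_of_isEmbedding (f := fun z : ℝ × ℝ => P z.1 z.2)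
    (f' := pairMap (Px x y) (Py x y)) (h := c) (t := sq δ) ?_ (by rw [e0]; exact hf) ?_ ?_ ?_ h0
  · exact tendsto_nhdsWithin_of_tendsto_nhds_of_eventually_within _ hcont
      (eventually_mem_nhdsWithin.mono fun s hs => coord_mem (hS s hs))
  · exact (pairEquiv hdet).toHomeomorph.isEmbedding
  · refine hd.hasFDerivWithinAt.congr_fderiv ?_
    ext
    simp
  · exact eventually_mem_nhdsWithin.mono fun s hs => map_coord (hS s hs)

/-- Along a curve whose normal rotates like along an asymptotic curve, one of the coordinates in a
cell is stationary. -/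
lemma hasDerivWithinAt_coord_zero (hψ : IsBranchedPSImmersion Ω ψ) (h : IsNet Ω ψ ε δ P Px Py)
    (hε : ε = 1 ∨ ε = -1) {x y : ℝ} (hx : x ∈ Ico 0 δ) (hy : y ∈ Ico 0 δ)
    {c : ℝ → ℂ} {X : ℂ} {ε' : ℝ} (hc : c 0 = P x y) (hd : HasDerivWithinAt c X (Ici 0) 0)
    (hn : HasDerivWithinAt (fun s => normal ψ (c s))
      (ε' • fderiv ℝ ψ (P x y) (Complex.I * X)) (Ici 0) 0) :
    (ε' = ε → HasDerivWithinAt (fun s => (coord δ P (c s)).2) 0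
      ({s | c s ∈ netImage δ P} ∩ Ici 0) 0) ∧
    (ε' = -ε → HasDerivWithinAt (fun s => (coord δ P (c s)).1) 0
      ({s | c s ∈ netImage δ P} ∩ Ici 0) 0) := by
  have hx' := Ico_subset_Icc_self hx
  have hy' := Ico_subset_Icc_self hy
  set S := {s | c s ∈ netImage δ P} ∩ Ici 0 with hS
  have h0 : (0 : ℝ) ∈ S := ⟨⟨(x, y), ⟨hx', hy'⟩, hc.symm⟩, self_mem_Ici⟩
  -- If the times spent in the cell do not accumulate at 0, any value is a derivative within that
  -- set.
  by_cases hacc : AccPt (0 : ℝ) (𝓟 S)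
  · have hdet := h.det_ne x hx' y hy'
    obtain ⟨p, q, hpq⟩ := exists_coords hdet X
    have key := h.hasDerivWithinAt_coord hx' hy' (S := S) (fun s hs => hs.1) h0 hc
      (by rw [← hpq]; exact hd.mono inter_subset_right)
    have k1 : HasDerivWithinAt (fun s => (coord δ P (c s)).1) p S 0 := key.fst
    have k2 : HasDerivWithinAt (fun s => (coord δ P (c s)).2) q S 0 := key.snd
    have hne : (𝓝[S \ {0}] (0 : ℝ)).NeBot := by
      rwa [accPt_principal_iff_nhdsWithin] at hacc
    have pos : ∀ {f : ℝ → ℝ} {f' : ℝ}, HasDerivWithinAt f f' S 0 → f 0 = 0 →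
        (∀ s ∈ S, 0 ≤ f s) → 0 ≤ f' := by
      intro f f' hf hf0 hfp
      refine ge_of_tendsto (hasDerivWithinAt_iff_tendsto_slope.1 hf) ?_
      filter_upwards [self_mem_nhdsWithin] with s hs
      rw [slope_def_field, hf0, sub_zero, sub_zero]
      exact div_nonneg (hfp s hs.1) hs.1.2
    have c0 : coord δ P (c 0) = (x, y) := by rw [hc, h.coord_eq hx' hy']
    have hp : 0 < x ∨ 0 ≤ p := by
      rcases hx.1.eq_or_lt with h1 | h1
      · right
        exact pos k1 (by rw [c0, ← h1]) fun s hs => (coord_mem hs.1).1.1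
      · exact Or.inl h1
    have hq : 0 < y ∨ 0 ≤ q := by
      rcases hy.1.eq_or_lt with h1 | h1
      · right
        exact pos k2 (by rw [c0, ← h1]) fun s hs => (coord_mem hs.1).2.1
      · exact Or.inl h1
    have ht := h.tangent_eq hψ hε hx hy hp hq hc hd hn hpq
    exact ⟨fun he => by have := ht.1 he; rwa [this] at k2,
      fun he => by have := ht.2 he; rwa [this] at k1⟩
  · exact ⟨fun _ => (HasFDerivWithinAt.of_not_accPt hacc).congr_fderiv rfl,
      fun _ => (HasFDerivWithinAt.of_not_accPt hacc).congr_fderiv rfl⟩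

end IsNet

namespace IsFan

variable {p : ℂ} {n : ℕ} {δ : ℝ} {P Px Py : ℕ → ℝ → ℝ → ℂ} {R : ℕ → ℝ → ℂ}

/-- The coordinate in cell `k` that vanishes on the rays of the parity of `e`. -/
def cellHeight (e k : ℕ) (z : ℝ × ℝ) : ℝ := if k % 2 = e % 2 then z.2 else z.1

lemma eq_center (h : IsFan Ω ψ p n δ P Px Py R) {k l : ℕ} (hk : k < n) (hl : l < n) {x y : ℝ}
    (hx : x ∈ Icc 0 δ) (hy : y ∈ Icc 0 δ) (he : P l x y = P k 0 0) : x = 0 ∧ y = 0 := by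
  rw [h.center k hk, ← h.center l hl] at he
  have := (h.net l hl).inj (x₁ := (x, y)) ⟨hx, hy⟩ (x₂ := (0, 0)) ⟨h.zero_mem, h.zero_mem⟩ he
  exact Prod.mk_inj.1 this

lemma cycPred_parity {n k : ℕ} (hn : Even n) (hk : k < n) (e : ℕ) :
    cycPred n k % 2 = e % 2 ↔ ¬ (k % 2 = e % 2) := by
  obtain ⟨r, rfl⟩ := hn
  unfold cycPred
  split_ifs <;> omega

/-- Different cells meet only along rays. The two cells at ray k have opposite parities, so the
definition picks matching coordinates: the vanishing one on both sides if k has the parity of e, and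
the parameter of the ray on both sides otherwise. -/
lemma cellHeight_eq (h : IsFan Ω ψ p n δ P Px Py R) (e : ℕ) {k l : ℕ} (hk : k < n) (hl : l < n)
    {x y x' y' : ℝ} (hx : x ∈ Icc 0 δ) (hy : y ∈ Icc 0 δ) (hx' : x' ∈ Icc 0 δ) (hy' : y' ∈ Icc 0 δ)
    (he : P k x y = P l x' y') : cellHeight e k (x, y) = cellHeight e l (x', y') := by
  have z0 := h.zero_mem
  have ray : ∀ {k l : ℕ} {x x' y' : ℝ}, k < n → l < n → x ∈ Icc 0 δ → x' ∈ Icc 0 δ → y' ∈ Icc 0 δ →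
      P k x 0 = P l x' y' → cellHeight e k (x, 0) = cellHeight e l (x', y') := by
    intro k l x x' y' hk hl hx hx' hy' he
    rcases hx.1.eq_or_lt with h1 | h1
    · subst h1
      obtain ⟨rfl, rfl⟩ := h.eq_center hk hl hx' hy' he.symm
      simp [cellHeight]
    · rcases h.eq_ray hk hl hx h1 hx' hy' (by rw [← he, h.left k hk x hx]) with ⟨rfl, rfl, rfl⟩ | ⟨rfl, rfl, rfl⟩
      · rfl
      · have := cycPred_parity h.even hk e
        unfold cellHeight
        by_cases hke : k % 2 = e % 2
        · rw [if_pos hke, if_neg (fun hc => this.1 hc hke)]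
        · rw [if_neg hke, if_pos (this.2 hke)]
  rcases hy.1.eq_or_lt with h2 | h2
  · subst h2
    exact ray hk hl hx hx' hy' he
  rcases hx.1.eq_or_lt with h1 | h1
  · subst h1
    obtain ⟨k', hk', -, hpr⟩ := h.ray_succ hk
    subst hpr
    rw [h.right_pred_eq hk' hy] at he
    have e1 := ray hk' hl hy hx' hy' he
    have e2 := ray hk' (cycPred_lt hk') hy z0 hy (h.right_pred_eq hk' hy).symm
    rw [← e2, e1]
  · have hkl := h.disj k hk l hl x hx y hy x' hx' y' hy' h1 h2 he
    subst hkl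
    have := (h.net k hk).inj (x₁ := (x, y)) ⟨hx, hy⟩ (x₂ := (x', y')) ⟨hx', hy'⟩ he
    rw [this]

/-- The function on the fan that is given by `cellHeight`. -/
def height (n : ℕ) (δ : ℝ) (P : ℕ → ℝ → ℝ → ℂ) (e : ℕ) (z : ℂ) : ℝ :=
  open Classical in
  if h : ∃ k < n, z ∈ netImage δ (P k) then
    cellHeight e h.choose (coord δ (P h.choose) z) else 0

lemma height_eq (h : IsFan Ω ψ p n δ P Px Py R) (e : ℕ) {k : ℕ} (hk : k < n) {z : ℂ}
    (hz : z ∈ netImage δ (P k)) : height n δ P e z = cellHeight e k (coord δ (P k) z) := by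
  have hex : ∃ k < n, z ∈ netImage δ (P k) := ⟨k, hk, hz⟩
  rw [height, dif_pos hex]
  obtain ⟨hl, hlz⟩ := hex.choose_spec
  have m1 := IsNet.coord_mem hlz
  have m2 := IsNet.coord_mem hz
  exact h.cellHeight_eq e hl hk (x := (coord δ (P hex.choose) z).1) (y := (coord δ (P hex.choose) z).2)
    (x' := (coord δ (P k) z).1) (y' := (coord δ (P k) z).2) m1.1 m1.2 m2.1 m2.2
    ((IsNet.map_coord hlz).trans (IsNet.map_coord hz).symm)

lemma continuousOn_height (h : IsFan Ω ψ p n δ P Px Py R) (e : ℕ) :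
    ContinuousOn (height n δ P e) (⋃ k : Fin n, netImage δ (P k)) := by
  intro z hz
  unfold ContinuousWithinAt
  rw [nhdsWithin_iUnion, tendsto_iSup]
  intro k
  by_cases hzk : z ∈ netImage δ (P k)
  · have h1 : ContinuousOn (fun w => cellHeight e k (coord δ (P k) w)) (netImage δ (P k)) := by
      have := (h.net k k.2).continuousOn_coord
      unfold cellHeight
      split_ifs
      · exact continuous_snd.comp_continuousOn this
      · exact continuous_fst.comp_continuousOn this
    exact (h1.congr fun w hw => h.height_eq e k.2 hw) z hzk
  · have : 𝓝[netImage δ (P k)] z = ⊥ := by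
      rw [← notMem_closure_iff_nhdsWithin_eq_bot,
        (h.net k k.2).isCompact_netImage.isClosed.closure_eq]
      exact hzk
    rw [this]
    exact tendsto_bot

lemma fanSet_subset : fanSet n δ P ⊆ ⋃ k : Fin n, netImage δ (P k) := by
  rintro z ⟨k, hk, x, hx, y, hy, rfl⟩
  exact mem_iUnion.2 ⟨⟨k, hk⟩, (x, y), ⟨Ico_subset_Icc_self hx, Ico_subset_Icc_self hy⟩, rfl⟩

/-- A curve whose normal rotates like along an asymptotic curve has stationary height. -/
lemma hasDerivWithinAt_height (hψ : IsBranchedPSImmersion Ω ψ) (h : IsFan Ω ψ p n δ P Px Py R)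
    (e : ℕ) {c : ℝ → ℂ} {X : ℂ} (hd : HasDerivWithinAt c X (Ici 0) 0)
    (hn : HasDerivWithinAt (fun s => normal ψ (c s))
      ((-1 : ℝ) ^ e • fderiv ℝ ψ (c 0) (Complex.I * X)) (Ici 0) 0)
    (hm : ∀ᶠ s in 𝓝[≥] (0 : ℝ), c s ∈ fanSet n δ P) :
    HasDerivWithinAt (fun s => height n δ P e (c s)) 0 (Ici 0) 0 := by
  have h0 : c 0 ∈ fanSet n δ P := hm.self_of_nhdsWithin self_mem_Ici
  -- The curve may change cells infinitely often near time 0. The derivative is therefore found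
  -- within the set of times spent in each closed cell, and these finitely many sets are united
  -- afterwards.
  have cell : ∀ k < n, HasDerivWithinAt (fun s => height n δ P e (c s)) 0
      ({s | c s ∈ netImage δ (P k)} ∩ Ici 0) 0 := by
    intro k hk
    by_cases hz : c 0 ∈ netImage δ (P k)
    · obtain ⟨⟨x, y⟩, ⟨hx, hy⟩, hxy⟩ := id hz
      simp only at hx hy hxy
      have hx' : x ∈ Ico 0 δ := ⟨hx.1, lt_of_le_of_ne hx.2 fun hc =>
        h.edge_notMem hk hx hy (Or.inl hc) (hxy ▸ h0)⟩
      have hy' : y ∈ Ico 0 δ := ⟨hy.1, lt_of_le_of_ne hy.2 fun hc =>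
        h.edge_notMem hk hx hy (Or.inr hc) (hxy ▸ h0)⟩
      have hε : ((-1 : ℝ) ^ k = 1 ∨ (-1 : ℝ) ^ k = -1) := neg_one_pow_eq_or ℝ k
      have key := (h.net k hk).hasDerivWithinAt_coord_zero hψ hε hx' hy' hxy.symm hd
        (by rw [hxy]; exact hn)
      refine HasDerivWithinAt.congr (f := fun s => cellHeight e k (coord δ (P k) (c s))) ?_
        (fun s hs => h.height_eq e hk hs.1) (h.height_eq e hk hz)
      unfold cellHeight
      split_ifs with hke
      · refine key.1 ?_
        rw [neg_one_pow_eq_pow_mod_two, ← hke, ← neg_one_pow_eq_pow_mod_two]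
      · refine key.2 ?_
        rcases Nat.mod_two_eq_zero_or_one k with a | a <;>
          rcases Nat.mod_two_eq_zero_or_one e with b | b
        · omega
        · rw [neg_one_pow_eq_pow_mod_two, b, neg_one_pow_eq_pow_mod_two (n := k), a]; simp
        · rw [neg_one_pow_eq_pow_mod_two, b, neg_one_pow_eq_pow_mod_two (n := k), a]; simp
        · omega
    · refine (HasFDerivWithinAt.of_not_accPt fun hacc => hz ?_).congr_fderiv rfl
      have h1 : (0 : ℝ) ∈ closure ({s | c s ∈ netImage δ (P k)} ∩ Ici 0) := hacc.clusterPt.mem_closure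
      have h2 : c 0 ∈ closure (netImage δ (P k)) := by
        have := (hd.continuousWithinAt.mono
          (inter_subset_right : {s | c s ∈ netImage δ (P k)} ∩ Ici 0 ⊆ _)).mem_closure h1
          (t := netImage δ (P k)) fun s hs => hs.1
        exact this
      rwa [(h.net k hk).isCompact_netImage.isClosed.closure_eq] at h2
  have union : ∀ N ≤ n, HasDerivWithinAt (fun s => height n δ P e (c s)) 0
      {s | (∃ k < N, c s ∈ netImage δ (P k)) ∧ s ∈ Ici (0 : ℝ)} 0 := by
    intro N
    induction N with
    | zero =>
      intro _
      simp only [Nat.not_lt_zero, false_and, exists_false, ofPred_false]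
      exact HasFDerivWithinAt.of_not_accPt (by simp [AccPt])
    | succ N ih =>
      intro hN
      refine ((ih (by omega)).union (cell N (by omega))).mono ?_
      rintro s ⟨⟨k, hk, hs⟩, hs0⟩
      rcases Nat.lt_succ_iff_lt_or_eq.1 hk with h1 | rfl
      · exact Or.inl ⟨⟨k, h1, hs⟩, hs0⟩
      · exact Or.inr ⟨hs, hs0⟩
  refine (union n le_rfl).mono_of_mem_nhdsWithin ?_
  filter_upwards [hm, self_mem_nhdsWithin] with s hs hs0
  obtain ⟨k, hk, x, hx, y, hy, hxy⟩ := hs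
  exact ⟨⟨k, hk, (x, y), ⟨Ico_subset_Icc_self hx, Ico_subset_Icc_self hy⟩, hxy⟩, hs0⟩

/-- The rays of any other fan at the centre lie in the rays of the same parity. -/
theorem ray_subset (hψ : IsBranchedPSImmersion Ω ψ) (h : IsFan Ω ψ p n δ P Px Py R)
    {n' : ℕ} {δ' : ℝ} {P' Px' Py' : ℕ → ℝ → ℝ → ℂ} {R' : ℕ → ℝ → ℂ}
    (h' : IsFan Ω ψ p n' δ' P' Px' Py' R') {e : ℕ} (he : e < n')
    (hsub : ∀ x ∈ Icc 0 δ', R' e x ∈ interior (fanSet n δ P)) {x : ℝ} (hx : x ∈ Ico 0 δ') :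
    ∃ k < n, k % 2 = e % 2 ∧ ∃ s ∈ Ico 0 δ, R' e x = R k s := by
  have z0 := h.zero_mem
  have hRc : ContinuousOn (R' e) (Icc 0 δ') := fun x hx =>
    (h'.hasDerivWithinAt_ray he hx).continuousWithinAt
  have hcont : ContinuousOn (fun x => height n δ P e (R' e x)) (Icc 0 δ') :=
    (h.continuousOn_height e).comp hRc fun x hx => fanSet_subset (interior_subset (hsub x hx))
  -- Along ray e of the other fan the normal rotates with the sign (-1)^e. Hence the height is
  -- continuous with zero right derivative, so it keeps the value 0 that it has at the centre.
  -- Height zero means lying on a ray of the parity of e.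
  have hconst := constant_of_has_deriv_right_zero hcont (fun x hx => by
    have hx' := Ico_subset_Icc_self hx
    have mem : ∀ᶠ s in 𝓝[≥] (0 : ℝ), x + s ∈ Icc 0 δ' := by
      have := eventually_mem_Icc hx (p := 1) (Or.inr zero_le_one)
      simpa using this
    have d1 := (h'.net e he).part.hasDerivWithinAt_line hx ⟨le_rfl, h'.pos⟩ (p := 1) (q := 0)
      (Or.inr zero_le_one) (Or.inr le_rfl)
    have d2 := (h'.net e he).part_normal.hasDerivWithinAt_line hx ⟨le_rfl, h'.pos⟩ (p := 1) (q := 0)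
      (Or.inr zero_le_one) (Or.inr le_rfl)
    have key := h.hasDerivWithinAt_height hψ e (c := fun s => P' e (x + s * 1) (0 + s * 0))
      (X := Px' e x 0) (by simpa using d1) (by simpa using d2) (by
        filter_upwards [mem] with s hs
        simp only [mul_one, mul_zero, add_zero]
        rw [h'.left e he _ hs]
        exact interior_subset (hsub _ hs))
    have key2 : HasDerivWithinAt (fun s => height n δ P e (R' e (x + s))) 0 (Ici 0) 0 := by
      refine key.congr_of_eventuallyEq ?_ ?_
      · filter_upwards [mem] with s hs
        simp only [mul_one, mul_zero, add_zero]
        rw [h'.left e he _ hs]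
      · simp only [mul_zero, add_zero]
        rw [h'.left e he _ (by simpa using hx')]
        simp
    have h3 : HasDerivWithinAt (fun t : ℝ => t - x) 1 (Ici x) x :=
      (hasDerivWithinAt_id _ _).sub_const x
    have h4 := HasDerivWithinAt.scomp (t' := Ici 0) (h := fun t => t - x) x
      (by simpa using key2) h3 (fun t ht => by simpa using ht)
    refine (h4.congr_deriv (by simp)).congr (fun t _ => ?_) ?_ <;> simp)
  have hp : R' e 0 = p := h'.ray_zero he
  have hx0 : height n δ P e (R' e x) = height n δ P e (R' e 0) := hconst x (Ico_subset_Icc_self hx)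
  have hz0 : height n δ P e (R' e 0) = 0 := by
    have hn := h.n_pos
    have : p = P 0 0 0 := (h.center 0 hn).symm
    rw [hp, this, h.height_eq e hn ⟨(0, 0), ⟨z0, z0⟩, rfl⟩, (h.net 0 hn).coord_eq z0 z0]
    simp [cellHeight]
  rw [hz0] at hx0
  obtain ⟨k, hk, a, ha, b, hb, hab⟩ := interior_subset (hsub x (Ico_subset_Icc_self hx))
  have ha' := Ico_subset_Icc_self ha
  have hb' := Ico_subset_Icc_self hb
  rw [← hab, h.height_eq e hk ⟨(a, b), ⟨ha', hb'⟩, rfl⟩, (h.net k hk).coord_eq ha' hb'] at hx0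
  unfold cellHeight at hx0
  split_ifs at hx0 with hke
  · simp only at hx0
    subst hx0
    exact ⟨k, hk, hke, a, ha, by rw [← hab, h.left k hk a ha']⟩
  · simp only at hx0
    subst hx0
    obtain ⟨l, hl, hR, hpr⟩ := h.ray_succ hk
    subst hpr
    refine ⟨l, hl, ?_, b, hb, by rw [← hab, h.right_pred hl hb']⟩
    have := cycPred_parity h.even hl e
    by_contra hc
    exact hke (this.2 hc)

end IsFan

end

/-! ### Arcs that follow the rays of a star chart -/

section

variable {Ω : Set ℂ} {ψ : ℂ → E3}

namespace StarChart

variable {q : ℂ} {m m' : ℕ} (c : StarChart Ω ψ q m)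

lemma mul_dir_mem {k : ℕ} (hk : k < 2 * m) {x : ℝ} (hx : x ∈ Ico 0 (c.star.len k)) :
    x * c.star.dir k ∈ c.homeo.target := by
  have := c.pt_mem hk hx (y := 0) ⟨le_rfl, c.star.len_pos (k + 1) hk⟩
  simpa [MStar.pt] using this

lemma homeo_ray {k : ℕ} (hk : k < 2 * m) {x : ℝ} (hx : x ∈ Ico 0 (c.star.len k)) :
    c.homeo (c.ray k x) = x * c.star.dir k := c.homeo.right_inv (c.mul_dir_mem hk hx)

lemma ray_mem_source {k : ℕ} (hk : k < 2 * m) {x : ℝ} (hx : x ∈ Ico 0 (c.star.len k)) :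
    c.ray k x ∈ c.homeo.source := c.homeo.map_target (c.mul_dir_mem hk hx)

lemma norm_homeo_ray {k : ℕ} (hk : k < 2 * m) {x : ℝ} (hx : x ∈ Ico 0 (c.star.len k)) :
    ‖c.homeo (c.ray k x)‖ = x := by
  rw [c.homeo_ray hk hx, norm_mul, c.star.norm_dir, mul_one, Complex.norm_real, Real.norm_eq_abs,
    abs_of_nonneg hx.1]

lemma eventually_lt_len : ∀ᶠ δ in 𝓝[>] (0 : ℝ), ∀ k ≤ 2 * m, δ < c.star.len k := by
  have : ∀ᶠ δ in 𝓝[>] (0 : ℝ), ∀ k ∈ Finset.range (2 * m + 1), δ < c.star.len k := by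
    rw [Filter.eventually_all_finset]
    exact fun k hk => nhdsWithin_le_nhds (eventually_lt_nhds
      (c.star.len_pos k (by have := Finset.mem_range.1 hk; omega)))
  exact this.mono fun δ h k hk => h k (Finset.mem_range.2 (by omega))

lemma eventually_netImage_subset {U : Set ℂ} (hU : U ∈ 𝓝 q) :
    ∀ᶠ δ in 𝓝[>] (0 : ℝ), ∀ k, netImage δ (c.cell k) ⊆ U := by
  have h0 : (0 : ℂ) ∈ c.homeo.target := c.map_center ▸ c.homeo.map_source c.mem_source
  have hc := c.homeo.continuousAt_symm h0
  have e0 : c.homeo.symm 0 = q := by rw [← c.map_center, c.homeo.left_inv c.mem_source]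
  have h1 : c.homeo.symm ⁻¹' U ∈ 𝓝 (0 : ℂ) := hc (by rwa [e0])
  obtain ⟨r, hr, hball⟩ := Metric.mem_nhds_iff.1 h1
  filter_upwards [Ioo_mem_nhdsGT (show (0 : ℝ) < r / 2 by linarith)] with δ hδ k
  rintro _ ⟨⟨x, y⟩, ⟨hx, hy⟩, rfl⟩
  refine hball ?_
  simp only at hx hy
  rw [mem_ball_zero_iff]
  calc ‖c.star.pt k x y‖ ≤ ‖(x : ℂ) * c.star.dir k‖ + ‖(y : ℂ) * c.star.dir (k + 1)‖ := norm_add_le _ _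
    _ = x + y := by
      rw [norm_mul, norm_mul, c.star.norm_dir, c.star.norm_dir, mul_one, mul_one, Complex.norm_real,
        Complex.norm_real, Real.norm_eq_abs, Real.norm_eq_abs, abs_of_nonneg hx.1, abs_of_nonneg hy.1]
    _ < r := by linarith [hx.2, hy.2, hδ.2]

lemma cell_zero (k : ℕ) (x : ℝ) : c.cell k x 0 = c.ray k x := by simp [cell, ray, MStar.pt]

/-- Scaling a small neighbourhood of 0 shows that the cones over the sectors cover the plane. The
complement of the set is then the union of the closed pieces of these cones on which some coordinate
is at least δ. Points on rays are told apart by their norms. -/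
lemma _root_.BranchedPS.MStar.isOpen_square {m : ℕ} (T : MStar m) {δ : ℝ} (hδ : 0 < δ)
    (hT : T.carrier ∈ 𝓝 (0 : ℂ)) :
    IsOpen {z : ℂ | ∃ k < 2 * m, ∃ x ∈ Ico 0 δ, ∃ y ∈ Ico 0 δ, T.pt k x y = z} := by
  have hcov : ∀ z : ℂ, ∃ k < 2 * m, ∃ x y : ℝ, 0 ≤ x ∧ 0 ≤ y ∧ T.pt k x y = z := by
    intro z
    have h1 : Tendsto (fun t : ℝ => (t : ℂ) * z) (𝓝[>] 0) (𝓝 0) := by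
      have : Continuous fun t : ℝ => (t : ℂ) * z := by fun_prop
      simpa using (this.tendsto 0).mono_left nhdsWithin_le_nhds
    obtain ⟨t, ht, ht0⟩ := ((h1.eventually hT).and self_mem_nhdsWithin).exists
    obtain ⟨k, hk, u, hu, v, hv, he⟩ := ht
    have ht0' : (0 : ℝ) < t := ht0
    have htc : (t : ℂ) ≠ 0 := by exact_mod_cast ht0'.ne'
    have main : ∀ x y : ℝ, 0 ≤ x → 0 ≤ y → (t : ℂ) * z = T.pt k x y →
        ∃ k < 2 * m, ∃ x y : ℝ, 0 ≤ x ∧ 0 ≤ y ∧ T.pt k x y = z := fun x y hx hy hxy => by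
      refine ⟨k, hk, x / t, y / t, by positivity, by positivity, mul_left_cancel₀ htc ?_⟩
      rw [hxy, MStar.pt, MStar.pt]
      push_cast
      field_simp
    by_cases hev : Even k
    · exact main u v hu.1 hv.1 (by rw [he, T.point_even hev])
    · exact main v u hv.1 hu.1 (by rw [he, T.point_odd hev])
  have hdet : ∀ k < 2 * m, planarDet (T.dir k) (T.dir (k + 1)) ≠ 0 := fun k hk => by
    rw [planarDet_eq_im, T.norm_dir, T.dir_succ, mul_div_cancel_left₀ _ (T.dir_ne_zero k),
      Complex.exp_ofReal_mul_I_im]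
    have := Real.sin_pos_of_pos_of_lt_pi (T.angle_pos k hk) (T.angle_lt k hk)
    simpa using this.ne'
  set D : Set (ℝ × ℝ) := {z | 0 ≤ z.1 ∧ 0 ≤ z.2 ∧ (δ ≤ z.1 ∨ δ ≤ z.2)} with hD
  have hDc : IsClosed D := by
    refine (isClosed_le continuous_const continuous_fst).inter
      ((isClosed_le continuous_const continuous_snd).inter
      ((isClosed_le continuous_const continuous_fst).union
        (isClosed_le continuous_const continuous_snd)))
  have hclosed : IsClosed (⋃ k : Fin (2 * m), (fun z : ℝ × ℝ => T.pt k z.1 z.2) '' D) := by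
    refine isClosed_iUnion_of_finite fun k => ?_
    have : (fun z : ℝ × ℝ => T.pt k z.1 z.2) = pairEquiv (hdet k k.2) := by
      funext z
      change _ = pairMap _ _ z
      simp [MStar.pt]
    rw [this]
    exact (pairEquiv (hdet k k.2)).toHomeomorph.isClosedMap D hDc
  convert hclosed.isOpen_compl using 1
  ext z
  have nx : ∀ (k : ℕ) (x : ℝ), 0 ≤ x → ‖T.pt k x 0‖ = x := fun k x hx => by
    simp [MStar.pt, T.norm_dir, abs_of_nonneg hx]
  have ny : ∀ (k : ℕ) (y : ℝ), 0 ≤ y → ‖T.pt k 0 y‖ = y := fun k y hy => by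
    simp [MStar.pt, T.norm_dir, abs_of_nonneg hy]
  constructor
  · rintro ⟨k, hk, x, hx, y, hy, rfl⟩ hc
    obtain ⟨⟨l, hl⟩, ⟨x', y'⟩, ⟨hx', hy', hxy'⟩, he⟩ := mem_iUnion.1 hc
    simp only at hx' hy' hxy' he
    have same : k = l → False := by
      rintro rfl
      obtain ⟨rfl, rfl⟩ := T.pt_injective hl he
      rcases hxy' with h | h
      · exact absurd hx.2 (not_lt.2 h)
      · exact absurd hy.2 (not_lt.2 h)
    by_cases h1 : 0 < x ∧ 0 < y
    · exact same (T.pt_disjoint hk hl h1.1 h1.2 hx' hy' he.symm)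
    by_cases h2 : 0 < x' ∧ 0 < y'
    · exact same (T.pt_disjoint hl hk h2.1 h2.2 hx.1 hy.1 he).symm
    have n1 : ‖T.pt k x y‖ < δ := by
      rcases not_and_or.1 h1 with h | h
      · rw [le_antisymm (not_lt.1 h) hx.1, ny k y hy.1]; exact hy.2
      · rw [le_antisymm (not_lt.1 h) hy.1, nx k x hx.1]; exact hx.2
    have n2 : δ ≤ ‖T.pt l x' y'‖ := by
      rcases not_and_or.1 h2 with h | h
      · have h0 := le_antisymm (not_lt.1 h) hx'
        rw [h0, ny l y' hy']
        exact hxy'.resolve_left (by rw [h0]; linarith)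
      · have h0 := le_antisymm (not_lt.1 h) hy'
        rw [h0, nx l x' hx']
        exact hxy'.resolve_right (by rw [h0]; linarith)
    rw [he] at n2
    linarith
  · intro hc
    obtain ⟨k, hk, x, y, hx, hy, he⟩ := hcov z
    refine ⟨k, hk, x, ⟨hx, ?_⟩, y, ⟨hy, ?_⟩, he⟩
    · by_contra h
      exact hc (mem_iUnion.2 ⟨⟨k, hk⟩, (x, y), ⟨hx, hy, Or.inl (not_lt.1 h)⟩, he⟩)
    · by_contra h
      exact hc (mem_iUnion.2 ⟨⟨k, hk⟩, (x, y), ⟨hx, hy, Or.inr (not_lt.1 h)⟩, he⟩)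

lemma isOpen_fanSet {δ : ℝ} (hδ : 0 < δ) (hlen : ∀ k ≤ 2 * m, δ < c.star.len k) :
    IsOpen (fanSet (2 * m) δ c.cell) := by
  have h0 : c.star.carrier ∈ 𝓝 (0 : ℂ) := by
    rw [← c.target_eq]
    exact c.homeo.open_target.mem_nhds (c.map_center ▸ c.homeo.map_source c.mem_source)
  have hS := c.star.isOpen_square hδ h0
  have himg := c.homeo.symm.isOpen_image_of_subset_source hS (by
    rintro _ ⟨k, hk, x, hx, y, hy, rfl⟩
    exact c.pt_mem hk ⟨hx.1, hx.2.trans (hlen k hk.le)⟩ ⟨hy.1, hy.2.trans (hlen (k + 1) hk)⟩)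
  convert himg using 1
  ext z
  constructor
  · rintro ⟨k, hk, x, hx, y, hy, rfl⟩
    exact ⟨_, ⟨k, hk, x, hx, y, hy, rfl⟩, rfl⟩
  · rintro ⟨_, ⟨k, hk, x, hx, y, hy, rfl⟩, rfl⟩
    exact ⟨k, hk, x, hx, y, hy, rfl⟩

/-- A simple arc from the centre that runs in the rays of one parity of some star chart runs, for a
while, along a single ray of the same parity of any other star chart. -/
theorem exists_ray_arc (hψ : IsBranchedPSImmersion Ω ψ) (c' : StarChart Ω ψ q m') {δ : ℝ}
    (h : IsFan Ω ψ q (2 * m) δ c.cell c.cellX c.cellY c.ray) (hδ : ∀ k ≤ 2 * m, δ < c.star.len k)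
    {e : ℕ} {g : ℝ → ℂ} {η : ℝ} (hη : 0 < η) (hg : ContinuousOn g (Icc 0 η))
    (hinj : InjOn g (Icc 0 η)) (h0 : g 0 = q)
    (hr : ∀ᶠ t in 𝓝[Icc 0 η] (0 : ℝ), ∃ k < 2 * m', k % 2 = e % 2 ∧
      ∃ x ∈ Ico 0 (c'.star.len k), g t = c'.ray k x) :
    ∃ η' ∈ Ioc 0 η, ∃ k < 2 * m, k % 2 = e % 2 ∧ ∃ ρ : ℝ → ℝ, ContinuousOn ρ (Icc 0 η') ∧
      StrictMonoOn ρ (Icc 0 η') ∧ ρ 0 = 0 ∧ ρ η' < δ ∧ ∀ t ∈ Icc 0 η', g t = c.ray k (ρ t) := by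
  have hV : interior (fanSet (2 * m) δ c.cell) ∈ 𝓝 q := interior_mem_nhds.2 h.mem_nhds
  obtain ⟨δ', hfan', hlen', himg'⟩ := ((c'.eventually_isFan hψ).and
    (c'.eventually_lt_len.and (c'.eventually_netImage_subset hV))).exists
  have key : ∀ k < 2 * m', ∀ x ∈ Ico 0 δ', ∃ l < 2 * m, l % 2 = k % 2 ∧
      ∃ s ∈ Ico 0 δ, c'.ray k x = c.ray l s := fun k hk x hx =>
    h.ray_subset hψ hfan' hk (fun x hx => himg' k ⟨(x, 0), ⟨hx, hfan'.zero_mem⟩, c'.cell_zero k x⟩) hx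
  have hgc : ContinuousWithinAt g (Icc 0 η) 0 := hg 0 ⟨le_rfl, hη.le⟩
  have hn' : ContinuousWithinAt (fun t => ‖c'.homeo (g t)‖) (Icc 0 η) 0 := by
    refine (ContinuousAt.comp_continuousWithinAt (g := c'.homeo) ?_ hgc).norm
    rw [h0]; exact c'.homeo.continuousAt c'.mem_source
  have hsmall : ∀ᶠ t in 𝓝[Icc 0 η] (0 : ℝ), ‖c'.homeo (g t)‖ < δ' :=
    hn'.eventually_lt_const (by simp only [h0, c'.map_center, norm_zero]; exact hfan'.pos)
  have hin : ∀ᶠ t in 𝓝[Icc 0 η] (0 : ℝ), ∃ l < 2 * m, l % 2 = e % 2 ∧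
      ∃ s ∈ Ico 0 δ, g t = c.ray l s := by
    filter_upwards [hr, hsmall] with t ht1 ht2
    obtain ⟨k, hk, hke, x, hx, he⟩ := ht1
    rw [he, c'.norm_homeo_ray hk hx] at ht2
    obtain ⟨l, hl, hlk, s, hs, hs'⟩ := key k hk x ⟨hx.1, ht2⟩
    exact ⟨l, hl, hlk.trans hke, s, hs, he.trans hs'⟩
  rw [nhdsWithin_Icc_eq_nhdsGE hη] at hin
  obtain ⟨b, hb, hb'⟩ := mem_nhdsGE_iff_exists_Icc_subset.1 hin
  set η' := min b η with hη'
  have hη'0 : 0 < η' := lt_min hb hη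
  have hsub : Icc 0 η' ⊆ Icc 0 η := Icc_subset_Icc_right (min_le_right _ _)
  have hray : ∀ t ∈ Icc 0 η', ∃ l < 2 * m, l % 2 = e % 2 ∧ ∃ s ∈ Ico 0 δ, g t = c.ray l s :=
    fun t ht => hb' ⟨ht.1, ht.2.trans (min_le_left _ _)⟩
  have hlen : ∀ l < 2 * m, ∀ s ∈ Ico 0 δ, s ∈ Ico 0 (c.star.len l) := fun l hl s hs =>
    ⟨hs.1, hs.2.trans (hδ l hl.le)⟩
  have hsrc : ∀ t ∈ Icc 0 η', g t ∈ c.homeo.source := fun t ht => by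
    obtain ⟨l, hl, -, s, hs, he⟩ := hray t ht
    rw [he]; exact c.ray_mem_source hl (hlen l hl s hs)
  have hgs : ContinuousOn (fun t => c.homeo (g t)) (Icc 0 η') :=
    c.homeo.continuousOn.comp (hg.mono hsub) hsrc
  have hpos : ∀ t ∈ Ioc 0 η', c.homeo (g t) ≠ 0 := fun t ht hc => by
    have ht' := Ioc_subset_Icc_self ht
    have : g t = q := by
      rw [← c.homeo.left_inv (hsrc t ht'), hc, ← c.map_center, c.homeo.left_inv c.mem_source]
    have := hinj (hsub ht') ⟨le_rfl, hη.le⟩ (this.trans h0.symm)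
    linarith [ht.1]
  have hdir : ∀ t ∈ Ioc 0 η', ∃ l < 2 * m, l % 2 = e % 2 ∧ g t = c.ray l ‖c.homeo (g t)‖ ∧
      ‖c.homeo (g t)‖ < δ ∧ c.homeo (g t) / ‖c.homeo (g t)‖ = c.star.dir l := fun t ht => by
    obtain ⟨l, hl, hle, s, hs, he⟩ := hray t (Ioc_subset_Icc_self ht)
    have e1 := c.norm_homeo_ray hl (hlen l hl s hs)
    have h1 := hpos t ht
    rw [he] at h1
    refine ⟨l, hl, hle, ?_, ?_, ?_⟩
    · rw [he, e1]
    · rw [he, e1]; exact hs.2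
    · rw [he, e1, c.homeo_ray hl (hlen l hl s hs)]
      have : (s : ℂ) ≠ 0 := by
        intro hc
        apply h1
        rw [c.homeo_ray hl (hlen l hl s hs), hc, zero_mul]
      field_simp
  have hdc : ContinuousOn (fun t => c.homeo (g t) / ‖c.homeo (g t)‖) (Ioc 0 η') := by
    have h1 := hgs.mono Ioc_subset_Icc_self
    refine h1.div (Complex.continuous_ofReal.comp_continuousOn h1.norm) fun t ht => ?_
    have := hpos t ht
    simpa using this
  obtain ⟨l, hl, hle, hl1, hl2, hl3⟩ := hdir η' ⟨hη'0, le_rfl⟩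
  have hfin : (c.star.dir '' (Iio (2 * m))).Countable := ((finite_Iio _).image _).countable
  -- The direction of the arc, seen in the star, is continuous and takes values in a finite set.
  have hconst : ∀ t ∈ Ioc 0 η', c.homeo (g t) / ‖c.homeo (g t)‖ = c.star.dir l := fun t ht => by
    have hs := hfin.isTotallyDisconnected ((fun t => c.homeo (g t) / ‖c.homeo (g t)‖) '' Ioc 0 η')
      (by
        rintro _ ⟨t, ht, rfl⟩
        obtain ⟨l, hl, -, -, -, h⟩ := hdir t ht
        exact ⟨l, hl, h.symm⟩) (isPreconnected_Ioc.image _ hdc)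
    rw [← hl3]
    exact hs ⟨t, ht, rfl⟩ ⟨η', ⟨hη'0, le_rfl⟩, rfl⟩
  have hn0 : ‖c.homeo (g 0)‖ = 0 := by rw [h0, c.map_center, norm_zero]
  have hfinal : ∀ t ∈ Icc 0 η', g t = c.ray l ‖c.homeo (g t)‖ := fun t ht => by
    rcases ht.1.eq_or_lt with h1 | h1
    · rw [← h1, hn0, h0, ← c.cell_zero, h.center l hl]
    · obtain ⟨l', hl', -, h2, -, h3⟩ := hdir t ⟨h1, ht.2⟩
      have := c.star.ray_disjoint hl' hl (x := 1) (x' := 1) one_pos zero_le_one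
        (by rw [← h3, hconst t ⟨h1, ht.2⟩])
      rw [← this]; exact h2
  have hnc : ContinuousOn (fun t => ‖c.homeo (g t)‖) (Icc 0 η') := hgs.norm
  -- On a single ray the norm determines the point, so a simple arc has an injective norm, which is
  -- then strictly increasing from 0.
  have hni : InjOn (fun t => ‖c.homeo (g t)‖) (Icc 0 η') := fun t ht t' ht' he =>
    hinj (hsub ht) (hsub ht') (by
      rw [hfinal t ht, hfinal t' ht']
      exact congrArg (c.ray l) he)
  refine ⟨η', ⟨hη'0, min_le_right _ _⟩, l, hl, hle, fun t => ‖c.homeo (g t)‖, hnc, ?_, hn0, hl2, hfinal⟩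
  refine hnc.strictMonoOn_of_injOn_Icc hη'0.le ?_ hni
  simp only [hn0]
  exact norm_nonneg _

end StarChart

end

/-! ### A Hamburger polygon near one of its points -/

section

variable {Ω : Set ℂ} {ψ : ℂ → E3}

namespace IsHamburgerPolygon

variable {j : ℕ} {γ : ℝ → ℂ}

lemma length_ge (hγ : IsHamburgerPolygon Ω ψ j γ) : (2 : ℝ) ≤ 2 * j := by
  have : (1 : ℝ) ≤ j := by exact_mod_cast hγ.pos
  linarith

lemma eq_or (hγ : IsHamburgerPolygon Ω ψ j γ) {s t : ℝ} (hs : s ∈ Icc 0 (2 * (j : ℝ)))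
    (ht : t ∈ Icc 0 (2 * (j : ℝ))) (h : γ s = γ t) :
    s = t ∨ (s = 0 ∧ t = 2 * j) ∨ (s = 2 * j ∧ t = 0) := by
  have hL := hγ.length_ge
  have z0 : (0 : ℝ) ∈ Ico 0 (2 * (j : ℝ)) := ⟨le_rfl, by linarith⟩
  rcases hs.2.eq_or_lt with h1 | h1 <;> rcases ht.2.eq_or_lt with h2 | h2
  · left; rw [h1, h2]
  · right; right
    rw [h1, hγ.closed] at h
    exact ⟨h1, (hγ.injOn z0 ⟨ht.1, h2⟩ h).symm⟩
  · right; left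
    rw [h2, hγ.closed] at h
    exact ⟨hγ.injOn ⟨hs.1, h1⟩ z0 h, h2⟩
  · left; exact hγ.injOn ⟨hs.1, h1⟩ ⟨ht.1, h2⟩ h

lemma side_subset {s : ℕ} (hs : s < 2 * j) : Icc (s : ℝ) (s + 1) ⊆ Icc 0 (2 * (j : ℝ)) := by
  have : (s : ℝ) + 1 ≤ 2 * j := by exact_mod_cast hs
  exact Icc_subset_Icc (by positivity) this

lemma injOn_side (hγ : IsHamburgerPolygon Ω ψ j γ) {s : ℕ} (hs : s < 2 * j) :
    InjOn γ (Icc (s : ℝ) (s + 1)) := by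
  intro t ht t' ht' he
  have hL := hγ.length_ge
  rcases hγ.eq_or (side_subset hs ht) (side_subset hs ht') he with h | ⟨h1, h2⟩ | ⟨h1, h2⟩
  · exact h
  · linarith [ht.1, ht'.2]
  · linarith [ht'.1, ht.2]

lemma mem_ray_of_mem_uRays {p z : ℂ} {m : ℕ} (c : StarChart Ω ψ p m)
    (h : z ∈ c.homeo.symm '' c.star.uRays) :
    ∃ k < 2 * m, k % 2 = 0 ∧ ∃ x ∈ Ico 0 (c.star.len k), z = c.ray k x := by
  obtain ⟨_, ⟨k, hk, he, x, hx, rfl⟩, rfl⟩ := h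
  exact ⟨k, hk, Nat.even_iff.1 he, x, hx, by simp [StarChart.ray]⟩

lemma mem_ray_of_mem_vRays {p z : ℂ} {m : ℕ} (c : StarChart Ω ψ p m)
    (h : z ∈ c.homeo.symm '' c.star.vRays) :
    ∃ k < 2 * m, k % 2 = 1 ∧ ∃ x ∈ Ico 0 (c.star.len k), z = c.ray k x := by
  obtain ⟨_, ⟨k, hk, he, x, hx, rfl⟩, rfl⟩ := h
  exact ⟨k, hk, Nat.odd_iff.1 he, x, hx, by simp [StarChart.ray]⟩

lemma exists_chart (hγ : IsHamburgerPolygon Ω ψ j γ) {s : ℕ} (hs : s < 2 * j) {t : ℝ}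
    (ht : t ∈ Icc (s : ℝ) (s + 1)) : ∃ (m : ℕ) (c : StarChart Ω ψ (γ t) m),
      ∀ᶠ r in 𝓝[Icc (s : ℝ) (s + 1)] t, ∃ k < 2 * m, k % 2 = s % 2 ∧
        ∃ x ∈ Ico 0 (c.star.len k), γ r = c.ray k x := by
  rcases Nat.even_or_odd s with h | h
  · obtain ⟨m, c, hc⟩ := hγ.uArc s hs h t ht
    refine ⟨m, c, hc.mono fun r hr => ?_⟩
    rw [Nat.even_iff.1 h]
    exact mem_ray_of_mem_uRays c hr
  · obtain ⟨m, c, hc⟩ := hγ.vArc s hs h t ht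
    refine ⟨m, c, hc.mono fun r hr => ?_⟩
    rw [Nat.odd_iff.1 h]
    exact mem_ray_of_mem_vRays c hr

/-- The polygon leaves a point along a ray. -/
lemma exists_out (hψ : IsBranchedPSImmersion Ω ψ) (hγ : IsHamburgerPolygon Ω ψ j γ) {q : ℂ} {m : ℕ}
    (c : StarChart Ω ψ q m) {δ : ℝ} (h : IsFan Ω ψ q (2 * m) δ c.cell c.cellX c.cellY c.ray)
    (hδ : ∀ k ≤ 2 * m, δ < c.star.len k) {s : ℕ} (hs : s < 2 * j) {t : ℝ}
    (ht : t ∈ Ico (s : ℝ) (s + 1)) (hq : γ t = q) :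
    ∃ η, 0 < η ∧ t + η ≤ s + 1 ∧ ∃ k < 2 * m, k % 2 = s % 2 ∧ ∃ ρ : ℝ → ℝ,
      ContinuousOn ρ (Icc t (t + η)) ∧ StrictMonoOn ρ (Icc t (t + η)) ∧ ρ t = 0 ∧ ρ (t + η) < δ ∧
      ∀ r ∈ Icc t (t + η), γ r = c.ray k (ρ r) := by
  subst hq
  obtain ⟨m', c', hc'⟩ := hγ.exists_chart hs (Ico_subset_Icc_self ht)
  set f : ℝ → ℝ := fun x => t + x with hf
  have hmaps : MapsTo f (Icc 0 (s + 1 - t)) (Icc (s : ℝ) (s + 1)) := fun x hx =>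
    ⟨by have := hx.1; have := ht.1; simp only [hf]; linarith, by have := hx.2; simp only [hf]; linarith⟩
  have hfc : Continuous f := by fun_prop
  obtain ⟨η, hη, k, hk, hke, ρ, h1, h2, h3, h4, h5⟩ := c.exists_ray_arc hψ c' h hδ
    (e := s) (g := γ ∘ f) (η := s + 1 - t) (by linarith [ht.2])
    ((hγ.continuousOn.mono (side_subset hs)).comp hfc.continuousOn hmaps)
    ((hγ.injOn_side hs).comp (fun x _ y _ hxy => by simpa [hf] using hxy) hmaps)
    (by simp [hf])
    (by
      have : Tendsto f (𝓝[Icc 0 (s + 1 - t)] 0) (𝓝[Icc (s : ℝ) (s + 1)] t) := by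
        have := hfc.continuousWithinAt.tendsto_nhdsWithin hmaps (x := 0)
        simpa [hf] using this
      exact this.eventually hc')
  have hm : MapsTo (fun r => r - t) (Icc t (t + η)) (Icc 0 η) := fun r hr =>
    ⟨by linarith [hr.1], by linarith [hr.2]⟩
  refine ⟨η, hη.1, by linarith [hη.2], k, hk, hke, fun r => ρ (r - t),
    h1.comp (by fun_prop) hm, ?_, by simpa using h3, by simpa using h4, fun r hr => ?_⟩
  · exact fun x hx y hy hxy => h2 (hm hx) (hm hy) (by linarith)
  · rw [← h5 _ (hm hr)]; simp [hf]

/-- The polygon arrives at a point along a ray. -/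
lemma exists_in (hψ : IsBranchedPSImmersion Ω ψ) (hγ : IsHamburgerPolygon Ω ψ j γ) {q : ℂ} {m : ℕ}
    (c : StarChart Ω ψ q m) {δ : ℝ} (h : IsFan Ω ψ q (2 * m) δ c.cell c.cellX c.cellY c.ray)
    (hδ : ∀ k ≤ 2 * m, δ < c.star.len k) {s : ℕ} (hs : s < 2 * j) {t : ℝ}
    (ht : t ∈ Ioc (s : ℝ) (s + 1)) (hq : γ t = q) :
    ∃ η, 0 < η ∧ s ≤ t - η ∧ ∃ k < 2 * m, k % 2 = s % 2 ∧ ∃ ρ : ℝ → ℝ,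
      ContinuousOn ρ (Icc (t - η) t) ∧ StrictAntiOn ρ (Icc (t - η) t) ∧ ρ t = 0 ∧ ρ (t - η) < δ ∧
      ∀ r ∈ Icc (t - η) t, γ r = c.ray k (ρ r) := by
  subst hq
  obtain ⟨m', c', hc'⟩ := hγ.exists_chart hs (Ioc_subset_Icc_self ht)
  set f : ℝ → ℝ := fun x => t - x with hf
  have hmaps : MapsTo f (Icc 0 (t - s)) (Icc (s : ℝ) (s + 1)) := fun x hx =>
    ⟨by have := hx.2; simp only [hf]; linarith, by have := hx.1; have := ht.2; simp only [hf]; linarith⟩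
  have hfc : Continuous f := by fun_prop
  obtain ⟨η, hη, k, hk, hke, ρ, h1, h2, h3, h4, h5⟩ := c.exists_ray_arc hψ c' h hδ
    (e := s) (g := γ ∘ f) (η := t - s) (by linarith [ht.1])
    ((hγ.continuousOn.mono (side_subset hs)).comp hfc.continuousOn hmaps)
    ((hγ.injOn_side hs).comp (fun x _ y _ hxy => by simpa [hf] using hxy) hmaps)
    (by simp [hf])
    (by
      have : Tendsto f (𝓝[Icc 0 (t - s)] 0) (𝓝[Icc (s : ℝ) (s + 1)] t) := by
        have := hfc.continuousWithinAt.tendsto_nhdsWithin hmaps (x := 0)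
        simpa [hf] using this
      exact this.eventually hc')
  have hm : MapsTo (fun r => t - r) (Icc (t - η) t) (Icc 0 η) := fun r hr =>
    ⟨by linarith [hr.2], by linarith [hr.1]⟩
  refine ⟨η, hη.1, by linarith [hη.2], k, hk, hke, fun r => ρ (t - r),
    h1.comp (by fun_prop) hm, ?_, by simpa using h3, by simpa using h4, fun r hr => ?_⟩
  · exact fun x hx y hy hxy => h2 (hm hy) (hm hx) (by linarith)
  · rw [← h5 _ (hm hr)]; simp [hf]

end IsHamburgerPolygon

/-- A fan at a point of the polygon `γ`, in which `γ` arrives along ray `i₁` (during `[a₁, b₁]`, as a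
part of side `n₁`) and leaves along ray `i₂` (during `[a₂, b₂]`, as a part of side `n₂`). -/
structure IsBoundaryFan (Ω : Set ℂ) (ψ : ℂ → E3) (j : ℕ) (γ : ℝ → ℂ) (q : ℂ) (n : ℕ) (δ : ℝ)
    (P Px Py : ℕ → ℝ → ℝ → ℂ) (R : ℕ → ℝ → ℂ) (i₁ i₂ n₁ n₂ : ℕ) (a₁ b₁ a₂ b₂ : ℝ)
    (ρ₁ ρ₂ : ℝ → ℝ) : Prop where
  fan : IsFan Ω ψ q n δ P Px Py R
  isOpen : IsOpen (fanSet n δ P)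
  lt₁ : i₁ < n
  lt₂ : i₂ < n
  ne : i₁ ≠ i₂
  par₁ : i₁ % 2 = n₁ % 2
  par₂ : i₂ % 2 = n₂ % 2
  side₁ : n₁ < 2 * j
  side₂ : n₂ < 2 * j
  left₁ : n₁ ≤ a₁
  left₂ : n₂ ≤ a₂
  ab₁ : a₁ < b₁
  ab₂ : a₂ < b₂
  right₁ : b₁ ≤ n₁ + 1
  right₂ : b₂ ≤ n₂ + 1
  cont₁ : ContinuousOn ρ₁ (Icc a₁ b₁)
  cont₂ : ContinuousOn ρ₂ (Icc a₂ b₂)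
  anti₁ : StrictAntiOn ρ₁ (Icc a₁ b₁)
  mono₂ : StrictMonoOn ρ₂ (Icc a₂ b₂)
  start₁ : ρ₁ a₁ = δ
  end₁ : ρ₁ b₁ = 0
  start₂ : ρ₂ a₂ = 0
  end₂ : ρ₂ b₂ = δ
  eq₁ : ∀ t ∈ Icc a₁ b₁, γ t = R i₁ (ρ₁ t)
  eq₂ : ∀ t ∈ Icc a₂ b₂, γ t = R i₂ (ρ₂ t)
  cover : ∀ t ∈ Icc 0 (2 * (j : ℝ)), ∀ k < n, γ t ∈ netImage δ (P k) → t ∈ Icc a₁ b₁ ∨ t ∈ Icc a₂ b₂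
  place : b₁ = a₂ ∨ (a₂ = 0 ∧ b₁ = 2 * j)

namespace IsHamburgerPolygon

variable {j : ℕ} {γ : ℝ → ℂ}

/-- The times t₁ of arrival and t₂ of departure differ only at the starting point of the closed
curve, which is reached at the times 2j and 0. The fan is shrunk until it is shorter than both ray
arcs and avoids the rest of the polygon. -/
lemma exists_boundaryFan_aux (hψ : IsBranchedPSImmersion Ω ψ) (hγ : IsHamburgerPolygon Ω ψ j γ)
    {q : ℂ} {m : ℕ} (c : StarChart Ω ψ q m) {n₁ n₂ : ℕ} (hn₁ : n₁ < 2 * j) (hn₂ : n₂ < 2 * j)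
    {t₁ t₂ : ℝ} (ht₁ : t₁ ∈ Ioc (n₁ : ℝ) (n₁ + 1)) (ht₂ : t₂ ∈ Ico (n₂ : ℝ) (n₂ + 1))
    (hq₁ : γ t₁ = q) (hq₂ : γ t₂ = q) (hplace : t₁ = t₂ ∨ (t₂ = 0 ∧ t₁ = 2 * j))
    {U : Set ℂ} (hU : U ∈ 𝓝 q) :
    ∃ (δ : ℝ) (i₁ i₂ : ℕ) (a₁ b₁ a₂ b₂ : ℝ) (ρ₁ ρ₂ : ℝ → ℝ), IsBoundaryFan Ω ψ j γ q (2 * m) δ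
      c.cell c.cellX c.cellY c.ray i₁ i₂ n₁ n₂ a₁ b₁ a₂ b₂ ρ₁ ρ₂ ∧
      (∀ k, netImage δ (c.cell k) ⊆ U) ∧ b₁ = t₁ ∧ a₂ = t₂ := by
  have hL := hγ.length_ge
  obtain ⟨δ₀, hfan, hlen⟩ := ((c.eventually_isFan hψ).and c.eventually_lt_len).exists
  obtain ⟨η₁, hη₁, hs₁, i₁, hi₁, hp₁, ρ₁, hc₁, hm₁, hz₁, hd₁, he₁⟩ :=
    hγ.exists_in hψ c hfan hlen hn₁ ht₁ hq₁
  obtain ⟨η₂, hη₂, hs₂, i₂, hi₂, hp₂, ρ₂, hc₂, hm₂, hz₂, hd₂, he₂⟩ :=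
    hγ.exists_out hψ c hfan hlen hn₂ ht₂ hq₂
  have L₁ : Icc (t₁ - η₁) t₁ ⊆ Icc 0 (2 * (j : ℝ)) :=
    (Icc_subset_Icc hs₁ ht₁.2).trans (side_subset hn₁)
  have L₂ : Icc t₂ (t₂ + η₂) ⊆ Icc 0 (2 * (j : ℝ)) :=
    (Icc_subset_Icc ht₂.1 hs₂).trans (side_subset hn₂)
  have m₁ : t₁ ∈ Icc 0 (2 * (j : ℝ)) := L₁ ⟨by linarith, le_rfl⟩
  have m₂ : t₂ ∈ Icc 0 (2 * (j : ℝ)) := L₂ ⟨le_rfl, by linarith⟩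
  -- C consists of the parameters away from the two arcs. The polygon is simple, so its image is a
  -- compact set that misses q.
  obtain ⟨C, hC, hCL, hCq, hCc⟩ : ∃ C : Set ℝ, IsCompact C ∧ C ⊆ Icc 0 (2 * (j : ℝ)) ∧ q ∉ γ '' C ∧
      ∀ t ∈ Icc 0 (2 * (j : ℝ)), t ∉ C → t ∈ Ioc (t₁ - η₁) t₁ ∨ t ∈ Ico t₂ (t₂ + η₂) := by
    rcases hplace with hpl | ⟨hpl, hpl'⟩
    · refine ⟨Icc 0 (2 * (j : ℝ)) \ Ioo (t₁ - η₁) (t₂ + η₂), isCompact_Icc.diff isOpen_Ioo,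
        sdiff_subset, ?_, fun t ht htC => ?_⟩
      · rintro ⟨t, ht, hte⟩
        rcases hγ.eq_or ht.1 m₁ (hte.trans hq₁.symm) with h | ⟨h, h'⟩ | ⟨h, h'⟩
        · exact ht.2 ⟨by rw [h]; linarith, by rw [h, hpl]; linarith⟩
        · have := (L₂ ⟨by linarith, le_rfl⟩ : t₂ + η₂ ∈ _).2; linarith
        · have := (L₁ ⟨le_rfl, by linarith⟩ : t₁ - η₁ ∈ _).1; linarith
      · have : t ∈ Ioo (t₁ - η₁) (t₂ + η₂) := by
          by_contra hc; exact htC ⟨ht, hc⟩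
        rcases le_total t t₁ with h | h
        · exact Or.inl ⟨this.1, h⟩
        · exact Or.inr ⟨hpl ▸ h, this.2⟩
    · refine ⟨Icc η₂ (2 * j - η₁), isCompact_Icc, Icc_subset_Icc hη₂.le (by linarith), ?_,
        fun t ht htC => ?_⟩
      · rintro ⟨t, ht, hte⟩
        rcases hγ.eq_or (Icc_subset_Icc hη₂.le (by linarith) ht) m₁ (hte.trans hq₁.symm) with
          h | ⟨h, h'⟩ | ⟨h, h'⟩
        · linarith [ht.2]
        · linarith [ht.1]
        · linarith
      · by_cases h : t < η₂
        · exact Or.inr ⟨by linarith [ht.1], by linarith⟩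
        · left
          refine ⟨?_, by linarith [ht.2]⟩
          by_contra hc
          exact htC ⟨by linarith, by linarith⟩
  have hK : (γ '' C)ᶜ ∈ 𝓝 q :=
    ((hC.image_of_continuousOn (hγ.continuousOn.mono hCL)).isClosed.isOpen_compl).mem_nhds hCq
  have r₁ : 0 < ρ₁ (t₁ - η₁) := by
    rw [← hz₁]; exact hm₁ ⟨le_rfl, by linarith⟩ ⟨by linarith, le_rfl⟩ (by linarith)
  have r₂ : 0 < ρ₂ (t₂ + η₂) := by
    rw [← hz₂]; exact hm₂ ⟨le_rfl, by linarith⟩ ⟨by linarith, le_rfl⟩ (by linarith)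
  obtain ⟨δ, ⟨⟨hδfan, hδsub⟩, hδlen⟩, hδpos, hδlt⟩ := ((c.eventually_isFan hψ).and
    (c.eventually_netImage_subset (inter_mem hU hK)) |>.and c.eventually_lt_len |>.and
    (Ioo_mem_nhdsGT (show (0 : ℝ) < min (ρ₁ (t₁ - η₁)) (ρ₂ (t₂ + η₂)) from lt_min r₁ r₂))).exists
  have hδ₁ : δ < ρ₁ (t₁ - η₁) := hδlt.trans_le (min_le_left _ _)
  have hδ₂ : δ < ρ₂ (t₂ + η₂) := hδlt.trans_le (min_le_right _ _)
  have hδδ : Icc 0 δ ⊆ Icc 0 δ₀ := Icc_subset_Icc_right (hδ₁.trans hd₁).le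
  have ivt₁ : ∀ x ∈ Icc 0 δ, ∃ a ∈ Icc (t₁ - η₁) t₁, ρ₁ a = x := fun x hx =>
    intermediate_value_Icc' (by linarith) hc₁ ⟨by rw [hz₁]; exact hx.1, hx.2.trans hδ₁.le⟩
  have ivt₂ : ∀ x ∈ Icc 0 δ, ∃ b ∈ Icc t₂ (t₂ + η₂), ρ₂ b = x := fun x hx =>
    intermediate_value_Icc (by linarith) hc₂ ⟨by rw [hz₂]; exact hx.1, hx.2.trans hδ₂.le⟩
  obtain ⟨a₁, ha₁, hρa₁⟩ := ivt₁ δ ⟨hδpos.le, le_rfl⟩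
  obtain ⟨b₂, hb₂, hρb₂⟩ := ivt₂ δ ⟨hδpos.le, le_rfl⟩
  have ha₁' : a₁ < t₁ := lt_of_le_of_ne ha₁.2 fun h => by rw [h, hz₁] at hρa₁; linarith
  have hb₂' : t₂ < b₂ := lt_of_le_of_ne hb₂.1 fun h => by rw [← h, hz₂] at hρb₂; linarith
  have w₁ : Icc a₁ t₁ ⊆ Icc (t₁ - η₁) t₁ := Icc_subset_Icc_left ha₁.1
  have w₂ : Icc t₂ b₂ ⊆ Icc t₂ (t₂ + η₂) := Icc_subset_Icc_right hb₂.2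
  -- On a common ray the point with parameter δ/2 would be passed twice, once on arrival and once on
  -- departure.
  have hne : i₁ ≠ i₂ := by
    rintro rfl
    obtain ⟨a, ha, hρa⟩ := ivt₁ (δ / 2) ⟨by linarith, by linarith⟩
    obtain ⟨b, hb, hρb⟩ := ivt₂ (δ / 2) ⟨by linarith, by linarith⟩
    have e : γ a = γ b := by rw [he₁ a ha, he₂ b hb, hρa, hρb]
    have a1 : t₁ - η₁ < a := lt_of_le_of_ne ha.1 fun h => by rw [← h] at hρa; linarith
    have a2 : a < t₁ := lt_of_le_of_ne ha.2 fun h => by rw [h, hz₁] at hρa; linarith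
    have b1 : t₂ < b := lt_of_le_of_ne hb.1 fun h => by rw [← h, hz₂] at hρb; linarith
    have b2 : b < t₂ + η₂ := lt_of_le_of_ne hb.2 fun h => by rw [h] at hρb; linarith
    have c1 := (L₁ ⟨le_rfl, by linarith⟩ : t₁ - η₁ ∈ _).1
    have c2 := (L₂ ⟨by linarith, le_rfl⟩ : t₂ + η₂ ∈ _).2
    have hab : a = b := by
      rcases hγ.eq_or (L₁ ha) (L₂ hb) e with h | h | h
      · exact h
      · linarith [h.1]
      · linarith [h.2, m₂.1]
    rcases hplace with h | ⟨h, h'⟩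
    · linarith
    · have : (n₁ : ℝ) < a := by linarith
      have h3 : b < 1 := by
        have : (n₂ : ℝ) ≤ 0 := by linarith [ht₂.1]
        linarith
      have h4 : (2 : ℝ) ≤ n₁ + 1 := by linarith [ht₁.2]
      linarith
  have small : ∀ {i : ℕ} {s : ℝ}, i < 2 * m → s ∈ Icc 0 δ₀ → ∀ k < 2 * m,
      c.ray i s ∈ netImage δ (c.cell k) → s ≤ δ := by
    rintro i s hi hs k hk ⟨⟨x, y⟩, ⟨hx, hy⟩, hxy⟩
    simp only at hx hy hxy
    rcases hs.1.eq_or_lt with h | h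
    · rw [← h]; exact hδpos.le
    · rcases hfan.eq_ray hi hk hs h (hδδ hx) (hδδ hy) hxy with ⟨-, h1, -⟩ | ⟨-, -, h1⟩
      · rw [← h1]; exact hx.2
      · rw [← h1]; exact hy.2
  refine ⟨δ, i₁, i₂, a₁, t₁, t₂, b₂, ρ₁, ρ₂, ⟨hδfan, c.isOpen_fanSet hδpos
    (fun k hk => hδlen k hk), hi₁, hi₂, hne, hp₁, hp₂, hn₁, hn₂,
    hs₁.trans ha₁.1, ht₂.1, ha₁', hb₂', ht₁.2, hb₂.2.trans hs₂, hc₁.mono w₁, hc₂.mono w₂, hm₁.mono w₁,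
    hm₂.mono w₂, hρa₁, hz₁, hz₂, hρb₂, fun t ht => he₁ t (w₁ ht), fun t ht => he₂ t (w₂ ht), ?_,
    hplace⟩, fun k => (hδsub k).trans inter_subset_left, rfl, rfl⟩
  intro t ht k hk hmem
  have htC : t ∉ C := fun h => (hδsub k hmem).2 ⟨t, h, rfl⟩
  rcases hCc t ht htC with h | h
  · left
    have h' := Ioc_subset_Icc_self h
    refine ⟨?_, h.2⟩
    by_contra hc
    have hlt := hm₁ h' ha₁ (not_le.1 hc)
    rw [he₁ t h'] at hmem
    have hup : ρ₁ t ≤ ρ₁ (t₁ - η₁) := hm₁.antitoneOn ⟨le_rfl, by linarith⟩ h' h.1.le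
    have := small hi₁ ⟨by linarith, by linarith⟩ k hk hmem
    linarith
  · right
    have h' := Ico_subset_Icc_self h
    refine ⟨h.1, ?_⟩
    by_contra hc
    have hlt := hm₂ hb₂ h' (not_le.1 hc)
    rw [he₂ t h'] at hmem
    have hup : ρ₂ t ≤ ρ₂ (t₂ + η₂) := hm₂.monotoneOn h' ⟨by linarith, le_rfl⟩ h.2.le
    have := small hi₂ ⟨by linarith, by linarith⟩ k hk hmem
    linarith

/-- Every point of a Hamburger polygon has a fan in which the polygon consists of two rays. -/
theorem exists_boundaryFan (hψ : IsBranchedPSImmersion Ω ψ) (hγ : IsHamburgerPolygon Ω ψ j γ)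
    {q : ℂ} (hq : q ∈ γ '' Icc 0 (2 * j)) {m : ℕ} (hm : HasSaddleOrder Ω ψ q m)
    {U : Set ℂ} (hU : U ∈ 𝓝 q) :
    ∃ (δ : ℝ) (P Px Py : ℕ → ℝ → ℝ → ℂ) (R : ℕ → ℝ → ℂ) (i₁ i₂ n₁ n₂ : ℕ) (a₁ b₁ a₂ b₂ : ℝ)
      (ρ₁ ρ₂ : ℝ → ℝ), IsBoundaryFan Ω ψ j γ q (2 * m) δ P Px Py R i₁ i₂ n₁ n₂ a₁ b₁ a₂ b₂ ρ₁ ρ₂ ∧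
      (∀ k, netImage δ (P k) ⊆ U) ∧
      ((q = γ n₂ ∧ n₁ % 2 ≠ n₂ % 2) ∨ (n₁ = n₂ ∧ ∀ n < 2 * j, q ≠ γ n)) := by
  obtain ⟨c⟩ := hm
  have hL := hγ.length_ge
  obtain ⟨t, ht, rfl⟩ : ∃ t ∈ Ico 0 (2 * (j : ℝ)), γ t = q := by
    obtain ⟨t, ht, rfl⟩ := hq
    rcases ht.2.eq_or_lt with h | h
    · exact ⟨0, ⟨le_rfl, by linarith⟩, by rw [h, hγ.closed]⟩
    · exact ⟨t, ⟨ht.1, h⟩, rfl⟩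
  -- There are three cases: the initial vertex, where the arriving side is side 2j - 1; another
  -- vertex, where it is side s - 1; and an inner point of side s, which carries both arcs.
  set s := ⌊t⌋₊ with hs
  have hs1 : (s : ℝ) ≤ t := Nat.floor_le ht.1
  have hs2 : t < s + 1 := Nat.lt_floor_add_one t
  have hs3 : s < 2 * j := by
    have : (s : ℝ) < (2 * j : ℕ) := by push_cast; linarith [ht.2]
    exact_mod_cast this
  rcases hs1.eq_or_lt with h | h
  · rcases Nat.eq_zero_or_pos s with h0 | h0
    · have hj : 2 * j - 1 < 2 * j := by have := hγ.pos; omega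
      have hcast : ((2 * j - 1 : ℕ) : ℝ) = 2 * j - 1 := by
        rw [Nat.cast_sub (by have := hγ.pos; omega)]; push_cast; ring
      have ht0 : t = 0 := by rw [← h, h0]; simp
      obtain ⟨δ, i₁, i₂, a₁, b₁, a₂, b₂, ρ₁, ρ₂, h1, h2, h3, h4⟩ := hγ.exists_boundaryFan_aux hψ c hj hs3
        (t₁ := 2 * j) (t₂ := t) ⟨by rw [hcast]; linarith, by rw [hcast]; linarith⟩ ⟨hs1, hs2⟩
        (by rw [hγ.closed, ht0]) rfl (Or.inr ⟨ht0, rfl⟩) hU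
      refine ⟨δ, _, _, _, _, i₁, i₂, _, _, a₁, b₁, a₂, b₂, ρ₁, ρ₂, h1, h2, Or.inl ⟨by rw [h], ?_⟩⟩
      rw [h0]; have := hγ.pos; omega
    · have hcast : ((s - 1 : ℕ) : ℝ) = s - 1 := by
        rw [Nat.cast_sub h0]; simp
      obtain ⟨δ, i₁, i₂, a₁, b₁, a₂, b₂, ρ₁, ρ₂, h1, h2, h3, h4⟩ := hγ.exists_boundaryFan_aux hψ c
        (n₁ := s - 1) (by omega) hs3
        (t₁ := t) (t₂ := t) ⟨by rw [hcast]; linarith, by rw [hcast]; linarith⟩ ⟨hs1, hs2⟩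
        rfl rfl (Or.inl rfl) hU
      exact ⟨δ, _, _, _, _, i₁, i₂, _, _, a₁, b₁, a₂, b₂, ρ₁, ρ₂, h1, h2, Or.inl ⟨by rw [h], by omega⟩⟩
  · obtain ⟨δ, i₁, i₂, a₁, b₁, a₂, b₂, ρ₁, ρ₂, h1, h2, h3, h4⟩ := hγ.exists_boundaryFan_aux hψ c hs3 hs3
        (t₁ := t) (t₂ := t) ⟨h, hs2.le⟩ ⟨hs1, hs2⟩ rfl rfl (Or.inl rfl) hU
    refine ⟨δ, _, _, _, _, i₁, i₂, _, _, a₁, b₁, a₂, b₂, ρ₁, ρ₂, h1, h2, Or.inr ⟨rfl, fun n hn he => ?_⟩⟩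
    have hn' : (n : ℝ) < 2 * j := by exact_mod_cast hn
    have := hγ.injOn ht ⟨by positivity, hn'⟩ he
    rw [this] at h hs2
    have a1 : s < n := by exact_mod_cast h
    have a2 : n < s + 1 := by exact_mod_cast hs2
    omega

end IsHamburgerPolygon

end

/-! ### Riemann–Stieltjes sums along a continuous curve -/

section

variable {E : Type*} [NormedAddCommGroup E] [NormedSpace ℝ E]

/-- The Riemann sum of `∫ Φ df` over `[0, L]` with `N` equal steps. -/
def riemannSum (L : ℝ) (Φ : ℝ → E) (f : ℝ → ℝ) (N : ℕ) : E :=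
  ∑ i ∈ Finset.range N, (f (L * (i + 1 : ℕ) / N) - f (L * i / N)) • Φ (L * i / N)

lemma riemannSum_add (L : ℝ) (Φ : ℝ → E) (f g : ℝ → ℝ) (N : ℕ) :
    riemannSum L Φ (fun t => f t + g t) N = riemannSum L Φ f N + riemannSum L Φ g N := by
  unfold riemannSum
  rw [← Finset.sum_add_distrib]
  refine Finset.sum_congr rfl fun i _ => ?_
  rw [← add_smul]
  congr 1
  ring

lemma grid_mem {L : ℝ} (hL : 0 ≤ L) {N i : ℕ} (hi : i ≤ N) : L * i / N ∈ Icc 0 L := by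
  rcases Nat.eq_zero_or_pos N with h | h
  · subst h; simpa using hL
  · have h1 : (0 : ℝ) < N := by exact_mod_cast h
    have h2 : (i : ℝ) ≤ N := by exact_mod_cast hi
    refine ⟨by positivity, ?_⟩
    rw [div_le_iff₀ h1]
    gcongr

lemma riemannSum_congr {L : ℝ} (hL : 0 ≤ L) {Φ : ℝ → E} {f g : ℝ → ℝ} {c : ℝ}
    (h : ∀ t ∈ Icc 0 L, f t = g t + c) (N : ℕ) : riemannSum L Φ f N = riemannSum L Φ g N := by
  unfold riemannSum
  refine Finset.sum_congr rfl fun i hi => ?_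
  have := Finset.mem_range.1 hi
  rw [h _ (grid_mem hL this), h _ (grid_mem hL this.le)]
  congr 1
  ring

/-- For t > 0 the expression is the left end of the grid interval, open on the left, that contains
t. -/
lemma tendsto_grid {L t : ℝ} (hL : 0 < L) (ht : 0 ≤ t) :
    Tendsto (fun N : ℕ => L * ((⌈t / L * N⌉₊ : ℝ) - 1) / N) atTop (𝓝 t) := by
  have h1 := (tendsto_nat_ceil_mul_div_atTop (a := t / L) (by positivity)).comp
    (tendsto_natCast_atTop_atTop (R := ℝ))
  have h2 := (h1.sub (tendsto_inv_atTop_nhds_zero_nat (𝕜 := ℝ))).const_mul L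
  have e : L * (t / L - 0) = t := by field_simp; ring
  rw [e] at h2
  refine h2.congr fun N => ?_
  simp only [Function.comp]
  ring

variable [CompleteSpace E]

/-- The Riemann sums over an arc with a continuous monotone parameter converge to an integral with
respect to that parameter. -/
theorem tendsto_riemannSum_mono {L a b δ C : ℝ} (hL : 0 < L) (ha : 0 ≤ a) (hab : a < b) (hb : b ≤ L)
    {ρ : ℝ → ℝ} (hρ : ContinuousOn ρ (Icc a b)) (hm : StrictMonoOn ρ (Icc a b)) (h0 : ρ a = 0)
    (h1 : ρ b = δ) {g : ℝ → ℝ} (hg : ContinuousOn g (Icc 0 δ)) {f : ℝ → ℝ} {c : ℝ}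
    (hf : ∀ t ∈ Icc a b, f t = c + ∫ x in 0..ρ t, g x) {Φ : ℝ → E} (hC : ∀ t ∈ Icc 0 L, ‖Φ t‖ ≤ C)
    {Ψ : ℝ → E} (hΦ : ∀ t ∈ Ioo a b, ContinuousAt Φ t) (hΨ : ∀ t ∈ Ioo a b, Φ t = Ψ (ρ t)) :
    Tendsto (riemannSum L Φ fun t => f (max a (min b t))) atTop (𝓝 (∫ x in 0..δ, g x • Ψ x)) := by
  have ma : a ∈ Icc a b := ⟨le_rfl, hab.le⟩
  have mb : b ∈ Icc a b := ⟨hab.le, le_rfl⟩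
  have hδ : 0 < δ := by rw [← h0, ← h1]; exact hm ma mb hab
  set r : ℝ → ℝ := fun t => ρ (max a (min b t)) with hr
  have cl : ∀ t, max a (min b t) ∈ Icc a b := fun t => ⟨le_max_left _ _, max_le hab.le (min_le_left _ _)⟩
  have hrm : Monotone r := fun s t hst =>
    hm.monotoneOn (cl s) (cl t) (max_le_max le_rfl (min_le_min le_rfl hst))
  have hr0 : ∀ t, 0 ≤ r t := fun t => by
    rw [← h0]; exact hm.monotoneOn ma (cl t) (cl t).1
  have hr1 : ∀ t, r t ≤ δ := fun t => by
    rw [← h1]; exact hm.monotoneOn (cl t) mb (cl t).2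
  set κ : ℝ → ℝ := Function.invFunOn ρ (Icc a b) with hκ
  have hex : ∀ x ∈ Icc 0 δ, ∃ t ∈ Icc a b, ρ t = x := fun x hx =>
    intermediate_value_Icc hab.le hρ (by rwa [h0, h1])
  have hκm : ∀ x ∈ Icc 0 δ, κ x ∈ Icc a b := fun x hx => Function.invFunOn_mem (hex x hx)
  have hκe : ∀ x ∈ Icc 0 δ, ρ (κ x) = x := fun x hx => Function.invFunOn_eq (hex x hx)
  -- κ inverts ρ, and F N is the step function of x whose value is Φ at the grid point to the left
  -- of κ x. The Riemann sum is exactly the integral of g times F N, so dominated convergence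
  -- applies. Clamping the time to [a, b] removes the rest of the curve from the sum.
  set F : ℕ → ℝ → E := fun N x => Φ (L * ((⌈κ x / L * N⌉₊ : ℝ) - 1) / N) with hF
  have step : ∀ N : ℕ, 0 < N → ∀ i < N, ∀ x ∈ Ioc (r (L * i / N)) (r (L * (i + 1 : ℕ) / N)),
      ⌈κ x / L * N⌉₊ = i + 1 := by
    intro N hN i hi x hx
    have hxm : x ∈ Icc 0 δ := ⟨(hr0 _).trans hx.1.le, hx.2.trans (hr1 _)⟩
    have km := hκm x hxm
    have ke := hκe x hxm
    have hNr : (0 : ℝ) < N := by exact_mod_cast hN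
    have x0 : 0 < x := (hr0 _).trans_lt hx.1
    have ka : a < κ x := lt_of_le_of_ne km.1 fun h => by rw [← h, h0] at ke; linarith
    have g1 : L * i / N < κ x := by
      by_contra hc
      push Not at hc
      have : κ x ≤ max a (min b (L * i / N)) := le_max_of_le_right (le_min km.2 hc)
      have := hm.monotoneOn km (cl _) this
      rw [ke] at this
      exact absurd hx.1 (not_lt.2 this)
    have g2 : κ x ≤ L * (i + 1 : ℕ) / N := by
      by_contra hc
      push Not at hc
      have : max a (min b (L * (i + 1 : ℕ) / N)) < κ x := max_lt ka (min_lt_of_right_lt hc)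
      have := hm (cl _) km this
      rw [ke] at this
      exact absurd hx.2 (not_le.2 this)
    rw [Nat.ceil_eq_iff (Nat.succ_ne_zero i)]
    constructor
    · simp only [Nat.succ_sub_one]
      rw [div_mul_eq_mul_div, lt_div_iff₀ hL]
      rw [div_lt_iff₀ hNr] at g1
      linarith
    · rw [div_mul_eq_mul_div, div_le_iff₀ hL]
      rw [le_div_iff₀ hNr] at g2
      linarith
  have gint : ∀ x y, x ∈ Icc 0 δ → y ∈ Icc 0 δ → IntervalIntegrable g volume x y := fun x y hx hy =>
    (hg.mono (uIcc_subset_Icc hx hy)).intervalIntegrable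
  have rm : ∀ t, r t ∈ Icc 0 δ := fun t => ⟨hr0 t, hr1 t⟩
  have z0 : (0 : ℝ) ∈ Icc 0 δ := ⟨le_rfl, hδ.le⟩
  have piece : ∀ N : ℕ, 0 < N → ∀ i < N,
      IntervalIntegrable (fun x => g x • F N x) volume (r (L * i / N)) (r (L * (i + 1 : ℕ) / N)) ∧
      (f (max a (min b (L * (i + 1 : ℕ) / N))) - f (max a (min b (L * i / N)))) • Φ (L * i / N)
        = ∫ x in r (L * i / N)..r (L * (i + 1 : ℕ) / N), g x • F N x := by
    intro N hN i hi
    have hle : r (L * i / N) ≤ r (L * (i + 1 : ℕ) / N) := hrm (by push_cast; gcongr; linarith)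
    have hFe : ∀ x ∈ Set.uIoc (r (L * i / N)) (r (L * (i + 1 : ℕ) / N)),
        g x • Φ (L * i / N) = g x • F N x := fun x hx => by
      rw [uIoc_of_le hle] at hx
      simp only [hF]
      rw [step N hN i hi x hx]
      push_cast
      rw [add_sub_cancel_right]
    constructor
    · exact (((hg.mono (uIcc_subset_Icc (rm _) (rm _))).smul
        (continuousOn_const (c := Φ (L * i / N)))).intervalIntegrable).congr hFe
    · rw [hf _ (cl _), hf _ (cl _), add_sub_add_left_eq_sub,
        intervalIntegral.integral_interval_sub_left (gint _ _ z0 (rm _)) (gint _ _ z0 (rm _)),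
        ← intervalIntegral.integral_smul_const]
      exact intervalIntegral.integral_congr_ae (Eventually.of_forall hFe)
  have ends : ∀ N : ℕ, 0 < N → r (L * (0 : ℕ) / N) = 0 ∧ r (L * N / N) = δ := by
    intro N hN
    have hNr : (N : ℝ) ≠ 0 := by exact_mod_cast hN.ne'
    constructor
    · simp only [hr, Nat.cast_zero, mul_zero, zero_div]
      rw [min_eq_right (by linarith), max_eq_left ha, h0]
    · simp only [hr]
      rw [mul_div_cancel_right₀ _ hNr, min_eq_left hb, max_eq_right hab.le, h1]
  have total : ∀ N : ℕ, 0 < N → IntervalIntegrable (fun x => g x • F N x) volume 0 δ ∧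
      riemannSum L Φ (fun t => f (max a (min b t))) N = ∫ x in 0..δ, g x • F N x := by
    intro N hN
    have p := piece N hN
    obtain ⟨e0, e1⟩ := ends N hN
    constructor
    · have := IntervalIntegrable.trans_iterate (a := fun i : ℕ => r (L * i / N)) (n := N)
        (μ := volume) (f := fun x => g x • F N x) fun k hk => (p k hk).1
      rwa [e0, e1] at this
    · rw [riemannSum, Finset.sum_congr rfl fun i hi => (p i (Finset.mem_range.1 hi)).2]
      have := intervalIntegral.sum_integral_adjacent_intervals (a := fun i : ℕ => r (L * i / N)) (n := N)
        (μ := volume) (f := fun x => g x • F N x) fun k hk => (p k hk).1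
      rwa [e0, e1] at this
  have main : Tendsto (fun N : ℕ => ∫ x in 0..δ, g x • F N x) atTop (𝓝 (∫ x in 0..δ, g x • Ψ x)) := by
    refine intervalIntegral.tendsto_integral_filter_of_dominated_convergence (fun x => |g x| * C) ?_ ?_ ?_ ?_
    · filter_upwards [eventually_gt_atTop 0] with N hN
      exact ((total N hN).1.def').aestronglyMeasurable
    · filter_upwards [eventually_gt_atTop 0] with N hN
      refine Eventually.of_forall fun x hx => ?_
      rw [uIoc_of_le hδ.le] at hx
      have hx' := Ioc_subset_Icc_self hx
      have km := hκm x hx'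
      have ka : 0 < κ x := lt_of_le_of_ne (ha.trans km.1) fun h => by
        have : κ x = a := le_antisymm (by linarith) km.1
        have ke := hκe x hx'
        rw [this, h0] at ke
        linarith [hx.1]
      rw [norm_smul, Real.norm_eq_abs]
      refine mul_le_mul_of_nonneg_left (hC _ ?_) (abs_nonneg _)
      have hNr : (0 : ℝ) < N := by exact_mod_cast hN
      have c1 : 1 ≤ ⌈κ x / L * N⌉₊ := Nat.one_le_ceil_iff.2 (by positivity)
      have c2 : ⌈κ x / L * N⌉₊ ≤ N := by
        rw [Nat.ceil_le, div_mul_eq_mul_div, div_le_iff₀ hL]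
        have := km.2.trans hb
        nlinarith
      have := grid_mem hL.le (N := N) (i := ⌈κ x / L * N⌉₊ - 1) (by omega)
      rwa [Nat.cast_sub c1, Nat.cast_one] at this
    · exact (gint _ _ z0 ⟨hδ.le, le_rfl⟩).abs.mul_const C
    · have : ∀ᵐ x : ℝ, x ≠ δ := by simp [ae_iff]
      filter_upwards [this] with x hxne hx
      rw [uIoc_of_le hδ.le] at hx
      have hx' := Ioc_subset_Icc_self hx
      have km := hκm x hx'
      have ke := hκe x hx'
      have kI : κ x ∈ Ioo a b := ⟨lt_of_le_of_ne km.1 fun h => by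
          rw [← h, h0] at ke; linarith [hx.1],
        lt_of_le_of_ne km.2 fun h => by
          rw [h, h1] at ke; exact hxne ke.symm⟩
      refine Tendsto.const_smul ?_ (g x)
      have e := hΨ _ kI
      rw [ke] at e
      rw [← e]
      exact (hΦ _ kI).tendsto.comp (tendsto_grid hL (ha.trans km.1))
  refine main.congr' ?_
  filter_upwards [eventually_gt_atTop 0] with N hN using (total N hN).2.symm

/-- The parameter δ - ρ is increasing, and the substitution x ↦ δ - x produces the sign. -/
theorem tendsto_riemannSum_anti {L a b δ C : ℝ} (hL : 0 < L) (ha : 0 ≤ a) (hab : a < b) (hb : b ≤ L)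
    {ρ : ℝ → ℝ} (hρ : ContinuousOn ρ (Icc a b)) (hm : StrictAntiOn ρ (Icc a b)) (h0 : ρ a = δ)
    (h1 : ρ b = 0) {g : ℝ → ℝ} (hg : ContinuousOn g (Icc 0 δ)) {f : ℝ → ℝ} {c : ℝ}
    (hf : ∀ t ∈ Icc a b, f t = c + ∫ x in 0..ρ t, g x) {Φ : ℝ → E} (hC : ∀ t ∈ Icc 0 L, ‖Φ t‖ ≤ C)
    {Ψ : ℝ → E} (hΦ : ∀ t ∈ Ioo a b, ContinuousAt Φ t) (hΨ : ∀ t ∈ Ioo a b, Φ t = Ψ (ρ t)) :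
    Tendsto (riemannSum L Φ fun t => f (max a (min b t))) atTop
      (𝓝 (-∫ x in 0..δ, g x • Ψ x)) := by
  have ma : a ∈ Icc a b := ⟨le_rfl, hab.le⟩
  have mb : b ∈ Icc a b := ⟨hab.le, le_rfl⟩
  have hmaps : MapsTo (fun x => δ - x) (Icc 0 δ) (Icc 0 δ) := fun x hx =>
    ⟨by linarith [hx.2], by linarith [hx.1]⟩
  have hδ : 0 < δ := by rw [← h0, ← h1]; exact hm ma mb hab
  have gint : ∀ x y, x ∈ Icc 0 δ → y ∈ Icc 0 δ → IntervalIntegrable g volume x y := fun x y hx hy =>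
    (hg.mono (uIcc_subset_Icc hx hy)).intervalIntegrable
  have z0 : (0 : ℝ) ∈ Icc 0 δ := ⟨le_rfl, hδ.le⟩
  have zδ : δ ∈ Icc 0 δ := ⟨hδ.le, le_rfl⟩
  have key := tendsto_riemannSum_mono hL ha hab hb (ρ := fun t => δ - ρ t)
    (continuousOn_const.sub hρ) (fun x hx y hy hxy => by
      have := hm hx hy hxy
      simp only; linarith) (δ := δ) (by simp [h0]) (by simp [h1])
    (g := fun x => -g (δ - x)) ((hg.comp (by fun_prop) hmaps).neg)
    (f := f) (c := c + ∫ x in 0..δ, g x) (fun t ht => by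
      have hρt : ρ t ∈ Icc 0 δ := ⟨by rw [← h1]; exact hm.antitoneOn ht mb ht.2,
        by rw [← h0]; exact hm.antitoneOn ma ht ht.1⟩
      rw [hf t ht, intervalIntegral.integral_neg, intervalIntegral.integral_comp_sub_left (fun x => g x) δ,
        sub_sub_cancel, sub_zero,
        ← intervalIntegral.integral_add_adjacent_intervals (gint _ _ z0 hρt) (gint _ _ hρt zδ)]
      ring) hC (Ψ := fun x => Ψ (δ - x)) hΦ
    (fun t ht => by simp only [sub_sub_cancel]; exact hΨ t ht)
  convert key using 2
  have := intervalIntegral.integral_comp_sub_left (a := 0) (b := δ) (fun x => g x • Ψ x) δ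
  rw [sub_self, sub_zero] at this
  rw [← this, ← intervalIntegral.integral_neg]
  simp only [neg_smul]

end

/-! ### Domains cut out of a fan by two rays -/

section

variable {Ω : Set ℂ} {ψ : ℂ → E3}

lemma IsNet.integral_fderiv {ε δ : ℝ} {P Px Py : ℝ → ℝ → ℂ}
    (h : IsNet Ω ψ ε δ P Px Py) {E : Type*} [NormedAddCommGroup E] [NormedSpace ℝ E] [CompleteSpace E]
    {χ : ℂ → E} (hχ : ContDiff ℝ 1 χ) {x : ℝ} (hx : x ∈ Icc 0 δ) :
    ∫ s in 0..x, fderiv ℝ χ (P s 0) (Px s 0) = χ (P x 0) - χ (P 0 0) := by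
  have z0 := h.zero_mem
  have hp := h.comp_partials hχ
  have hsub : Icc 0 x ⊆ Icc 0 δ := Icc_subset_Icc_right hx.2
  refine intervalIntegral.integral_eq_sub_of_hasDerivAt_of_le hx.1
    (fun s hs => ((hp.hu s (hsub hs) 0 z0).continuousWithinAt.mono hsub)) (fun s hs => ?_) ?_
  · exact (hp.hu s (hsub (Ioo_subset_Icc_self hs)) 0 z0).hasDerivAt
      (Icc_mem_nhds hs.1 (hs.2.trans_le hx.2))
  · refine ContinuousOn.intervalIntegrable ?_
    rw [uIcc_of_le hx.1]
    exact (hp.cu.comp (f := fun s : ℝ => (s, (0 : ℝ))) (by fun_prop) fun s hs => ⟨hs, z0⟩).mono hsub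

/-- An open set that consists, within a fan, of whole sectors bounded by the rays `i₁` and `i₂`. -/
structure IsCut (Γ : Set ℂ) (n : ℕ) (δ : ℝ) (P : ℕ → ℝ → ℝ → ℂ) (i₁ i₂ : ℕ) (a : ℕ → ℝ) : Prop where
  cell : ∀ k < n, (a k = 1 ∧ ∀ x ∈ Ioo 0 δ, ∀ y ∈ Ioo 0 δ, P k x y ∈ Γ) ∨
      (a k = 0 ∧ ∀ x ∈ Ioo 0 δ, ∀ y ∈ Ioo 0 δ, P k x y ∉ Γ)
  eq_pred : ∀ k < n, k ≠ i₁ → k ≠ i₂ → a k = a (cycPred n k)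
  ray₁ : ∀ x ∈ Ico 0 δ, P i₁ x 0 ∉ Γ
  ray₂ : ∀ x ∈ Ico 0 δ, P i₂ x 0 ∉ Γ

/-- Membership in Γ changes only across the two rays of the polygon. -/
lemma IsCut.sum_sub {Γ : Set ℂ} {n : ℕ} {δ : ℝ} {P : ℕ → ℝ → ℝ → ℂ} {i₁ i₂ : ℕ} {a : ℕ → ℝ}
    (hc : IsCut Γ n δ P i₁ i₂ a) (h1 : i₁ < n) (h2 : i₂ < n) (hne : i₁ ≠ i₂)
    {E : Type*} [AddCommGroup E] [Module ℝ E] (G : ℕ → E) :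
    ∑ k ∈ Finset.range n, (a k - a (cycPred n k)) • G k
      = (a i₁ - a (cycPred n i₁)) • G i₁ + (a i₂ - a (cycPred n i₂)) • G i₂ := by
  refine Finset.sum_eq_add i₁ i₂ hne (fun k hk hki => ?_) (fun h => absurd (Finset.mem_range.2 h1) h)
    (fun h => absurd (Finset.mem_range.2 h2) h)
  rw [hc.eq_pred k (Finset.mem_range.1 hk) hki.1 hki.2, sub_self, zero_smul]

/-- The jumps around the whole cycle add up to zero, and only two of them can be nonzero. -/
lemma IsCut.sub_add_sub {Γ : Set ℂ} {n : ℕ} {δ : ℝ} {P : ℕ → ℝ → ℝ → ℂ} {i₁ i₂ : ℕ} {a : ℕ → ℝ}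
    (hc : IsCut Γ n δ P i₁ i₂ a) (h1 : i₁ < n) (h2 : i₂ < n) (hne : i₁ ≠ i₂) :
    (a i₁ - a (cycPred n i₁)) + (a i₂ - a (cycPred n i₂)) = 0 := by
  have := hc.sum_sub h1 h2 hne (fun _ => (1 : ℝ))
  simp only [smul_eq_mul, mul_one] at this
  rw [← this, Finset.sum_sub_distrib, sum_cycPred, sub_self]

namespace IsFan

variable {p : ℂ} {n : ℕ} {δ : ℝ} {P Px Py : ℕ → ℝ → ℝ → ℂ} {R : ℕ → ℝ → ℂ}

/-- Stokes' formula for an open set that consists of sectors of a fan. -/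
lemma setIntegral_curl (hψ : IsBranchedPSImmersion Ω ψ) (h : IsFan Ω ψ p n δ P Px Py R) {τ : ℝ}
    (hτ : τ = 1 ∨ τ = -1)
    (hd : ∀ k < n, ∀ x ∈ Icc 0 δ, ∀ y ∈ Icc 0 δ, 0 < τ * planarDet (Px k x y) (Py k x y))
    {Γ : Set ℂ} (hΓ : IsOpen Γ) {i₁ i₂ : ℕ} {a : ℕ → ℝ} (hc : IsCut Γ n δ P i₁ i₂ a)
    (h1 : i₁ < n) (h2 : i₂ < n) (hne : i₁ ≠ i₂) {g : ℂ → ℂ} (hg : ContDiff ℝ 1 g)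
    (hsupp : tsupport g ⊆ fanSet n δ P) :
    IntegrableOn (curl g) Γ ∧
    ∫ z in Γ, curl g z = (τ * (a i₂ - a (cycPred n i₂))) •
      ((∫ x in 0..δ, g (P i₂ x 0) * Px i₂ x 0) - ∫ x in 0..δ, g (P i₁ x 0) * Px i₁ x 0) := by
  have z0 := h.zero_mem
  have hcc : Continuous (curl g) := by
    have := hg.continuous_fderiv one_ne_zero
    exact (continuous_const.mul (this.clm_apply continuous_const)).sub (this.clm_apply continuous_const)
  have hoff : ∀ z ∉ fanSet n δ P, curl g z = 0 := fun z hz => by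
    have : fderiv ℝ g z = 0 := IsNet.fderiv_eq_zero_of_notMem fun hc => hz (hsupp hc)
    simp [curl, this]
  have hedge : ∀ k < n, ∀ x ∈ Icc 0 δ, ∀ y ∈ Icc 0 δ, x = δ ∨ y = δ → P k x y ∉ tsupport g :=
    fun k hk x hx y hy hxy hm => h.edge_notMem hk hx hy hxy (hsupp hm)
  obtain ⟨k1, k2⟩ := h.setIntegral_eq_sum hΓ hc.cell hoff fun k hk _ =>
    hcc.continuousOn.integrableOn_compact (h.net k hk).isCompact_netImage
  refine ⟨k1, k2.trans ?_⟩
  set G : ℕ → ℂ := fun k => ∫ x in 0..δ, g (P k x 0) * Px k x 0 with hG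
  have e1 : ∀ k < n, ∫ z in netImage δ (P k), curl g z
      = (τ : ℂ) * (G k - ∫ y in 0..δ, g (P k 0 y) * Py k 0 y) := fun k hk =>
    (h.net k hk).integral_curl hψ hτ (hd k hk) hg (hedge k hk)
  have e2 : ∀ k < n, ∫ y in 0..δ, g (P (cycPred n k) 0 y) * Py (cycPred n k) 0 y = G k := by
    intro k hk
    refine intervalIntegral.integral_congr fun y hy => ?_
    rw [uIcc_of_le h.pos.le] at hy
    rw [h.right_pred_eq hk hy, h.py_pred hk hy]
  -- Summation by parts around the centre: each ray is the first edge of one cell and the second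
  -- edge of the preceding one, with opposite signs.
  have e3 : ∑ k ∈ Finset.range n, a k • ∫ z in netImage δ (P k), curl g z
      = (τ : ℂ) * ∑ k ∈ Finset.range n, (a k - a (cycPred n k)) • G k := by
    have : ∑ k ∈ Finset.range n, a k • ∫ y in 0..δ, g (P k 0 y) * Py k 0 y
        = ∑ k ∈ Finset.range n, a (cycPred n k) • G k := by
      rw [← sum_cycPred]
      exact Finset.sum_congr rfl fun k hk => by rw [e2 k (Finset.mem_range.1 hk)]
    simp_rw [sub_smul]
    rw [Finset.sum_sub_distrib, ← this, ← Finset.sum_sub_distrib, Finset.mul_sum]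
    refine Finset.sum_congr rfl fun k hk => ?_
    rw [e1 k (Finset.mem_range.1 hk), ← smul_sub, mul_smul_comm]
  rw [e3, hc.sum_sub h1 h2 hne]
  have := hc.sub_add_sub h1 h2 hne
  have e4 : a i₁ - a (cycPred n i₁) = -(a i₂ - a (cycPred n i₂)) := by linarith
  rw [e4]
  simp only [hG, Complex.real_smul]
  push_cast
  ring

end IsFan

namespace IsBoundaryFan

variable {j : ℕ} {γ : ℝ → ℂ} {q : ℂ} {n : ℕ} {δ : ℝ} {P Px Py : ℕ → ℝ → ℝ → ℂ} {R : ℕ → ℝ → ℂ}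
  {i₁ i₂ n₁ n₂ : ℕ} {a₁ b₁ a₂ b₂ : ℝ} {ρ₁ ρ₂ : ℝ → ℝ}

section

variable (h : IsBoundaryFan Ω ψ j γ q n δ P Px Py R i₁ i₂ n₁ n₂ a₁ b₁ a₂ b₂ ρ₁ ρ₂)

include h

lemma param_mem₁ {t : ℝ} (ht : t ∈ Icc a₁ b₁) : ρ₁ t ∈ Icc 0 δ :=
  ⟨by rw [← h.end₁]; exact h.anti₁.antitoneOn ht ⟨h.ab₁.le, le_rfl⟩ ht.2,
    by rw [← h.start₁]; exact h.anti₁.antitoneOn ⟨le_rfl, h.ab₁.le⟩ ht ht.1⟩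

lemma param_mem₂ {t : ℝ} (ht : t ∈ Icc a₂ b₂) : ρ₂ t ∈ Icc 0 δ :=
  ⟨by rw [← h.start₂]; exact h.mono₂.monotoneOn ⟨le_rfl, h.ab₂.le⟩ ht ht.1,
    by rw [← h.end₂]; exact h.mono₂.monotoneOn ht ⟨h.ab₂.le, le_rfl⟩ ht.2⟩

lemma a₁_nonneg : 0 ≤ a₁ := (Nat.cast_nonneg _).trans h.left₁

lemma a₂_nonneg : 0 ≤ a₂ := (Nat.cast_nonneg _).trans h.left₂

lemma b₁_le : b₁ ≤ 2 * j := h.right₁.trans (by exact_mod_cast h.side₁)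

lemma b₂_le : b₂ ≤ 2 * j := h.right₂.trans (by exact_mod_cast h.side₂)

lemma map_b₁ : γ b₁ = q := by
  rw [h.eq₁ b₁ ⟨h.ab₁.le, le_rfl⟩, h.end₁, h.fan.ray_zero h.lt₁]

lemma map_a₂ : γ a₂ = q := by
  rw [h.eq₂ a₂ ⟨le_rfl, h.ab₂.le⟩, h.start₂, h.fan.ray_zero h.lt₂]

lemma eq_cell₁ {t : ℝ} (ht : t ∈ Icc a₁ b₁) : γ t = P i₁ (ρ₁ t) 0 := by
  rw [h.eq₁ t ht, h.fan.left i₁ h.lt₁ _ (h.param_mem₁ ht)]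

lemma eq_cell₂ {t : ℝ} (ht : t ∈ Icc a₂ b₂) : γ t = P i₂ (ρ₂ t) 0 := by
  rw [h.eq₂ t ht, h.fan.left i₂ h.lt₂ _ (h.param_mem₂ ht)]

lemma exists_param₁ {x : ℝ} (hx : x ∈ Icc 0 δ) : ∃ t ∈ Icc a₁ b₁, ρ₁ t = x :=
  intermediate_value_Icc' h.ab₁.le h.cont₁ (by rwa [h.start₁, h.end₁])

lemma exists_param₂ {x : ℝ} (hx : x ∈ Icc 0 δ) : ∃ t ∈ Icc a₂ b₂, ρ₂ t = x :=
  intermediate_value_Icc h.ab₂.le h.cont₂ (by rwa [h.start₂, h.end₂])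

lemma eq_or_of_mem {t : ℝ} (ht : t ∈ Icc 0 (2 * (j : ℝ))) {k : ℕ} (hk : k < n) {x y : ℝ}
    (hx : x ∈ Icc 0 δ) (hy : y ∈ Icc 0 δ) (he : γ t = P k x y) :
    ∃ s ∈ Icc 0 δ, P k x y = R i₁ s ∨ P k x y = R i₂ s := by
  rcases h.cover t ht k hk ⟨(x, y), ⟨hx, hy⟩, he.symm⟩ with h1 | h1
  · exact ⟨ρ₁ t, h.param_mem₁ h1, Or.inl (by rw [← he, h.eq₁ t h1])⟩
  · exact ⟨ρ₂ t, h.param_mem₂ h1, Or.inr (by rw [← he, h.eq₂ t h1])⟩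

lemma cell_notMem {k : ℕ} (hk : k < n) {x y : ℝ} (hx : x ∈ Ioo 0 δ) (hy : y ∈ Ioo 0 δ) :
    P k x y ∉ γ '' Icc 0 (2 * (j : ℝ)) := by
  rintro ⟨t, ht, he⟩
  have hx' := Ioo_subset_Icc_self hx
  have hy' := Ioo_subset_Icc_self hy
  have key : ∀ i < n, ∀ s ∈ Icc 0 δ, P k x y ≠ R i s := fun i hi s hs he => by
    rcases hs.1.eq_or_lt with h0 | h0
    · rw [← h0, h.fan.ray_zero hi, ← h.fan.center k hk] at he
      linarith [(h.fan.eq_center hk hk hx' hy' he).1, hx.1]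
    · rcases h.fan.eq_ray hi hk hs h0 hx' hy' he with ⟨-, -, h1⟩ | ⟨-, h1, -⟩
      · linarith [hy.1]
      · linarith [hx.1]
  obtain ⟨s, hs, h1 | h1⟩ := h.eq_or_of_mem ht hk hx' hy' he
  · exact key _ h.lt₁ _ hs h1
  · exact key _ h.lt₂ _ hs h1

lemma ray_notMem {k : ℕ} (hk : k < n) (hk1 : k ≠ i₁) (hk2 : k ≠ i₂) {x : ℝ} (hx : x ∈ Ioo 0 δ) :
    P k x 0 ∉ γ '' Icc 0 (2 * (j : ℝ)) := by
  rintro ⟨t, ht, he⟩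
  have hx' := Ioo_subset_Icc_self hx
  obtain ⟨s, hs, h1 | h1⟩ := h.eq_or_of_mem ht hk hx' h.fan.zero_mem he
  · rw [h.fan.left k hk x hx'] at h1
    exact hk1 (h.fan.ray_disj k hk i₁ h.lt₁ x hx' s hs hx.1 h1)
  · rw [h.fan.left k hk x hx'] at h1
    exact hk2 (h.fan.ray_disj k hk i₂ h.lt₂ x hx' s hs hx.1 h1)

/-- A domain bounded by the polygon consists of whole sectors of the fan. -/
lemma exists_cut {Γ : Set ℂ} (hΓ : IsOpen Γ) (hfr : frontier Γ = γ '' Icc 0 (2 * (j : ℝ))) :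
    ∃ a : ℕ → ℝ, IsCut Γ n δ P i₁ i₂ a := by
  classical
  have hδ := h.fan.pos
  have z0 := h.fan.zero_mem
  -- The image of an open cell is connected and misses the frontier of Γ.
  have dich : ∀ k < n, (∀ x ∈ Ioo 0 δ, ∀ y ∈ Ioo 0 δ, P k x y ∈ Γ) ∨
      (∀ x ∈ Ioo 0 δ, ∀ y ∈ Ioo 0 δ, P k x y ∉ Γ) := by
    intro k hk
    by_contra hcon
    push Not at hcon
    obtain ⟨⟨x, hx, y, hy, h1⟩, x', hx', y', hy', h2⟩ := hcon
    have hpre : IsPreconnected ((fun z : ℝ × ℝ => P k z.1 z.2) '' (Ioo 0 δ ×ˢ Ioo 0 δ)) :=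
      (isPreconnected_Ioo.prod isPreconnected_Ioo).image _ ((h.fan.net k hk).cont.mono
        (prod_mono Ioo_subset_Icc_self Ioo_subset_Icc_self))
    have hdich : ∀ z ∈ (fun z : ℝ × ℝ => P k z.1 z.2) '' (Ioo 0 δ ×ˢ Ioo 0 δ), z ∈ Γ ∨ z ∈ (closure Γ)ᶜ := by
      rintro _ ⟨⟨u, v⟩, ⟨hu, hv⟩, rfl⟩
      by_contra hcon
      push Not at hcon
      refine h.cell_notMem hk hu hv ?_
      rw [← hfr, hΓ.frontier_eq]
      exact ⟨notMem_compl_iff.1 hcon.2, hcon.1⟩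
    have m1 : P k x y ∈ (fun z : ℝ × ℝ => P k z.1 z.2) '' (Ioo 0 δ ×ˢ Ioo 0 δ) := ⟨(x, y), ⟨hx, hy⟩, rfl⟩
    have m2 : P k x' y' ∈ (fun z : ℝ × ℝ => P k z.1 z.2) '' (Ioo 0 δ ×ˢ Ioo 0 δ) :=
      ⟨(x', y'), ⟨hx', hy'⟩, rfl⟩
    obtain ⟨z, -, hz1, hz2⟩ := hpre Γ (closure Γ)ᶜ hΓ isClosed_closure.isOpen_compl hdich
      ⟨_, m2, h2⟩ ⟨_, m1, (hdich _ m1).resolve_left h1⟩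
    exact hz2 (subset_closure hz1)
  set a : ℕ → ℝ := fun k => if ∀ x ∈ Ioo 0 δ, ∀ y ∈ Ioo 0 δ, P k x y ∈ Γ then 1 else 0 with ha
  have hcell : ∀ k < n, (a k = 1 ∧ ∀ x ∈ Ioo 0 δ, ∀ y ∈ Ioo 0 δ, P k x y ∈ Γ) ∨
      (a k = 0 ∧ ∀ x ∈ Ioo 0 δ, ∀ y ∈ Ioo 0 δ, P k x y ∉ Γ) := by
    intro k hk
    by_cases hh : ∀ x ∈ Ioo 0 δ, ∀ y ∈ Ioo 0 δ, P k x y ∈ Γ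
    · left; exact ⟨if_pos hh, hh⟩
    · right; exact ⟨if_neg hh, (dich k hk).resolve_left hh⟩
  have hfrn : ∀ z ∈ γ '' Icc 0 (2 * (j : ℝ)), z ∉ Γ := fun z hz hzΓ => by
    rw [← hfr, hΓ.frontier_eq] at hz
    exact hz.2 hzΓ
  have hm : δ / 2 ∈ Ioo 0 δ := ⟨by linarith, by linarith⟩
  refine ⟨a, hcell, fun k hk h1 h2 => ?_, fun x hx => hfrn _ ?_, fun x hx => hfrn _ ?_⟩
  -- The midpoint of a ray off the polygon lies in Γ or in the exterior. Both are open, and both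
  -- adjacent open cells come arbitrarily close to that point.
  · have hz : P k (δ / 2) 0 ∉ frontier Γ := by
      rw [hfr]; exact h.ray_notMem hk h1 h2 hm
    have hpk := cycPred_lt hk
    have e1 := h.fan.right_pred_eq hk (Ioo_subset_Icc_self hm)
    have near : ∀ {V : Set ℂ}, IsOpen V → P k (δ / 2) 0 ∈ V →
        (∃ y ∈ Ioo 0 δ, P k (δ / 2) y ∈ V) ∧ ∃ y ∈ Ioo 0 δ, P (cycPred n k) y (δ / 2) ∈ V := by
      intro V hV hzV
      have c1 := ((h.fan.net k hk).part.hv (δ / 2) (Ioo_subset_Icc_self hm) 0 z0).continuousWithinAt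
      have c2 := ((h.fan.net _ hpk).part.hu 0 z0 (δ / 2) (Ioo_subset_Icc_self hm)).continuousWithinAt
      have f1 := c1.preimage_mem_nhdsWithin (hV.mem_nhds hzV)
      have f2 := c2.preimage_mem_nhdsWithin (hV.mem_nhds (by rwa [e1]))
      have hne : (𝓝[Ioo 0 δ] (0 : ℝ)).NeBot := by
        rw [← mem_closure_iff_nhdsWithin_neBot, closure_Ioo hδ.ne]; exact z0
      have hle := nhdsWithin_mono (0 : ℝ) (Ioo_subset_Icc_self : Ioo 0 δ ⊆ Icc 0 δ)
      constructor
      · obtain ⟨y, hy, hy'⟩ := (Filter.inter_mem (hle f1) self_mem_nhdsWithin |> hne.nonempty_of_mem)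
        exact ⟨y, hy', hy⟩
      · obtain ⟨y, hy, hy'⟩ := (Filter.inter_mem (hle f2) self_mem_nhdsWithin |> hne.nonempty_of_mem)
        exact ⟨y, hy', hy⟩
    by_cases hzΓ : P k (δ / 2) 0 ∈ Γ
    · obtain ⟨⟨y, hy, hy1⟩, y', hy', hy2⟩ := near hΓ hzΓ
      rcases hcell k hk with ⟨c1, c2⟩ | ⟨c1, c2⟩
      · rcases hcell _ hpk with ⟨d1, d2⟩ | ⟨d1, d2⟩
        · rw [c1, d1]
        · exact absurd hy2 (d2 _ hy' _ hm)
      · exact absurd hy1 (c2 _ hm _ hy)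
    · have hzc : P k (δ / 2) 0 ∈ (closure Γ)ᶜ := fun hc => hz (by
        rw [hΓ.frontier_eq]; exact ⟨hc, hzΓ⟩)
      obtain ⟨⟨y, hy, hy1⟩, y', hy', hy2⟩ := near isClosed_closure.isOpen_compl hzc
      rcases hcell k hk with ⟨c1, c2⟩ | ⟨c1, c2⟩
      · exact absurd (subset_closure (c2 _ hm _ hy)) hy1
      · rcases hcell _ hpk with ⟨d1, d2⟩ | ⟨d1, d2⟩
        · exact absurd (subset_closure (d2 _ hy' _ hm)) hy2
        · rw [c1, d1]
  · obtain ⟨t, ht, rfl⟩ := h.exists_param₁ (Ico_subset_Icc_self hx)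
    exact ⟨t, ⟨h.a₁_nonneg.trans ht.1, ht.2.trans h.b₁_le⟩, h.eq_cell₁ ht⟩
  · obtain ⟨t, ht, rfl⟩ := h.exists_param₂ (Ico_subset_Icc_self hx)
    exact ⟨t, ⟨h.a₂_nonneg.trans ht.1, ht.2.trans h.b₂_le⟩, h.eq_cell₂ ht⟩

/-- The Riemann sums of a test function supported in the fan converge to integrals along the
two rays. -/
lemma tendsto_riemannSum {E : Type*} [NormedAddCommGroup E] [NormedSpace ℝ E] [CompleteSpace E]
    {χ : ℂ → ℝ} (hχ : ContDiff ℝ 1 χ) (hsupp : tsupport χ ⊆ fanSet n δ P) {Φ : ℝ → E} {C : ℝ}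
    (hC : ∀ t ∈ Icc 0 (2 * (j : ℝ)), ‖Φ t‖ ≤ C)
    (hΦ₁ : ∀ t ∈ Ioo a₁ b₁, ContinuousAt Φ t) (hΦ₂ : ∀ t ∈ Ioo a₂ b₂, ContinuousAt Φ t)
    {Ψ₁ Ψ₂ : ℝ → E} (hΨ₁ : ∀ t ∈ Ioo a₁ b₁, Φ t = Ψ₁ (ρ₁ t))
    (hΨ₂ : ∀ t ∈ Ioo a₂ b₂, Φ t = Ψ₂ (ρ₂ t)) :
    Tendsto (riemannSum (2 * j) Φ fun t => χ (γ t)) atTop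
      (𝓝 ((∫ x in 0..δ, fderiv ℝ χ (P i₂ x 0) (Px i₂ x 0) • Ψ₂ x)
        - ∫ x in 0..δ, fderiv ℝ χ (P i₁ x 0) (Px i₁ x 0) • Ψ₁ x)) := by
  have z0 := h.fan.zero_mem
  have hL : (0 : ℝ) < 2 * j := by
    have := h.a₁_nonneg; have := h.ab₁; have := h.b₁_le; linarith
  have hcont : ∀ i < n, ContinuousOn (fun x => fderiv ℝ χ (P i x 0) (Px i x 0)) (Icc 0 δ) := fun i hi =>
    (((h.fan.net i hi).comp_partials hχ).cu.comp (f := fun s : ℝ => (s, (0 : ℝ))) (by fun_prop)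
      fun s hs => ⟨hs, z0⟩)
  have T₁ := tendsto_riemannSum_anti hL h.a₁_nonneg h.ab₁ h.b₁_le h.cont₁ h.anti₁ h.start₁ h.end₁
    (hcont i₁ h.lt₁) (f := fun t => χ (γ t)) (c := χ q) (fun t ht => by
      rw [(h.fan.net i₁ h.lt₁).integral_fderiv hχ (h.param_mem₁ ht), ← h.eq_cell₁ ht,
        h.fan.center i₁ h.lt₁]
      ring) hC hΦ₁ hΨ₁
  have T₂ := tendsto_riemannSum_mono hL h.a₂_nonneg h.ab₂ h.b₂_le h.cont₂ h.mono₂ h.start₂ h.end₂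
    (hcont i₂ h.lt₂) (f := fun t => χ (γ t)) (c := χ q) (fun t ht => by
      rw [(h.fan.net i₂ h.lt₂).integral_fderiv hχ (h.param_mem₂ ht), ← h.eq_cell₂ ht,
        h.fan.center i₂ h.lt₂]
      ring) hC hΦ₂ hΨ₂
  have hzero : ∀ z ∉ fanSet n δ P, χ z = 0 := fun z hz =>
    image_eq_zero_of_notMem_tsupport fun hc => hz (hsupp hc)
  have hout : ∀ t ∈ Icc 0 (2 * (j : ℝ)), t ∉ Icc a₁ b₁ → t ∉ Icc a₂ b₂ → χ (γ t) = 0 := by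
    intro t ht h1 h2
    refine hzero _ ?_
    rintro ⟨k, hk, x, hx, y, hy, he⟩
    rcases h.cover t ht k hk ⟨(x, y), ⟨Ico_subset_Icc_self hx, Ico_subset_Icc_self hy⟩, he⟩ with h3 | h3
    · exact h1 h3
    · exact h2 h3
  have zδ : δ ∈ Icc 0 δ := ⟨h.fan.pos.le, le_rfl⟩
  have hza : χ (γ a₁) = 0 := by
    rw [h.eq_cell₁ ⟨le_rfl, h.ab₁.le⟩, h.start₁]
    exact hzero _ (h.fan.edge_notMem h.lt₁ zδ z0 (Or.inl rfl))
  have hzb : χ (γ b₂) = 0 := by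
    rw [h.eq_cell₂ ⟨h.ab₂.le, le_rfl⟩, h.end₂]
    exact hzero _ (h.fan.edge_notMem h.lt₂ zδ z0 (Or.inl rfl))
  have hab₁ := h.ab₁
  have hab₂ := h.ab₂
  -- Up to a constant, χ ∘ γ is the sum of its two clamped copies. If the arcs follow each other,
  -- χ(q) is counted twice. If they lie at the two ends of the parameter interval, each copy
  -- vanishes where the other is active.
  obtain ⟨c, hc⟩ : ∃ c : ℝ, ∀ t ∈ Icc 0 (2 * (j : ℝ)),
      χ (γ t) = (χ (γ (max a₂ (min b₂ t))) + χ (γ (max a₁ (min b₁ t)))) + c := by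
    rcases h.place with hp | ⟨hp, hp'⟩
    · refine ⟨-χ q, fun t ht => ?_⟩
      have hq : χ q = χ (γ a₂) := by rw [h.map_a₂]
      rcases le_total t a₂ with h1 | h1
      · rw [min_eq_right (show t ≤ b₂ by linarith), max_eq_left h1, min_eq_right (show t ≤ b₁ by linarith), hq]
        rcases le_total t a₁ with h2 | h2
        · rw [max_eq_left h2, hza]
          rcases h2.eq_or_lt with h3 | h3
          · rw [h3, hza]; ring
          · rw [hout t ht (fun hc => by linarith [hc.1]) (fun hc => by linarith [hc.1])]; ring
        · rw [max_eq_right h2]; ring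
      · rw [min_eq_left (show b₁ ≤ t by linarith), max_eq_right (show a₁ ≤ b₁ by linarith), h.map_b₁]
        rcases le_total t b₂ with h2 | h2
        · rw [min_eq_right h2, max_eq_right h1]; ring
        · rw [min_eq_left h2, max_eq_right (by linarith), hzb]
          rcases h2.eq_or_lt with h3 | h3
          · rw [← h3, hzb]; ring
          · rw [hout t ht (fun hc => by linarith [hc.2]) (fun hc => by linarith [hc.2])]; ring
    · refine ⟨0, fun t ht => ?_⟩
      have hba : b₂ ≤ a₁ := by
        have c1 := h.right₂
        have c2 := h.left₂
        have c3 := h.left₁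
        have c4 := h.right₁
        have c5 : (n₂ : ℝ) ≤ 0 := by linarith
        have c6 : (1 : ℝ) ≤ j := by
          have : 0 < j := by have := h.side₁; omega
          exact_mod_cast this
        linarith
      rcases le_total t b₂ with h1 | h1
      · rw [min_eq_right h1, max_eq_right (by linarith [ht.1]), min_eq_right (by linarith),
          max_eq_left (by linarith), hza]
        ring
      · rw [min_eq_left h1, max_eq_right (by linarith), hzb, min_eq_right (by linarith [ht.2])]
        rcases le_total t a₁ with h2 | h2
        · rw [max_eq_left h2, hza]
          rcases h1.eq_or_lt with h3 | h3
          · rw [← h3, hzb]; ring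
          rcases h2.eq_or_lt with h4 | h4
          · rw [h4, hza]; ring
          rw [hout t ht (fun hc => by linarith [hc.1]) (fun hc => by linarith [hc.2])]; ring
        · rw [max_eq_right h2]; ring
  have T := T₂.add T₁
  rw [← sub_eq_add_neg] at T
  refine T.congr fun N => ?_
  rw [riemannSum_congr hL.le hc, riemannSum_add]

end

end IsBoundaryFan

end

/-! ### Hazzidakis' formula in a fan -/

section

variable {Ω : Set ℂ} {ψ : ℂ → E3}

/-- The angle of the cell `k`, up to the sign of the orientation and the family. -/
def fanAngle (o τ : ℝ) (Px Py : ℕ → ℝ → ℝ → ℂ) (k : ℕ) (x y : ℝ) : ℝ :=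
  τ * netAngle (Px k) (Py k) x y - Real.pi * ((1 - o * τ * (-1) ^ k) / 2)

/-- The derivative of a test function along ray `k`. -/
def rayDeriv (χ : ℂ → ℝ) (P Px : ℕ → ℝ → ℝ → ℂ) (k : ℕ) (x : ℝ) : ℝ :=
  fderiv ℝ χ (P k x 0) (Px k x 0)

lemma neg_one_pow_cycPred {n k : ℕ} (hn : Even n) (hk : k < n) :
    (-1 : ℝ) ^ cycPred n k = -(-1) ^ k := by
  obtain ⟨r, rfl⟩ := hn
  unfold cycPred
  split_ifs with h
  · subst h
    have : r + r - 1 = 2 * (r - 1) + 1 := by omega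
    rw [this, pow_succ, pow_mul]; simp
  · obtain ⟨l, rfl⟩ := Nat.exists_eq_succ_of_ne_zero h
    simp [pow_succ]

lemma covHess_eq_zero {χ : ℂ → ℝ} {z : ℂ} (hz : z ∉ tsupport χ) (X Y : ℂ) : covHess χ z X Y = 0 := by
  have h1 : fderiv ℝ χ z = 0 := IsNet.fderiv_eq_zero_of_notMem hz
  have h2 : fderiv ℝ (fderiv ℝ χ) z = 0 := by
    by_contra hne
    exact hz (tsupport_fderiv_subset ℝ (support_fderiv_subset ℝ hne))
  simp [covHess, h1, h2]

namespace IsFan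

variable {p : ℂ} {n : ℕ} {δ : ℝ} {P Px Py : ℕ → ℝ → ℝ → ℂ} {R : ℕ → ℝ → ℂ}

lemma sum_neg_one_pow (h : IsFan Ω ψ p n δ P Px Py R) : ∑ k ∈ Finset.range n, (-1 : ℝ) ^ k = 0 := by
  obtain ⟨r, hr⟩ := h.even
  rw [geom_sum_eq (by norm_num), hr, ← two_mul, pow_mul]
  simp

lemma continuousOn_fanAngle_left (h : IsFan Ω ψ p n δ P Px Py R) (o τ : ℝ) {k : ℕ} (hk : k < n) :
    ContinuousOn (fun x => fanAngle o τ Px Py k x 0) (Icc 0 δ) :=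
  (continuousOn_const.mul ((h.net k hk).continuousOn_netAngle.comp (f := fun s : ℝ => (s, (0 : ℝ)))
    (by fun_prop) fun _ hs => ⟨hs, h.zero_mem⟩)).sub continuousOn_const

lemma continuousOn_fanAngle_right (h : IsFan Ω ψ p n δ P Px Py R) (o τ : ℝ) {k : ℕ} (hk : k < n) :
    ContinuousOn (fun x => fanAngle o τ Px Py k 0 x) (Icc 0 δ) :=
  (continuousOn_const.mul ((h.net k hk).continuousOn_netAngle.comp (f := fun s : ℝ => ((0 : ℝ), s))
    (by fun_prop) fun _ hs => ⟨h.zero_mem, hs⟩)).sub continuousOn_const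

lemma continuousOn_rayDeriv (h : IsFan Ω ψ p n δ P Px Py R) {χ : ℂ → ℝ} (hχ : ContDiff ℝ 1 χ)
    {k : ℕ} (hk : k < n) : ContinuousOn (rayDeriv χ P Px k) (Icc 0 δ) :=
  ((h.net k hk).comp_partials hχ).cu.comp (f := fun s : ℝ => (s, (0 : ℝ))) (by fun_prop)
      fun _ hs => ⟨hs, h.zero_mem⟩

lemma integral_rayDeriv (h : IsFan Ω ψ p n δ P Px Py R) {χ : ℂ → ℝ} (hχ : ContDiff ℝ 1 χ)
    (hsupp : tsupport χ ⊆ fanSet n δ P) {k : ℕ} (hk : k < n) :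
    ∫ x in 0..δ, rayDeriv χ P Px k x = -χ p := by
  have zδ : δ ∈ Icc 0 δ := ⟨h.pos.le, le_rfl⟩
  have h1 := (h.net k hk).integral_fderiv hχ zδ
  have h2 : χ (P k δ 0) = 0 := image_eq_zero_of_notMem_tsupport fun hc =>
    h.edge_notMem hk zδ h.zero_mem (Or.inl rfl) (hsupp hc)
  rw [h2, h.center k hk, zero_sub] at h1
  exact h1

lemma fanAngle_add (h : IsFan Ω ψ p n δ P Px Py R) (o τ : ℝ) {k : ℕ} (hk : k < n) {x : ℝ}
    (hx : x ∈ Icc 0 δ) : fanAngle o τ Px Py k x 0 + fanAngle o τ Px Py (cycPred n k) 0 x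
      = fanAngle o τ Px Py k 0 0 + fanAngle o τ Px Py (cycPred n k) 0 0 := by
  have := h.angle_const hk hx
  unfold fanAngle
  linear_combination τ * this

/-- Hazzidakis' formula for an open set that consists of some of the cells of a fan. -/
theorem setIntegral_formula (hψ : IsBranchedPSImmersion Ω ψ) (h : IsFan Ω ψ p n δ P Px Py R) {τ o : ℝ}
    (hτ : τ = 1 ∨ τ = -1) (ho : o = 1 ∨ o = -1)
    (hd : ∀ k < n, ∀ x ∈ Icc 0 δ, ∀ y ∈ Icc 0 δ, 0 < τ * planarDet (Px k x y) (Py k x y))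
    {ω φ : ℂ → ℝ} {U V : ℂ → ℂ} (hf : IsFrameField Ω ψ ω φ U V) {Γ : Set ℂ} (hΓ : IsOpen Γ)
    (hω : ∀ z ∈ Γ, Real.sign (ω z) = o) {a : ℕ → ℝ}
    (ha : ∀ k < n, (a k = 1 ∧ ∀ x ∈ Ioo 0 δ, ∀ y ∈ Ioo 0 δ, P k x y ∈ Γ) ∨
      (a k = 0 ∧ ∀ x ∈ Ioo 0 δ, ∀ y ∈ Ioo 0 δ, P k x y ∉ Γ))
    {χ : ℂ → ℝ} (hχ : ContDiff ℝ 2 χ) (hsupp : tsupport χ ⊆ fanSet n δ P) :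
    IntegrableOn (fun z => χ z * lam z - hessWeight ω φ U V χ z) Γ ∧
    ∫ z in Γ, (χ z * lam z - hessWeight ω φ U V χ z)
      = ∑ k ∈ Finset.range n, (a k * (χ p * fanAngle o τ Px Py k 0 0)
        + ∫ x in 0..δ, rayDeriv χ P Px k x *
          (a k * fanAngle o τ Px Py k x 0 + a (cycPred n k) * fanAngle o τ Px Py (cycPred n k) 0 x)) := by
  have z0 := h.zero_mem
  have hχ1 : ContDiff ℝ 1 χ := hχ.of_le (by norm_num)
  have hedge : ∀ k < n, ∀ x ∈ Icc 0 δ, ∀ y ∈ Icc 0 δ, x = δ ∨ y = δ → P k x y ∉ tsupport χ :=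
    fun k hk x hx y hy hxy hm => h.edge_notMem hk hx hy hxy (hsupp hm)
  have cell : ∀ k < n, a k = 1 → IntegrableOn (fun z => χ z * lam z) (netImage δ (P k)) ∧
      IntegrableOn (hessWeight ω φ U V χ) (netImage δ (P k)) ∧
      ∫ z in netImage δ (P k), (χ z * lam z - hessWeight ω φ U V χ z)
      = χ p * fanAngle o τ Px Py k 0 0
        + (∫ x in 0..δ, rayDeriv χ P Px k x * fanAngle o τ Px Py k x 0)
        + ∫ y in 0..δ, fderiv ℝ χ (P k 0 y) (Py k 0 y) * fanAngle o τ Px Py k 0 y := by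
    intro k hk hak
    have hcell := (ha k hk).resolve_right fun hc => by rw [hc.1] at hak; norm_num at hak
    have := (h.net k hk).integral_sub hψ hτ (hd k hk) (Real.pi * ((1 - o * τ * (-1) ^ k) / 2)) hχ
      (hedge k hk) (w := hessWeight ω φ U V χ) fun x hx y hy =>
        ((h.net k hk).phi_eq hψ (neg_one_pow_eq_or ℝ k) hf hτ ho hx hy
          (hd k hk x (Ioo_subset_Icc_self hx) y (Ioo_subset_Icc_self hy))
          (hω _ (hcell.2 x hx y hy))).2 χ hχ
    rwa [h.center k hk] at this
  obtain ⟨k1, k2⟩ := h.setIntegral_eq_sum hΓ ha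
    (g := fun z => χ z * lam z - hessWeight ω φ U V χ z) (fun z hz => by
      have hz' : z ∉ tsupport χ := fun hc => hz (hsupp hc)
      simp [hessWeight, covHess_eq_zero hz', image_eq_zero_of_notMem_tsupport hz'])
    (fun k hk hak => (cell k hk hak).1.sub (cell k hk hak).2.1)
  refine ⟨k1, k2.trans ?_⟩
  set G : ℕ → ℝ := fun k => ∫ y in 0..δ, fderiv ℝ χ (P k 0 y) (Py k 0 y) * fanAngle o τ Px Py k 0 y
  have e1 : ∀ k < n, a k • ∫ z in netImage δ (P k), (χ z * lam z - hessWeight ω φ U V χ z)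
      = (a k * (χ p * fanAngle o τ Px Py k 0 0)
        + a k * (∫ x in 0..δ, rayDeriv χ P Px k x * fanAngle o τ Px Py k x 0)) + a k * G k := by
    intro k hk
    rcases ha k hk with h1 | h1
    · rw [(cell k hk h1.1).2.2, smul_eq_mul]; ring
    · rw [h1.1]; simp
  -- The second edge of the preceding cell is ray k. After this shift each ray carries the angles
  -- from both of its cells.
  have e2 : ∀ k < n, G (cycPred n k)
      = ∫ x in 0..δ, rayDeriv χ P Px k x * fanAngle o τ Px Py (cycPred n k) 0 x := by
    intro k hk
    refine intervalIntegral.integral_congr fun y hy => ?_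
    rw [uIcc_of_le h.pos.le] at hy
    rw [h.right_pred_eq hk hy, h.py_pred hk hy, rayDeriv]
  rw [Finset.sum_congr rfl fun k hk => e1 k (Finset.mem_range.1 hk), Finset.sum_add_distrib,
    ← sum_cycPred n fun k => a k * G k, ← Finset.sum_add_distrib]
  refine Finset.sum_congr rfl fun k hk => ?_
  have hk' := Finset.mem_range.1 hk
  have hD := h.continuousOn_rayDeriv hχ1 hk'
  have i1 : IntervalIntegrable (fun x => a k * (rayDeriv χ P Px k x * fanAngle o τ Px Py k x 0))
      volume 0 δ := ContinuousOn.intervalIntegrable (by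
    rw [uIcc_of_le h.pos.le]
    exact continuousOn_const.mul (hD.mul (h.continuousOn_fanAngle_left o τ hk')))
  have i2 : IntervalIntegrable (fun x => a (cycPred n k) * (rayDeriv χ P Px k x
      * fanAngle o τ Px Py (cycPred n k) 0 x)) volume 0 δ := ContinuousOn.intervalIntegrable (by
    rw [uIcc_of_le h.pos.le]
    exact continuousOn_const.mul (hD.mul (h.continuousOn_fanAngle_right o τ (cycPred_lt hk'))))
  rw [e2 k hk', add_assoc, ← intervalIntegral.integral_const_mul, ← intervalIntegral.integral_const_mul,
    ← intervalIntegral.integral_add i1 i2]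
  congr 1
  refine intervalIntegral.integral_congr fun x _ => ?_
  ring

/-- The contribution of a ray that does not separate. -/
lemma integral_rayDeriv_mul (h : IsFan Ω ψ p n δ P Px Py R) (o τ : ℝ) {χ : ℂ → ℝ}
    (hχ : ContDiff ℝ 1 χ) (hsupp : tsupport χ ⊆ fanSet n δ P) {k : ℕ} (hk : k < n) {a : ℕ → ℝ}
    (ha : a k = a (cycPred n k)) :
    ∫ x in 0..δ, rayDeriv χ P Px k x *
      (a k * fanAngle o τ Px Py k x 0 + a (cycPred n k) * fanAngle o τ Px Py (cycPred n k) 0 x)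
    = -χ p * (a k * fanAngle o τ Px Py k 0 0
        + a (cycPred n k) * fanAngle o τ Px Py (cycPred n k) 0 0) := by
  -- The two angles have a constant sum along the ray, which leaves the integral of dχ alone.
  rw [← h.integral_rayDeriv hχ hsupp hk, ← intervalIntegral.integral_mul_const]
  refine intervalIntegral.integral_congr fun x hx => ?_
  rw [uIcc_of_le h.pos.le] at hx
  rw [ha, ← mul_add, ← mul_add, h.fanAngle_add o τ hk hx]

/-- The formula for test functions that are supported in a full fan inside `Γ`. -/
theorem setIntegral_of_subset (hψ : IsBranchedPSImmersion Ω ψ) (h : IsFan Ω ψ p n δ P Px Py R) {o : ℝ}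
    (ho : o = 1 ∨ o = -1) {ω φ : ℂ → ℝ} {U V : ℂ → ℂ} (hf : IsFrameField Ω ψ ω φ U V) {Γ : Set ℂ}
    (hΓ : IsOpen Γ) (hω : ∀ z ∈ Γ, Real.sign (ω z) = o) (hsub : ∀ k < n, netImage δ (P k) ⊆ Γ)
    {χ : ℂ → ℝ} (hχ : ContDiff ℝ 2 χ) (hsupp : tsupport χ ⊆ fanSet n δ P) :
    IntegrableOn (fun z => χ z * lam z - hessWeight ω φ U V χ z) Γ ∧
    ∫ z in Γ, (χ z * lam z - hessWeight ω φ U V χ z) = ((n : ℝ) / 2 - 2) * Real.pi * χ p := by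
  obtain ⟨τ, hτ, hd⟩ := h.exists_sign
  obtain ⟨k1, k2⟩ := h.setIntegral_formula hψ hτ ho hd hf hΓ hω (a := fun _ => 1)
    (fun k hk => Or.inl ⟨rfl, fun x hx y hy => hsub k hk
      ⟨(x, y), ⟨Ioo_subset_Icc_self hx, Ioo_subset_Icc_self hy⟩, rfl⟩⟩) hχ hsupp
  refine ⟨k1, k2.trans ?_⟩
  have hχ1 : ContDiff ℝ 1 χ := hχ.of_le (by norm_num)
  have e1 : ∀ k < n, ∫ x in 0..δ, rayDeriv χ P Px k x *
      ((1 : ℝ) * fanAngle o τ Px Py k x 0 + 1 * fanAngle o τ Px Py (cycPred n k) 0 x)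
      = -χ p * (fanAngle o τ Px Py k 0 0 + fanAngle o τ Px Py (cycPred n k) 0 0) := fun k hk => by
    have := h.integral_rayDeriv_mul o τ hχ1 hsupp hk (a := fun _ => 1) rfl
    simpa using this
  rw [Finset.sum_congr rfl fun k hk => by rw [e1 k (Finset.mem_range.1 hk)]]
  rw [Finset.sum_add_distrib, ← Finset.mul_sum, ← Finset.mul_sum, ← Finset.mul_sum,
    Finset.sum_add_distrib, sum_cycPred n fun k => fanAngle o τ Px Py k 0 0]
  -- The angles of the cells add up to 2π, and because the signs alternate, π is subtracted in
  -- exactly half of the n cells. The sum enters once from the corners and twice with a minus sign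
  -- from the rays, so χ(p) is multiplied by -(2π - nπ/2).
  have e2 : ∑ k ∈ Finset.range n, fanAngle o τ Px Py k 0 0 = 2 * Real.pi - n * (Real.pi / 2) := by
    have hs := h.sum_neg_one_pow
    have : ∀ k ∈ Finset.range n, fanAngle o τ Px Py k 0 0 = τ * netAngle (Px k) (Py k) 0 0
        + (-(Real.pi / 2) + (Real.pi * (o * τ) / 2) * (-1) ^ k) := fun k _ => by
      unfold fanAngle; ring
    have h0 : ∑ k ∈ Finset.range n, Real.pi * (o * τ) / 2 * (-1 : ℝ) ^ k = 0 := by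
      rw [← Finset.mul_sum, hs, mul_zero]
    rw [Finset.sum_congr rfl this, Finset.sum_add_distrib, Finset.sum_add_distrib, h0,
      h.angle_sum hτ hd, Finset.sum_const, Finset.card_range, nsmul_eq_mul]
    ring
  rw [e2]
  ring

end IsFan

end

/-! ### Boundary values of the angle, and the formula at a boundary point -/

section

variable {Ω : Set ℂ} {ψ : ℂ → E3}

/-- The boundary values of the angle from within `Γ`. -/
def boundaryAngle (Γ : Set ℂ) (φ : ℂ → ℝ) (z : ℂ) : ℝ :=
  max 0 (min Real.pi (limUnder (𝓝[Γ] z) φ))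

/-- The boundary values of the angle along a polygon, with alternating signs. -/
def sideAngle (Γ : Set ℂ) (φ : ℂ → ℝ) (γ : ℝ → ℂ) (t : ℝ) : ℝ :=
  (-1) ^ ⌊t⌋₊ * boundaryAngle Γ φ (γ t)

/-- The angle on the side of ray `k` that belongs to the cut `a`. -/
def rayAngle (n : ℕ) (o τ : ℝ) (Px Py : ℕ → ℝ → ℝ → ℂ) (a : ℕ → ℝ) (k : ℕ) (x : ℝ) : ℝ :=
  o * τ * (-1) ^ k * (a k - a (cycPred n k)) *
    (a k * fanAngle o τ Px Py k x 0 + a (cycPred n k) * fanAngle o τ Px Py (cycPred n k) 0 x)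

/-- The truncation in `boundaryAngle` gives this bound even where φ has no limit from Γ. It
dominates the Riemann sums. -/
lemma abs_sideAngle_le (Γ : Set ℂ) (φ : ℂ → ℝ) (γ : ℝ → ℂ) (t : ℝ) :
    ‖sideAngle Γ φ γ t‖ ≤ Real.pi := by
  have h0 : 0 ≤ boundaryAngle Γ φ (γ t) := le_max_left _ _
  have h1 : boundaryAngle Γ φ (γ t) ≤ Real.pi := max_le Real.pi_pos.le (min_le_left _ _)
  rw [sideAngle, norm_mul, norm_pow, norm_neg, norm_one, one_pow, one_mul, Real.norm_of_nonneg h0]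
  exact h1

lemma boundaryAngle_eq {Γ : Set ℂ} {φ : ℂ → ℝ} {z : ℂ} {θ : ℝ} (hz : z ∈ closure Γ)
    (h : Tendsto φ (𝓝[Γ] z) (𝓝 θ)) (h0 : 0 ≤ θ) (h1 : θ ≤ Real.pi) : boundaryAngle Γ φ z = θ := by
  have := mem_closure_iff_nhdsWithin_neBot.1 hz
  rw [boundaryAngle, h.limUnder_eq, min_eq_right h1, max_eq_right h0]

section

variable {p : ℂ} {n : ℕ} {δ : ℝ} {P Px Py : ℕ → ℝ → ℝ → ℂ} {R : ℕ → ℝ → ℂ} {τ o : ℝ}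
  {ω φ : ℂ → ℝ} {U V : ℂ → ℂ} {Γ : Set ℂ} {i₁ i₂ : ℕ} {a : ℕ → ℝ}

lemma mul_sq_eq_one (hτ : τ = 1 ∨ τ = -1) (ho : o = 1 ∨ o = -1) (k : ℕ) :
    (o * τ * (-1) ^ k) * (o * τ * (-1) ^ k) = 1 := by
  rcases hτ with rfl | rfl <;> rcases ho with rfl | rfl <;>
    rcases neg_one_pow_eq_or ℝ k with h | h <;> rw [h] <;> norm_num

lemma IsCut.eq_or (hc : IsCut Γ n δ P i₁ i₂ a) {k : ℕ} (hk : k < n) : a k = 1 ∨ a k = 0 :=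
  (hc.cell k hk).imp And.left And.left

lemma IsCut.mem (hc : IsCut Γ n δ P i₁ i₂ a) {k : ℕ} (hk : k < n) (ha : a k = 1) {x y : ℝ}
    (hx : x ∈ Ioo 0 δ) (hy : y ∈ Ioo 0 δ) : P k x y ∈ Γ :=
  ((hc.cell k hk).resolve_right fun h => by rw [h.1] at ha; norm_num at ha).2 x hx y hy

namespace IsFan

lemma phi_eq (hψ : IsBranchedPSImmersion Ω ψ) (h : IsFan Ω ψ p n δ P Px Py R)
    (hτ : τ = 1 ∨ τ = -1) (ho : o = 1 ∨ o = -1)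
    (hd : ∀ k < n, ∀ x ∈ Icc 0 δ, ∀ y ∈ Icc 0 δ, 0 < τ * planarDet (Px k x y) (Py k x y))
    (hf : IsFrameField Ω ψ ω φ U V) (hω : ∀ z ∈ Γ, Real.sign (ω z) = o)
    (hc : IsCut Γ n δ P i₁ i₂ a) {k : ℕ} (hk : k < n) (ha : a k = 1) {x y : ℝ}
    (hx : x ∈ Ioo 0 δ) (hy : y ∈ Ioo 0 δ) :
    φ (P k x y) = o * τ * (-1) ^ k * fanAngle o τ Px Py k x y := by
  have := ((h.net k hk).phi_eq hψ (neg_one_pow_eq_or ℝ k) hf hτ ho hx hy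
          (hd k hk x (Ioo_subset_Icc_self hx) y (Ioo_subset_Icc_self hy))
          (hω _ (hc.mem hk ha hx hy))).1
  rw [fanAngle, ← this, ← mul_assoc, mul_sq_eq_one hτ ho, one_mul]

lemma fanAngle_mem (hτ : τ = 1 ∨ τ = -1) (ho : o = 1 ∨ o = -1)
    (hd : ∀ k < n, ∀ x ∈ Icc 0 δ, ∀ y ∈ Icc 0 δ, 0 < τ * planarDet (Px k x y) (Py k x y))
    {k : ℕ} (hk : k < n) {x y : ℝ} (hx : x ∈ Icc 0 δ) (hy : y ∈ Icc 0 δ) :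
    o * τ * (-1) ^ k * fanAngle o τ Px Py k x y ∈ Icc 0 Real.pi := by
  have h1 := IsNet.angle_mem (Px := Px k) (Py := Py k) hτ (hd k hk x hx y hy)
  have h2 : o * τ * (-1) ^ k = 1 ∨ o * τ * (-1) ^ k = -1 := mul_self_eq_one_iff.1 (mul_sq_eq_one hτ ho k)
  unfold fanAngle
  rcases h2 with h2 | h2 <;> rw [h2] <;> constructor <;> linarith [h1.1, h1.2]

lemma continuousOn_fanAngle (h : IsFan Ω ψ p n δ P Px Py R) (o τ : ℝ) {k : ℕ} (hk : k < n) :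
    ContinuousOn (fun z : ℝ × ℝ => fanAngle o τ Px Py k z.1 z.2) (Icc 0 δ ×ˢ Icc 0 δ) :=
  (continuousOn_const.mul (h.net k hk).continuousOn_netAngle).sub continuousOn_const

/-- Limits of the angle from within a cell. -/
lemma tendsto_phi (hψ : IsBranchedPSImmersion Ω ψ) (h : IsFan Ω ψ p n δ P Px Py R)
    (hτ : τ = 1 ∨ τ = -1) (ho : o = 1 ∨ o = -1)
    (hd : ∀ k < n, ∀ x ∈ Icc 0 δ, ∀ y ∈ Icc 0 δ, 0 < τ * planarDet (Px k x y) (Py k x y))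
    (hf : IsFrameField Ω ψ ω φ U V) (hω : ∀ z ∈ Γ, Real.sign (ω z) = o)
    (hc : IsCut Γ n δ P i₁ i₂ a) {k : ℕ} (hk : k < n) (ha : a k = 1) {x y : ℝ}
    (hx : x ∈ Icc 0 δ) (hy : y ∈ Icc 0 δ) {l : Filter ℂ} (hl : l ≤ 𝓝 (P k x y))
    (hD : ∀ᶠ z in l, ∃ u ∈ Ioo 0 δ, ∃ v ∈ Ioo 0 δ, P k u v = z) :
    Tendsto φ l (𝓝 (o * τ * (-1) ^ k * fanAngle o τ Px Py k x y)) := by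
  have hsub : ∀ᶠ z in l, z ∈ netImage δ (P k) := hD.mono fun z ⟨u, hu, v, hv, e⟩ =>
    ⟨(u, v), ⟨Ioo_subset_Icc_self hu, Ioo_subset_Icc_self hv⟩, e⟩
  have c1 := (h.net k hk).continuousOn_coord (P k x y) ⟨(x, y), ⟨hx, hy⟩, rfl⟩
  rw [ContinuousWithinAt, (h.net k hk).coord_eq hx hy] at c1
  have c2 : Tendsto (coord δ (P k)) l (𝓝[Icc 0 δ ×ˢ Icc 0 δ] (x, y)) :=
    tendsto_nhdsWithin_iff.2 ⟨c1.mono_left (le_inf hl (le_principal_iff.2 hsub)),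
      hsub.mono fun z hz => IsNet.coord_mem hz⟩
  refine (((h.continuousOn_fanAngle o τ hk (x, y) ⟨hx, hy⟩).tendsto.comp c2).const_mul
    (o * τ * (-1) ^ k)).congr' (hD.mono ?_)
  rintro _ ⟨u, hu, v, hv, rfl⟩
  rw [h.phi_eq hψ hτ ho hd hf hω hc hk ha hu hv, Function.comp_apply,
    (h.net k hk).coord_eq (Ioo_subset_Icc_self hu) (Ioo_subset_Icc_self hv)]

/-- The angle at the centre, if it is continuous from `Γ`. -/
lemma phi_center (hψ : IsBranchedPSImmersion Ω ψ) (h : IsFan Ω ψ p n δ P Px Py R)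
    (hτ : τ = 1 ∨ τ = -1) (ho : o = 1 ∨ o = -1)
    (hd : ∀ k < n, ∀ x ∈ Icc 0 δ, ∀ y ∈ Icc 0 δ, 0 < τ * planarDet (Px k x y) (Py k x y))
    (hf : IsFrameField Ω ψ ω φ U V) (hω : ∀ z ∈ Γ, Real.sign (ω z) = o)
    (hc : IsCut Γ n δ P i₁ i₂ a) {k : ℕ} (hk : k < n) (ha : a k = 1)
    (hcont : ContinuousWithinAt φ Γ p) : φ p = o * τ * (-1) ^ k * fanAngle o τ Px Py k 0 0 := by
  have z0 := h.zero_mem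
  set D := (fun z : ℝ × ℝ => P k z.1 z.2) '' (Ioo 0 δ ×ˢ Ioo 0 δ) with hD
  have hcl : P k 0 0 ∈ closure D := by
    refine ((h.net k hk).cont (0, 0) ⟨z0, z0⟩).mono (prod_mono Ioo_subset_Icc_self Ioo_subset_Icc_self)
      |>.mem_closure_image ?_
    rw [closure_prod_eq, closure_Ioo h.pos.ne]
    exact ⟨z0, z0⟩
  have := mem_closure_iff_nhdsWithin_neBot.1 hcl
  have hsub : D ⊆ Γ := by
    rintro _ ⟨z, hz, rfl⟩
    exact hc.mem hk ha hz.1 hz.2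
  rw [← h.center k hk] at hcont ⊢
  refine tendsto_nhds_unique (hcont.mono hsub) (h.tendsto_phi hψ hτ ho hd hf hω hc hk ha z0 z0
    nhdsWithin_le_nhds (eventually_mem_nhdsWithin.mono ?_))
  rintro _ ⟨z, hz, rfl⟩
  exact ⟨z.1, hz.1, z.2, hz.2, rfl⟩

/-- Limits of the angle from within `Γ` at an inner point of a ray that bounds `Γ`. -/
lemma tendsto_phi_ray (hψ : IsBranchedPSImmersion Ω ψ) (h : IsFan Ω ψ p n δ P Px Py R)
    (hopen : IsOpen (fanSet n δ P)) (hτ : τ = 1 ∨ τ = -1) (ho : o = 1 ∨ o = -1)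
    (hd : ∀ k < n, ∀ x ∈ Icc 0 δ, ∀ y ∈ Icc 0 δ, 0 < τ * planarDet (Px k x y) (Py k x y))
    (hf : IsFrameField Ω ψ ω φ U V) (hω : ∀ z ∈ Γ, Real.sign (ω z) = o)
    (hc : IsCut Γ n δ P i₁ i₂ a) {k : ℕ} (hk : k < n) (ha : a k ≠ a (cycPred n k))
    (hray : ∀ x ∈ Ico 0 δ, P k x 0 ∉ Γ) {x : ℝ} (hx : x ∈ Ioo 0 δ) :
    Tendsto φ (𝓝[Γ] (P k x 0)) (𝓝 (rayAngle n o τ Px Py a k x)) ∧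
      rayAngle n o τ Px Py a k x ∈ Icc 0 Real.pi := by
  have z0 := h.zero_mem
  have hx' := Ioo_subset_Icc_self hx
  have hpk := cycPred_lt hk
  have hkk : (-1 : ℝ) ^ k = -(-1) ^ cycPred n k := by rw [neg_one_pow_cycPred h.even hk, neg_neg]
  -- Near an inner point of ray k only the two adjacent cells occur. Points of Γ avoid the ray
  -- itself, so they lie in an open cell that is contained in Γ.
  have near : ∀ᶠ z in 𝓝[Γ] (P k x 0), ∃ l < n, (l = k ∨ l = cycPred n k) ∧ a l = 1 ∧
      ∃ u ∈ Ioo 0 δ, ∃ v ∈ Ioo 0 δ, P l u v = z := by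
    have hne : ∀ l < n, l ≠ k → l ≠ cycPred n k → P k x 0 ∉ netImage δ (P l) := by
      rintro l hl h1 h2 ⟨z, hz, he⟩
      rcases h.eq_ray hk hl hx' hx.1 hz.1 hz.2 (he.trans (h.left k hk x hx')) with h3 | h3
      · exact h1 h3.1
      · exact h2 h3.1
    have hne' : ∀ l < n, l ≠ k → P k x 0 ∉ R l '' Icc 0 δ := by
      rintro l hl h1 ⟨s, hs, he⟩
      rw [h.left k hk x hx'] at he
      exact h1 (h.ray_disj k hk l hl x hx' s hs hx.1 he.symm).symm
    have e1 : ∀ᶠ z in 𝓝 (P k x 0), ∀ l ∈ Finset.range n, l ≠ k → l ≠ cycPred n k →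
        z ∉ netImage δ (P l) := by
      rw [Filter.eventually_all_finset]
      intro l hl
      by_cases hlk : l ≠ k ∧ l ≠ cycPred n k
      · filter_upwards [(h.net l (Finset.mem_range.1 hl)).isCompact_netImage.isClosed.isOpen_compl.mem_nhds
          (hne l (Finset.mem_range.1 hl) hlk.1 hlk.2)] with z hz _ _ using hz
      · exact Filter.Eventually.of_forall fun z h1 h2 => absurd ⟨h1, h2⟩ hlk
    have e2 : ∀ᶠ z in 𝓝 (P k x 0), ∀ l ∈ Finset.range n, l ≠ k → z ∉ R l '' Icc 0 δ := by
      rw [Filter.eventually_all_finset]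
      intro l hl
      by_cases hlk : l ≠ k
      · have hcl : IsClosed (R l '' Icc 0 δ) := (isCompact_Icc.image_of_continuousOn fun s hs =>
          (h.hasDerivWithinAt_ray (Finset.mem_range.1 hl) hs).continuousWithinAt).isClosed
        filter_upwards [hcl.isOpen_compl.mem_nhds (hne' l (Finset.mem_range.1 hl) hlk)] with z hz _ using hz
      · exact Filter.Eventually.of_forall fun z h1 => absurd h1 hlk
    have e3 : fanSet n δ P ∈ 𝓝 (P k x 0) := hopen.mem_nhds
      ⟨k, hk, x, Ioo_subset_Ico_self hx, 0, ⟨le_rfl, h.pos⟩, rfl⟩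
    filter_upwards [nhdsWithin_le_nhds e1, nhdsWithin_le_nhds e2, nhdsWithin_le_nhds e3,
      self_mem_nhdsWithin] with z f1 f2 ⟨l, hl, u, hu, v, hv, he⟩ hzΓ
    have hu' := Ico_subset_Icc_self hu
    have hv' := Ico_subset_Icc_self hv
    have hlk : l = k ∨ l = cycPred n k := by
      by_contra hcon
      push Not at hcon
      exact f1 l (Finset.mem_range.2 hl) hcon.1 hcon.2 ⟨(u, v), ⟨hu', hv'⟩, he⟩
    have hr : ∀ i < n, ∀ s ∈ Ico 0 δ, z ≠ R i s := by
      intro i hi s hs hzs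
      have hik : i = k := by
        by_contra hik
        exact f2 i (Finset.mem_range.2 hi) hik ⟨s, Ico_subset_Icc_self hs, hzs.symm⟩
      subst hik
      rw [hzs, ← h.left i hi s (Ico_subset_Icc_self hs)] at hzΓ
      exact hray s hs hzΓ
    have hv0 : 0 < v := hv.1.lt_of_ne fun h0 => by
      rw [← h0, h.left l hl u hu'] at he
      exact hr l hl u hu he.symm
    have hu0 : 0 < u := hu.1.lt_of_ne fun h0 => by
      obtain ⟨i, hi, hRi, -⟩ := h.ray_succ hl
      rw [← h0, h.right l hl v hv', hRi] at he
      exact hr i hi v hv he.symm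
    refine ⟨l, hl, hlk, (hc.eq_or hl).resolve_right fun h0 => ?_, u, ⟨hu0, hu.2⟩, v, ⟨hv0, hv.2⟩, he⟩
    have := (hc.cell l hl).resolve_left fun h1 => by rw [h1.1] at h0; norm_num at h0
    exact this.2 u ⟨hu0, hu.2⟩ v ⟨hv0, hv.2⟩ (he ▸ hzΓ)
  rcases hc.eq_or hk with h1 | h1 <;> rcases hc.eq_or hpk with h2 | h2
  · exact absurd (h1.trans h2.symm) ha
  · have e : rayAngle n o τ Px Py a k x = o * τ * (-1) ^ k * fanAngle o τ Px Py k x 0 := by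
      rw [rayAngle, h1, h2]; ring
    rw [e]
    refine ⟨h.tendsto_phi hψ hτ ho hd hf hω hc hk h1 hx' z0 nhdsWithin_le_nhds (near.mono ?_),
      fanAngle_mem hτ ho hd hk hx' z0⟩
    rintro z ⟨l, hl, rfl | rfl, h3, h4⟩
    · exact h4
    · rw [h3] at h2; norm_num at h2
  · have e : rayAngle n o τ Px Py a k x
        = o * τ * (-1) ^ cycPred n k * fanAngle o τ Px Py (cycPred n k) 0 x := by
      rw [rayAngle, h1, h2, hkk]; ring
    rw [e]
    refine ⟨h.tendsto_phi hψ hτ ho hd hf hω hc hpk h2 z0 hx' ?_ (near.mono ?_),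
      fanAngle_mem hτ ho hd hpk z0 hx'⟩
    · rw [h.right_pred_eq hk hx']; exact nhdsWithin_le_nhds
    rintro z ⟨l, hl, rfl | rfl, h3, h4⟩
    · rw [h3] at h1; norm_num at h1
    · exact h4
  · exact absurd (h1.trans h2.symm) ha

lemma continuousOn_rayAngle (h : IsFan Ω ψ p n δ P Px Py R) (o τ : ℝ) (a : ℕ → ℝ) {k : ℕ} (hk : k < n) :
    ContinuousOn (rayAngle n o τ Px Py a k) (Icc 0 δ) :=
  continuousOn_const.mul ((continuousOn_const.mul (h.continuousOn_fanAngle_left o τ hk)).add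
    (continuousOn_const.mul (h.continuousOn_fanAngle_right o τ (cycPred_lt hk))))

end IsFan

namespace IsBoundaryFan

variable {j : ℕ} {γ : ℝ → ℂ} {q : ℂ} {n₁ n₂ : ℕ} {a₁ b₁ a₂ b₂ : ℝ} {ρ₁ ρ₂ : ℝ → ℝ}

/-- Hazzidakis' formula near a boundary point of `Γ`. -/
theorem setIntegral_formula (hψ : IsBranchedPSImmersion Ω ψ)
    (h : IsBoundaryFan Ω ψ j γ q n δ P Px Py R i₁ i₂ n₁ n₂ a₁ b₁ a₂ b₂ ρ₁ ρ₂)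
    (hτ : τ = 1 ∨ τ = -1) (ho : o = 1 ∨ o = -1)
    (hd : ∀ k < n, ∀ x ∈ Icc 0 δ, ∀ y ∈ Icc 0 δ, 0 < τ * planarDet (Px k x y) (Py k x y))
    (hf : IsFrameField Ω ψ ω φ U V) (hΓ : IsOpen Γ) (hω : ∀ z ∈ Γ, Real.sign (ω z) = o)
    (hfr : frontier Γ = γ '' Icc 0 (2 * (j : ℝ)))
    (hc : IsCut Γ n δ P i₁ i₂ a) (hor : τ * (a i₂ - a (cycPred n i₂)) = o)
    (hcorner : (ContinuousWithinAt φ Γ q ∧ n₁ % 2 ≠ n₂ % 2) ∨ (n = 4 ∧ n₁ = n₂))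
    {χ : ℂ → ℝ} (hχ : ContDiff ℝ 2 χ) (hsupp : tsupport χ ⊆ fanSet n δ P) :
    IntegrableOn (fun z => χ z * lam z - hessWeight ω φ U V χ z) Γ ∧
    Tendsto (riemannSum (2 * j) (sideAngle Γ φ γ) fun t => χ (γ t)) atTop
      (𝓝 ((∫ z in Γ, (χ z * lam z - hessWeight ω φ U V χ z))
        - if n₁ = n₂ then 0 else (-1) ^ n₂ * φ q * χ q)) := by
  have hF := h.fan
  have hχ1 : ContDiff ℝ 1 χ := hχ.of_le (by norm_num)
  obtain ⟨k1, k2⟩ := hF.setIntegral_formula hψ hτ ho hd hf hΓ hω hc.cell hχ hsupp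
  refine ⟨k1, ?_⟩
  have oτ : (o * τ) * (o * τ) = 1 := by simpa using mul_sq_eq_one hτ ho 0
  -- The hypothesis on the side fixes the two jumps, and with them the signs under which the
  -- Stieltjes integrals along the rays agree with the ray terms of the fan.
  have A₂ : a i₂ - a (cycPred n i₂) = o * τ := by
    rcases hτ with rfl | rfl <;> linarith
  have A₁ : a i₁ - a (cycPred n i₁) = -(o * τ) := by linarith [hc.sub_add_sub h.lt₁ h.lt₂ h.ne]
  have hoτ : o * τ ≠ 0 := left_ne_zero_of_mul_eq_one oτ
  have L₁ := fun x hx => hF.tendsto_phi_ray hψ h.isOpen hτ ho hd hf hω hc h.lt₁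
    (fun e => hoτ (by rw [e, sub_self] at A₁; linarith)) hc.ray₁ (x := x) hx
  have L₂ := fun x hx => hF.tendsto_phi_ray hψ h.isOpen hτ ho hd hf hω hc h.lt₂
    (fun e => hoτ (by rw [e, sub_self] at A₂; linarith)) hc.ray₂ (x := x) hx
  have hpow : ∀ {i m : ℕ}, i % 2 = m % 2 → (-1 : ℝ) ^ m = (-1) ^ i := fun {i m} e => by
    rw [neg_one_pow_eq_pow_mod_two, ← e, ← neg_one_pow_eq_pow_mod_two]
  have hfloor : ∀ {m : ℕ} {u v t : ℝ}, (m : ℝ) ≤ u → v ≤ m + 1 → t ∈ Ioo u v → ⌊t⌋₊ = m :=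
    fun {m u v t} h1 h2 ht => (Nat.floor_eq_iff ((Nat.cast_nonneg m).trans (h1.trans ht.1.le))).2
      ⟨h1.trans ht.1.le, ht.2.trans_le h2⟩
  have hcl : ∀ t ∈ Icc 0 (2 * (j : ℝ)), γ t ∈ closure Γ := fun t ht =>
    frontier_subset_closure (hfr ▸ mem_image_of_mem γ ht)
  have S₁ : ∀ t ∈ Ioo a₁ b₁, sideAngle Γ φ γ t = (-1) ^ i₁ * rayAngle n o τ Px Py a i₁ (ρ₁ t) := by
    intro t ht
    have ht' := Ioo_subset_Icc_self ht
    have hm : ρ₁ t ∈ Ioo 0 δ := ⟨by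
      rw [← h.end₁]; exact h.anti₁ ht' ⟨h.ab₁.le, le_rfl⟩ ht.2, by
      rw [← h.start₁]; exact h.anti₁ ⟨le_rfl, h.ab₁.le⟩ ht' ht.1⟩
    have hz := hcl t ⟨h.a₁_nonneg.trans ht'.1, ht'.2.trans h.b₁_le⟩
    rw [sideAngle, hfloor h.left₁ h.right₁ ht, hpow h.par₁]
    rw [h.eq_cell₁ ht'] at hz ⊢
    rw [boundaryAngle_eq hz (L₁ _ hm).1 (L₁ _ hm).2.1 (L₁ _ hm).2.2]
  have S₂ : ∀ t ∈ Ioo a₂ b₂, sideAngle Γ φ γ t = (-1) ^ i₂ * rayAngle n o τ Px Py a i₂ (ρ₂ t) := by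
    intro t ht
    have ht' := Ioo_subset_Icc_self ht
    have hm : ρ₂ t ∈ Ioo 0 δ := ⟨by
      rw [← h.start₂]; exact h.mono₂ ⟨le_rfl, h.ab₂.le⟩ ht' ht.1, by
      rw [← h.end₂]; exact h.mono₂ ht' ⟨h.ab₂.le, le_rfl⟩ ht.2⟩
    have hz := hcl t ⟨h.a₂_nonneg.trans ht'.1, ht'.2.trans h.b₂_le⟩
    rw [sideAngle, hfloor h.left₂ h.right₂ ht, hpow h.par₂]
    rw [h.eq_cell₂ ht'] at hz ⊢
    rw [boundaryAngle_eq hz (L₂ _ hm).1 (L₂ _ hm).2.1 (L₂ _ hm).2.2]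
  have hcontAt : ∀ {u v : ℝ} {i : ℕ} {ρ : ℝ → ℝ}, i < n → ContinuousOn ρ (Icc u v) →
      (∀ t ∈ Icc u v, ρ t ∈ Icc 0 δ) →
      (∀ t ∈ Ioo u v, sideAngle Γ φ γ t = (-1) ^ i * rayAngle n o τ Px Py a i (ρ t)) →
      ∀ t ∈ Ioo u v, ContinuousAt (sideAngle Γ φ γ) t := fun hi hρ hm hS t ht =>
    (((continuousOn_const.mul ((hF.continuousOn_rayAngle o τ a hi).comp hρ hm)).mono
      Ioo_subset_Icc_self).congr hS).continuousAt (Ioo_mem_nhds ht.1 ht.2)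
  have T := h.tendsto_riemannSum hχ1 hsupp (Φ := sideAngle Γ φ γ)
    (Ψ₁ := fun x => (-1) ^ i₁ * rayAngle n o τ Px Py a i₁ x)
    (Ψ₂ := fun x => (-1) ^ i₂ * rayAngle n o τ Px Py a i₂ x) (fun t _ => abs_sideAngle_le Γ φ γ t)
    (hcontAt h.lt₁ h.cont₁ (fun t => h.param_mem₁) S₁) (hcontAt h.lt₂ h.cont₂ (fun t => h.param_mem₂) S₂)
    S₁ S₂
  convert T using 2
  rw [k2]
  set θ : ℕ → ℝ := fun k => fanAngle o τ Px Py k 0 0 with hθ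
  set E : ℕ → ℝ → ℝ := fun k x => a k * fanAngle o τ Px Py k x 0
    + a (cycPred n k) * fanAngle o τ Px Py (cycPred n k) 0 x with hE
  set B : ℕ → ℝ := fun k => ∫ x in 0..δ, rayDeriv χ P Px k x * E k x with hB
  set c : ℕ → ℝ := fun k => a k * θ k + a (cycPred n k) * θ (cycPred n k) with hcdef
  have e2 : ∫ x in 0..δ, fderiv ℝ χ (P i₂ x 0) (Px i₂ x 0) • ((-1) ^ i₂ * rayAngle n o τ Px Py a i₂ x)
      = B i₂ := by
    refine intervalIntegral.integral_congr fun x _ => ?_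
    have : (-1) ^ i₂ * rayAngle n o τ Px Py a i₂ x = E i₂ x := by
      have e : rayAngle n o τ Px Py a i₂ x = o * τ * (-1) ^ i₂ * (a i₂ - a (cycPred n i₂)) * E i₂ x := rfl
      rw [e, A₂]
      linear_combination (E i₂ x) * mul_sq_eq_one hτ ho i₂
    simp only [this, smul_eq_mul]; rfl
  have e1 : ∫ x in 0..δ, fderiv ℝ χ (P i₁ x 0) (Px i₁ x 0) • ((-1) ^ i₁ * rayAngle n o τ Px Py a i₁ x)
      = -B i₁ := by
    rw [hB, ← intervalIntegral.integral_neg]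
    refine intervalIntegral.integral_congr fun x _ => ?_
    have : (-1) ^ i₁ * rayAngle n o τ Px Py a i₁ x = -E i₁ x := by
      have e : rayAngle n o τ Px Py a i₁ x = o * τ * (-1) ^ i₁ * (a i₁ - a (cycPred n i₁)) * E i₁ x := rfl
      rw [e, A₁]
      linear_combination -(E i₁ x) * mul_sq_eq_one hτ ho i₁
    simp only [this, smul_eq_mul, mul_neg]; rfl
  rw [e1, e2]
  have hsum : ∑ k ∈ Finset.range n, (B k + χ q * c k) = (B i₁ + χ q * c i₁) + (B i₂ + χ q * c i₂) := by
    refine Finset.sum_eq_add i₁ i₂ h.ne (fun k hk hki => ?_)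
      (fun hh => absurd (Finset.mem_range.2 h.lt₁) hh) (fun hh => absurd (Finset.mem_range.2 h.lt₂) hh)
    have := hF.integral_rayDeriv_mul o τ hχ1 hsupp (Finset.mem_range.1 hk)
      (hc.eq_pred k (Finset.mem_range.1 hk) hki.1 hki.2)
    change B k = -χ q * c k at this
    rw [this]; ring
  set S := ∑ k ∈ Finset.range n, a k * θ k with hS
  have hcS : ∑ k ∈ Finset.range n, c k = 2 * S := by
    rw [Finset.sum_add_distrib, sum_cycPred n fun k => a k * θ k, two_mul]
  -- On the other rays B_k = -χ(q) c_k. Each cell borders two rays, so the c_k add up to 2S.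
  have htot : ∑ k ∈ Finset.range n, (a k * (χ q * θ k) + B k)
      = χ q * (c i₁ + c i₂ - S) + (B i₁ + B i₂) := by
    have : ∑ k ∈ Finset.range n, (a k * (χ q * θ k) + B k)
        = χ q * S + (∑ k ∈ Finset.range n, (B k + χ q * c k) - χ q * ∑ k ∈ Finset.range n, c k) := by
      rw [hS, Finset.mul_sum, Finset.mul_sum, ← Finset.sum_sub_distrib, ← Finset.sum_add_distrib]
      exact Finset.sum_congr rfl fun k _ => by ring
    rw [this, hsum, hcS]; ring
  -- At a vertex, continuity from Γ gives a_k θ_k = o τ φ(q) (-1)^k a_k. Then c_k is proportional to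
  -- the jump at ray k, only two of the c_k survive, and their sum is 2S, so the corner term is S.
  -- At an inner point of a side there are four cells and the two rays are opposite; c_{i₁} + c_{i₂}
  -- then runs over every cell once and equals S.
  have hcor : χ q * (c i₁ + c i₂ - S) = if n₁ = n₂ then 0 else (-1) ^ n₂ * φ q * χ q := by
    rcases hcorner with ⟨hq, hpar⟩ | ⟨hn4, hn⟩
    · rw [if_neg fun e => hpar (by rw [e]), hpow h.par₂]
      have hi : (-1 : ℝ) ^ i₁ = -(-1) ^ i₂ := by
        have : i₁ % 2 = (i₂ + 1) % 2 := by have := h.par₁; have := h.par₂; omega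
        rw [hpow this.symm, pow_succ]; ring
      have hk : ∀ k < n, a k * θ k = o * τ * φ q * ((-1) ^ k * a k) := fun k hk => by
        rcases hc.eq_or hk with h1 | h1
        · have := hF.phi_center hψ hτ ho hd hf hω hc hk h1 hq
          change φ q = o * τ * (-1) ^ k * θ k at this
          rw [this, h1]
          linear_combination -θ k * mul_sq_eq_one hτ ho k
        · rw [h1]; ring
      have hck : ∀ k < n, c k = o * τ * φ q * ((a k - a (cycPred n k)) * (-1) ^ k) := fun k hkn => by
        rw [hcdef]
        simp only
        rw [hk k hkn, hk _ (cycPred_lt hkn), neg_one_pow_cycPred hF.even hkn]; ring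
      have hsum2 := hc.sum_sub h.lt₁ h.lt₂ h.ne fun k => o * τ * φ q * (-1 : ℝ) ^ k
      have : 2 * S = ∑ k ∈ Finset.range n, (a k - a (cycPred n k)) • (o * τ * φ q * (-1 : ℝ) ^ k) := by
        rw [← hcS]
        refine Finset.sum_congr rfl fun k hkn => ?_
        rw [hck k (Finset.mem_range.1 hkn), smul_eq_mul]; ring
      rw [hsum2, A₁, A₂, hi] at this
      have hS' : S = (-1) ^ i₂ * φ q := by
        simp only [smul_eq_mul] at this
        linear_combination this / 2 + (-1) ^ i₂ * φ q * oτ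
      rw [hck _ h.lt₁, hck _ h.lt₂, A₁, A₂, hS', hi]
      linear_combination 2 * (-1) ^ i₂ * φ q * χ q * oτ
    · rw [if_pos hn]
      have hpar : i₁ % 2 = i₂ % 2 := by rw [h.par₁, h.par₂, hn]
      have : c i₁ + c i₂ = S := by
        have h1 := h.lt₁
        have h2 := h.lt₂
        have h3 := h.ne
        rw [hS, hcdef]
        simp only [cycPred]
        subst hn4
        simp only [Finset.sum_range_succ, Finset.sum_range_zero, zero_add]
        have : (i₁ = 0 ∧ i₂ = 2) ∨ (i₁ = 2 ∧ i₂ = 0) ∨ (i₁ = 1 ∧ i₂ = 3) ∨ (i₁ = 3 ∧ i₂ = 1) := by omega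
        rcases this with ⟨r1, r2⟩ | ⟨r1, r2⟩ | ⟨r1, r2⟩ | ⟨r1, r2⟩ <;> rw [r1, r2] <;> norm_num <;> ring
      rw [this]; ring
  rw [htot, hcor]; ring

end IsBoundaryFan

end

end

/-! ### Localization of test functions, and integration by parts along the polygon -/

section

variable {Ω : Set ℂ} {ψ : ℂ → E3}

/-- A property of functions that is additive and holds for bump functions with small support
holds for some function that is equal to one on a given compact set. -/
lemma exists_eqOn_one {K : Set ℂ} (hK : IsCompact K) {Good : (ℂ → ℝ) → Prop} (h0 : Good 0)
    (hadd : ∀ f g, Good f → Good g → Good (f + g))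
    (hloc : ∀ q ∈ K, ∃ U ∈ 𝓝 q, ∀ χ, ContDiff ℝ 2 χ → HasCompactSupport χ → tsupport χ ⊆ U → Good χ) :
    ∃ χ, Good χ ∧ EqOn χ 1 K := by
  classical
  choose! U hU hg using hloc
  -- Intersecting with unit balls makes the supports of the partition compact.
  obtain ⟨f, hf⟩ := SmoothPartitionOfUnity.exists_isSubordinate (modelWithCornersSelf ℝ ℂ) hK.isClosed
    (fun q : K => interior (U q) ∩ Metric.ball (q : ℂ) 1)
    (fun q => isOpen_interior.inter Metric.isOpen_ball) fun q hq => mem_iUnion.2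
      ⟨⟨q, hq⟩, mem_interior_iff_mem_nhds.2 (hU q hq), Metric.mem_ball_self one_pos⟩
  have hfin := f.locallyFinite.finite_nonempty_inter_compact hK
  refine ⟨∑ i ∈ hfin.toFinset, (f i : ℂ → ℝ), ?_, fun z hz => ?_⟩
  · refine Finset.sum_induction _ Good hadd h0 fun i _ => hg i i.2 _ ?_ ?_ ?_
    · exact_mod_cast contDiff_infty.1 (f i).contMDiff.contDiff 2
    · exact Metric.isCompact_of_isClosed_isBounded (isClosed_tsupport _)
        (Metric.isBounded_ball.subset fun z hz => (hf i hz).2)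
    · exact fun z hz => interior_subset (hf i hz).1
  · have h1 := f.sum_eq_one hz
    rw [finsum_eq_sum_of_support_subset (s := hfin.toFinset)] at h1
    · rw [Finset.sum_apply, h1]; rfl
    · intro i hi
      exact hfin.mem_toFinset.2 ⟨z, hi, hz⟩

lemma contDiff_smul_of_tsupport {χ : ℂ → ℝ} {n : ℕ∞} (hχ : ContDiff ℝ n χ) {U : Set ℂ} (hU : IsOpen U)
    (hsupp : tsupport χ ⊆ U) {F : ℂ → ℂ} (hF : ContDiffOn ℝ n F U) : ContDiff ℝ n fun z => χ z • F z := by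
  refine contDiff_iff_contDiffAt.2 fun z => ?_
  by_cases hz : z ∈ tsupport χ
  · exact hχ.contDiffAt.smul (hF.contDiffAt (hU.mem_nhds (hsupp hz)))
  · refine (contDiffAt_const (c := (0 : ℂ))).congr_of_eventuallyEq ?_
    filter_upwards [(isClosed_tsupport χ).isOpen_compl.mem_nhds hz] with w hw
    rw [image_eq_zero_of_notMem_tsupport hw, zero_smul]

lemma tsupport_smul_subset {χ : ℂ → ℝ} {F : ℂ → ℂ} : tsupport (fun z => χ z • F z) ⊆ tsupport χ :=
  closure_mono (Function.support_smul_subset_left χ F)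

lemma continuous_curl {g : ℂ → ℂ} (hg : ContDiff ℝ 1 g) : Continuous (curl g) := by
  have := hg.continuous_fderiv one_ne_zero
  exact (continuous_const.mul (this.clm_apply continuous_const)).sub (this.clm_apply continuous_const)

lemma curl_eq_zero_of_notMem {g : ℂ → ℂ} {z : ℂ} (hz : z ∉ tsupport g) : curl g z = 0 := by
  simp [curl, IsNet.fderiv_eq_zero_of_notMem hz]

lemma integral_curl_eq_zero {g : ℂ → ℂ} (hg : ContDiff ℝ 1 g) (hc : HasCompactSupport g) :
    ∫ z, curl g z = 0 := by
  have hcont := hg.continuous_fderiv one_ne_zero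
  have hi : ∀ v : ℂ, Integrable fun z => fderiv ℝ g z v := fun v =>
    (hcont.clm_apply continuous_const).integrable_of_hasCompactSupport
      ((hc.fderiv (𝕜 := ℝ)).comp_left (g := fun A : ℂ →L[ℝ] ℂ => A v) rfl)
  have h0 : ∀ v : ℂ, ∫ z, fderiv ℝ g z v = 0 := fun v => by
    have := integral_smul_fderiv_eq_neg_fderiv_smul_of_integrable (𝕜 := ℝ) (μ := volume) (f := fun _ : ℂ => (1 : ℝ))
      (g := g) (v := v) (by simp) (by simpa using hi v)
      (by simpa using hg.continuous.integrable_of_hasCompactSupport hc)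
      (by simp) (fun z _ => (hg.differentiable one_ne_zero) z)
    simpa using this
  unfold curl
  rw [integral_sub ((hi 1).const_mul _) (hi _), integral_const_mul, h0, h0]
  simp

lemma riemannSum_eq_zero {E : Type*} [NormedAddCommGroup E] [NormedSpace ℝ E] {L c : ℝ} (hL : 0 ≤ L)
    {Φ : ℝ → E} {f : ℝ → ℝ} (h : ∀ t ∈ Icc 0 L, f t = c) (N : ℕ) : riemannSum L Φ f N = 0 := by
  rw [riemannSum_congr hL (g := fun _ => 0) (c := c) fun t ht => by rw [h t ht, zero_add]]
  simp [riemannSum]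

namespace IsBoundaryFan

variable {j : ℕ} {γ : ℝ → ℂ} {q : ℂ} {n : ℕ} {δ : ℝ} {P Px Py : ℕ → ℝ → ℝ → ℂ} {R : ℕ → ℝ → ℂ}
  {i₁ i₂ n₁ n₂ : ℕ} {a₁ b₁ a₂ b₂ : ℝ} {ρ₁ ρ₂ : ℝ → ℝ}

/-- Integration by parts along a polygon near one of its points. -/
lemma tendsto_riemannSum_deriv
    (h : IsBoundaryFan Ω ψ j γ q n δ P Px Py R i₁ i₂ n₁ n₂ a₁ b₁ a₂ b₂ ρ₁ ρ₂)
    {χ : ℂ → ℝ} (hχ : ContDiff ℝ 1 χ) (hsupp : tsupport χ ⊆ fanSet n δ P) {U : Set ℂ} (hU : IsOpen U)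
    (hPU : ∀ k, netImage δ (P k) ⊆ U) {Λ : ℂ → ℂ} (hΛ : DifferentiableOn ℂ Λ U) {Φ : ℝ → ℂ}
    (hΦ : ContinuousOn Φ (Icc 0 (2 * j))) {c₁ c₂ : ℂ} (h₁ : ∀ t ∈ Icc a₁ b₁, Φ t = Λ (γ t) + c₁)
    (h₂ : ∀ t ∈ Icc a₂ b₂, Φ t = Λ (γ t) + c₂) :
    Tendsto (riemannSum (2 * j) Φ fun t => χ (γ t)) atTop
      (𝓝 (-((∫ x in 0..δ, (χ (P i₂ x 0) • deriv Λ (P i₂ x 0)) * Px i₂ x 0)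
        - ∫ x in 0..δ, (χ (P i₁ x 0) • deriv Λ (P i₁ x 0)) * Px i₁ x 0) - χ q • (c₂ - c₁))) := by
  have hF := h.fan
  have hfU : fanSet n δ P ⊆ U := IsFan.fanSet_subset.trans (iUnion_subset fun k => hPU k)
  have hΛc : ContDiffOn ℝ 1 Λ U := (hΛ.contDiffOn hU).restrict_scalars ℝ
  obtain ⟨C, hC⟩ := (isCompact_Icc.image_of_continuousOn hΦ).isBounded.exists_norm_le
  have hat : ∀ {u v : ℝ}, 0 ≤ u → v ≤ 2 * j → ∀ t ∈ Ioo u v, ContinuousAt Φ t := fun hu hv t ht =>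
    hΦ.continuousAt (Icc_mem_nhds (hu.trans_lt ht.1) (ht.2.trans_le hv))
  have T := h.tendsto_riemannSum hχ hsupp (Φ := Φ) (Ψ₁ := fun x => Λ (P i₁ x 0) + c₁)
    (Ψ₂ := fun x => Λ (P i₂ x 0) + c₂) (fun t ht => hC _ ⟨t, ht, rfl⟩)
    (hat h.a₁_nonneg h.b₁_le) (hat h.a₂_nonneg h.b₂_le)
    (fun t ht => by rw [h₁ t (Ioo_subset_Icc_self ht), h.eq_cell₁ (Ioo_subset_Icc_self ht)])
    (fun t ht => by rw [h₂ t (Ioo_subset_Icc_self ht), h.eq_cell₂ (Ioo_subset_Icc_self ht)])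
  -- This is the fundamental theorem of calculus for χ (Λ + c) along the ray, where χ vanishes at
  -- the outer end.
  have key : ∀ i < n, ∀ c : ℂ, ∫ x in 0..δ, fderiv ℝ χ (P i x 0) (Px i x 0) • (Λ (P i x 0) + c)
      = -(χ q • (Λ q + c)) - ∫ x in 0..δ, (χ (P i x 0) • deriv Λ (P i x 0)) * Px i x 0 := by
    intro i hi c
    have zδ : δ ∈ Icc 0 δ := ⟨hF.pos.le, le_rfl⟩
    have z0 := hF.zero_mem
    have hG : ContDiff ℝ 1 fun z => χ z • (Λ z + c) :=
      contDiff_smul_of_tsupport hχ hU (hsupp.trans hfU) (hΛc.add contDiffOn_const)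
    have e := (hF.net i hi).integral_fderiv hG zδ
    rw [image_eq_zero_of_notMem_tsupport fun hc => hF.edge_notMem hi zδ z0 (Or.inl rfl) (hsupp hc),
      hF.center i hi, zero_smul, zero_sub] at e
    have cP : ContinuousOn (fun x => P i x 0) (Icc 0 δ) := (hF.net i hi).cont.comp
      (f := fun s : ℝ => (s, (0 : ℝ))) (by fun_prop) fun s hs => ⟨hs, z0⟩
    have hPm : MapsTo (fun x => P i x 0) (Icc 0 δ) U := fun x hx => hPU i ⟨(x, 0), ⟨hx, z0⟩, rfl⟩
    have cPx : ContinuousOn (fun x => Px i x 0) (Icc 0 δ) := (hF.net i hi).part.cu.comp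
      (f := fun s : ℝ => (s, (0 : ℝ))) (by fun_prop) fun s hs => ⟨hs, z0⟩
    have ii : IntervalIntegrable (fun x => (χ (P i x 0) • deriv Λ (P i x 0)) * Px i x 0) volume 0 δ :=
      ContinuousOn.intervalIntegrable (by
        rw [uIcc_of_le hF.pos.le]
        exact ((hχ.continuous.comp_continuousOn cP).smul
          ((hΛ.deriv hU).continuousOn.comp cP hPm)).mul cPx)
    have ij : IntervalIntegrable (fun x => fderiv ℝ χ (P i x 0) (Px i x 0) • (Λ (P i x 0) + c))
        volume 0 δ := ContinuousOn.intervalIntegrable (by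
        rw [uIcc_of_le hF.pos.le]
        exact (hF.continuousOn_rayDeriv hχ hi).smul
          ((hΛ.continuousOn.comp cP hPm).add continuousOn_const))
    rw [← e, eq_sub_iff_add_eq, ← intervalIntegral.integral_add ij ii]
    refine intervalIntegral.integral_congr fun x hx => ?_
    rw [uIcc_of_le hF.pos.le] at hx
    have hd : HasDerivAt Λ (deriv Λ (P i x 0)) (P i x 0) :=
      (hΛ.differentiableAt (hU.mem_nhds (hPm hx))).hasDerivAt
    have := ((hχ.differentiable one_ne_zero (P i x 0)).hasFDerivAt.smul
      ((hd.hasFDerivAt.restrictScalars ℝ).add_const c)).fderiv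
    rw [show (fun z => χ z • (Λ z + c)) = χ • fun z => Λ z + c from rfl, this]
    simp [add_comm, mul_comm, mul_left_comm]
  convert T using 2
  rw [key i₁ h.lt₁, key i₂ h.lt₂]
  simp only [smul_add, smul_sub]
  ring

end IsBoundaryFan

end

/-! ### The side on which the polygon sees the domain is locally constant -/

section

variable {Ω : Set ℂ} {ψ : ℂ → E3}

namespace IsBoundaryFan

variable {j : ℕ} {γ : ℝ → ℂ} {q : ℂ} {n : ℕ} {δ : ℝ} {P Px Py : ℕ → ℝ → ℝ → ℂ} {R : ℕ → ℝ → ℂ}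
  {i₁ i₂ n₁ n₂ : ℕ} {a₁ b₁ a₂ b₂ : ℝ} {ρ₁ ρ₂ : ℝ → ℝ}

/-- Two fans at nearby boundary points see the domain on the same side of the polygon. -/
lemma sign_eq (hψ : IsBranchedPSImmersion Ω ψ) (hγ : ContinuousOn γ (Icc 0 (2 * j)))
    (h : IsBoundaryFan Ω ψ j γ q n δ P Px Py R i₁ i₂ n₁ n₂ a₁ b₁ a₂ b₂ ρ₁ ρ₂) {τ : ℝ}
    (hτ : τ = 1 ∨ τ = -1)
    (hd : ∀ k < n, ∀ x ∈ Icc 0 δ, ∀ y ∈ Icc 0 δ, 0 < τ * planarDet (Px k x y) (Py k x y))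
    {Γ : Set ℂ} (hΓ : IsOpen Γ) {a : ℕ → ℝ} (hc : IsCut Γ n δ P i₁ i₂ a)
    {q' : ℂ} {n' : ℕ} {δ' : ℝ} {P' Px' Py' : ℕ → ℝ → ℝ → ℂ} {R' : ℕ → ℝ → ℂ}
    {i₁' i₂' n₁' n₂' : ℕ} {a₁' b₁' a₂' b₂' : ℝ} {ρ₁' ρ₂' : ℝ → ℝ}
    (h' : IsBoundaryFan Ω ψ j γ q' n' δ' P' Px' Py' R' i₁' i₂' n₁' n₂' a₁' b₁' a₂' b₂' ρ₁' ρ₂')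
    {τ' : ℝ} (hτ' : τ' = 1 ∨ τ' = -1)
    (hd' : ∀ k < n', ∀ x ∈ Icc 0 δ', ∀ y ∈ Icc 0 δ', 0 < τ' * planarDet (Px' k x y) (Py' k x y))
    {a' : ℕ → ℝ} (hc' : IsCut Γ n' δ' P' i₁' i₂' a') (hq' : q' ∈ fanSet n δ P) :
    τ * (a i₂ - a (cycPred n i₂)) = τ' * (a' i₂' - a' (cycPred n' i₂')) := by
  have hF := h'.fan
  have z0 := hF.zero_mem
  -- The test form is χ c⁻¹ dz, with χ supported near a point of the outgoing ray of the second fan,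
  -- inside both fans and off the incoming ray. In either fan its line integral is minus the limit
  -- of the same Riemann sums, while the integral of its curl over Γ carries the sign of that fan.
  -- The line integral is not zero, because the tangent direction divided by c stays in the right
  -- half-plane.
  set W : Set ℂ := fanSet n δ P ∩ fanSet n' δ' P' ∩ (R' i₁' '' Icc 0 δ')ᶜ with hW
  have hcl : ∀ {i : ℕ}, i < n' → ContinuousOn (R' i) (Icc 0 δ') := fun hi s hs =>
    (hF.hasDerivWithinAt_ray hi hs).continuousWithinAt
  have hWo : IsOpen W := (h.isOpen.inter h'.isOpen).inter
    (isCompact_Icc.image_of_continuousOn (hcl h'.lt₁)).isClosed.isOpen_compl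
  obtain ⟨x₀, hx₀, hx₀W⟩ : ∃ x ∈ Ioo 0 δ', R' i₂' x ∈ W := by
    have e1 : ∀ᶠ x in 𝓝[Icc 0 δ'] (0 : ℝ), R' i₂' x ∈ fanSet n δ P :=
      (hcl h'.lt₂ 0 z0).eventually (h.isOpen.mem_nhds (by rwa [hF.ray_zero h'.lt₂]))
    have e2 : ∀ᶠ x in 𝓝[Ioo 0 δ'] (0 : ℝ), R' i₂' x ∈ fanSet n δ P :=
      nhdsWithin_mono _ Ioo_subset_Icc_self e1
    have : (𝓝[Ioo 0 δ'] (0 : ℝ)).NeBot := by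
      rw [← mem_closure_iff_nhdsWithin_neBot, closure_Ioo hF.pos.ne]; exact z0
    obtain ⟨x, hx1, hx2⟩ := (e2.and eventually_mem_nhdsWithin).exists
    refine ⟨x, hx2, ⟨hx1, i₂', h'.lt₂, x, Ioo_subset_Ico_self hx2, 0, ⟨le_rfl, hF.pos⟩,
      hF.left _ h'.lt₂ x (Ioo_subset_Icc_self hx2)⟩, ?_⟩
    rintro ⟨s, hs, he⟩
    exact h'.ne (hF.ray_disj _ h'.lt₂ _ h'.lt₁ x (Ioo_subset_Icc_self hx2) s hs hx2.1 he.symm).symm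
  obtain ⟨χ, hχW, -, hχ, hχr, hχ1⟩ := exists_contDiff_tsupport_subset (n := 1) (hWo.mem_nhds hx₀W)
  set c := Px' i₂' 0 0 with hcdef
  have hc0 : c ≠ 0 := planarDet_ne_zero_left ((hF.net _ h'.lt₂).det_ne 0 z0 0 z0)
  set Λ : ℂ → ℂ := fun z => c⁻¹ * z with hΛ
  have hΛd : Differentiable ℂ Λ := differentiable_id.const_mul _
  have hderiv : ∀ z, deriv Λ z = c⁻¹ := fun z => by
    rw [hΛ, deriv_const_mul _ differentiableAt_fun_id, deriv_id'', mul_one]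
  have hg : ContDiff ℝ 1 fun z => χ z • deriv Λ z := by
    simp only [hderiv]
    exact hχ.smul contDiff_const
  have hs1 : tsupport χ ⊆ fanSet n δ P := fun z hz => (hχW hz).1.1
  have hs2 : tsupport χ ⊆ fanSet n' δ' P' := fun z hz => (hχW hz).1.2
  have T1 := h.tendsto_riemannSum_deriv hχ hs1 isOpen_univ (fun _ => subset_univ _)
    hΛd.differentiableOn (Φ := fun t => Λ (γ t)) (hΛd.continuous.comp_continuousOn hγ)
    (c₁ := 0) (c₂ := 0) (fun t _ => (add_zero _).symm) (fun t _ => (add_zero _).symm)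
  have T2 := h'.tendsto_riemannSum_deriv hχ hs2 isOpen_univ (fun _ => subset_univ _)
    hΛd.differentiableOn (Φ := fun t => Λ (γ t)) (hΛd.continuous.comp_continuousOn hγ)
    (c₁ := 0) (c₂ := 0) (fun t _ => (add_zero _).symm) (fun t _ => (add_zero _).symm)
  have hT := tendsto_nhds_unique T1 T2
  rw [sub_self, smul_zero, smul_zero, sub_zero, sub_zero, neg_inj] at hT
  have S1 := (h.fan.setIntegral_curl hψ hτ hd hΓ hc h.lt₁ h.lt₂ h.ne hg (tsupport_smul_subset.trans hs1)).2
  have S2 := (hF.setIntegral_curl hψ hτ' hd' hΓ hc' h'.lt₁ h'.lt₂ h'.ne hg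
    (tsupport_smul_subset.trans hs2)).2
  rw [S1, hT] at S2
  refine smul_left_injective (R := ℝ) (M := ℂ) ?_ S2
  have I1 : ∫ x in 0..δ', (χ (P' i₁' x 0) • deriv Λ (P' i₁' x 0)) * Px' i₁' x 0 = 0 := by
    refine (intervalIntegral.integral_congr fun x hx => ?_).trans
      (intervalIntegral.integral_zero (E := ℂ))
    rw [uIcc_of_le hF.pos.le] at hx
    have : χ (P' i₁' x 0) = 0 := image_eq_zero_of_notMem_tsupport fun hm =>
      (hχW hm).2 ⟨x, hx, (hF.left _ h'.lt₁ x hx).symm⟩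
    rw [this, zero_smul, zero_mul]
  rw [I1, sub_zero]
  have cP : ContinuousOn (fun x => P' i₂' x 0) (Icc 0 δ') := (hF.net _ h'.lt₂).cont.comp
    (f := fun s : ℝ => (s, (0 : ℝ))) (by fun_prop) fun s hs => ⟨hs, z0⟩
  have cPx : ContinuousOn (fun x => Px' i₂' x 0) (Icc 0 δ') := (hF.net _ h'.lt₂).part.cu.comp
    (f := fun s : ℝ => (s, (0 : ℝ))) (by fun_prop) fun s hs => ⟨hs, z0⟩
  have hcont : ContinuousOn (fun x => (χ (P' i₂' x 0) • deriv Λ (P' i₂' x 0)) * Px' i₂' x 0)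
      (Icc 0 δ') := by
    simp only [hderiv]
    exact ((hχ.continuous.comp_continuousOn cP).smul continuousOn_const).mul cPx
  intro h0
  have hii : IntervalIntegrable (fun x => (χ (P' i₂' x 0) • deriv Λ (P' i₂' x 0)) * Px' i₂' x 0)
      volume 0 δ' := ContinuousOn.intervalIntegrable (by rw [uIcc_of_le hF.pos.le]; exact hcont)
  have hre := Complex.reCLM.intervalIntegral_comp_comm hii
  rw [h0, map_zero] at hre
  have hval : ∀ x, Complex.reCLM ((χ (P' i₂' x 0) • deriv Λ (P' i₂' x 0)) * Px' i₂' x 0)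
      = χ (P' i₂' x 0) * (Px' i₂' x 0 / c).re := fun x => by
    rw [hderiv, smul_mul_assoc, map_smul, smul_eq_mul, inv_mul_eq_div]; rfl
  refine (intervalIntegral.integral_pos hF.pos (Complex.reCLM.continuous.comp_continuousOn hcont)
    (fun x hx => ?_) ⟨x₀, Ioo_subset_Icc_self hx₀, ?_⟩).ne' hre
  · simp only [Function.comp_apply, hval]
    exact mul_nonneg (hχr ⟨_, rfl⟩).1 ((hF.net _ h'.lt₂).re_x x (Ioc_subset_Icc_self hx) 0 z0).le
  · simp only [Function.comp_apply, hval]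
    rw [hF.left _ h'.lt₂ x₀ (Ioo_subset_Icc_self hx₀), hχ1, one_mul]
    exact (hF.net _ h'.lt₂).re_x x₀ (Ioo_subset_Icc_self hx₀) 0 z0

end IsBoundaryFan

end

/-! ### The smoothed Cauchy kernel and the winding number -/

section

variable {Ω : Set ℂ} {ψ : ℂ → E3}

/-- A smooth modification of the Cauchy kernel near its pole. -/
lemma exists_cauchy_kernel (a : ℂ) {r : ℝ} (hr : 0 < r) : ∃ (k : ℂ → ℂ) (f : ℂ → ℝ), ContDiff ℝ 1 k ∧
    (∀ z ∉ Metric.closedBall a (2 * r), k z = (z - a)⁻¹) ∧ (∀ z, curl k z = f z * Complex.I) ∧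
    (∀ z ∉ Metric.closedBall a (2 * r), f z = 0) ∧ 0 < ∫ z, f z := by
  set S := Real.smoothTransition
  have hS : ContDiff ℝ 2 S := Real.smoothTransition.contDiff
  have hSd : ∀ x, HasDerivAt S (deriv S x) x := fun x => (hS.differentiable (by norm_num) x).hasDerivAt
  have S1 : ∀ x, 1 ≤ x → S x = 1 := fun x hx => Real.smoothTransition.one_of_one_le hx
  have S0 : ∀ x ≤ 0, S x = 0 := fun x hx => Real.smoothTransition.zero_of_nonpos hx
  -- S(u) is a radial cut-off that vanishes for |z - a| ≤ r and equals 1 for |z - a| ≥ √2 r. The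
  -- curl of S(u)/(z - a) is then i times a nonnegative radial function.
  set u : ℂ → ℝ := fun z => ‖z - a‖ ^ 2 / r ^ 2 - 1 with hu
  have huc : ContDiff ℝ 2 u := ((contDiff_id.sub contDiff_const).norm_sq ℝ).div_const _ |>.sub contDiff_const
  have hfar : ∀ z ∉ Metric.closedBall a (2 * r), 1 < u z := fun z hz => by
    rw [Metric.mem_closedBall, dist_eq_norm, not_le] at hz
    have h1 : (2 * r) ^ 2 < ‖z - a‖ ^ 2 := by gcongr
    have h2 : 4 < ‖z - a‖ ^ 2 / r ^ 2 := by rw [lt_div_iff₀ (by positivity)]; linarith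
    simp only [hu]; linarith
  have hdS : ∀ x, 1 < x → deriv S x = 0 := fun x hx => by
    have : S =ᶠ[𝓝 x] fun _ => 1 := by
      filter_upwards [lt_mem_nhds hx] with y hy using S1 y hy.le
    rw [this.deriv_eq, deriv_const]
  have hdS0 : ∀ x, x < 0 → deriv S x = 0 := fun x hx => by
    have : S =ᶠ[𝓝 x] fun _ => 0 := by
      filter_upwards [gt_mem_nhds hx] with y hy using S0 y hy.le
    rw [this.deriv_eq, deriv_const]
  set k : ℂ → ℂ := fun z => S (u z) • (z - a)⁻¹ with hk
  set f : ℂ → ℝ := fun z => deriv S (u z) * (2 / r ^ 2) with hf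
  have hka : k =ᶠ[𝓝 a] fun _ => 0 := by
    have : ∀ᶠ z in 𝓝 a, u z < 0 := huc.continuous.continuousAt.eventually_lt continuousAt_const (by simp [hu])
    filter_upwards [this] with z hz
    simp only [hk]
    rw [S0 _ hz.le, zero_smul]
  refine ⟨k, f, contDiff_iff_contDiffAt.2 fun z => ?_, fun z hz => ?_, fun z => ?_, fun z hz => ?_, ?_⟩
  · by_cases hz : z = a
    · subst hz
      exact contDiffAt_const.congr_of_eventuallyEq hka
    · exact (((hS.of_le (by norm_num)).comp (huc.of_le (by norm_num))).contDiffAt).smul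
        ((contDiffAt_id.sub contDiffAt_const).inv (sub_ne_zero.2 hz))
  · simp only [hk]
    rw [S1 _ (hfar z hz).le, one_smul]
  · by_cases hz : z = a
    · subst hz
      rw [curl, hka.fderiv_eq]
      simp [hf, hu, hdS0]
    · have hz' := sub_ne_zero.2 hz
      have d1 : HasFDerivAt (fun z => S (u z)) (deriv S (u z) • ((r ^ 2)⁻¹ • (2 • innerSL ℝ (z - a)))) z := by
        have := ((hasFDerivAt_id (𝕜 := ℝ) z).sub_const a).norm_sq
        have e := ((this.mul_const ((r ^ 2)⁻¹)).sub_const 1)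
        exact (hSd (u z)).comp_hasFDerivAt z (by simpa [hu, div_eq_mul_inv] using e)
      have d2 : HasFDerivAt (fun z : ℂ => (z - a)⁻¹) _ z :=
        ((((hasDerivAt_id z).sub_const a).inv hz').hasFDerivAt.restrictScalars ℝ)
      have d3 : fderiv ℝ k z = _ := (d1.smul d2).fderiv
      rw [curl, d3]
      have e : (z - a) * (z - a)⁻¹ = 1 := mul_inv_cancel₀ hz'
      have hw : Complex.I * ((z.re : ℂ) - a.re) - (z.im - a.im) = Complex.I * (z - a) := by
        apply Complex.ext <;> simp
      simp [hf]
      linear_combination (((deriv S (u z) : ℝ) : ℂ) * ((r : ℂ) ^ 2)⁻¹ * 2 * (z - a)⁻¹) * hw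
        + (((deriv S (u z) : ℝ) : ℂ) * ((r : ℂ) ^ 2)⁻¹ * 2 * Complex.I) * e
  · simp only [hf]
    rw [hdS _ (hfar z hz), zero_mul]
  · have hfc : Continuous f := (((hS.continuous_deriv (by norm_num)).comp huc.continuous).mul continuous_const)
    -- The mean value theorem finds a place where S' = 1, hence a point where f does not vanish.
    obtain ⟨t, ht, hts⟩ := exists_deriv_eq_slope S zero_lt_one hS.continuous.continuousOn
      (hS.differentiable (by norm_num)).differentiableOn
    refine hfc.integral_pos_of_hasCompactSupport_nonneg_nonzero (x := a + (r * Real.sqrt (1 + t) : ℝ)) ?_ ?_ ?_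
    · refine HasCompactSupport.intro (isCompact_closedBall a (2 * r)) fun z hz => ?_
      simp only [hf]
      rw [hdS _ (hfar z hz), zero_mul]
    · intro z
      exact mul_nonneg Real.smoothTransition.monotone.deriv_nonneg (by positivity)
    · have : u (a + (r * Real.sqrt (1 + t) : ℝ)) = t := by
        simp only [hu, add_sub_cancel_left, Complex.norm_real, Real.norm_eq_abs, sq_abs, mul_pow]
        rw [Real.sq_sqrt (by linarith [ht.1])]
        field_simp
        ring
      simp only [hf, this]
      rw [hts]
      rw [S1 1 le_rfl, S0 0 le_rfl]
      simp [hr.ne']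

/-- The fans at a boundary point `q` of `Γ` see `Γ` on the left (`ε = 1`) or on the right (`ε = -1`)
of the polygon. -/
def HasSide (Ω : Set ℂ) (ψ : ℂ → E3) (Γ : Set ℂ) (j : ℕ) (γ : ℝ → ℂ) (q : ℂ) (ε : ℝ) : Prop :=
  ∃ (n : ℕ) (δ : ℝ) (P Px Py : ℕ → ℝ → ℝ → ℂ) (R : ℕ → ℝ → ℂ) (i₁ i₂ n₁ n₂ : ℕ) (a₁ b₁ a₂ b₂ : ℝ)
    (ρ₁ ρ₂ : ℝ → ℝ) (τ : ℝ) (a : ℕ → ℝ),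
    IsBoundaryFan Ω ψ j γ q n δ P Px Py R i₁ i₂ n₁ n₂ a₁ b₁ a₂ b₂ ρ₁ ρ₂ ∧ (τ = 1 ∨ τ = -1) ∧
    (∀ k < n, ∀ x ∈ Icc 0 δ, ∀ y ∈ Icc 0 δ, 0 < τ * planarDet (Px k x y) (Py k x y)) ∧
    IsCut Γ n δ P i₁ i₂ a ∧ τ * (a i₂ - a (cycPred n i₂)) = ε

/-- Every boundary point has a fan. Nearby ones agree by `IsBoundaryFan.sign_eq`, and the polygon is
connected. -/
lemma exists_hasSide (hψ : IsBranchedPSImmersion Ω ψ) {j : ℕ} {γ : ℝ → ℂ}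
    (hγ : IsHamburgerPolygon Ω ψ j γ) {m : ℂ → ℕ} (hm : ∀ p ∈ Ω, HasSaddleOrder Ω ψ p (m p)) {Γ : Set ℂ}
    (hΓ : IsOpen Γ) (hfr : frontier Γ = γ '' Icc 0 (2 * j)) (hΓΩ : closure Γ ⊆ Ω) :
    ∃ ε, ∀ q ∈ γ '' Icc 0 (2 * (j : ℝ)), ∀ ε', HasSide Ω ψ Γ j γ q ε' → ε' = ε := by
  have hex : ∀ t ∈ Icc 0 (2 * (j : ℝ)), ∃ ε, HasSide Ω ψ Γ j γ (γ t) ε := fun t ht => by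
    have hq : γ t ∈ γ '' Icc 0 (2 * (j : ℝ)) := ⟨t, ht, rfl⟩
    have hΩ : γ t ∈ Ω := hΓΩ (frontier_subset_closure (hfr ▸ hq))
    obtain ⟨δ, P, Px, Py, R, i₁, i₂, n₁, n₂, a₁, b₁, a₂, b₂, ρ₁, ρ₂, h, -⟩ :=
      hγ.exists_boundaryFan hψ hq (hm _ hΩ) univ_mem
    obtain ⟨τ, hτ, hd⟩ := h.fan.exists_sign
    obtain ⟨a, ha⟩ := h.exists_cut hΓ hfr
    exact ⟨_, _, δ, P, Px, Py, R, i₁, i₂, n₁, n₂, a₁, b₁, a₂, b₂, ρ₁, ρ₂, τ, a, h, hτ, hd, ha, rfl⟩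
  have huniq : ∀ {q ε}, HasSide Ω ψ Γ j γ q ε → ∀ᶠ q' in 𝓝 q, ∀ ε', HasSide Ω ψ Γ j γ q' ε' → ε = ε' := by
    rintro q ε ⟨n, δ, P, Px, Py, R, i₁, i₂, n₁, n₂, a₁, b₁, a₂, b₂, ρ₁, ρ₂, τ, a, h, hτ, hd, hc, rfl⟩
    filter_upwards [h.fan.mem_nhds] with q' hq'
    rintro ε' ⟨n', δ', P', Px', Py', R', i₁', i₂', n₁', n₂', a₁', b₁', a₂', b₂', ρ₁', ρ₂', τ', a', h', hτ',
      hd', hc', rfl⟩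
    exact h.sign_eq hψ hγ.continuousOn hτ hd hΓ hc h' hτ' hd' hc' hq'
  choose! e he using hex
  have h0 : (0 : ℝ) ∈ Icc 0 (2 * (j : ℝ)) := ⟨le_rfl, by positivity⟩
  have hconst : ∀ t ∈ Icc 0 (2 * (j : ℝ)), e t = e 0 := fun t ht =>
    isPreconnected_Icc.induction₂ (fun x y => e x = e y) (fun x hx => by
      filter_upwards [(hγ.continuousOn x hx).eventually (huniq (he x hx)), self_mem_nhdsWithin] with y h1 hy
      exact h1 _ (he y hy)) (fun _ _ _ _ _ _ h1 h2 => h1.trans h2) (fun _ _ _ _ h1 => h1.symm) ht h0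
  refine ⟨e 0, ?_⟩
  rintro _ ⟨t, ht, rfl⟩ ε' hε'
  rw [← hconst t ht]
  exact ((huniq (he t ht)).self_of_nhds ε' hε').symm

/-- If the polygon winds once around the points of `Γ`, then it sees `Γ` on the corresponding side. -/
theorem hasSide_eq (hψ : IsBranchedPSImmersion Ω ψ) {j : ℕ} {γ : ℝ → ℂ}
    (hγ : IsHamburgerPolygon Ω ψ j γ) {m : ℂ → ℕ} (hm : ∀ p ∈ Ω, HasSaddleOrder Ω ψ p (m p)) {Γ : Set ℂ}
    (hΓ : IsOpen Γ) (hΓk : IsCompact (closure Γ)) (hfr : frontier Γ = γ '' Icc 0 (2 * j))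
    (hΓΩ : closure Γ ⊆ Ω) {a : ℂ} (ha : a ∈ Γ) {w : ℝ} (hw : w = 1 ∨ w = -1)
    (hwind : HasWindingNumber γ (2 * j) a w) {q : ℂ} (hq : q ∈ γ '' Icc 0 (2 * (j : ℝ))) {ε : ℝ}
    (hε : HasSide Ω ψ Γ j γ q ε) : ε = w := by
  obtain ⟨ε₀, hε₀⟩ := exists_hasSide hψ hγ hm hΓ hfr hΓΩ
  have hval : ε = 1 ∨ ε = -1 ∨ ε = 0 := by
    obtain ⟨n, δ, P, Px, Py, R, i₁, i₂, n₁, n₂, a₁, b₁, a₂, b₂, ρ₁, ρ₂, τ, a, h, hτ, hd, hc, rfl⟩ := hε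
    rcases hτ with rfl | rfl <;> rcases hc.eq_or h.lt₂ with h1 | h1 <;>
      rcases hc.eq_or (cycPred_lt h.lt₂) with h2 | h2 <;> rw [h1, h2] <;> norm_num
  have hεε := hε₀ q hq ε hε
  subst hεε
  suffices hpos : 0 < ε * w by
    rcases hval with rfl | rfl | rfl <;> rcases hw with rfl | rfl <;>
      first | rfl | norm_num at hpos
  obtain ⟨ϑ, hϑ, hϑγ, hϑw⟩ := hwind
  have hL : (0 : ℝ) ≤ 2 * j := by positivity
  have hγΓ : ∀ t ∈ Icc 0 (2 * (j : ℝ)), γ t ∈ closure Γ ∧ γ t ∉ Γ := fun t ht => by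
    have : γ t ∈ frontier Γ := hfr ▸ mem_image_of_mem γ ht
    rwa [hΓ.frontier_eq] at this
  obtain ⟨s, hs, hsΓ⟩ := Metric.nhds_basis_closedBall.mem_iff.1 (hΓ.mem_nhds ha)
  obtain ⟨k, f, hk, hkinv, hkcurl, hkf, hfpos⟩ := exists_cauchy_kernel a (half_pos hs)
  rw [mul_div_cancel₀ s two_ne_zero] at hkinv hkf
  set L : ℝ → ℂ := fun t => Real.log ‖γ t - a‖ + ϑ t * Complex.I with hLdef
  have hLc : ContinuousOn L (Icc 0 (2 * j)) := by
    refine ContinuousOn.add ?_ ((Complex.continuous_ofReal.comp_continuousOn hϑ).mul continuousOn_const)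
    exact Complex.continuous_ofReal.comp_continuousOn ((hγ.continuousOn.sub continuousOn_const).norm.log
      fun t ht => norm_ne_zero_iff.2 (sub_ne_zero.2 (hϑγ t ht).1))
  have hexp : ∀ t ∈ Icc 0 (2 * (j : ℝ)), Complex.exp (L t) = γ t - a := fun t ht => by
    rw [hLdef, Complex.exp_add, ← Complex.ofReal_exp,
      Real.exp_log (norm_pos_iff.2 (sub_ne_zero.2 (hϑγ t ht).1))]
    exact (hϑγ t ht).2.symm
  set D : ℂ := 2 * Real.pi * Complex.I * w with hD
  -- Weak form of ∫_Γ curl k = ε ∮ k dz: the integral of χ dL is integrated by parts, since γ cannot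
  -- be differentiated, and T stands for the integral of L d(χ ∘ γ). If χ = 1 on the closure, then T
  -- = 0 and the identity reads i ∫ f = ε 2πi w. Hence ε w > 0.
  suffices hex : ∃ χ : ℂ → ℝ, (ContDiff ℝ 1 χ ∧ IntegrableOn (curl fun z => χ z • k z) Γ ∧
      ∃ T, Tendsto (riemannSum (2 * j) L fun t => χ (γ t)) atTop (𝓝 T) ∧
        ∫ z in Γ, curl (fun z => χ z • k z) z = -(ε • (T - χ (γ 0) • D))) ∧ EqOn χ 1 (closure Γ) by
    obtain ⟨χ, ⟨hχ, hχi, T, hT, hχT⟩, hχ1⟩ := hex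
    have hT0 : T = 0 := tendsto_nhds_unique hT (tendsto_const_nhds.congr fun N =>
      (riemannSum_eq_zero hL (c := 1) (fun t ht => hχ1 (hγΓ t ht).1) N).symm)
    have e1 : ∫ z in Γ, curl (fun z => χ z • k z) z = ∫ z in Γ, curl k z := by
      refine setIntegral_congr_fun hΓ.measurableSet fun z hz => ?_
      have : (fun z => χ z • k z) =ᶠ[𝓝 z] k := by
        filter_upwards [hΓ.mem_nhds hz] with y hy
        rw [hχ1 (subset_closure hy)]; simp
      simp only [curl, this.fderiv_eq]
    have e2 : ∫ z in Γ, curl k z = (∫ z, f z : ℝ) * Complex.I := by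
      rw [setIntegral_eq_integral_of_forall_compl_eq_zero fun z hz => by
        rw [hkcurl, hkf z fun hc => hz (hsΓ hc)]; simp]
      simp_rw [hkcurl]
      rw [integral_mul_const]
      exact congrArg (· * Complex.I) integral_ofReal
    rw [e1, e2, hT0, hχ1 (hγΓ 0 ⟨le_rfl, hL⟩).1] at hχT
    have := congrArg Complex.im hχT
    simp [hD] at this
    rw [this] at hfpos
    have h2 : 0 < 2 * Real.pi := by positivity
    by_contra hcon
    nlinarith
  have hsm : ∀ {χ : ℂ → ℝ}, ContDiff ℝ 1 χ → ContDiff ℝ 1 fun z => χ z • k z := fun h => h.smul hk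
  refine exists_eqOn_one hΓk ?_ ?_ ?_
  · have h0 : (curl fun z => (0 : ℂ → ℝ) z • k z) = fun _ => 0 := by ext z; simp [curl]
    refine ⟨contDiff_const, by rw [h0]; exact integrableOn_zero, 0, tendsto_const_nhds.congr fun N =>
      (riemannSum_eq_zero hL (c := 0) (fun t _ => rfl) N).symm, by rw [h0]; simp⟩
  · rintro χ₁ χ₂ ⟨d1, i1, T₁, t1, f1⟩ ⟨d2, i2, T₂, t2, f2⟩
    have hadd : ∀ z, curl (fun z => (χ₁ + χ₂) z • k z) z
        = curl (fun z => χ₁ z • k z) z + curl (fun z => χ₂ z • k z) z := fun z => by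
      have : (fun z => (χ₁ + χ₂) z • k z) = (fun z => χ₁ z • k z) + fun z => χ₂ z • k z := by
        ext z; simp [add_mul]
      rw [this, curl, fderiv_add ((hsm d1).differentiable one_ne_zero z)
        ((hsm d2).differentiable one_ne_zero z)]
      simp [curl]; ring
    refine ⟨d1.add d2, ?_, T₁ + T₂, (t1.add t2).congr fun N => (riemannSum_add _ _ _ _ N).symm, ?_⟩
    · exact (i1.add i2).congr (Filter.Eventually.of_forall fun z => (hadd z).symm)
    · simp_rw [hadd]
      rw [integral_add i1 i2, f1, f2]
      simp only [Pi.add_apply, smul_sub, smul_add, add_smul]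
      ring
  · intro q hq
    by_cases hqΓ : q ∈ Γ
    · refine ⟨Γ, hΓ.mem_nhds hqΓ, fun χ hχ2 hχc hχs => ?_⟩
      have hχ := hχ2.of_le one_le_two
      have hg := hsm hχ
      have h0 : ∀ z ∉ Γ, χ z = 0 := fun z hz => image_eq_zero_of_notMem_tsupport fun hc => hz (hχs hc)
      have hgs := tsupport_smul_subset (χ := χ) (F := k)
      refine ⟨hχ, ((continuous_curl hg).continuousOn.integrableOn_compact hΓk).mono_set subset_closure, 0,
        tendsto_const_nhds.congr fun N => (riemannSum_eq_zero hL (c := 0)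
          (fun t ht => h0 _ (hγΓ t ht).2) N).symm, ?_⟩
      rw [h0 _ (hγΓ 0 ⟨le_rfl, hL⟩).2, setIntegral_eq_integral_of_forall_compl_eq_zero fun z hz =>
        curl_eq_zero_of_notMem fun hc => hz (hχs (hgs hc)),
        integral_curl_eq_zero hg (hχc.of_isClosed_subset (isClosed_tsupport _) hgs)]
      simp
    · have hqf : q ∈ γ '' Icc 0 (2 * (j : ℝ)) := by
        rw [← hfr, hΓ.frontier_eq]; exact ⟨hq, hqΓ⟩
      have hqa : q - a ≠ 0 := sub_ne_zero.2 fun e => hqΓ (e ▸ ha)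
      -- On V the function log((z - a)/(q - a)) is a holomorphic branch and k is the true Cauchy
      -- kernel. The starting point γ 0 is excluded from V unless it is q.
      set V : Set ℂ := {z | (z - a) / (q - a) ∈ Complex.slitPlane} ∩ (Metric.closedBall a s)ᶜ ∩
        {z | z = γ 0 → q = γ 0} with hV
      have hVo : IsOpen V := by
        refine ((Complex.isOpen_slitPlane.preimage (by fun_prop)).inter
          Metric.isClosed_closedBall.isOpen_compl).inter ?_
        by_cases h0 : q = γ 0
        · simp [h0]
        · have : {z | z = γ 0 → q = γ 0} = {γ 0}ᶜ := by ext z; simp [h0]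
          rw [this]; exact isOpen_compl_singleton
      have hqV : q ∈ V := ⟨⟨by simp [div_self hqa], fun hc => hqΓ (hsΓ hc)⟩, fun h => h⟩
      obtain ⟨δ, P, Px, Py, R, i₁, i₂, n₁, n₂, a₁, b₁, a₂, b₂, ρ₁, ρ₂, h, hPV, -⟩ :=
        hγ.exists_boundaryFan hψ hqf (hm _ (hΓΩ hq)) (hVo.mem_nhds hqV)
      obtain ⟨τ, hτ, hd⟩ := h.fan.exists_sign
      obtain ⟨c, hc⟩ := h.exists_cut hΓ hfr
      have hside := hε₀ q hqf _ ⟨_, δ, P, Px, Py, R, i₁, i₂, n₁, n₂, a₁, b₁, a₂, b₂, ρ₁, ρ₂, τ, c, h, hτ, hd,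
        hc, rfl⟩
      refine ⟨fanSet (2 * m q) δ P, h.fan.mem_nhds, fun χ hχ2 hχc hχs => ?_⟩
      have hχ := hχ2.of_le one_le_two
      have hg := hsm hχ
      have hfV : fanSet (2 * m q) δ P ⊆ V := IsFan.fanSet_subset.trans (iUnion_subset fun k => hPV k)
      set Λ : ℂ → ℂ := fun z => Complex.log ((z - a) / (q - a)) with hΛ
      have hΛd : ∀ z ∈ V, HasDerivAt Λ (z - a)⁻¹ z := fun z hz => by
        have := (((hasDerivAt_id z).sub_const a).div_const (q - a)).clog hz.1.1
        refine this.congr_deriv ?_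
        simp only [id]
        field_simp
      have hΛk : ∀ z, χ z • deriv Λ z = χ z • k z := fun z => by
        by_cases hz : z ∈ tsupport χ
        · rw [(hΛd z (hfV (hχs hz))).deriv, hkinv z (hfV (hχs hz)).1.2]
        · rw [image_eq_zero_of_notMem_tsupport hz, zero_smul, zero_smul]
      have hΛD : DifferentiableOn ℂ Λ V := fun z hz => (hΛd z hz).differentiableAt.differentiableWithinAt
      -- Two lifts through the exponential covering that agree at one time agree on the whole
      -- interval.
      have lift : ∀ {u v c : ℝ}, Icc u v ⊆ Icc 0 (2 * (j : ℝ)) → MapsTo γ (Icc u v) V → c ∈ Icc u v →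
          γ c = q → ∀ t ∈ Icc u v, L t = Λ (γ t) + L c := by
        intro u v c huv hmaps hcm hcq
        refine Complex.isCoveringMap_exp.eqOn_of_comp_eqOn isPreconnected_Icc (hLc.mono huv)
          ((hΛD.continuousOn.comp (hγ.continuousOn.mono huv) hmaps).add continuousOn_const)
          (fun t ht => Subtype.ext ?_) hcm ?_
        · have h1 := (hmaps ht).1.1
          simp only [Function.comp_apply]
          rw [hexp t (huv ht), Complex.exp_add, Complex.exp_log (Complex.slitPlane_ne_zero h1),
            hexp c (huv hcm), hcq, div_mul_cancel₀ _ hqa]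
        · simp [hΛ, hcq]
      have z0 := h.fan.zero_mem
      have m₁ : MapsTo γ (Icc a₁ b₁) V := fun t ht => hPV i₁ ⟨(_, 0), ⟨h.param_mem₁ ht, z0⟩, (h.eq_cell₁ ht).symm⟩
      have m₂ : MapsTo γ (Icc a₂ b₂) V := fun t ht => hPV i₂ ⟨(_, 0), ⟨h.param_mem₂ ht, z0⟩, (h.eq_cell₂ ht).symm⟩
      have hT := h.tendsto_riemannSum_deriv hχ hχs hVo hPV hΛD hLc
        (lift (Icc_subset_Icc h.a₁_nonneg h.b₁_le) m₁ ⟨h.ab₁.le, le_rfl⟩ h.map_b₁)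
        (lift (Icc_subset_Icc h.a₂_nonneg h.b₂_le) m₂ ⟨le_rfl, h.ab₂.le⟩ h.map_a₂)
      have hS := h.fan.setIntegral_curl hψ hτ hd hΓ hc h.lt₁ h.lt₂ h.ne hg (tsupport_smul_subset.trans hχs)
      -- The lift L is discontinuous around the closed curve only at γ 0, where the arriving arc
      -- ends at time 2j and the leaving arc starts at time 0.
      have hjump : χ q • (L a₂ - L b₁) = -(χ (γ 0) • D) := by
        have hlt : a₂ < 2 * j := h.ab₂.trans_le h.b₂_le
        by_cases h0 : q = γ 0
        · have ha₂ : a₂ = 0 := hγ.injOn ⟨h.a₂_nonneg, hlt⟩ ⟨le_rfl, h.a₂_nonneg.trans_lt hlt⟩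
            (h.map_a₂.trans h0)
          have hb₁ : b₁ = 2 * j := h.place.elim
            (fun e => by linarith [h.a₁_nonneg, h.ab₁]) And.right
          rw [ha₂, hb₁, ← h0, ← smul_neg]
          congr 1
          have : (ϑ (2 * j) : ℂ) = ϑ 0 + 2 * Real.pi * w := by
            have e : ϑ (2 * j) = ϑ 0 + 2 * Real.pi * w := by linarith
            rw [e]; push_cast; ring
          simp only [hLdef, hD, hγ.closed, this]
          ring
        · have h1 : χ (γ 0) = 0 := image_eq_zero_of_notMem_tsupport fun hc => h0 ((hfV (hχs hc)).2 rfl)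
          have h2 : b₁ = a₂ := h.place.resolve_right fun e => h0 (by rw [← e.1, h.map_a₂])
          rw [h1, h2]; simp
      rw [hjump] at hT
      simp only [hΛk] at hT
      refine ⟨hχ, hS.1, _, hT, ?_⟩
      rw [hS.2, hside, ← smul_neg]
      congr 1
      ring

end

/-! ### Additivity of the Hessian, and constancy of the orientation -/

section

variable {Ω : Set ℂ} {ψ : ℂ → E3}

lemma covHess_add {χ₁ χ₂ : ℂ → ℝ} (h₁ : ContDiff ℝ 2 χ₁) (h₂ : ContDiff ℝ 2 χ₂) (z X Y : ℂ) :
    covHess (χ₁ + χ₂) z X Y = covHess χ₁ z X Y + covHess χ₂ z X Y := by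
  have e : fderiv ℝ (χ₁ + χ₂) = fderiv ℝ χ₁ + fderiv ℝ χ₂ := funext fun w =>
    fderiv_add (h₁.differentiable two_ne_zero w) (h₂.differentiable two_ne_zero w)
  have d : ∀ {χ : ℂ → ℝ}, ContDiff ℝ 2 χ → Differentiable ℝ (fderiv ℝ χ) := fun h =>
    (h.fderiv_right (m := 1) (by norm_num)).differentiable one_ne_zero
  rw [covHess, e, fderiv_add (d h₁ z) (d h₂ z)]
  simp only [covHess, add_apply, Pi.add_apply]
  ring

lemma covHess_of_eventuallyEq_one {χ : ℂ → ℝ} {z : ℂ} (h : χ =ᶠ[𝓝 z] 1) (X Y : ℂ) :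
    covHess χ z X Y = 0 := by
  have h1 : fderiv ℝ χ =ᶠ[𝓝 z] fun _ => 0 := by
    refine h.fderiv.trans (Filter.Eventually.of_forall fun w => ?_)
    exact congrFun (fderiv_const (1 : ℝ)) w
  rw [covHess, h1.fderiv_eq, h1.self_of_nhds]
  simp

lemma sign_eq_of_isPreconnected {Γ : Set ℂ} (hΓ : IsPreconnected Γ) {ω : ℂ → ℝ} (hω : ContinuousOn ω Γ)
    (h0 : ∀ z ∈ Γ, ω z ≠ 0) {a z : ℂ} (ha : a ∈ Γ) (hz : z ∈ Γ) : Real.sign (ω z) = Real.sign (ω a) := by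
  have key : ∀ {a z : ℂ}, a ∈ Γ → z ∈ Γ → ω a < 0 → 0 < ω z → False := fun ha hz h1 h2 => by
    obtain ⟨w, hw, hw0⟩ := hΓ.intermediate_value ha hz hω ⟨h1.le, h2.le⟩
    exact h0 w hw hw0
  rcases lt_or_gt_of_ne (h0 a ha) with h1 | h1 <;> rcases lt_or_gt_of_ne (h0 z hz) with h2 | h2
  · rw [Real.sign_of_neg h1, Real.sign_of_neg h2]
  · exact (key ha hz h1 h2).elim
  · exact (key hz ha h2 h1).elim
  · rw [Real.sign_of_pos h1, Real.sign_of_pos h2]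

end

end BranchedPS

end

open BranchedPS in
theorem theorem2
    (Ω : Set ℂ) (ψ : ℂ → BranchedPS.E3)
    (hψ : BranchedPS.IsBranchedPSImmersion Ω ψ)
    -- the orders of saddleness; the branch points are those of order other than two
    (m : ℂ → ℕ) (hm : ∀ p ∈ Ω, BranchedPS.HasSaddleOrder Ω ψ p (m p))
    (hfin : {p | p ∈ Ω ∧ m p ≠ 2}.Finite)
    -- an orientation of `Ω`, as the nowhere vanishing two-form `ω(z) dx ∧ dy`
    (ω : ℂ → ℝ) (hω : ContinuousOn ω Ω) (hω0 : ∀ z ∈ Ω, ω z ≠ 0)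
    -- the angle between the asymptotic directions
    (φ : ℂ → ℝ) (hφ : ∀ x ∈ Ω, BranchedPS.IsAsymptoticAngle Ω ψ ω x (φ x))
    -- the domain
    (Γ : Set ℂ) (hΓo : IsOpen Γ) (hΓc : IsConnected Γ)
    (hΓk : IsCompact (closure Γ)) (hΓΩ : closure Γ ⊆ Ω)
    -- its boundary, a Hamburger polygon with the orientation induced by `ω`
    (j : ℕ) (γ : ℝ → ℂ) (hγ : BranchedPS.IsHamburgerPolygon Ω ψ j γ)
    (hγΓ : frontier Γ = γ '' Set.Icc 0 (2 * j))
    (hor : ∀ z ∈ Γ, BranchedPS.HasWindingNumber γ (2 * j) z (Real.sign (ω z)))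
    -- `φ` is continuous from `Γ` at each vertex, and no side has a branch point inside it
    (hvert : ∀ n < 2 * j, ContinuousWithinAt φ Γ (γ n))
    (hside : ∀ p ∈ frontier Γ, m p ≠ 2 → ∃ n < 2 * j, p = γ n) :
    ∑ n ∈ Finset.range (2 * j), (-1 : ℝ) ^ n * φ (γ n)
      = BranchedPS.hyperbolicArea Γ
        - ∑ᶠ p ∈ Γ ∩ {p | m p ≠ 2}, ((m p : ℝ) - 2) * Real.pi := by
  classical
  obtain ⟨U, V, hf⟩ := exists_frameField hψ hφ
  have hsub := subset_closure.trans hΓΩ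
  obtain ⟨a, ha⟩ := hΓc.nonempty
  set o := Real.sign (ω a) with ho_def
  have ho : o = 1 ∨ o = -1 := (Real.sign_apply_eq_of_ne_zero _ (hω0 a (hsub ha))).symm
  have hωo : ∀ z ∈ Γ, Real.sign (ω z) = o := fun z hz =>
    sign_eq_of_isPreconnected hΓc.isPreconnected (hω.mono hsub) (fun z hz => hω0 z (hsub hz)) ha hz
  have hL : (0 : ℝ) ≤ 2 * j := by positivity
  have hγc : ∀ t ∈ Icc 0 (2 * (j : ℝ)), γ t ∈ closure Γ ∧ γ t ∉ Γ := fun t ht => by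
    have : γ t ∈ frontier Γ := hγΓ ▸ mem_image_of_mem γ ht
    rwa [hΓo.frontier_eq] at this
  have hnat : ∀ n < 2 * j, (n : ℝ) ∈ Ico 0 (2 * (j : ℝ)) := fun n hn =>
    ⟨Nat.cast_nonneg n, by exact_mod_cast hn⟩
  have hfin' : (Γ ∩ {p | m p ≠ 2}).Finite := hfin.subset fun p hp => ⟨hsub hp.1, hp.2⟩
  set S := hfin'.toFinset with hS
  -- F contains all points at which C has a mass. The local test functions are supported off F,
  -- except possibly at q.
  set F : Finset ℂ := S ∪ (Finset.range (2 * j)).image fun n : ℕ => γ n with hF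
  set A : (ℂ → ℝ) → ℝ := fun χ => ∫ z in Γ, (χ z * lam z - hessWeight ω φ U V χ z) with hA
  set C : (ℂ → ℝ) → ℝ := fun χ => ∑ p ∈ S, ((m p : ℝ) - 2) * Real.pi * χ p
    + ∑ n ∈ Finset.range (2 * j), (-1 : ℝ) ^ n * φ (γ n) * χ (γ n) with hC
  -- The Stieltjes integral of the signed boundary angle against d(χ ∘ γ) equals A χ - C χ. If χ = 1
  -- on the closure of Γ, the Riemann sums and the Hessian term vanish, so A χ is the area and A χ =
  -- C χ is the claim.
  suffices hex : ∃ χ : ℂ → ℝ, (ContDiff ℝ 2 χ ∧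
      IntegrableOn (fun z => χ z * lam z - hessWeight ω φ U V χ z) Γ ∧
      Tendsto (riemannSum (2 * j) (sideAngle Γ φ γ) fun t => χ (γ t)) atTop (𝓝 (A χ - C χ))) ∧
      EqOn χ 1 (closure Γ) by
    obtain ⟨χ, ⟨-, -, hT⟩, h1⟩ := hex
    have h0 : A χ - C χ = 0 := tendsto_nhds_unique hT (tendsto_const_nhds.congr fun N =>
      (riemannSum_eq_zero hL (c := 1) (fun t ht => h1 (hγc t ht).1) N).symm)
    have hA1 : A χ = hyperbolicArea Γ := setIntegral_congr_fun hΓo.measurableSet fun z hz => by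
      have hz1 : χ =ᶠ[𝓝 z] 1 := by
        filter_upwards [hΓo.mem_nhds hz] with y hy using h1 (subset_closure hy)
      simp only [hessWeight, covHess_of_eventuallyEq_one hz1, hz1.self_of_nhds]
      simp [lam]
    have hC1 : C χ = ∑ᶠ p ∈ Γ ∩ {p | m p ≠ 2}, ((m p : ℝ) - 2) * Real.pi
        + ∑ n ∈ Finset.range (2 * j), (-1 : ℝ) ^ n * φ (γ n) := by
      rw [finsum_mem_eq_finite_toFinset_sum _ hfin']
      refine congrArg₂ _ (Finset.sum_congr rfl fun p hp => ?_) (Finset.sum_congr rfl fun n hn => ?_)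
      · rw [h1 (subset_closure (hfin'.mem_toFinset.1 hp).1)]; simp
      · rw [h1 (hγc _ (Ico_subset_Icc_self (hnat n (Finset.mem_range.1 hn)))).1]; simp
    rw [hA1, hC1] at h0
    linarith
  refine exists_eqOn_one hΓk ?_ ?_ ?_
  · have e : (fun z => (0 : ℂ → ℝ) z * lam z - hessWeight ω φ U V 0 z) = fun _ => 0 := by
      ext z; simp [hessWeight, covHess]
    refine ⟨contDiff_const, by rw [e]; exact integrableOn_zero, tendsto_const_nhds.congr fun N =>
      (show A 0 - C 0 = _ from ?_)⟩
    rw [riemannSum_eq_zero hL (f := fun t => (0 : ℂ → ℝ) (γ t)) (c := 0) (fun t _ => rfl) N]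
    simp only [hA, hC, e]
    simp
  · rintro χ₁ χ₂ ⟨d1, i1, t1⟩ ⟨d2, i2, t2⟩
    have e : ∀ z, (χ₁ + χ₂) z * lam z - hessWeight ω φ U V (χ₁ + χ₂) z
        = (χ₁ z * lam z - hessWeight ω φ U V χ₁ z) + (χ₂ z * lam z - hessWeight ω φ U V χ₂ z) := fun z => by
      simp only [hessWeight, covHess_add d1 d2, Pi.add_apply]; ring
    refine ⟨d1.add d2, ?_, ?_⟩
    · simp_rw [e]; exact i1.add i2
    · have e1 : A (χ₁ + χ₂) = A χ₁ + A χ₂ := by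
        simp only [hA]; simp_rw [e]; exact integral_add i1 i2
      have e2 : C (χ₁ + χ₂) = C χ₁ + C χ₂ := by
        simp only [hC, Pi.add_apply, mul_add, Finset.sum_add_distrib]; ring
      rw [e1, e2, add_sub_add_comm]
      exact (t1.add t2).congr fun N => (riemannSum_add _ _ _ _ N).symm
  · intro q hq
    have hFq : IsOpen ((↑(F.erase q) : Set ℂ)ᶜ) := (F.erase q).finite_toSet.isClosed.isOpen_compl
    have hqF : q ∈ (↑(F.erase q) : Set ℂ)ᶜ := by simp
    have hSF : ∀ {p : ℂ}, p ∈ S → p ∈ F := fun hp => Finset.mem_union_left _ hp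
    have hγF : ∀ {n : ℕ}, n ∈ Finset.range (2 * j) → γ n ∈ F := fun hn =>
      Finset.mem_union_right _ (Finset.mem_image_of_mem _ hn)
    have hzero : ∀ {χ : ℂ → ℝ}, tsupport χ ⊆ (↑(F.erase q) : Set ℂ)ᶜ → ∀ p ∈ F, p ≠ q → χ p = 0 :=
      fun h p hp hpq => image_eq_zero_of_notMem_tsupport fun hc => h hc (Finset.mem_coe.2 (Finset.mem_erase.2 ⟨hpq, hp⟩))
    by_cases hqΓ : q ∈ Γ
    · obtain ⟨c⟩ := hm q (hsub hqΓ)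
      obtain ⟨δ, hfan, hδ⟩ := ((c.eventually_isFan hψ).and (c.eventually_netImage_subset
        (Filter.inter_mem (hΓo.mem_nhds hqΓ) (hFq.mem_nhds hqF)))).exists
      refine ⟨_, hfan.mem_nhds, fun χ hχ _ hχs => ?_⟩
      have hχs' : tsupport χ ⊆ Γ ∩ (↑(F.erase q) : Set ℂ)ᶜ :=
        hχs.trans (IsFan.fanSet_subset.trans (iUnion_subset fun k => hδ k))
      have h0 : ∀ t ∈ Icc 0 (2 * (j : ℝ)), χ (γ t) = 0 := fun t ht =>
        image_eq_zero_of_notMem_tsupport fun hc => (hγc t ht).2 (hχs' hc).1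
      obtain ⟨k1, k2⟩ := hfan.setIntegral_of_subset hψ ho hf hΓo hωo
        (fun k _ => (hδ k).trans inter_subset_left) hχ hχs
      refine ⟨hχ, k1, tendsto_const_nhds.congr fun N => (show A χ - C χ = _ from ?_)⟩
      rw [riemannSum_eq_zero hL h0 N, hA, hC]
      simp only
      rw [k2, Finset.sum_eq_single q, Finset.sum_eq_zero (s := Finset.range (2 * j))]
      · push_cast; ring
      · intro n hn
        rw [h0 _ (Ico_subset_Icc_self (hnat n (Finset.mem_range.1 hn))), mul_zero]
      · intro p hp hpq
        rw [hzero (hχs'.trans inter_subset_right) p (hSF hp) hpq, mul_zero]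
      -- Away from the branch points the order is 2 and the mass is zero.
      · intro hqS
        have : m q = 2 := by
          by_contra hne
          exact hqS (hfin'.mem_toFinset.2 ⟨hqΓ, hne⟩)
        rw [this]; simp
    · have hqf : q ∈ frontier Γ := by rw [hΓo.frontier_eq]; exact ⟨hq, hqΓ⟩
      obtain ⟨δ, P, Px, Py, R, i₁, i₂, n₁, n₂, a₁, b₁, a₂, b₂, ρ₁, ρ₂, h, hPF, hdich⟩ :=
        hγ.exists_boundaryFan hψ (hγΓ ▸ hqf) (hm _ (hΓΩ hq)) (hFq.mem_nhds hqF)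
      obtain ⟨τ, hτ, hd⟩ := h.fan.exists_sign
      obtain ⟨c, hc⟩ := h.exists_cut hΓo hγΓ
      have hsd := hasSide_eq hψ hγ hm hΓo hΓk hγΓ hΓΩ ha ho (hor a ha) (hγΓ ▸ hqf)
        ⟨_, δ, P, Px, Py, R, i₁, i₂, n₁, n₂, a₁, b₁, a₂, b₂, ρ₁, ρ₂, τ, c, h, hτ, hd, hc, rfl⟩
      refine ⟨_, h.fan.mem_nhds, fun χ hχ _ hχs => ?_⟩
      have hχs' : tsupport χ ⊆ (↑(F.erase q) : Set ℂ)ᶜ :=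
        hχs.trans (IsFan.fanSet_subset.trans (iUnion_subset fun k => hPF k))
      -- A point of the polygon that is not a vertex is not a branch point, so its fan has four
      -- cells.
      have hcorner : (ContinuousWithinAt φ Γ q ∧ n₁ % 2 ≠ n₂ % 2) ∨ (2 * m q = 4 ∧ n₁ = n₂) := by
        rcases hdich with ⟨h1, h2⟩ | ⟨h1, h2⟩
        · exact Or.inl ⟨h1 ▸ hvert n₂ h.side₂, h2⟩
        · refine Or.inr ⟨?_, h1⟩
          by_contra hne
          obtain ⟨n, hn, hqn⟩ := hside q hqf (by omega)
          exact h2 n hn hqn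
      obtain ⟨k1, k2⟩ := h.setIntegral_formula hψ hτ ho hd hf hΓo hωo hγΓ hc hsd hcorner hχ hχs
      refine ⟨hχ, k1, ?_⟩
      convert k2 using 3
      rw [hC]
      simp only
      rw [Finset.sum_eq_zero (s := S) fun p hp => by
        rw [hzero hχs' p (hSF hp) fun e => hqΓ (e ▸ (hfin'.mem_toFinset.1 hp).1), mul_zero], zero_add]
      rcases hdich with ⟨h1, h2⟩ | ⟨h1, h2⟩
      · rw [if_neg fun e => h2 (by rw [e]), Finset.sum_eq_single n₂, ← h1]
        · intro n hn hne
          have hn' := Finset.mem_range.1 hn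
          rw [hzero hχs' _ (hγF hn) fun e => hne (by
            exact_mod_cast hγ.injOn (hnat n hn') (hnat n₂ h.side₂) (e.trans h1)), mul_zero]
        · intro hn
          exact absurd (Finset.mem_range.2 h.side₂) hn
      · rw [if_pos h1]
        refine Finset.sum_eq_zero fun n hn => ?_
        rw [hzero hχs' _ (hγF hn) fun e => h2 n (Finset.mem_range.1 hn) e.symm, mul_zero]
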